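/- **Setting.** Let $\epsilon$ be a formal parameter, $T_xf(x,y)=f(x+\epsilon,y)$, $\triangle_x^+=\frac{T_x-1}{\epsilon}$, $\triangle_x^-=\frac{1-T_x^{-1}}{\epsilon}$. Consider equations $$u_t=\psi u_y+\eta w_y+f\triangle_x^+g+p\triangle_x^-q,\qquad \triangle_x^+w=\frac{T_x+1}{2}u_y, \tag{E}$$ where $\psi,\eta,f,g,p,q$ are complex-analytic functions of $(u,w)$ on a connected non-empty open set $\Omega\subset\mathbb C^2$. The dispersionless limit ($\epsilon\to0$) of (E) is $u_t=\varphi u_x+\tilde\psi u_y+\eta w_y$, $w_x=u_y$, with $\varphi=fg_u+pq_u$ and $\tilde\psi=\psi+fg_w+pq_w$. It is assumed non-degenerate: $\eta\not\equiv0$, and the four functions $\eta_w$, $\tilde\psi_w+\eta_u$, $\varphi_w+\tilde\psi_u$, $\varphi_u$ do not all vanish identically on $\Omega$. **Integrability.** For an analytic function $w=h(R)$ of one variable, with $\mu=h'$, the dispersionless limit has the one-phase solutions $u=R$, $w=h(R)$, $R_y=\mu R_x$, $R_t=(\varphi+\tilde\psi\mu+\eta\mu^2)R_x$. The one-phase solution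 is *inherited by (E) up to the order $\epsilon^4$* near $R=r$ if there are formal series $$u=R,\qquad w=h(R)+\sum_{k\ge1}\epsilon^kW_k,\qquad R_y=\mu R_x+\sum_{k\ge1}\epsilon^kY_k,\qquad R_t=(\varphi+\tilde\psi\mu+\eta\mu^2)R_x+\sum_{k\ge1}\epsilon^kZ_k,$$ where $W_k$ (respectively $Y_k,Z_k$) are polynomials in $R_x,R_{xx},\dots$, homogeneous of degree $k$ (respectively $k+1$) in $x$-derivatives, with coefficients analytic functions of $R$ near $r$, such that both equations (E) and the compatibility condition $R_{yt}=R_{ty}$ hold identically modulo $\epsilon^5$. The equation (E) is called *integrable* if all generic one-phase solutions of its dispersionless limit are inherited up to the order $\epsilon^4$, that is, those with arbitrary $r$ and $h$ analytic near $r$, $(r,h(r))\in\Omega$, such that $$\varphi_u+(\varphi_w+\tilde\psi_u)\mu+(\tilde\psi_w+\eta_u)\mu^2+\eta_w\mu^3\neq0\quad\text{at } u=r,\ w=h(r),\ \mu=h'(r).$$ **Theorem.** The equations $$\begin{aligned} u_t&=uu_y+w_y,\\ u_t&=(w+\alpha e^u)u_y+w_y\qquad(\alpha\in\mathbb C),\\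 u_t&=wu_y+w_y+\tfrac12(\triangle_x^++\triangle_x^-)e^{2u},\\ u_t&=wu_y+w_y+e^u(\triangle_x^++\triangle_x^-)e^u \end{aligned}$$ (with $\triangle_x^+w=\frac{T_x+1}2u_y$) are non-degenerate and integrable on $\mathbb C^2$. A non-degenerate equation (E) on $\Omega$ is integrable if and only if it can be obtained from one of these four by a Galilean transformation $y\to y+ct$, a rescaling of time $t\to st$, and a transformation $u\to au+b$, $w\to aw+d$ with complex constants $s\ne0$, $a\neq0$, $b,c,d$; that is, iff for one of the four equations $u_t=F$ the right-hand side of (E) equals $\frac{s}{a}F(au+b,aw+d)+cu_y$. -/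

import Mathlib

open scoped Topology

noncomputable section

namespace ILW

/-! ### Analytic germs in one variable, with their derivation -/

/-- The ring of germs at `z` of analytic functions of one complex variable. -/
def analyticGermSubring (z : ℂ) : Subring (Filter.Germ (𝓝 z) ℂ) where
  carrier := {φ | ∃ f : ℂ → ℂ, AnalyticAt ℂ f z ∧ φ = (f : Filter.Germ (𝓝 z) ℂ)}
  mul_mem' := by
    rintro _ _ ⟨f, hf, rfl⟩ ⟨g, hg, rfl⟩
    exact ⟨f * g, hf.mul hg, rfl⟩
  one_mem' := ⟨fun _ => 1, analyticAt_const, rfl⟩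
  add_mem' := by
    rintro _ _ ⟨f, hf, rfl⟩ ⟨g, hg, rfl⟩
    exact ⟨f + g, hf.add hg, rfl⟩
  zero_mem' := ⟨fun _ => 0, analyticAt_const, rfl⟩
  neg_mem' := by
    rintro _ ⟨f, hf, rfl⟩
    exact ⟨-f, hf.neg, rfl⟩

/-- The ring of germs at `z` of analytic functions of one complex variable, as a type. -/
abbrev AnalyticGerm (z : ℂ) : Type := analyticGermSubring z

/-- Constants as analytic germs. -/
def constGerm (z : ℂ) : ℂ →+* AnalyticGerm z where
  toFun c := ⟨((fun _ => c : ℂ → ℂ) : Filter.Germ (𝓝 z) ℂ), fun _ => c, analyticAt_const, rfl⟩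
  map_one' := rfl
  map_mul' _ _ := rfl
  map_zero' := rfl
  map_add' _ _ := rfl

instance analyticGermAlgebra (z : ℂ) : Algebra ℂ (AnalyticGerm z) := (constGerm z).toAlgebra

/-- The derivative of a germ. -/
def germDeriv (z : ℂ) (φ : Filter.Germ (𝓝 z) ℂ) : Filter.Germ (𝓝 z) ℂ :=
  Filter.Germ.map' deriv (fun _ _ h => Filter.EventuallyEq.deriv h) φ

theorem germDeriv_coe (z : ℂ) (f : ℂ → ℂ) :
    germDeriv z (f : Filter.Germ (𝓝 z) ℂ) = (deriv f : Filter.Germ (𝓝 z) ℂ) := rfl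

theorem germDeriv_mem (z : ℂ) (φ : AnalyticGerm z) :
    germDeriv z (φ : Filter.Germ (𝓝 z) ℂ) ∈ analyticGermSubring z := by
  obtain ⟨_, f, hf, rfl⟩ := φ
  exact ⟨deriv f, hf.deriv, rfl⟩

theorem germDeriv_add (z : ℂ) (φ ψ : AnalyticGerm z) :
    germDeriv z ((φ + ψ : AnalyticGerm z) : Filter.Germ (𝓝 z) ℂ) =
      germDeriv z φ + germDeriv z ψ := by
  obtain ⟨_, f, hf, rfl⟩ := φ
  obtain ⟨_, g, hg, rfl⟩ := ψ
  change ((deriv (f + g) : ℂ → ℂ) : Filter.Germ (𝓝 z) ℂ) =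
    ((deriv f + deriv g : ℂ → ℂ) : Filter.Germ (𝓝 z) ℂ)
  refine Filter.Germ.coe_eq.2 ?_
  filter_upwards [hf.eventually_analyticAt, hg.eventually_analyticAt] with x hx hy
  exact deriv_add hx.differentiableAt hy.differentiableAt

theorem germDeriv_mul (z : ℂ) (φ ψ : AnalyticGerm z) :
    germDeriv z ((φ * ψ : AnalyticGerm z) : Filter.Germ (𝓝 z) ℂ) =
      φ * germDeriv z ψ + ψ * germDeriv z φ := by
  obtain ⟨_, f, hf, rfl⟩ := φ
  obtain ⟨_, g, hg, rfl⟩ := ψ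
  change ((deriv (f * g) : ℂ → ℂ) : Filter.Germ (𝓝 z) ℂ) =
    ((f * deriv g + g * deriv f : ℂ → ℂ) : Filter.Germ (𝓝 z) ℂ)
  refine Filter.Germ.coe_eq.2 ?_
  filter_upwards [hf.eventually_analyticAt, hg.eventually_analyticAt] with x hx hy
  rw [deriv_mul hx.differentiableAt hy.differentiableAt]
  simp only [Pi.add_apply, Pi.mul_apply]
  ring

theorem germDeriv_smul (z : ℂ) (c : ℂ) (φ : AnalyticGerm z) :
    germDeriv z ((c • φ : AnalyticGerm z) : Filter.Germ (𝓝 z) ℂ) =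
      ((c • (⟨germDeriv z φ, germDeriv_mem z φ⟩ : AnalyticGerm z) : AnalyticGerm z) :
        Filter.Germ (𝓝 z) ℂ) := by
  obtain ⟨_, f, hf, rfl⟩ := φ
  change ((deriv (fun x => c * f x) : ℂ → ℂ) : Filter.Germ (𝓝 z) ℂ) =
    ((fun x => c * deriv f x : ℂ → ℂ) : Filter.Germ (𝓝 z) ℂ)
  refine Filter.Germ.coe_eq.2 ?_
  filter_upwards [hf.eventually_analyticAt] with x hx
  exact deriv_const_mul c hx.differentiableAt

/-- The derivation `d/dR` on analytic germs. -/
def germDerivation (z : ℂ) : Derivation ℂ (AnalyticGerm z) (AnalyticGerm z) :=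
  Derivation.mk'
    { toFun := fun φ => ⟨germDeriv z φ, germDeriv_mem z φ⟩
      map_add' := fun φ ψ => Subtype.ext (germDeriv_add z φ ψ)
      map_smul' := fun c φ => Subtype.ext (germDeriv_smul z c φ) }
    (fun φ ψ => Subtype.ext (germDeriv_mul z φ ψ))

open Classical in
/-- The germ at `z` of a function; it is only used for functions analytic at `z`. -/
def germOf (z : ℂ) (f : ℂ → ℂ) : AnalyticGerm z :=
  if hf : AnalyticAt ℂ f z then ⟨(f : Filter.Germ (𝓝 z) ℂ), f, hf, rfl⟩ else 0

/-! ### Differential polynomials in one function `R(x)` and formal series in `ε`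

`A` is a ring of functions of `R` with derivation `δ = d/dR`.  The variable `X k` of
`MvPolynomial ℕ A` stands for the `x`-derivative of `R` of order `k + 1`. -/

/-- Differential polynomials in `R` with coefficients in `A`. -/
abbrev DiffPoly (A : Type) [CommRing A] : Type := MvPolynomial ℕ A

/-- Formal power series in `ε` whose coefficients are differential polynomials. -/
abbrev EpsSeries (A : Type) [CommRing A] : Type := PowerSeries (DiffPoly A)

/-- A function `a(R)`, regarded as a series in `ε`. -/
def ofFun {A : Type} [CommRing A] (a : A) : EpsSeries A :=
  PowerSeries.C (MvPolynomial.C a)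

/-- Apply `d/dR` to the coefficients of a differential polynomial. -/
def coeffDeriv {A : Type} [CommRing A] [Algebra ℂ A] (δ : Derivation ℂ A A)
    (P : DiffPoly A) : DiffPoly A :=
  ∑ m ∈ P.support, MvPolynomial.monomial m (δ (P.coeff m))

/-- The derivation of differential polynomials which sends `a(R)` to `a'(R) * Y 0` and the
derivative of `R` of order `k` to `Y k`. -/
def prolong {A : Type} [CommRing A] [Algebra ℂ A] (δ : Derivation ℂ A A)
    (Y : ℕ → DiffPoly A) (P : DiffPoly A) : DiffPoly A :=
  coeffDeriv δ P * Y 0 + MvPolynomial.mkDerivation A (fun k => Y (k + 1)) P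

/-- The total `x`-derivative: `a(R) ↦ a'(R) R_x`, and the derivative of order `k` of `R` goes to
that of order `k + 1`. -/
def totalDeriv {A : Type} [CommRing A] [Algebra ℂ A] (δ : Derivation ℂ A A)
    (P : DiffPoly A) : DiffPoly A :=
  prolong δ (fun k => MvPolynomial.X k) P

/-- The derivative of `P` along the evolutionary flow `R_τ = Y`: the derivation commuting with the
total `x`-derivative and sending `R` to `Y`, extended to series in `ε`. -/
def flowDeriv {A : Type} [CommRing A] [Algebra ℂ A] (δ : Derivation ℂ A A)
    (Y P : EpsSeries A) : EpsSeries A :=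
  PowerSeries.mk fun n => ∑ ij ∈ Finset.HasAntidiagonal.antidiagonal n,
    prolong δ (fun k => (totalDeriv δ)^[k] (PowerSeries.coeff ij.1 Y)) (PowerSeries.coeff ij.2 P)

/-- The shift `x ↦ x + c ε`, i.e. `∑ i, (c ε) ^ i / i! * D_x ^ i`. -/
def shift {A : Type} [CommRing A] [Algebra ℂ A] (δ : Derivation ℂ A A) (c : ℂ)
    (P : EpsSeries A) : EpsSeries A :=
  PowerSeries.mk fun n => ∑ ij ∈ Finset.HasAntidiagonal.antidiagonal n,
    (c ^ ij.1 / (Nat.factorial ij.1 : ℂ)) • (totalDeriv δ)^[ij.1] (PowerSeries.coeff ij.2 P)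

/-- Division by `ε` of a series without constant term. -/
def divEps {A : Type} [CommRing A] (P : EpsSeries A) : EpsSeries A :=
  PowerSeries.mk fun n => PowerSeries.coeff (n + 1) P

/-- The forward difference `(T - 1) / ε`. -/
def forwardDiff {A : Type} [CommRing A] [Algebra ℂ A] (δ : Derivation ℂ A A)
    (P : EpsSeries A) : EpsSeries A :=
  divEps (shift δ 1 P - P)

/-- The backward difference `(1 - T⁻¹) / ε`. -/
def backwardDiff {A : Type} [CommRing A] [Algebra ℂ A] (δ : Derivation ℂ A A)
    (P : EpsSeries A) : EpsSeries A :=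
  divEps (P - shift δ (-1) P)

/-- The value `F(R, w)` at a series `w = h(R) + O(ε)`, by Taylor expansion in the second argument:
`F j` is the function `R ↦ (∂_w ^ j F)(R, h(R))`. -/
def evalAt {A : Type} [CommRing A] [Algebra ℂ A] (h : A) (F : ℕ → A) (w : EpsSeries A) :
    EpsSeries A :=
  PowerSeries.mk fun n => ∑ j ∈ Finset.range (n + 1),
    ((Nat.factorial j : ℂ)⁻¹) •
      (MvPolynomial.C (F j) * PowerSeries.coeff n ((w - ofFun h) ^ j))

/-- Homogeneity: the coefficient of `ε ^ n` has degree `n + d` in `x`-derivatives. -/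
def IsHomogeneousSeries {A : Type} [CommRing A] (d : ℕ) (P : EpsSeries A) : Prop :=
  ∀ n, MvPolynomial.IsWeightedHomogeneous (fun k : ℕ => k + 1) (PowerSeries.coeff n P) (n + d)

/-- The formal deformation
`u = R`, `w = h(R) + ε (...) + ε² (...) + ...`,
`R_y = Y = h'(R) R_x + ε (...) + ...`, `R_t = Z = λ(R) R_x + ε (...) + ...`
of a one-phase solution satisfies, modulo `ε ^ (m + 1)`, the equations
`(T - 1) / ε w = (T + 1) / 2 u_y`,
`u_t = ψ u_y + η w_y + f (T - 1) / ε g + p (1 - T⁻¹) / ε q`,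
and the compatibility condition `R_{yt} = R_{ty}`.
The functions `ψ, η, f, g, p, q` of `(u, w)` enter through their Taylor coefficients in `w` along
`w = h(R)`.  The leading term of `Z` is determined by the second equation. -/
structure IsDeformation {A : Type} [CommRing A] [Algebra ℂ A] (δ : Derivation ℂ A A) (m : ℕ)
    (h : A) (ψ η f g p q : ℕ → A) (w Y Z : EpsSeries A) : Prop where
  homogeneous_w : IsHomogeneousSeries 0 w
  homogeneous_Y : IsHomogeneousSeries 1 Y
  homogeneous_Z : IsHomogeneousSeries 1 Z
  leading_w : PowerSeries.coeff 0 w = MvPolynomial.C h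
  leading_Y : PowerSeries.coeff 0 Y = MvPolynomial.C (δ h) * MvPolynomial.X 0
  nonlocality : ∀ n ≤ m, PowerSeries.coeff n (forwardDiff δ w) =
    PowerSeries.coeff n ((2⁻¹ : ℂ) • (shift δ 1 Y + Y))
  equation : ∀ n ≤ m, PowerSeries.coeff n Z = PowerSeries.coeff n
    (evalAt h ψ w * Y + evalAt h η w * flowDeriv δ Y w
      + evalAt h f w * forwardDiff δ (evalAt h g w) + evalAt h p w * backwardDiff δ (evalAt h q w))
  compatibility : ∀ n ≤ m, PowerSeries.coeff n (flowDeriv δ Z Y) =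
    PowerSeries.coeff n (flowDeriv δ Y Z)

/-! ### The class of equations -/

/-- The partial derivative in `u` of a function of `(u, w)`. -/
def du (F : ℂ × ℂ → ℂ) (P : ℂ × ℂ) : ℂ := deriv (fun z => F (z, P.2)) P.1

/-- The partial derivative in `w` of a function of `(u, w)`. -/
def dw (F : ℂ × ℂ → ℂ) (P : ℂ × ℂ) : ℂ := deriv (fun z => F (P.1, z)) P.2

/-- The Taylor coefficients in `w` of `F` along `w = h(R)`: the germs at `r` of the functions
`R ↦ (∂_w ^ j F)(R, h(R))`. -/
def jet (r : ℂ) (h : ℂ → ℂ) (F : ℂ × ℂ → ℂ) (j : ℕ) : AnalyticGerm r :=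
  germOf r (fun z => (dw^[j] F) (z, h z))

/-- Partial derivatives of analytic functions are analytic. -/
theorem analyticAt_dw {F : ℂ × ℂ → ℂ} {P : ℂ × ℂ} (hF : AnalyticAt ℂ F P) :
    AnalyticAt ℂ (dw F) P := by
  have h1 : AnalyticAt ℂ (fun Q => fderiv ℂ F Q ((0 : ℂ), (1 : ℂ))) P :=
    ((ContinuousLinearMap.apply ℂ ℂ ((0 : ℂ), (1 : ℂ))).analyticAt _).comp hF.fderiv
  refine h1.congr ?_
  filter_upwards [hF.eventually_analyticAt] with Q hQ
  have h2 : HasDerivAt (fun z : ℂ => (Q.1, z)) ((0 : ℂ), (1 : ℂ)) Q.2 :=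
    (hasDerivAt_const _ _).prodMk (hasDerivAt_id _)
  have h3 : HasFDerivAt F (fderiv ℂ F Q) ((fun z : ℂ => (Q.1, z)) Q.2) :=
    hQ.differentiableAt.hasFDerivAt
  exact (h3.comp_hasDerivAt Q.2 h2).deriv.symm

/-- The functions `R ↦ (∂_w ^ j F)(R, h(R))` are analytic. -/
theorem analyticAt_jet {F : ℂ × ℂ → ℂ} {h : ℂ → ℂ} {r : ℂ} (hh : AnalyticAt ℂ h r)
    (hF : AnalyticAt ℂ F (r, h r)) (j : ℕ) :
    AnalyticAt ℂ (fun z => (dw^[j] F) (z, h z)) r := by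
  have h1 : AnalyticAt ℂ (dw^[j] F) (r, h r) := by
    induction j with
    | zero => exact hF
    | succ j ih =>
      rw [Function.iterate_succ_apply']
      exact analyticAt_dw ih
  exact AnalyticAt.fun_comp (f := fun z => (z, h z)) h1 (analyticAt_id.prod hh)

/-- The right-hand side of
`u_t = ψ u_y + η w_y + f △_x^+ g + p △_x^- q`, with nonlocality `△_x^+ w = (T_x + 1) / 2 u_y`,
given by six functions of `(u, w)`. -/
structure Equation where
  psi : ℂ × ℂ → ℂ
  eta : ℂ × ℂ → ℂ
  f : ℂ × ℂ → ℂ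
  g : ℂ × ℂ → ℂ
  p : ℂ × ℂ → ℂ
  q : ℂ × ℂ → ℂ

namespace Equation

/-- All coefficient functions are analytic on `Ω`. -/
def IsAnalyticOn (E : Equation) (Ω : Set (ℂ × ℂ)) : Prop :=
  AnalyticOnNhd ℂ E.psi Ω ∧ AnalyticOnNhd ℂ E.eta Ω ∧ AnalyticOnNhd ℂ E.f Ω ∧
    AnalyticOnNhd ℂ E.g Ω ∧ AnalyticOnNhd ℂ E.p Ω ∧ AnalyticOnNhd ℂ E.q Ω

/-- The coefficient of `u_x` in the dispersionless limit
`u_t = limPhi u_x + limPsi u_y + η w_y`, `w_x = u_y`. -/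
def limPhi (E : Equation) (P : ℂ × ℂ) : ℂ := E.f P * du E.g P + E.p P * du E.q P

/-- The coefficient of `u_y` in the dispersionless limit (terms with `w_x` are rewritten by
`w_x = u_y`). -/
def limPsi (E : Equation) (P : ℂ × ℂ) : ℂ := E.psi P + E.f P * dw E.g P + E.p P * dw E.q P

/-- The dispersionless limit is totally linearly degenerate on `Ω`. -/
def TotallyLinearlyDegenerate (E : Equation) (Ω : Set (ℂ × ℂ)) : Prop :=
  ∀ P ∈ Ω, dw E.eta P = 0 ∧ dw E.limPsi P + du E.eta P = 0 ∧
    dw E.limPhi P + du E.limPsi P = 0 ∧ du E.limPhi P = 0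

/-- The dispersionless limit is non-degenerate on `Ω`: the function `η` is nonzero, and the limit is
not totally linearly degenerate. -/
def NonDegenerate (E : Equation) (Ω : Set (ℂ × ℂ)) : Prop :=
  (∃ P ∈ Ω, E.eta P ≠ 0) ∧ ¬ E.TotallyLinearlyDegenerate Ω

/-- The cubic in `μ` formed with the four quantities that vanish for totally linearly degenerate
systems.  Along a one-phase solution `u = R`, `w = h(R)`, with `μ = h'(R)` and characteristic speed
`λ = limPhi + limPsi μ + η μ²`, it equals `λ' - (limPsi + 2 η μ) μ'`. -/
def degeneracyCubic (E : Equation) (P : ℂ × ℂ) (μ : ℂ) : ℂ :=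
  du E.limPhi P + (dw E.limPhi P + du E.limPsi P) * μ
    + (dw E.limPsi P + du E.eta P) * μ ^ 2 + dw E.eta P * μ ^ 3

/-- The one-phase solution `u = R`, `w = h(R)` of the dispersionless limit is inherited, near
`R = r`, by the equation up to the order `ε ^ m`. -/
def InheritsAt (E : Equation) (m : ℕ) (r : ℂ) (h : ℂ → ℂ) : Prop :=
  ∃ w Y Z : EpsSeries (AnalyticGerm r),
    IsDeformation (germDerivation r) m (germOf r h) (jet r h E.psi) (jet r h E.eta)
      (jet r h E.f) (jet r h E.g) (jet r h E.p) (jet r h E.q) w Y Z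

/-- Integrability: all (generic) one-phase solutions of the dispersionless limit are inherited by
the equation up to the order `ε ^ 4`.  Here `h` is an arbitrary analytic function near `r` whose
graph lies in the domain; generic means that the degeneracy cubic, by which one divides when solving
for the coefficients of the deformation, does not vanish at `R = r`. -/
def Integrable (E : Equation) (Ω : Set (ℂ × ℂ)) : Prop :=
  ∀ (r : ℂ) (h : ℂ → ℂ), AnalyticAt ℂ h r → (r, h r) ∈ Ω →
    E.degeneracyCubic (r, h r) (deriv h r) ≠ 0 → E.InheritsAt 4 r h

/-- The equation satisfied by `(u, w)` if `(α u + β, α w + γ)` satisfies `M` in the variables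
`x`, `y + c t`, `s t`: indeed then
`α (u_t - c u_y) = s (ψ α u_y + η α w_y + f △_x^+ g + p △_x^- q)` with the coefficient functions of
`M` evaluated at `(α u + β, α w + γ)`. -/
def transform (M : Equation) (s c α β γ : ℂ) : Equation where
  psi P := s * M.psi (α * P.1 + β, α * P.2 + γ) + c
  eta P := s * M.eta (α * P.1 + β, α * P.2 + γ)
  f P := s / α * M.f (α * P.1 + β, α * P.2 + γ)
  g P := M.g (α * P.1 + β, α * P.2 + γ)
  p P := s / α * M.p (α * P.1 + β, α * P.2 + γ)
  q P := M.q (α * P.1 + β, α * P.2 + γ)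

/-- The value of `ε (f △_x^+ g + p △_x^- q)` at a lattice point at which `(u, w)` takes the value
`P`, with values `Pp` at the next point and `Pm` at the previous point. -/
def discretePart (E : Equation) (P Pp Pm : ℂ × ℂ) : ℂ :=
  E.f P * (E.g Pp - E.g P) + E.p P * (E.q P - E.q Pm)

/-- `E` and `M` have the same right-hand side on `Ω` (the six functions themselves are not
determined by the right-hand side). -/
def SameOn (E M : Equation) (Ω : Set (ℂ × ℂ)) : Prop :=
  (∀ P ∈ Ω, E.psi P = M.psi P) ∧ (∀ P ∈ Ω, E.eta P = M.eta P) ∧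
    ∀ P ∈ Ω, ∀ Pp ∈ Ω, ∀ Pm ∈ Ω, E.discretePart P Pp Pm = M.discretePart P Pp Pm

/-- `E` on `Ω` is obtained from `M` by a Galilean transformation, a rescaling of time, and a
transformation `u → α u + β`, `w → α w + γ`. -/
def EquivalentOn (E M : Equation) (Ω : Set (ℂ × ℂ)) : Prop :=
  ∃ s c α β γ : ℂ, s ≠ 0 ∧ α ≠ 0 ∧ E.SameOn (M.transform s c α β γ) Ω

end Equation

/-- `u_t = u u_y + w_y`. -/
def eqn1 : Equation where
  psi P := P.1
  eta _ := 1
  f _ := 0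
  g _ := 0
  p _ := 0
  q _ := 0

/-- `u_t = (w + α e^u) u_y + w_y`. -/
def eqn2 (α : ℂ) : Equation where
  psi P := P.2 + α * Complex.exp P.1
  eta _ := 1
  f _ := 0
  g _ := 0
  p _ := 0
  q _ := 0

/-- `u_t = w u_y + w_y + (△_x^+ + △_x^-) / 2 e^{2u}`. -/
def eqn3 : Equation where
  psi P := P.2
  eta _ := 1
  f _ := 1 / 2
  g P := Complex.exp (2 * P.1)
  p _ := 1 / 2
  q P := Complex.exp (2 * P.1)

/-- `u_t = w u_y + w_y + e^u (△_x^+ + △_x^-) e^u`. -/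
def eqn4 : Equation where
  psi P := P.2
  eta _ := 1
  f P := Complex.exp P.1
  g P := Complex.exp P.1
  p P := Complex.exp P.1
  q P := Complex.exp P.1

/-- The list of the classification. -/
inductive IsListed : Equation → Prop
  | eqn1 : IsListed eqn1
  | eqn2 (α : ℂ) : IsListed (eqn2 α)
  | eqn3 : IsListed eqn3
  | eqn4 : IsListed eqn4

end ILW

end

/-! Solving in powers of ε leaves only the coefficients of w as unknowns. The nonlocality expresses
Y as (2/ε) tanh(ε∂/2) w (`nonlocality_iff`), the evolution equation then gives Z, and what remains
is R_yt = R_ty. At each order this is a finite system for the new coefficients of w, in which the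
leading unknown is multiplied by the degeneracy cubic c. Since c is invertible for generic h, the
question is whether the surplus equations hold.

Sufficiency. A deformation does not see the choice of the six functions (`InheritsAt.congr`), and
rescaling of t only rescales Z. It remains to treat two families (`IsNormal`): u_t = (κw + Θ(u))u_y
+ w_y with Θ'' = κΘ', and u_t = (κw + c)u_y + w_y + a(u)(△⁺ + △⁻)b(u) with either a' = 0, b'' =
2κb', or a' = κa, b'' = κb'. For these a deformation even in ε is written down explicitly. Its
coefficients are polynomials in a few functions of R on which d/dR acts polynomially. In the first
family these are t = Θ' + κh' and the quotients of h', h'' by t; in the second, with p = 2ab', one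
takes 4t² = 2p + h'² and h' = 2tx. Genericity makes t invertible in both cases. Compatibility
becomes the vanishing of fourteen polynomials, four at order ε² and ten at order ε⁴, which is
checked by certified polynomial arithmetic (`hydrodynamic_allZero`, `phiConst_allZero`,
`phiExp_allZero`).

Necessity. It is enough to classify on a small convex open set where η ≠ 0 and c is not the zero
polynomial in μ, because equality of right-hand sides continues analytically to Ω
(`SameOn.of_subset`). Along functions h with h(r) and h'(r) = μ prescribed, h''(r) = H and h''' = 0,
every obstruction becomes a polynomial identity in H and then in μ.

Order ε gives f g_u = p q_u, f g_w = p q_w and relations between first derivatives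
(`mul_eq_mul_of_integrable`). Hence p = kf and g = kq + const, and the difference term is f(△⁺ +
△⁻)g (`exists_sameOn_even`).

Order ε² gives four equations, the coefficients of powers of H (`elimination`). The highest one
forces η to be constant (`order_two_relations`), so that η = 1 after a rescaling. Without a
difference term the others give ψ_w = κ constant and ψ_uu = κψ_u, hence the first two equations of
the list (`locallyListed_of_trivial`). With a difference term they force ψ = kw + c with k ≠ 0, make
f and g functions of u alone, and give (fg')' = 2kfg' and 3f'g'' + fg''' = 4k²fg'
(`exists_reduced_form`).

For a = f'/f the last two equations say a' = 2a(k - a), which still leaves a one-parameter family of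
solutions. Order ε⁴, tested on the exponential h with h'² = 4fg', yields a(k - a) = 0
(`IsExponential.mul_sub_eq_zero`). The roots a = 0 and a = k are the third and the fourth equation
of the list. -/

noncomputable section

namespace ILW

/-! ### Prolonged derivations and evolutionary flows -/

section Prolong

variable {A : Type} [CommRing A] [Algebra ℂ A] (δ : Derivation ℂ A A)

theorem coeff_coeffDeriv (P : DiffPoly A) (m : ℕ →₀ ℕ) :
    (coeffDeriv δ P).coeff m = δ (P.coeff m) := by
  classical
  simp only [coeffDeriv, MvPolynomial.coeff_sum, MvPolynomial.coeff_monomial]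
  rw [Finset.sum_ite_eq']
  split_ifs with h
  · rfl
  · rw [MvPolynomial.notMem_support_iff.1 h, map_zero]

theorem coeffDeriv_add (P Q : DiffPoly A) :
    coeffDeriv δ (P + Q) = coeffDeriv δ P + coeffDeriv δ Q := by
  ext m
  simp only [coeff_coeffDeriv, MvPolynomial.coeff_add, map_add]

theorem coeffDeriv_mul (P Q : DiffPoly A) :
    coeffDeriv δ (P * Q) = P * coeffDeriv δ Q + Q * coeffDeriv δ P := by
  classical
  ext m
  rw [mul_comm Q]
  simp only [coeff_coeffDeriv, MvPolynomial.coeff_add, MvPolynomial.coeff_mul, map_sum,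
    Derivation.leibniz, smul_eq_mul, ← Finset.sum_add_distrib]
  refine Finset.sum_congr rfl fun _ _ => ?_
  ring

theorem coeffDeriv_C (a : A) :
    coeffDeriv δ (MvPolynomial.C a) = MvPolynomial.C (δ a) := by
  classical
  ext m
  simp only [coeff_coeffDeriv, MvPolynomial.coeff_C]
  split_ifs <;> simp

theorem coeffDeriv_X (k : ℕ) : coeffDeriv δ (MvPolynomial.X k : DiffPoly A) = 0 := by
  classical
  ext m
  simp only [coeff_coeffDeriv, MvPolynomial.coeff_X, MvPolynomial.coeff_zero]
  split_ifs <;> simp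

variable (Y : ℕ → DiffPoly A)

theorem prolong_add (P Q : DiffPoly A) :
    prolong δ Y (P + Q) = prolong δ Y P + prolong δ Y Q := by
  simp only [prolong, coeffDeriv_add, map_add]
  ring

theorem prolong_mul (P Q : DiffPoly A) :
    prolong δ Y (P * Q) = P * prolong δ Y Q + Q * prolong δ Y P := by
  simp only [prolong, coeffDeriv_mul, Derivation.leibniz, smul_eq_mul]
  ring

theorem prolong_C (a : A) :
    prolong δ Y (MvPolynomial.C a) = MvPolynomial.C (δ a) * Y 0 := by
  simp [prolong, coeffDeriv_C]

theorem prolong_X (k : ℕ) : prolong δ Y (MvPolynomial.X k : DiffPoly A) = Y (k + 1) := by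
  simp [prolong, coeffDeriv_X, MvPolynomial.mkDerivation_X]

theorem prolong_zero : prolong δ Y 0 = 0 := by
  have := prolong_add δ Y 0 0
  simpa using this

theorem prolong_neg (P : DiffPoly A) : prolong δ Y (-P) = -prolong δ Y P := by
  have h := prolong_add δ Y P (-P)
  rw [add_neg_cancel, prolong_zero] at h
  exact (neg_eq_of_add_eq_zero_right h.symm).symm

theorem prolong_sub (P Q : DiffPoly A) :
    prolong δ Y (P - Q) = prolong δ Y P - prolong δ Y Q := by
  rw [sub_eq_add_neg, prolong_add, prolong_neg, ← sub_eq_add_neg]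

theorem algebraMap_diffPoly (c : ℂ) :
    algebraMap ℂ (DiffPoly A) c = MvPolynomial.C (algebraMap ℂ A c) := rfl

theorem prolong_smul (c : ℂ) (P : DiffPoly A) :
    prolong δ Y (c • P) = c • prolong δ Y P := by
  simp [Algebra.smul_def, prolong_mul, prolong_C]

theorem prolong_pow_two (P : DiffPoly A) :
    prolong δ Y (P ^ 2) = 2 * P * prolong δ Y P := by
  rw [pow_two, prolong_mul]
  ring

theorem prolong_zero_left (P : DiffPoly A) : prolong δ (fun _ => 0) P = 0 := by
  induction P using MvPolynomial.induction_on with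
  | C a => simp [prolong_C]
  | add P Q hP hQ => rw [prolong_add, hP, hQ, add_zero]
  | mul_X P k hP => rw [prolong_mul, hP, prolong_X]; simp

/-- A prolongation is determined by its values on coefficients and variables, so induction on the
polynomial suffices. This gives linearity of a flow derivative in the flow, which is needed for the
rational normalizations 1/24 and 1/5760. -/
theorem prolong_smul_left (c : ℂ) (P : DiffPoly A) :
    prolong δ (fun k => c • Y k) P = c • prolong δ Y P := by
  induction P using MvPolynomial.induction_on with
  | C a => simp only [prolong_C, mul_smul_comm]
  | add P Q hP hQ => simp only [prolong_add, hP, hQ, smul_add]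
  | mul_X P k hP => simp only [prolong_mul, hP, prolong_X, mul_smul_comm, smul_add]

theorem totalDeriv_add (P Q : DiffPoly A) :
    totalDeriv δ (P + Q) = totalDeriv δ P + totalDeriv δ Q := prolong_add _ _ _ _

theorem totalDeriv_sub (P Q : DiffPoly A) :
    totalDeriv δ (P - Q) = totalDeriv δ P - totalDeriv δ Q := prolong_sub _ _ _ _

theorem totalDeriv_neg (P : DiffPoly A) : totalDeriv δ (-P) = -totalDeriv δ P :=
  prolong_neg _ _ _

theorem totalDeriv_zero : totalDeriv δ (0 : DiffPoly A) = 0 := prolong_zero _ _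

theorem totalDeriv_mul (P Q : DiffPoly A) :
    totalDeriv δ (P * Q) = P * totalDeriv δ Q + Q * totalDeriv δ P := prolong_mul _ _ _ _

theorem totalDeriv_pow_two (P : DiffPoly A) :
    totalDeriv δ (P ^ 2) = 2 * P * totalDeriv δ P := prolong_pow_two _ _ _

theorem totalDeriv_smul (c : ℂ) (P : DiffPoly A) :
    totalDeriv δ (c • P) = c • totalDeriv δ P := prolong_smul _ _ _ _

theorem totalDeriv_C (a : A) :
    totalDeriv δ (MvPolynomial.C a) = MvPolynomial.C (δ a) * MvPolynomial.X 0 :=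
  prolong_C _ _ _

theorem totalDeriv_X (k : ℕ) :
    totalDeriv δ (MvPolynomial.X k : DiffPoly A) = MvPolynomial.X (k + 1) :=
  prolong_X _ _ _

theorem iterate_totalDeriv_zero (n : ℕ) : (totalDeriv δ)^[n] (0 : DiffPoly A) = 0 :=
  Function.iterate_fixed (totalDeriv_zero δ) n

theorem iterate_totalDeriv_smul (n : ℕ) (c : ℂ) (P : DiffPoly A) :
    (totalDeriv δ)^[n] (c • P) = c • (totalDeriv δ)^[n] P := by
  induction n generalizing P with
  | zero => rfl
  | succ n ih => rw [Function.iterate_succ_apply, totalDeriv_smul, ih, Function.iterate_succ_apply]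

theorem iterate_totalDeriv_add (n : ℕ) (P Q : DiffPoly A) :
    (totalDeriv δ)^[n] (P + Q) = (totalDeriv δ)^[n] P + (totalDeriv δ)^[n] Q := by
  induction n generalizing P Q with
  | zero => rfl
  | succ n ih => simp only [Function.iterate_succ_apply, totalDeriv_add, ih]

/-- The derivative along the flow `R_τ = Q` of a differential polynomial. -/
def flowBy (Q P : DiffPoly A) : DiffPoly A :=
  prolong δ (fun k => (totalDeriv δ)^[k] Q) P

theorem flowBy_zero_left (P : DiffPoly A) : flowBy δ 0 P = 0 := by
  simp only [flowBy, iterate_totalDeriv_zero, prolong_zero_left]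

theorem flowBy_zero (Q : DiffPoly A) : flowBy δ Q 0 = 0 := prolong_zero _ _

theorem flowBy_smul_left (c : ℂ) (Q P : DiffPoly A) :
    flowBy δ (c • Q) P = c • flowBy δ Q P := by
  simp only [flowBy, iterate_totalDeriv_smul, prolong_smul_left]

theorem flowBy_smul (c : ℂ) (Q P : DiffPoly A) :
    flowBy δ Q (c • P) = c • flowBy δ Q P := prolong_smul _ _ _ _

theorem coeff_flowDeriv (n : ℕ) (Y P : EpsSeries A) :
    PowerSeries.coeff n (flowDeriv δ Y P) = ∑ ij ∈ Finset.HasAntidiagonal.antidiagonal n,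
      flowBy δ (PowerSeries.coeff ij.1 Y) (PowerSeries.coeff ij.2 P) := by
  simp [flowDeriv, flowBy]

theorem flowDeriv_smul_left (c : ℂ) (Y P : EpsSeries A) :
    flowDeriv δ (c • Y) P = c • flowDeriv δ Y P := by
  ext1 n
  simp only [coeff_flowDeriv, PowerSeries.coeff_smul, flowBy_smul_left, Finset.smul_sum]

theorem flowDeriv_smul (c : ℂ) (Y P : EpsSeries A) :
    flowDeriv δ Y (c • P) = c • flowDeriv δ Y P := by
  ext1 n
  simp only [coeff_flowDeriv, PowerSeries.coeff_smul, flowBy_smul, Finset.smul_sum]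

end Prolong

/-! ### Convolution sums of low order -/

theorem sum_antidiagonal_one {M : Type*} [AddCommMonoid M] (f : ℕ × ℕ → M) :
    ∑ ij ∈ Finset.HasAntidiagonal.antidiagonal 1, f ij = f (0, 1) + f (1, 0) := by
  rw [Finset.Nat.sum_antidiagonal_eq_sum_range_succ_mk]
  simp [Finset.sum_range_succ]

theorem sum_antidiagonal_two {M : Type*} [AddCommMonoid M] (f : ℕ × ℕ → M) :
    ∑ ij ∈ Finset.HasAntidiagonal.antidiagonal 2, f ij = f (0, 2) + f (1, 1) + f (2, 0) := by
  rw [Finset.Nat.sum_antidiagonal_eq_sum_range_succ_mk]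
  simp [Finset.sum_range_succ]

theorem sum_antidiagonal_three {M : Type*} [AddCommMonoid M] (f : ℕ × ℕ → M) :
    ∑ ij ∈ Finset.HasAntidiagonal.antidiagonal 3, f ij =
      f (0, 3) + f (1, 2) + f (2, 1) + f (3, 0) := by
  rw [Finset.Nat.sum_antidiagonal_eq_sum_range_succ_mk]
  simp [Finset.sum_range_succ]

theorem sum_antidiagonal_four {M : Type*} [AddCommMonoid M] (f : ℕ × ℕ → M) :
    ∑ ij ∈ Finset.HasAntidiagonal.antidiagonal 4, f ij =
      f (0, 4) + f (1, 3) + f (2, 2) + f (3, 1) + f (4, 0) := by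
  rw [Finset.Nat.sum_antidiagonal_eq_sum_range_succ_mk]
  simp [Finset.sum_range_succ]

theorem sum_antidiagonal_five {M : Type*} [AddCommMonoid M] (f : ℕ × ℕ → M) :
    ∑ ij ∈ Finset.HasAntidiagonal.antidiagonal 5, f ij =
      f (0, 5) + f (1, 4) + f (2, 3) + f (3, 2) + f (4, 1) + f (5, 0) := by
  rw [Finset.Nat.sum_antidiagonal_eq_sum_range_succ_mk]
  simp [Finset.sum_range_succ]

/-! ### Low order coefficients of a Taylor substitution -/

section Coefficients

variable {A : Type} [CommRing A] [Algebra ℂ A] (δ : Derivation ℂ A A)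

open PowerSeries (coeff)

theorem coeff_ofFun_succ {A : Type} [CommRing A] (a : A) (n : ℕ) : coeff (n + 1) (ofFun a) = 0 := by
  simp [ofFun]

theorem coeff_zero_ofFun {A : Type} [CommRing A] (a : A) : coeff 0 (ofFun a) = MvPolynomial.C a := by
  simp [ofFun]

variable {h : A} (F : ℕ → A) {w : EpsSeries A}

theorem coeff_evalAt_zero : coeff 0 (evalAt h F w) = MvPolynomial.C (F 0) := by
  simp [evalAt]

theorem coeff_evalAt_one : coeff 1 (evalAt h F w) = MvPolynomial.C (F 1) * coeff 1 w := by
  have h1 : coeff 1 (ofFun h) = 0 := coeff_ofFun_succ h 0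
  simp [evalAt, Finset.sum_range_succ, h1, PowerSeries.coeff_one]

theorem coeff_zero_sub_ofFun (hw : coeff 0 w = MvPolynomial.C h) : coeff 0 (w - ofFun h) = 0 := by
  rw [map_sub, hw, coeff_zero_ofFun, sub_self]

theorem coeff_sub_ofFun_sq_two (hw : coeff 0 w = MvPolynomial.C h) (hw1 : coeff 1 w = 0) : coeff 2 ((w - ofFun h) ^ 2) = 0 := by
  have h0 := coeff_zero_sub_ofFun hw
  have h1 : coeff 1 (w - ofFun h) = 0 := by rw [map_sub, hw1, coeff_ofFun_succ h 0, sub_self]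
  rw [pow_two, PowerSeries.coeff_mul, sum_antidiagonal_two]
  simp [h0, h1]

/-- When the correction of order ε vanishes, w - h is divisible by ε², so its square is already
divisible by ε⁴. -/
theorem coeff_sub_ofFun_three (hw : coeff 0 w = MvPolynomial.C h) (hw1 : coeff 1 w = 0) (j : ℕ) : coeff 3 ((w - ofFun h) ^ (j + 2)) = 0 := by
  have h0 := coeff_zero_sub_ofFun hw
  have h1 : coeff 1 (w - ofFun h) = 0 := by rw [map_sub, hw1, coeff_ofFun_succ h 0, sub_self]
  have hd : PowerSeries.X ^ 2 ∣ w - ofFun h := by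
    rw [PowerSeries.X_pow_dvd_iff]
    intro m hm
    interval_cases m
    · exact h0
    · exact h1
  have h4 : PowerSeries.X ^ 4 ∣ (w - ofFun h) ^ (j + 2) := by
    have h5 := pow_dvd_pow_of_dvd hd (j + 2)
    rw [← pow_mul] at h5
    exact (pow_dvd_pow _ (by omega)).trans h5
  exact PowerSeries.X_pow_dvd_iff.1 h4 3 (by norm_num)

theorem coeff_sub_ofFun_four (hw : coeff 0 w = MvPolynomial.C h) (hw1 : coeff 1 w = 0) (j : ℕ) : coeff 4 ((w - ofFun h) ^ (j + 3)) = 0 := by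
  have h0 := coeff_zero_sub_ofFun hw
  have h1 : coeff 1 (w - ofFun h) = 0 := by rw [map_sub, hw1, coeff_ofFun_succ h 0, sub_self]
  have hd : PowerSeries.X ^ 2 ∣ w - ofFun h := by
    rw [PowerSeries.X_pow_dvd_iff]
    intro m hm
    interval_cases m
    · exact h0
    · exact h1
  have h4 : PowerSeries.X ^ 6 ∣ (w - ofFun h) ^ (j + 3) := by
    have h5 := pow_dvd_pow_of_dvd hd (j + 3)
    rw [← pow_mul] at h5
    exact (pow_dvd_pow _ (by omega)).trans h5
  exact PowerSeries.X_pow_dvd_iff.1 h4 4 (by norm_num)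

theorem coeff_sub_ofFun_sq_four (hw : coeff 0 w = MvPolynomial.C h) (hw1 : coeff 1 w = 0) : coeff 4 ((w - ofFun h) ^ 2) = coeff 2 w ^ 2 := by
  have h0 := coeff_zero_sub_ofFun hw
  have h1 : coeff 1 (w - ofFun h) = 0 := by rw [map_sub, hw1, coeff_ofFun_succ h 0, sub_self]
  have h2 : coeff 2 (w - ofFun h) = coeff 2 w := by rw [map_sub, coeff_ofFun_succ h 1, sub_zero]
  rw [pow_two, PowerSeries.coeff_mul, sum_antidiagonal_four]
  simp only [h0, h1, h2]
  ring

theorem coeff_evalAt_two (hw : coeff 0 w = MvPolynomial.C h) (hw1 : coeff 1 w = 0) :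
    coeff 2 (evalAt h F w) = MvPolynomial.C (F 1) * coeff 2 w := by
  have h2 : coeff 2 (ofFun h) = 0 := coeff_ofFun_succ h 1
  simp [evalAt, Finset.sum_range_succ, h2, PowerSeries.coeff_one, coeff_sub_ofFun_sq_two hw hw1]

theorem coeff_evalAt_three (hw : coeff 0 w = MvPolynomial.C h) (hw1 : coeff 1 w = 0) :
    coeff 3 (evalAt h F w) = MvPolynomial.C (F 1) * coeff 3 w := by
  have h2 : coeff 3 (ofFun h) = 0 := coeff_ofFun_succ h 2
  simp [evalAt, Finset.sum_range_succ, h2, PowerSeries.coeff_one, coeff_sub_ofFun_three hw hw1 0,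
    coeff_sub_ofFun_three hw hw1 1]

/-- Order ε⁴ is the first at which the Taylor expansion in w is not linear, since w - h = O(ε²);
cubic terms start at ε⁶. -/
theorem coeff_evalAt_four (hw : coeff 0 w = MvPolynomial.C h) (hw1 : coeff 1 w = 0) :
    coeff 4 (evalAt h F w) = MvPolynomial.C (F 1) * coeff 4 w +
      (2⁻¹ : ℂ) • (MvPolynomial.C (F 2) * coeff 2 w ^ 2) := by
  have h2 : coeff 4 (ofFun h) = 0 := coeff_ofFun_succ h 3
  simp [evalAt, Finset.sum_range_succ, h2, PowerSeries.coeff_one, coeff_sub_ofFun_sq_four hw hw1,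
    coeff_sub_ofFun_four hw hw1 0, coeff_sub_ofFun_four hw hw1 1, Nat.factorial]

end Coefficients

/-! ### Shifts, differences and the nonlocality -/

section Differences

variable {A : Type} [CommRing A] [Algebra ℂ A] (δ : Derivation ℂ A A)

open PowerSeries (coeff)

variable (P : EpsSeries A)

local notation "T" => totalDeriv δ

/-- The coefficients of the shift by `± 1`. -/
theorem coeff_shift_zero (c : ℂ) : coeff 0 (shift δ c P) = coeff 0 P := by
  simp [shift]

theorem coeff_shift_one (c : ℂ) :
    coeff 1 (shift δ c P) = coeff 1 P + c • T (coeff 0 P) := by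
  simp only [shift, PowerSeries.coeff_mk, sum_antidiagonal_one]
  simp

theorem coeff_shift_two (c : ℂ) : coeff 2 (shift δ c P) = coeff 2 P + c • T (coeff 1 P) +
    (c ^ 2 / 2) • T (T (coeff 0 P)) := by
  simp only [shift, PowerSeries.coeff_mk, sum_antidiagonal_two]
  simp [Function.iterate_succ_apply', Nat.factorial]

theorem coeff_shift_three (c : ℂ) : coeff 3 (shift δ c P) = coeff 3 P + c • T (coeff 2 P) +
    (c ^ 2 / 2) • T (T (coeff 1 P)) + (c ^ 3 / 6) • T (T (T (coeff 0 P))) := by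
  simp only [shift, PowerSeries.coeff_mk, sum_antidiagonal_three]
  simp [Function.iterate_succ_apply', Nat.factorial]

theorem coeff_shift_four (c : ℂ) : coeff 4 (shift δ c P) = coeff 4 P + c • T (coeff 3 P) +
    (c ^ 2 / 2) • T (T (coeff 2 P)) + (c ^ 3 / 6) • T (T (T (coeff 1 P))) +
    (c ^ 4 / 24) • T (T (T (T (coeff 0 P)))) := by
  simp only [shift, PowerSeries.coeff_mk, sum_antidiagonal_four]
  simp [Function.iterate_succ_apply', Nat.factorial]

theorem coeff_shift_five (c : ℂ) : coeff 5 (shift δ c P) = coeff 5 P + c • T (coeff 4 P) +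
    (c ^ 2 / 2) • T (T (coeff 3 P)) + (c ^ 3 / 6) • T (T (T (coeff 2 P))) +
    (c ^ 4 / 24) • T (T (T (T (coeff 1 P)))) + (c ^ 5 / 120) • T (T (T (T (T (coeff 0 P))))) := by
  simp only [shift, PowerSeries.coeff_mk, sum_antidiagonal_five]
  simp [Function.iterate_succ_apply', Nat.factorial]

theorem coeff_forwardDiff (n : ℕ) :
    coeff n (forwardDiff δ P) = coeff (n + 1) (shift δ 1 P) - coeff (n + 1) P := by
  simp [forwardDiff, divEps]

theorem coeff_backwardDiff (n : ℕ) :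
    coeff n (backwardDiff δ P) = coeff (n + 1) P - coeff (n + 1) (shift δ (-1) P) := by
  simp [backwardDiff, divEps]

variable (w Y : EpsSeries A)

/-- The nonlocality, solved for the flow: `Y = 2 / ε tanh (ε ∂ / 2) w`. -/
theorem nonlocality_iff :
    (∀ n ≤ 4, coeff n (forwardDiff δ w) = coeff n ((2⁻¹ : ℂ) • (shift δ 1 Y + Y))) ↔
      coeff 0 Y = T (coeff 0 w) ∧ coeff 1 Y = T (coeff 1 w) ∧
      coeff 2 Y = T (coeff 2 w) - (12⁻¹ : ℂ) • T (T (T (coeff 0 w))) ∧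
      coeff 3 Y = T (coeff 3 w) - (12⁻¹ : ℂ) • T (T (T (coeff 1 w))) ∧
      coeff 4 Y = T (coeff 4 w) - (12⁻¹ : ℂ) • T (T (T (coeff 2 w))) +
        (120⁻¹ : ℂ) • T (T (T (T (T (coeff 0 w))))) := by
  have e : (∀ n ≤ 4, coeff n (forwardDiff δ w) = coeff n ((2⁻¹ : ℂ) • (shift δ 1 Y + Y))) ↔
      (coeff 0 (forwardDiff δ w) = coeff 0 ((2⁻¹ : ℂ) • (shift δ 1 Y + Y)) ∧
      coeff 1 (forwardDiff δ w) = coeff 1 ((2⁻¹ : ℂ) • (shift δ 1 Y + Y)) ∧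
      coeff 2 (forwardDiff δ w) = coeff 2 ((2⁻¹ : ℂ) • (shift δ 1 Y + Y)) ∧
      coeff 3 (forwardDiff δ w) = coeff 3 ((2⁻¹ : ℂ) • (shift δ 1 Y + Y)) ∧
      coeff 4 (forwardDiff δ w) = coeff 4 ((2⁻¹ : ℂ) • (shift δ 1 Y + Y))) := by
    constructor
    · intro H
      exact ⟨H 0 (by norm_num), H 1 (by norm_num), H 2 (by norm_num), H 3 (by norm_num),
        H 4 (by norm_num)⟩
    · rintro ⟨h0, h1, h2, h3, h4⟩ n hn
      interval_cases n <;> assumption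
  rw [e]
  simp only [coeff_forwardDiff, PowerSeries.coeff_smul, map_add, Nat.reduceAdd, zero_add,
    coeff_shift_zero, coeff_shift_one, coeff_shift_two, coeff_shift_three, coeff_shift_four,
    coeff_shift_five]
  constructor
  -- The system is triangular: the n-th equation contains the n-th coefficient of Y with factor one
  -- and otherwise only earlier coefficients. The numbers 1/12 and 1/120 come from 2 tanh(x/2) = x -
  -- x³/12 + x⁵/120 - ….
  · rintro ⟨h0, h1, h2, h3, h4⟩
    have k0 : coeff 0 Y = T (coeff 0 w) := by linear_combination (norm := module) -h0
    rw [k0] at h1 h2 h3 h4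
    have k1 : coeff 1 Y = T (coeff 1 w) := by linear_combination (norm := module) -h1
    rw [k1] at h2 h3 h4
    have k2 : coeff 2 Y = T (coeff 2 w) - (12⁻¹ : ℂ) • T (T (T (coeff 0 w))) := by
      linear_combination (norm := module) -h2
    rw [k2] at h3 h4
    simp only [totalDeriv_sub, totalDeriv_smul] at h3 h4
    have k3 : coeff 3 Y = T (coeff 3 w) - (12⁻¹ : ℂ) • T (T (T (coeff 1 w))) := by
      linear_combination (norm := module) -h3
    rw [k3] at h4
    simp only [totalDeriv_sub, totalDeriv_smul] at h4
    refine ⟨k0, k1, k2, k3, ?_⟩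
    linear_combination (norm := module) -h4
  · rintro ⟨h0, h1, h2, h3, h4⟩
    rw [h0, h1, h2, h3, h4]
    simp only [totalDeriv_sub, totalDeriv_smul]
    refine ⟨?_, ?_, ?_, ?_, ?_⟩ <;> module

end Differences

/-! ### Homogeneous differential polynomials of degrees two to five -/

section Forms

variable {A : Type} [CommRing A]

/-- The general homogeneous differential polynomial of degree two. -/
def form2 (a b : A) : DiffPoly A :=
  MvPolynomial.C a * MvPolynomial.X 1 + MvPolynomial.C b * (MvPolynomial.X 0) ^ 2

/-- The general homogeneous differential polynomial of degree three. -/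
def form3 (a b c : A) : DiffPoly A :=
  MvPolynomial.C a * MvPolynomial.X 2 + MvPolynomial.C b * (MvPolynomial.X 1 * MvPolynomial.X 0) +
    MvPolynomial.C c * (MvPolynomial.X 0) ^ 3

/-- The general homogeneous differential polynomial of degree four. -/
def form4 (a b c d e : A) : DiffPoly A :=
  MvPolynomial.C a * MvPolynomial.X 3 + MvPolynomial.C b * (MvPolynomial.X 2 * MvPolynomial.X 0) +
    MvPolynomial.C c * (MvPolynomial.X 1) ^ 2 +
    MvPolynomial.C d * (MvPolynomial.X 1 * (MvPolynomial.X 0) ^ 2) +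
    MvPolynomial.C e * (MvPolynomial.X 0) ^ 4

/-- The general homogeneous differential polynomial of degree five. -/
def form5 (a b c d e f g : A) : DiffPoly A :=
  MvPolynomial.C a * MvPolynomial.X 4 + MvPolynomial.C b * (MvPolynomial.X 3 * MvPolynomial.X 0) +
    MvPolynomial.C c * (MvPolynomial.X 2 * MvPolynomial.X 1) +
    MvPolynomial.C d * (MvPolynomial.X 2 * (MvPolynomial.X 0) ^ 2) +
    MvPolynomial.C e * ((MvPolynomial.X 1) ^ 2 * MvPolynomial.X 0) +
    MvPolynomial.C f * (MvPolynomial.X 1 * (MvPolynomial.X 0) ^ 3) +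
    MvPolynomial.C g * (MvPolynomial.X 0) ^ 5

end Forms

/-! ### Commutators of scalar flows -/

section Commutators

variable {A : Type} [CommRing A] [Algebra ℂ A] (δ : Derivation ℂ A A)

theorem derivation_ofNat (n : ℕ) [n.AtLeastTwo] : δ (ofNat(n) : A) = 0 := by
  rw [← Nat.cast_ofNat, Derivation.map_natCast]

/-- The terms with R_xxx cancel, as the leading symbols of scalar flows commute. The two remaining
coefficients are the compatibility conditions at order ε. -/
theorem commutator_one (μ l y2 y11 z2 z11 : A) :
    flowBy δ (MvPolynomial.C l * MvPolynomial.X 0) (form2 y2 y11) +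
      flowBy δ (form2 z2 z11) (MvPolynomial.C μ * MvPolynomial.X 0) -
      flowBy δ (MvPolynomial.C μ * MvPolynomial.X 0) (form2 z2 z11) -
      flowBy δ (form2 y2 y11) (MvPolynomial.C l * MvPolynomial.X 0) =
      MvPolynomial.C (2 * (y2 * δ l - z2 * δ μ)) * (MvPolynomial.X 1 * MvPolynomial.X 0) +
      MvPolynomial.C (y11 * δ l + y2 * δ (δ l) - z11 * δ μ - z2 * δ (δ μ)) *
        (MvPolynomial.X 0) ^ 3 := by
  simp only [flowBy, form2, pow_succ, pow_zero, one_mul, prolong_add, prolong_mul, prolong_C, prolong_X,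
    Function.iterate_succ_apply', Function.iterate_zero_apply, totalDeriv_add, totalDeriv_mul,
    totalDeriv_C, totalDeriv_X, map_add, map_sub, map_mul, map_ofNat]
  ring

/-- This is the part of the compatibility condition at order ε² that remains when the corrections of
order ε vanish. Again the highest derivative of R drops out. -/
theorem commutator_two (μ l y3 y21 y111 z3 z21 z111 : A) :
    flowBy δ (MvPolynomial.C l * MvPolynomial.X 0) (form3 y3 y21 y111) +
      flowBy δ (form3 z3 z21 z111) (MvPolynomial.C μ * MvPolynomial.X 0) -
      flowBy δ (MvPolynomial.C μ * MvPolynomial.X 0) (form3 z3 z21 z111) -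
      flowBy δ (form3 y3 y21 y111) (MvPolynomial.C l * MvPolynomial.X 0) =
      MvPolynomial.C (3 * y3 * (δ l) - 3 * z3 * (δ μ)) * ((MvPolynomial.X 1) ^ 2) +
      MvPolynomial.C (3 * y21 * (δ l) + 6 * y3 * (δ (δ l)) - 3 * z21 * (δ μ) - 6 * z3 * (δ (δ
        μ))) * (MvPolynomial.X 1 * (MvPolynomial.X 0) ^ 2) +
      MvPolynomial.C (3 * y3 * (δ l) - 3 * z3 * (δ μ)) * (MvPolynomial.X 2 * MvPolynomial.X 0) +
      MvPolynomial.C (2 * y111 * (δ l) + y21 * (δ (δ l)) + y3 * (δ (δ (δ l))) - 2 * z111 * (δ μ)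
        - z21 * (δ (δ μ)) - z3 * (δ (δ (δ μ)))) * ((MvPolynomial.X 0) ^ 4) := by
  simp only [flowBy, form3, pow_succ, pow_zero, one_mul, prolong_add, prolong_mul, prolong_C, prolong_X,
    Function.iterate_succ_apply', Function.iterate_zero_apply, totalDeriv_add, totalDeriv_mul,
    totalDeriv_C, totalDeriv_X, map_add, map_sub, map_mul, map_ofNat]
  ring

/-- The interaction of the leading terms with those of order ε⁴; the interaction of the terms of
order ε² with each other is `commutator_form3`. -/
theorem commutator_four_linear (μ l y5 y41 y32 y311 y221 y2111 y11111 z5 z41 z32 z311 z221 z2111 z11111 : A) :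
    flowBy δ (MvPolynomial.C l * MvPolynomial.X 0) (form5 y5 y41 y32 y311 y221 y2111 y11111) +
      flowBy δ (form5 z5 z41 z32 z311 z221 z2111 z11111) (MvPolynomial.C μ * MvPolynomial.X 0) -
      flowBy δ (MvPolynomial.C μ * MvPolynomial.X 0) (form5 z5 z41 z32 z311 z221 z2111 z11111) -
      flowBy δ (form5 y5 y41 y32 y311 y221 y2111 y11111) (MvPolynomial.C l * MvPolynomial.X 0) =
      MvPolynomial.C (5 * y41 * (δ l) + 15 * y5 * (δ (δ l)) - 5 * z41 * (δ μ) - 15 * z5 * (δ (δ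
        μ))) * (MvPolynomial.X 3 * (MvPolynomial.X 0) ^ 2) +
      MvPolynomial.C (5 * y311 * (δ l) + y32 * (δ (δ l)) + 10 * y41 * (δ (δ l)) + 20 * y5 * (δ
        (δ (δ l))) - 5 * z311 * (δ μ) - z32 * (δ (δ μ)) - 10 * z41 * (δ (δ μ)) - 20 * z5 * (δ (δ
        (δ μ)))) * (MvPolynomial.X 2 * (MvPolynomial.X 0) ^ 3) +
      MvPolynomial.C (6 * y221 * (δ l) + 3 * y311 * (δ l) + 6 * y32 * (δ (δ l)) + 15 * y41 * (δ
        (δ l)) + 45 * y5 * (δ (δ (δ l))) - 6 * z221 * (δ μ) - 3 * z311 * (δ μ) - 6 * z32 * (δ (δ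
        μ)) - 15 * z41 * (δ (δ μ)) - 45 * z5 * (δ (δ (δ μ)))) * ((MvPolynomial.X 1) ^ 2 *
        (MvPolynomial.X 0) ^ 2) +
      MvPolynomial.C (5 * y2111 * (δ l) + 2 * y221 * (δ (δ l)) + 6 * y311 * (δ (δ l)) + y32 * (δ
        (δ (δ l))) + 10 * y41 * (δ (δ (δ l))) + 15 * y5 * (δ (δ (δ (δ l)))) - 5 * z2111 * (δ μ) -
        2 * z221 * (δ (δ μ)) - 6 * z311 * (δ (δ μ)) - z32 * (δ (δ (δ μ))) - 10 * z41 * (δ (δ (δ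
        μ))) - 15 * z5 * (δ (δ (δ (δ μ))))) * (MvPolynomial.X 1 * (MvPolynomial.X 0) ^ 4) +
      MvPolynomial.C (4 * y11111 * (δ l) + y2111 * (δ (δ l)) + y311 * (δ (δ (δ l))) + y41 * (δ
        (δ (δ (δ l)))) + y5 * (δ (δ (δ (δ (δ l))))) - 4 * z11111 * (δ μ) - z2111 * (δ (δ μ)) -
        z311 * (δ (δ (δ μ))) - z41 * (δ (δ (δ (δ μ)))) - z5 * (δ (δ (δ (δ (δ μ)))))) *
        ((MvPolynomial.X 0) ^ 6) +
      MvPolynomial.C (3 * y32 * (δ l) + 15 * y5 * (δ (δ l)) - 3 * z32 * (δ μ) - 15 * z5 * (δ (δ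
        μ))) * ((MvPolynomial.X 1) ^ 3) +
      MvPolynomial.C (6 * y32 * (δ l) + 10 * y41 * (δ l) + 60 * y5 * (δ (δ l)) - 6 * z32 * (δ μ)
        - 10 * z41 * (δ μ) - 60 * z5 * (δ (δ μ))) * (MvPolynomial.X 2 * MvPolynomial.X 1 *
        MvPolynomial.X 0) +
      MvPolynomial.C (15 * y5 * (δ l) - 15 * z5 * (δ μ)) * (MvPolynomial.X 3 * MvPolynomial.X 1) +
      MvPolynomial.C (10 * y5 * (δ l) - 10 * z5 * (δ μ)) * ((MvPolynomial.X 2) ^ 2) +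
      MvPolynomial.C (5 * y5 * (δ l) - 5 * z5 * (δ μ)) * (MvPolynomial.X 4 * MvPolynomial.X 0) := by
  simp only [flowBy, form5, pow_succ, pow_zero, one_mul, prolong_add, prolong_mul, prolong_C, prolong_X,
    Function.iterate_succ_apply', Function.iterate_zero_apply, totalDeriv_add, totalDeriv_mul,
    totalDeriv_C, totalDeriv_X, map_add, map_sub, map_mul, map_ofNat]
  ring

theorem commutator_form3 (y3 y21 y111 z3 z21 z111 : A) :
    flowBy δ (form3 z3 z21 z111) (form3 y3 y21 y111) - flowBy δ (form3 y3 y21 y111) (form3 z3 z21 z111) =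
      MvPolynomial.C (-6 * y111 * z3 + 6 * y3 * z111 + 3 * y3 * (δ z21) - 3 * z3 * (δ y21)) *
        ((MvPolynomial.X 1) ^ 3) +
      MvPolynomial.C (-6 * y111 * z21 + 6 * y21 * z111 + 3 * y21 * (δ z21) + 27 * y3 * (δ z111)
        + 6 * y3 * (δ (δ z21)) - 3 * z21 * (δ y21) - 27 * z3 * (δ y111) - 6 * z3 * (δ (δ y21))) *
        ((MvPolynomial.X 1) ^ 2 * (MvPolynomial.X 0) ^ 2) +
      MvPolynomial.C (-3 * y21 * z3 + 3 * y3 * z21 + 3 * y3 * (δ z3) - 3 * z3 * (δ y3)) *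
        (MvPolynomial.X 3 * MvPolynomial.X 1) +
      MvPolynomial.C (-18 * y111 * z3 + y21 * (δ z3) + 18 * y3 * z111 + 12 * y3 * (δ z21) + 3 *
        y3 * (δ (δ z3)) - z21 * (δ y3) - 12 * z3 * (δ y21) - 3 * z3 * (δ (δ y3))) *
        (MvPolynomial.X 2 * MvPolynomial.X 1 * MvPolynomial.X 0) +
      MvPolynomial.C (2 * y111 * (δ z21) + 7 * y21 * (δ z111) + y21 * (δ (δ z21)) + 12 * y3 * (δ
        (δ z111)) + y3 * (δ (δ (δ z21))) - 2 * z111 * (δ y21) - 7 * z21 * (δ y111) - z21 * (δ (δ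
        y21)) - 12 * z3 * (δ (δ y111)) - z3 * (δ (δ (δ y21)))) * (MvPolynomial.X 1 *
        (MvPolynomial.X 0) ^ 4) +
      MvPolynomial.C (2 * y21 * (δ z3) + 3 * y3 * (δ z21) + 3 * y3 * (δ (δ z3)) - 2 * z21 * (δ
        y3) - 3 * z3 * (δ y21) - 3 * z3 * (δ (δ y3))) * (MvPolynomial.X 3 * (MvPolynomial.X 0) ^
        2) +
      MvPolynomial.C (-3 * y21 * z3 + 3 * y3 * z21) * ((MvPolynomial.X 2) ^ 2) +
      MvPolynomial.C (2 * y111 * (δ z3) + 2 * y21 * (δ z21) + y21 * (δ (δ z3)) + 9 * y3 * (δ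
        z111) + 3 * y3 * (δ (δ z21)) + y3 * (δ (δ (δ z3))) - 2 * z111 * (δ y3) - 2 * z21 * (δ y21)
        - z21 * (δ (δ y3)) - 9 * z3 * (δ y111) - 3 * z3 * (δ (δ y21)) - z3 * (δ (δ (δ y3)))) *
        (MvPolynomial.X 2 * (MvPolynomial.X 0) ^ 3) +
      MvPolynomial.C (3 * y3 * (δ z3) - 3 * z3 * (δ y3)) * (MvPolynomial.X 4 * MvPolynomial.X 0) +
      MvPolynomial.C (2 * y111 * (δ z111) + y21 * (δ (δ z111)) + y3 * (δ (δ (δ z111))) - 2 *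
        z111 * (δ y111) - z21 * (δ (δ y111)) - z3 * (δ (δ (δ y111)))) * ((MvPolynomial.X 0) ^ 6) := by
  simp only [flowBy, form3, pow_succ, pow_zero, one_mul, prolong_add, prolong_mul, prolong_C, prolong_X,
    Function.iterate_succ_apply', Function.iterate_zero_apply, totalDeriv_add, totalDeriv_mul,
    totalDeriv_C, totalDeriv_X, map_add, map_sub, map_mul, map_neg, map_ofNat]
  ring

end Commutators

section Commutators

variable {A : Type} [CommRing A] [Algebra ℂ A] (δ : Derivation ℂ A A)

/-- The commutator of the flows with terms `C μ * X 0`, `form3 y` and `C (s μ + l) * X 0`,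
`form3 (s y + z)`: only the derivatives of `s` enter. -/
theorem commutator_two_add_mul (s μ l y3 y21 y111 z3 z21 z111 : A) :
    flowBy δ (MvPolynomial.C (s * μ + l) * MvPolynomial.X 0) (form3 y3 y21 y111) +
      flowBy δ (form3 (s * y3 + z3) (s * y21 + z21) (s * y111 + z111))
        (MvPolynomial.C μ * MvPolynomial.X 0) -
      flowBy δ (MvPolynomial.C μ * MvPolynomial.X 0)
        (form3 (s * y3 + z3) (s * y21 + z21) (s * y111 + z111)) -
      flowBy δ (form3 y3 y21 y111) (MvPolynomial.C (s * μ + l) * MvPolynomial.X 0) =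
      MvPolynomial.C (3 * μ * y3 * (δ s) + 3 * y3 * (δ l) - 3 * z3 * (δ μ)) * ((MvPolynomial.X
        1) ^ 2) +
      MvPolynomial.C (3 * μ * y21 * (δ s) + 6 * μ * y3 * (δ (δ s)) + 3 * y21 * (δ l) + 6 * y3 *
        (δ (δ l)) + 12 * y3 * (δ μ) * (δ s) - 3 * z21 * (δ μ) - 6 * z3 * (δ (δ μ))) *
        (MvPolynomial.X 1 * (MvPolynomial.X 0) ^ 2) +
      MvPolynomial.C (3 * μ * y3 * (δ s) + 3 * y3 * (δ l) - 3 * z3 * (δ μ)) * (MvPolynomial.X 2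
        * MvPolynomial.X 0) +
      MvPolynomial.C (2 * μ * y111 * (δ s) + μ * y21 * (δ (δ s)) + μ * y3 * (δ (δ (δ s))) + 2 *
        y111 * (δ l) + y21 * (δ (δ l)) + 2 * y21 * (δ μ) * (δ s) + y3 * (δ (δ (δ l))) + 3 * y3 *
        (δ μ) * (δ (δ s)) + 3 * y3 * (δ (δ μ)) * (δ s) - 2 * z111 * (δ μ) - z21 * (δ (δ μ)) - z3 *
        (δ (δ (δ μ)))) * ((MvPolynomial.X 0) ^ 4) := by
  rw [commutator_two]
  simp only [map_add, map_mul, Derivation.leibniz, smul_eq_mul, map_sub, map_ofNat]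
  ring

-- The factor 10 is 5760 / 24²: it accounts for the product of two terms of order ε² when orders ε²
-- and ε⁴ are multiplied by 24 and 5760. The undifferentiated s drops out because it multiplies the
-- commutator of one flow with itself.
set_option maxRecDepth 10000 in
set_option maxHeartbeats 2000000 in
theorem commutator_four_add_mul (s μ l y3 y21 y111
      z3 z21 z111 y5 y41 y32 y311 y221 y2111 y11111
      z5 z41 z32 z311 z221 z2111 z11111 : A) :
    flowBy δ (MvPolynomial.C (s * μ + l) * MvPolynomial.X 0) (form5 y5 y41 y32 y311 y221 y2111 y11111) +
      flowBy δ (form5 (s * y5 + z5) (s * y41 + z41) (s * y32 + z32) (s * y311 + z311) (s * y221 + z221) (s *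
        y2111 + z2111) (s * y11111 + z11111))
        (MvPolynomial.C μ * MvPolynomial.X 0) -
      flowBy δ (MvPolynomial.C μ * MvPolynomial.X 0)
        (form5 (s * y5 + z5) (s * y41 + z41) (s * y32 + z32) (s * y311 + z311) (s * y221 + z221) (s *
        y2111 + z2111) (s * y11111 + z11111)) -
      flowBy δ (form5 y5 y41 y32 y311 y221 y2111 y11111)
        (MvPolynomial.C (s * μ + l) * MvPolynomial.X 0) +
      10 * (flowBy δ (form3 (s * y3 + z3) (s * y21 + z21) (s * y111 + z111))
        (form3 y3 y21 y111) -
      flowBy δ (form3 y3 y21 y111)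
        (form3 (s * y3 + z3) (s * y21 + z21) (s * y111 + z111))) =
      MvPolynomial.C (3 * μ * y32 * (δ s) + 15 * μ * y5 * (δ (δ s)) - 60 * y111 * z3 + 3 * y32 *
        (δ l) + 30 * y3 * y21 * (δ s) + 60 * y3 * z111 + 30 * y3 * (δ z21) + 15 * y5 * (δ (δ l)) +
        30 * y5 * (δ μ) * (δ s) - 3 * z32 * (δ μ) - 30 * z3 * (δ y21) - 15 * z5 * (δ (δ μ))) *
        ((MvPolynomial.X 1) ^ 3) +
      MvPolynomial.C (6 * μ * y221 * (δ s) + 3 * μ * y311 * (δ s) + 6 * μ * y32 * (δ (δ s)) + 15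
        * μ * y41 * (δ (δ s)) + 45 * μ * y5 * (δ (δ (δ s))) - 60 * y111 * z21 + 60 * y21 * z111 +
        30 * y21 * (δ z21) + 30 * y21 * y21 * (δ s) + 6 * y221 * (δ l) + 3 * y311 * (δ l) + 6 *
        y32 * (δ (δ l)) + 12 * y32 * (δ μ) * (δ s) + 270 * y3 * y111 * (δ s) + 60 * y3 * y21 * (δ
        (δ s)) + 120 * y3 * (δ y21) * (δ s) + 270 * y3 * (δ z111) + 60 * y3 * (δ (δ z21)) + 15 *
        y41 * (δ (δ l)) + 30 * y41 * (δ μ) * (δ s) + 45 * y5 * (δ (δ (δ l))) + 135 * y5 * (δ μ) *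
        (δ (δ s)) + 135 * y5 * (δ (δ μ)) * (δ s) - 30 * z21 * (δ y21) - 6 * z221 * (δ μ) - 3 *
        z311 * (δ μ) - 6 * z32 * (δ (δ μ)) - 270 * z3 * (δ y111) - 60 * z3 * (δ (δ y21)) - 15 *
        z41 * (δ (δ μ)) - 45 * z5 * (δ (δ (δ μ)))) * ((MvPolynomial.X 1) ^ 2 * (MvPolynomial.X 0)
        ^ 2) +
      MvPolynomial.C (15 * μ * y5 * (δ s) - 30 * y21 * z3 + 30 * y3 * z21 + 30 * y3 * (δ z3) +
        30 * y3 * y3 * (δ s) + 15 * y5 * (δ l) - 30 * z3 * (δ y3) - 15 * z5 * (δ μ)) *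
        (MvPolynomial.X 3 * MvPolynomial.X 1) +
      MvPolynomial.C (6 * μ * y32 * (δ s) + 10 * μ * y41 * (δ s) + 60 * μ * y5 * (δ (δ s)) - 180
        * y111 * z3 + 10 * y21 * (δ z3) + 6 * y32 * (δ l) + 130 * y3 * y21 * (δ s) + 60 * y3 * (δ
        y3) * (δ s) + 180 * y3 * z111 + 120 * y3 * (δ z21) + 30 * y3 * (δ (δ z3)) + 30 * y3 * y3 *
        (δ (δ s)) + 10 * y41 * (δ l) + 60 * y5 * (δ (δ l)) + 120 * y5 * (δ μ) * (δ s) - 10 * z21 *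
        (δ y3) - 6 * z32 * (δ μ) - 120 * z3 * (δ y21) - 30 * z3 * (δ (δ y3)) - 10 * z41 * (δ μ) -
        60 * z5 * (δ (δ μ))) * (MvPolynomial.X 2 * MvPolynomial.X 1 * MvPolynomial.X 0) +
      MvPolynomial.C (5 * μ * y2111 * (δ s) + 2 * μ * y221 * (δ (δ s)) + 6 * μ * y311 * (δ (δ
        s)) + μ * y32 * (δ (δ (δ s))) + 10 * μ * y41 * (δ (δ (δ s))) + 15 * μ * y5 * (δ (δ (δ (δ
        s)))) + 20 * y111 * (δ z21) + 5 * y2111 * (δ l) + 90 * y21 * y111 * (δ s) + 20 * y21 * (δ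
        y21) * (δ s) + 70 * y21 * (δ z111) + 10 * y21 * (δ (δ z21)) + 10 * y21 * y21 * (δ (δ s)) +
        2 * y221 * (δ (δ l)) + 4 * y221 * (δ μ) * (δ s) + 6 * y311 * (δ (δ l)) + 12 * y311 * (δ μ)
        * (δ s) + y32 * (δ (δ (δ l))) + 3 * y32 * (δ μ) * (δ (δ s)) + 3 * y32 * (δ (δ μ)) * (δ s)
        + 120 * y3 * y111 * (δ (δ s)) + 240 * y3 * (δ y111) * (δ s) + 10 * y3 * y21 * (δ (δ (δ
        s))) + 30 * y3 * (δ y21) * (δ (δ s)) + 30 * y3 * (δ (δ y21)) * (δ s) + 120 * y3 * (δ (δ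
        z111)) + 10 * y3 * (δ (δ (δ z21))) + 10 * y41 * (δ (δ (δ l))) + 30 * y41 * (δ μ) * (δ (δ
        s)) + 30 * y41 * (δ (δ μ)) * (δ s) + 15 * y5 * (δ (δ (δ (δ l)))) + 60 * y5 * (δ μ) * (δ (δ
        (δ s))) + 90 * y5 * (δ (δ μ)) * (δ (δ s)) + 60 * y5 * (δ (δ (δ μ))) * (δ s) - 20 * z111 *
        (δ y21) - 5 * z2111 * (δ μ) - 70 * z21 * (δ y111) - 10 * z21 * (δ (δ y21)) - 2 * z221 * (δ
        (δ μ)) - 6 * z311 * (δ (δ μ)) - z32 * (δ (δ (δ μ))) - 120 * z3 * (δ (δ y111)) - 10 * z3 *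
        (δ (δ (δ y21))) - 10 * z41 * (δ (δ (δ μ))) - 15 * z5 * (δ (δ (δ (δ μ))))) *
        (MvPolynomial.X 1 * (MvPolynomial.X 0) ^ 4) +
      MvPolynomial.C (5 * μ * y41 * (δ s) + 15 * μ * y5 * (δ (δ s)) + 20 * y21 * (δ z3) + 50 *
        y3 * y21 * (δ s) + 60 * y3 * (δ y3) * (δ s) + 30 * y3 * (δ z21) + 30 * y3 * (δ (δ z3)) +
        30 * y3 * y3 * (δ (δ s)) + 5 * y41 * (δ l) + 15 * y5 * (δ (δ l)) + 30 * y5 * (δ μ) * (δ s)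
        - 20 * z21 * (δ y3) - 30 * z3 * (δ y21) - 30 * z3 * (δ (δ y3)) - 5 * z41 * (δ μ) - 15 * z5
        * (δ (δ μ))) * (MvPolynomial.X 3 * (MvPolynomial.X 0) ^ 2) +
      MvPolynomial.C (10 * μ * y5 * (δ s) - 30 * y21 * z3 + 30 * y3 * z21 + 10 * y5 * (δ l) - 10
        * z5 * (δ μ)) * ((MvPolynomial.X 2) ^ 2) +
      MvPolynomial.C (5 * μ * y311 * (δ s) + μ * y32 * (δ (δ s)) + 10 * μ * y41 * (δ (δ s)) + 20
        * μ * y5 * (δ (δ (δ s))) + 20 * y111 * (δ z3) + 20 * y21 * (δ y3) * (δ s) + 20 * y21 * (δ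
        z21) + 10 * y21 * (δ (δ z3)) + 20 * y21 * y21 * (δ s) + 5 * y311 * (δ l) + y32 * (δ (δ l))
        + 2 * y32 * (δ μ) * (δ s) + 110 * y3 * y111 * (δ s) + 40 * y3 * y21 * (δ (δ s)) + 60 * y3
        * (δ y21) * (δ s) + 30 * y3 * (δ y3) * (δ (δ s)) + 30 * y3 * (δ (δ y3)) * (δ s) + 90 * y3
        * (δ z111) + 30 * y3 * (δ (δ z21)) + 10 * y3 * (δ (δ (δ z3))) + 10 * y3 * y3 * (δ (δ (δ
        s))) + 10 * y41 * (δ (δ l)) + 20 * y41 * (δ μ) * (δ s) + 20 * y5 * (δ (δ (δ l))) + 60 * y5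
        * (δ μ) * (δ (δ s)) + 60 * y5 * (δ (δ μ)) * (δ s) - 20 * z111 * (δ y3) - 20 * z21 * (δ
        y21) - 10 * z21 * (δ (δ y3)) - 5 * z311 * (δ μ) - z32 * (δ (δ μ)) - 90 * z3 * (δ y111) -
        30 * z3 * (δ (δ y21)) - 10 * z3 * (δ (δ (δ y3))) - 10 * z41 * (δ (δ μ)) - 20 * z5 * (δ (δ
        (δ μ)))) * (MvPolynomial.X 2 * (MvPolynomial.X 0) ^ 3) +
      MvPolynomial.C (5 * μ * y5 * (δ s) + 30 * y3 * (δ z3) + 30 * y3 * y3 * (δ s) + 5 * y5 * (δ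
        l) - 30 * z3 * (δ y3) - 5 * z5 * (δ μ)) * (MvPolynomial.X 4 * MvPolynomial.X 0) +
      MvPolynomial.C (4 * μ * y11111 * (δ s) + μ * y2111 * (δ (δ s)) + μ * y311 * (δ (δ (δ s)))
        + μ * y41 * (δ (δ (δ (δ s)))) + μ * y5 * (δ (δ (δ (δ (δ s))))) + 4 * y11111 * (δ l) + 20 *
        y111 * (δ z111) + 20 * y111 * y111 * (δ s) + y2111 * (δ (δ l)) + 2 * y2111 * (δ μ) * (δ s)
        + 10 * y21 * y111 * (δ (δ s)) + 20 * y21 * (δ y111) * (δ s) + 10 * y21 * (δ (δ z111)) +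
        y311 * (δ (δ (δ l))) + 3 * y311 * (δ μ) * (δ (δ s)) + 3 * y311 * (δ (δ μ)) * (δ s) + 10 *
        y3 * y111 * (δ (δ (δ s))) + 30 * y3 * (δ y111) * (δ (δ s)) + 30 * y3 * (δ (δ y111)) * (δ
        s) + 10 * y3 * (δ (δ (δ z111))) + y41 * (δ (δ (δ (δ l)))) + 4 * y41 * (δ μ) * (δ (δ (δ
        s))) + 6 * y41 * (δ (δ μ)) * (δ (δ s)) + 4 * y41 * (δ (δ (δ μ))) * (δ s) + y5 * (δ (δ (δ
        (δ (δ l))))) + 5 * y5 * (δ μ) * (δ (δ (δ (δ s)))) + 10 * y5 * (δ (δ μ)) * (δ (δ (δ s))) +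
        10 * y5 * (δ (δ (δ μ))) * (δ (δ s)) + 5 * y5 * (δ (δ (δ (δ μ)))) * (δ s) - 4 * z11111 * (δ
        μ) - 20 * z111 * (δ y111) - z2111 * (δ (δ μ)) - 10 * z21 * (δ (δ y111)) - z311 * (δ (δ (δ
        μ))) - 10 * z3 * (δ (δ (δ y111))) - z41 * (δ (δ (δ (δ μ)))) - z5 * (δ (δ (δ (δ (δ μ))))))
        * ((MvPolynomial.X 0) ^ 6) := by
  rw [commutator_four_linear, commutator_form3]
  simp only [map_add, map_mul, Derivation.leibniz, smul_eq_mul, map_sub, map_neg, map_ofNat]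
  ring


end Commutators

/-! ### Deformations even in ε -/

section Even

/-- The series with the given coefficients of `ε ^ 0`, `ε ^ 2`, `ε ^ 4` and no others. -/
def evenSeries {A : Type} [CommRing A] (a b c : DiffPoly A) : EpsSeries A :=
  PowerSeries.mk fun n => if n = 0 then a else if n = 2 then b else if n = 4 then c else 0

open PowerSeries (coeff)

section EvenSeries

variable {A : Type} [CommRing A] (a b c : DiffPoly A)

theorem coeff_evenSeries (n : ℕ) : coeff n (evenSeries a b c) =
    if n = 0 then a else if n = 2 then b else if n = 4 then c else 0 := by
  simp [evenSeries]

theorem coeff_evenSeries_zero : coeff 0 (evenSeries a b c) = a := by simp [coeff_evenSeries]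

theorem coeff_evenSeries_one : coeff 1 (evenSeries a b c) = 0 := by simp [coeff_evenSeries]

theorem coeff_evenSeries_two : coeff 2 (evenSeries a b c) = b := by simp [coeff_evenSeries]

theorem coeff_evenSeries_three : coeff 3 (evenSeries a b c) = 0 := by simp [coeff_evenSeries]

theorem coeff_evenSeries_four : coeff 4 (evenSeries a b c) = c := by simp [coeff_evenSeries]

theorem isHomogeneousSeries_evenSeries (d : ℕ)
    (ha : MvPolynomial.IsWeightedHomogeneous (fun k : ℕ => k + 1) a (0 + d))
    (hb : MvPolynomial.IsWeightedHomogeneous (fun k : ℕ => k + 1) b (2 + d))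
    (hc : MvPolynomial.IsWeightedHomogeneous (fun k : ℕ => k + 1) c (4 + d)) :
    IsHomogeneousSeries d (evenSeries a b c) := by
  intro n
  rw [coeff_evenSeries]
  split_ifs with h0 h2 h4
  · rw [h0]; exact ha
  · rw [h2]; exact hb
  · rw [h4]; exact hc
  · exact MvPolynomial.isWeightedHomogeneous_zero _ _ _

end EvenSeries

section Homogeneous

variable {A : Type} [CommRing A]

theorem isWeightedHomogeneous_C_mul {P : DiffPoly A} {n : ℕ} (a : A)
    (h : MvPolynomial.IsWeightedHomogeneous (fun k : ℕ => k + 1) P n) :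
    MvPolynomial.IsWeightedHomogeneous (fun k : ℕ => k + 1) (MvPolynomial.C a * P) n := by
  simpa using (MvPolynomial.isWeightedHomogeneous_C (fun k : ℕ => k + 1) a).mul h

theorem isWeightedHomogeneous_X_mul {P : DiffPoly A} {n : ℕ} (k : ℕ)
    (h : MvPolynomial.IsWeightedHomogeneous (fun k : ℕ => k + 1) P n) :
    MvPolynomial.IsWeightedHomogeneous (fun k : ℕ => k + 1) (MvPolynomial.X k * P) (k + 1 + n) :=
  (MvPolynomial.isWeightedHomogeneous_X A (fun k : ℕ => k + 1) k).mul h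

theorem isWeightedHomogeneous_X (k : ℕ) :
    MvPolynomial.IsWeightedHomogeneous (fun k : ℕ => k + 1) (MvPolynomial.X k : DiffPoly A)
      (k + 1) :=
  MvPolynomial.isWeightedHomogeneous_X A (fun k : ℕ => k + 1) k

theorem isWeightedHomogeneous_X_zero_pow (n : ℕ) :
    MvPolynomial.IsWeightedHomogeneous (fun k : ℕ => k + 1)
      ((MvPolynomial.X 0 : DiffPoly A) ^ n) n := by
  simpa using (isWeightedHomogeneous_X (A := A) 0).pow n

theorem isWeightedHomogeneous_X_one_sq :
    MvPolynomial.IsWeightedHomogeneous (fun k : ℕ => k + 1)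
      ((MvPolynomial.X 1 : DiffPoly A) ^ 2) 4 := by
  simpa using (isWeightedHomogeneous_X (A := A) 1).pow 2

theorem isWeightedHomogeneous_form2 (a b : A) :
    MvPolynomial.IsWeightedHomogeneous (fun k : ℕ => k + 1) (form2 a b) 2 :=
  (isWeightedHomogeneous_C_mul a (isWeightedHomogeneous_X 1)).add
    (isWeightedHomogeneous_C_mul b (isWeightedHomogeneous_X_zero_pow 2))

theorem isWeightedHomogeneous_form3 (a b c : A) :
    MvPolynomial.IsWeightedHomogeneous (fun k : ℕ => k + 1) (form3 a b c) 3 :=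
  ((isWeightedHomogeneous_C_mul a (isWeightedHomogeneous_X 2)).add
    (isWeightedHomogeneous_C_mul b (isWeightedHomogeneous_X_mul 1 (isWeightedHomogeneous_X 0)))).add
    (isWeightedHomogeneous_C_mul c (isWeightedHomogeneous_X_zero_pow 3))

theorem isWeightedHomogeneous_form4 (a b c d e : A) :
    MvPolynomial.IsWeightedHomogeneous (fun k : ℕ => k + 1) (form4 a b c d e) 4 :=
  ((((isWeightedHomogeneous_C_mul a (isWeightedHomogeneous_X 3)).add
    (isWeightedHomogeneous_C_mul b
      (isWeightedHomogeneous_X_mul 2 (isWeightedHomogeneous_X 0)))).add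
    (isWeightedHomogeneous_C_mul c isWeightedHomogeneous_X_one_sq)).add
    (isWeightedHomogeneous_C_mul d
      (isWeightedHomogeneous_X_mul 1 (isWeightedHomogeneous_X_zero_pow 2)))).add
    (isWeightedHomogeneous_C_mul e (isWeightedHomogeneous_X_zero_pow 4))

theorem isWeightedHomogeneous_form5 (a b c d e f g : A) :
    MvPolynomial.IsWeightedHomogeneous (fun k : ℕ => k + 1) (form5 a b c d e f g) 5 :=
  ((((((isWeightedHomogeneous_C_mul a (isWeightedHomogeneous_X 4)).add
    (isWeightedHomogeneous_C_mul b
      (isWeightedHomogeneous_X_mul 3 (isWeightedHomogeneous_X 0)))).add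
    (isWeightedHomogeneous_C_mul c
      (isWeightedHomogeneous_X_mul 2 (isWeightedHomogeneous_X 1)))).add
    (isWeightedHomogeneous_C_mul d
      (isWeightedHomogeneous_X_mul 2 (isWeightedHomogeneous_X_zero_pow 2)))).add
    (isWeightedHomogeneous_C_mul e
      (isWeightedHomogeneous_X_one_sq.mul (isWeightedHomogeneous_X 0)))).add
    (isWeightedHomogeneous_C_mul f
      (isWeightedHomogeneous_X_mul 1 (isWeightedHomogeneous_X_zero_pow 3)))).add
    (isWeightedHomogeneous_C_mul g (isWeightedHomogeneous_X_zero_pow 5))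

theorem isWeightedHomogeneous_smul [Algebra ℂ A] {P : DiffPoly A} {n : ℕ} (c : ℂ)
    (h : MvPolynomial.IsWeightedHomogeneous (fun k : ℕ => k + 1) P n) :
    MvPolynomial.IsWeightedHomogeneous (fun k : ℕ => k + 1) (c • P) n := by
  rw [Algebra.smul_def]
  exact isWeightedHomogeneous_C_mul _ h

end Homogeneous

section Forms

variable {A : Type} [CommRing A] [Algebra ℂ A] (δ : Derivation ℂ A A)

local notation "T" => totalDeriv δ

theorem totalDeriv_C_mul_X_zero (a : A) :
    T (MvPolynomial.C a * MvPolynomial.X 0) = form2 a (δ a) := by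
  simp only [form2, totalDeriv_mul, totalDeriv_C, totalDeriv_X]
  ring

theorem totalDeriv_form2 (a b : A) : T (form2 a b) = form3 a (δ a + 2 * b) (δ b) := by
  simp only [form2, form3, totalDeriv_add, totalDeriv_mul, totalDeriv_C, totalDeriv_X,
    totalDeriv_pow_two, map_add, map_mul, map_ofNat]
  ring

theorem totalDeriv_form3 (a b c : A) :
    T (form3 a b c) = form4 a (δ a + b) b (δ b + 3 * c) (δ c) := by
  simp only [form3, form4, pow_succ, pow_zero, one_mul, totalDeriv_add, totalDeriv_mul,
    totalDeriv_C, totalDeriv_X, map_add, map_mul, map_ofNat]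
  ring

theorem totalDeriv_form4 (a b c d e : A) : T (form4 a b c d e) =
    form5 a (δ a + b) (b + 2 * c) (δ b + d) (δ c + 2 * d) (δ d + 4 * e) (δ e) := by
  simp only [form4, form5, pow_succ, pow_zero, one_mul, totalDeriv_add, totalDeriv_mul,
    totalDeriv_C, totalDeriv_X, map_add, map_mul, map_ofNat]
  ring

theorem ofNat_smul_diffPoly (n : ℕ) [n.AtLeastTwo] (P : DiffPoly A) :
    (ofNat(n) : ℂ) • P = ofNat(n) * P := by
  rw [Algebra.smul_def, map_ofNat]

theorem totalDeriv_ofNat (n : ℕ) [n.AtLeastTwo] : T (ofNat(n) : DiffPoly A) = 0 := by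
  rw [← map_ofNat (MvPolynomial.C : A →+* DiffPoly A) n, totalDeriv_C, derivation_ofNat, map_zero,
    zero_mul]

theorem flowBy_C (P : DiffPoly A) (a : A) :
    flowBy δ P (MvPolynomial.C a) = MvPolynomial.C (δ a) * P := by
  simp [flowBy, prolong_C]



theorem flowBy_X_zero_comm (a b : A) :
    flowBy δ (MvPolynomial.C a * MvPolynomial.X 0) (MvPolynomial.C b * MvPolynomial.X 0) =
      flowBy δ (MvPolynomial.C b * MvPolynomial.X 0) (MvPolynomial.C a * MvPolynomial.X 0) := by
  simp only [flowBy, prolong_mul, prolong_C, prolong_X, Function.iterate_succ_apply',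
    Function.iterate_zero_apply, totalDeriv_mul, totalDeriv_C, totalDeriv_X]
  ring

/-- The coefficients `y` of `24 Y`, `5760 Y` and `s y + z` of `24 Z`, `5760 Z` for the deformation with
coefficients `q` of `24 w`, `5760 w`. -/
structure IsFormCoeffs (μ K b p : A) (q2 q11 q4 q31 q22 q211 q1111 : A)
    (y3 y21 y111 y5 y41 y32 y311 y221 y2111 y11111 : A)
    (z3 z21 z111 z5 z41 z32 z311 z221 z2111 z11111 : A) : Prop where
  eq_y3 : y3 = -2 * μ + q2
  eq_y21 : y21 = -6 * (δ μ) + 2 * q11 + (δ q2)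
  eq_y111 : y111 = -2 * (δ (δ μ)) + (δ q11)
  eq_y5 : y5 = 48 * μ - 20 * q2 + q4
  eq_y41 : y41 = 240 * (δ μ) - 40 * q11 - 60 * (δ q2) + q31 + (δ q4)
  eq_y32 : y32 = 480 * (δ μ) - 120 * q11 + 2 * q22 - 80 * (δ q2) + q31
  eq_y311 : y311 = 480 * (δ (δ μ)) - 140 * (δ q11) + q211 - 60 * (δ (δ q2)) + (δ q31)
  eq_y221 : y221 = 720 * (δ (δ μ)) - 240 * (δ q11) + 2 * q211 + (δ q22) - 60 * (δ (δ q2))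
  eq_y2111 : y2111 = 480 * (δ (δ (δ μ))) + 4 * q1111 - 180 * (δ (δ q11)) + (δ q211) - 20 * (δ
    (δ (δ q2)))
  eq_y11111 : y11111 = 48 * (δ (δ (δ (δ μ)))) + (δ q1111) - 20 * (δ (δ (δ q11)))
  eq_z3 : z3 = 2 * μ * q2 - 2 * μ * μ + 4 * p
  eq_z21 : z21 = -6 * μ * (δ μ) + 4 * μ * q11 + μ * q2 * K + 2 * μ * (δ q2) + 12 * p * b + 3 *
    q2 * (δ μ)
  eq_z111 : z111 = -2 * μ * (δ (δ μ)) + μ * q11 * K + 2 * μ * (δ q11) + 4 * p * b * b + 2 * q11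
    * (δ μ) + q2 * (δ (δ μ))
  eq_z5 : z5 = -40 * μ * q2 + 2 * μ * q4 + 48 * μ * μ + 48 * p + 10 * q2 * q2
  eq_z41 : z41 = 240 * μ * (δ μ) - 80 * μ * q11 - 60 * μ * (δ q2) + 2 * μ * q31 + μ * q4 * K +
    2 * μ * (δ q4) + 240 * p * b - 100 * q2 * (δ μ) + 40 * q2 * q11 + 30 * q2 * (δ q2) + 5 * q4
    * (δ μ)
  eq_z32 : z32 = 480 * μ * (δ μ) - 120 * μ * q11 + 4 * μ * q22 - 20 * μ * q2 * K - 100 * μ * (δ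
    q2) + 2 * μ * q31 + 480 * p * b - 200 * q2 * (δ μ) + 60 * q2 * q11 + 50 * q2 * (δ q2) + 10 *
    q2 * q2 * K + 10 * q4 * (δ μ)
  eq_z311 : z311 = 480 * μ * (δ (δ μ)) - 20 * μ * q11 * K - 160 * μ * (δ q11) + 2 * μ * q211 -
    60 * μ * (δ (δ q2)) + μ * q31 * K + 2 * μ * (δ q31) + 480 * p * b * b - 160 * q11 * (δ μ) +
    40 * q11 * (δ q2) + 40 * q11 * q11 - 200 * q2 * (δ (δ μ)) + 10 * q2 * q11 * K + 80 * q2 * (δ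
    q11) + 30 * q2 * (δ (δ q2)) + 5 * q31 * (δ μ) + 10 * q4 * (δ (δ μ))
  eq_z221 : z221 = 720 * μ * (δ (δ μ)) - 240 * μ * (δ q11) + 4 * μ * q211 + μ * q22 * K + 2 * μ
    * (δ q22) - 60 * μ * (δ (δ q2)) + 720 * p * b * b - 120 * q11 * (δ μ) + 40 * q11 * (δ q2) +
    40 * q11 * q11 + 6 * q22 * (δ μ) - 60 * q2 * (δ μ) * K - 300 * q2 * (δ (δ μ)) + 20 * q2 *
    q11 * K + 120 * q2 * (δ q11) + 10 * q2 * (δ q2) * K + 30 * q2 * (δ (δ q2)) - 60 * (δ q2) *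
    (δ μ) + 10 * (δ q2) * (δ q2) + 3 * q31 * (δ μ) + 15 * q4 * (δ (δ μ))
  eq_z2111 : z2111 = 480 * μ * (δ (δ (δ μ))) + 8 * μ * q1111 - 180 * μ * (δ (δ q11)) + μ * q211
    * K + 2 * μ * (δ q211) - 20 * μ * (δ (δ (δ q2))) + 480 * p * b * b * b - 60 * q11 * (δ μ) *
    K - 240 * q11 * (δ (δ μ)) + 120 * q11 * (δ q11) + 10 * q11 * (δ q2) * K + 20 * q11 * (δ (δ
    q2)) + 20 * q11 * q11 * K - 60 * (δ q11) * (δ μ) + 20 * (δ q11) * (δ q2) + 5 * q211 * (δ μ)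
    + 2 * q22 * (δ (δ μ)) - 20 * q2 * (δ (δ μ)) * K - 200 * q2 * (δ (δ (δ μ))) + 10 * q2 * (δ
    q11) * K + 90 * q2 * (δ (δ q11)) + 10 * q2 * (δ (δ (δ q2))) - 20 * (δ q2) * (δ (δ μ)) + 6 *
    q31 * (δ (δ μ)) + 10 * q4 * (δ (δ (δ μ)))
  eq_z11111 : z11111 = 48 * μ * (δ (δ (δ (δ μ)))) + μ * q1111 * K + 2 * μ * (δ q1111) - 20 * μ
    * (δ (δ (δ q11))) + 48 * p * b * b * b * b + 4 * q1111 * (δ μ) - 20 * q11 * (δ (δ μ)) * K -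
    40 * q11 * (δ (δ (δ μ))) + 10 * q11 * (δ q11) * K + 20 * q11 * (δ (δ q11)) - 20 * (δ q11) *
    (δ (δ μ)) + 10 * (δ q11) * (δ q11) + q211 * (δ (δ μ)) - 20 * q2 * (δ (δ (δ (δ μ)))) + 10 *
    q2 * (δ (δ (δ q11))) + q31 * (δ (δ (δ μ))) + q4 * (δ (δ (δ (δ μ))))

set_option maxRecDepth 10000 in
set_option maxHeartbeats 4000000 in
/-- A deformation with explicit even terms. The coefficients of `24 Y`, `5760 Y` are called `y`, and
those of `24 Z`, `5760 Z` are `s y + z`. -/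
theorem exists_isDeformation_of_forms {h μ s K b p l : A} {ψ η f g : ℕ → A} (hμ : δ h = μ)
    (hψ0 : ψ 0 = s) (hψ1 : ψ 1 = K) (hψ2 : ψ 2 = 0) (hη0 : η 0 = 1) (hη1 : η 1 = 0) (hη2 : η 2 = 0)
    (hf1 : f 1 = 0) (hf2 : f 2 = 0) (hg1 : g 1 = 0) (hg2 : g 2 = 0)
    (hp1 : 2 * f 0 * δ (g 0) = p) (hp2 : 2 * f 0 * δ (δ (g 0)) = b * p)
    (hp3 : 2 * f 0 * δ (δ (δ (g 0))) = b ^ 2 * p) (hp4 : 2 * f 0 * δ (δ (δ (δ (g 0)))) = b ^ 3 * p)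
    (hp5 : 2 * f 0 * δ (δ (δ (δ (δ (g 0))))) = b ^ 4 * p) (hl : l = μ * μ + p)
    {q2 q11 q4 q31 q22 q211 q1111 : A} {y3 y21 y111 y5 y41 y32 y311 y221 y2111 y11111 : A}
    {z3 z21 z111 z5 z41 z32 z311 z221 z2111 z11111 : A}
    (F : IsFormCoeffs δ μ K b p q2 q11 q4 q31 q22 q211 q1111 y3 y21 y111 y5 y41 y32 y311 y221 y2111 y11111
      z3 z21 z111 z5 z41 z32 z311 z221 z2111 z11111)
    (h2 : flowBy δ (MvPolynomial.C (s * μ + l) * MvPolynomial.X 0) (form3 y3 y21 y111) +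
      flowBy δ (form3 (s * y3 + z3) (s * y21 + z21) (s * y111 + z111))
        (MvPolynomial.C μ * MvPolynomial.X 0) -
      flowBy δ (MvPolynomial.C μ * MvPolynomial.X 0)
        (form3 (s * y3 + z3) (s * y21 + z21) (s * y111 + z111)) -
      flowBy δ (form3 y3 y21 y111) (MvPolynomial.C (s * μ + l) * MvPolynomial.X 0) = 0)
    (h4 : flowBy δ (MvPolynomial.C (s * μ + l) * MvPolynomial.X 0) (form5 y5 y41 y32 y311 y221 y2111 y11111) +
      flowBy δ (form5 (s * y5 + z5) (s * y41 + z41) (s * y32 + z32) (s * y311 + z311) (s * y221 + z221) (s *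
        y2111 + z2111) (s * y11111 + z11111))
        (MvPolynomial.C μ * MvPolynomial.X 0) -
      flowBy δ (MvPolynomial.C μ * MvPolynomial.X 0)
        (form5 (s * y5 + z5) (s * y41 + z41) (s * y32 + z32) (s * y311 + z311) (s * y221 + z221) (s *
        y2111 + z2111) (s * y11111 + z11111)) -
      flowBy δ (form5 y5 y41 y32 y311 y221 y2111 y11111)
        (MvPolynomial.C (s * μ + l) * MvPolynomial.X 0) +
      10 * (flowBy δ (form3 (s * y3 + z3) (s * y21 + z21) (s * y111 + z111)) (form3 y3 y21 y111) -
      flowBy δ (form3 y3 y21 y111) (form3 (s * y3 + z3) (s * y21 + z21) (s * y111 + z111))) = 0) :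
    ∃ w Y Z : EpsSeries A, IsDeformation δ 4 h ψ η f g f g w Y Z := by
  obtain ⟨hy3, hy21, hy111, hy5, hy41, hy32, hy311, hy221, hy2111, hy11111, hz3, hz21, hz111, hz5, hz41, hz32, hz311, hz221, hz2111, hz11111⟩ := F
  have hT3 : T (T (T (MvPolynomial.C h))) = form3 μ (3 * δ μ) (δ (δ μ)) := by
    rw [totalDeriv_C, totalDeriv_C_mul_X_zero, totalDeriv_form2, hμ]
    congr 1
    ring
  have hT5 : T (T (T (T (T (MvPolynomial.C h))))) = form5 μ (5 * δ μ) (10 * δ μ) (10 * δ (δ μ))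
      (15 * δ (δ μ)) (10 * δ (δ (δ μ))) (δ (δ (δ (δ μ)))) := by
    rw [hT3, totalDeriv_form3, totalDeriv_form4]
    simp only [Derivation.leibniz, map_add, derivation_ofNat, smul_eq_mul, mul_zero, add_zero]
    congr 1 <;> ring
  -- This is the nonlocality at order ε²; after multiplication by 24 the factor 1/12 becomes 2.
  have hY2 : (24⁻¹ : ℂ) • form3 y3 y21 y111 =
      T ((24⁻¹ : ℂ) • form2 q2 q11) - (12⁻¹ : ℂ) • form3 μ (3 * δ μ) (δ (δ μ)) := by
    have e : form3 y3 y21 y111 = T (form2 q2 q11) - (2 : ℂ) • form3 μ (3 * δ μ) (δ (δ μ)) := by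
      rw [ofNat_smul_diffPoly, totalDeriv_form2, hy3, hy21, hy111]
      simp only [form3, map_add, map_neg, map_mul, map_ofNat]
      ring
    rw [e, totalDeriv_smul]
    module
  -- This is the nonlocality at order ε⁴: the integers are 20 = 5760/(12·24) and 48 = 5760/120.
  have hY4 : (5760⁻¹ : ℂ) • form5 y5 y41 y32 y311 y221 y2111 y11111 =
      T ((5760⁻¹ : ℂ) • form4 q4 q31 q22 q211 q1111) -
        (12⁻¹ : ℂ) • T (T (T ((24⁻¹ : ℂ) • form2 q2 q11))) +
        (120⁻¹ : ℂ) • form5 μ (5 * δ μ) (10 * δ μ) (10 * δ (δ μ))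
        (15 * δ (δ μ)) (10 * δ (δ (δ μ))) (δ (δ (δ (δ μ)))) := by
    have e : form5 y5 y41 y32 y311 y221 y2111 y11111 = T (form4 q4 q31 q22 q211 q1111) -
        (20 : ℂ) • T (T (T (form2 q2 q11))) + (48 : ℂ) • form5 μ (5 * δ μ) (10 * δ μ) (10 * δ (δ μ))
      (15 * δ (δ μ)) (10 * δ (δ (δ μ))) (δ (δ (δ (δ μ)))) := by
      rw [ofNat_smul_diffPoly, ofNat_smul_diffPoly, totalDeriv_form2, totalDeriv_form3,
        totalDeriv_form4, totalDeriv_form4, hy5, hy41, hy32,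
        hy311, hy221, hy2111, hy11111]
      simp only [form5, map_add, map_sub, map_mul, map_ofNat, Derivation.leibniz,
        derivation_ofNat, smul_eq_mul, mul_zero, add_zero]
      ring
    rw [e]
    simp only [totalDeriv_smul]
    module
  have hG3 : MvPolynomial.C (2 * f 0) * T (T (T (MvPolynomial.C (g 0)))) =
      form3 p (3 * (b * p)) (b ^ 2 * p) := by
    rw [totalDeriv_C, totalDeriv_C_mul_X_zero, totalDeriv_form2, ← hp3, ← hp2, ← hp1]
    simp only [form3, map_add, map_mul, map_ofNat]
    ring
  have hG5 : MvPolynomial.C (2 * f 0) * T (T (T (T (T (MvPolynomial.C (g 0)))))) =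
      form5 p (5 * (b * p)) (10 * (b * p)) (10 * (b ^ 2 * p)) (15 * (b ^ 2 * p)) (10 * (b ^ 3 * p))
        (b ^ 4 * p) := by
    rw [totalDeriv_C, totalDeriv_C_mul_X_zero, totalDeriv_form2, totalDeriv_form3, totalDeriv_form4,
      ← hp5, ← hp4, ← hp3, ← hp2, ← hp1]
    simp only [form5, map_add, map_mul, map_ofNat, Derivation.leibniz, derivation_ofNat, smul_eq_mul,
      mul_zero, add_zero]
    ring
  have hf0 : MvPolynomial.C (f 0) = (2⁻¹ : ℂ) • MvPolynomial.C (σ := ℕ) (2 * f 0) := by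
    rw [map_mul, map_ofNat, ← ofNat_smul_diffPoly]
    module
  have hG3' : MvPolynomial.C (f 0) * T (T (T (MvPolynomial.C (g 0)))) =
      (2⁻¹ : ℂ) • form3 p (3 * (b * p)) (b ^ 2 * p) := by
    rw [hf0, smul_mul_assoc, hG3]
  have hG5' : MvPolynomial.C (f 0) * T (T (T (T (T (MvPolynomial.C (g 0)))))) =
      (2⁻¹ : ℂ) • form5 p (5 * (b * p)) (10 * (b * p)) (10 * (b ^ 2 * p)) (15 * (b ^ 2 * p))
        (10 * (b ^ 3 * p)) (b ^ 4 * p) := by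
    rw [hf0, smul_mul_assoc, hG5]
  -- The evolution equation at order ε², times 24. The two differences of g together contribute
  -- 2·(1/6)∂³g, which turns 2f∂³g into 24/6 = 4 times itself.
  have hZ2 : form3 (s * y3 + z3) (s * y21 + z21) (s * y111 + z111) = MvPolynomial.C s * form3 y3 y21 y111 +
      MvPolynomial.C K * form2 q2 q11 * (MvPolynomial.C μ * MvPolynomial.X 0) +
      (flowBy δ (MvPolynomial.C μ * MvPolynomial.X 0) (form2 q2 q11) +
        MvPolynomial.C μ * form3 y3 y21 y111) + (4 : ℂ) • form3 p (3 * (b * p)) (b ^ 2 * p) := by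
    rw [ofNat_smul_diffPoly, hz3, hz21, hz111,
      hy3, hy21, hy111]
    simp only [flowBy, form2, form3, pow_succ, pow_zero, one_mul, prolong_add, prolong_mul, prolong_C,
      prolong_X, Function.iterate_succ_apply', Function.iterate_zero_apply, totalDeriv_add,
      totalDeriv_mul, totalDeriv_C, totalDeriv_X, map_add, map_sub, map_mul, map_neg, map_ofNat]
    ring
  -- The evolution equation at order ε⁴, times 5760: products of two corrections of order ε² receive
  -- 5760/24² = 10, and the fifth derivatives of g receive 5760/120 = 48.
  have hZ4 : form5 (s * y5 + z5) (s * y41 + z41) (s * y32 + z32) (s * y311 + z311) (s * y221 + z221) (s *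
        y2111 + z2111) (s * y11111 + z11111) =
      MvPolynomial.C s * form5 y5 y41 y32 y311 y221 y2111 y11111 +
      (10 : ℂ) • (MvPolynomial.C K * form2 q2 q11 * form3 y3 y21 y111) +
      MvPolynomial.C K * form4 q4 q31 q22 q211 q1111 * (MvPolynomial.C μ * MvPolynomial.X 0) +
      (flowBy δ (MvPolynomial.C μ * MvPolynomial.X 0) (form4 q4 q31 q22 q211 q1111) +
        (10 : ℂ) • flowBy δ (form3 y3 y21 y111) (form2 q2 q11) +
        MvPolynomial.C μ * form5 y5 y41 y32 y311 y221 y2111 y11111) +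
      (48 : ℂ) • form5 p (5 * (b * p)) (10 * (b * p)) (10 * (b ^ 2 * p)) (15 * (b ^ 2 * p))
        (10 * (b ^ 3 * p)) (b ^ 4 * p) := by
    simp only [ofNat_smul_diffPoly]
    rw [hz5, hz41, hz32, hz311, hz221, hz2111, hz11111,
      hy5, hy41, hy32, hy311, hy221, hy2111, hy11111,
      hy3, hy21, hy111]
    simp only [flowBy, form2, form3, form4, form5, pow_succ, pow_zero, one_mul, prolong_add,
      prolong_mul, prolong_C, prolong_X, Function.iterate_succ_apply', Function.iterate_zero_apply,
      totalDeriv_add, totalDeriv_mul, totalDeriv_C, totalDeriv_X, map_add, map_sub, map_mul, map_neg,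
      map_ofNat, totalDeriv_neg, totalDeriv_ofNat, mul_zero, add_zero, neg_zero]
    ring
  have hfl : flowBy δ (MvPolynomial.C μ * MvPolynomial.X 0) (MvPolynomial.C h) =
      MvPolynomial.C μ * (MvPolynomial.C μ * MvPolynomial.X 0) := by rw [flowBy_C, hμ]
  refine ⟨evenSeries (MvPolynomial.C h) ((24⁻¹ : ℂ) • form2 q2 q11)
      ((5760⁻¹ : ℂ) • form4 q4 q31 q22 q211 q1111),
    evenSeries (MvPolynomial.C μ * MvPolynomial.X 0) ((24⁻¹ : ℂ) • form3 y3 y21 y111)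
      ((5760⁻¹ : ℂ) • form5 y5 y41 y32 y311 y221 y2111 y11111),
    evenSeries (MvPolynomial.C (s * μ + l) * MvPolynomial.X 0)
      ((24⁻¹ : ℂ) • form3 (s * y3 + z3) (s * y21 + z21) (s * y111 + z111))
      ((5760⁻¹ : ℂ) • form5 (s * y5 + z5) (s * y41 + z41) (s * y32 + z32) (s * y311 + z311) (s * y221 + z221) (s *
        y2111 + z2111) (s * y11111 + z11111)), ?_⟩
  set w := evenSeries (MvPolynomial.C h) ((24⁻¹ : ℂ) • form2 q2 q11)
      ((5760⁻¹ : ℂ) • form4 q4 q31 q22 q211 q1111) with hw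
  have hw0 : coeff 0 w = MvPolynomial.C h := coeff_evenSeries_zero _ _ _
  have hw1 : coeff 1 w = 0 := coeff_evenSeries_one _ _ _
  have hw2 : coeff 2 w = (24⁻¹ : ℂ) • form2 q2 q11 := coeff_evenSeries_two _ _ _
  have hw3 : coeff 3 w = 0 := coeff_evenSeries_three _ _ _
  have hw4 : coeff 4 w = (5760⁻¹ : ℂ) • form4 q4 q31 q22 q211 q1111 := coeff_evenSeries_four _ _ _
  refine ⟨isHomogeneousSeries_evenSeries _ _ _ _ (MvPolynomial.isWeightedHomogeneous_C _ _)
      (isWeightedHomogeneous_smul _ (isWeightedHomogeneous_form2 _ _))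
      (isWeightedHomogeneous_smul _ (isWeightedHomogeneous_form4 _ _ _ _ _)),
    isHomogeneousSeries_evenSeries _ _ _ _
      (isWeightedHomogeneous_C_mul _ (isWeightedHomogeneous_X 0))
      (isWeightedHomogeneous_smul _ (isWeightedHomogeneous_form3 _ _ _))
      (isWeightedHomogeneous_smul _ (isWeightedHomogeneous_form5 _ _ _ _ _ _ _)),
    isHomogeneousSeries_evenSeries _ _ _ _
      (isWeightedHomogeneous_C_mul _ (isWeightedHomogeneous_X 0))
      (isWeightedHomogeneous_smul _ (isWeightedHomogeneous_form3 _ _ _))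
      (isWeightedHomogeneous_smul _ (isWeightedHomogeneous_form5 _ _ _ _ _ _ _)),
    hw0, ?_, ?_, ?_, ?_⟩
  · rw [coeff_evenSeries_zero, hμ]
  · rw [nonlocality_iff, hw0, hw1, hw2, hw3, hw4, coeff_evenSeries_zero, coeff_evenSeries_one,
      coeff_evenSeries_two, coeff_evenSeries_three, coeff_evenSeries_four, hT5, hT3]
    refine ⟨by rw [totalDeriv_C, hμ], (totalDeriv_zero δ).symm, hY2, ?_, hY4⟩
    simp only [totalDeriv_zero, smul_zero, sub_zero]
  · intro n hn
    have hg5 : ∀ c : ℂ, coeff 5 (shift δ c (evalAt h g w)) - coeff 5 (evalAt h g w) =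
        (c ^ 5 / 120) • T (T (T (T (T (MvPolynomial.C (g 0)))))) := by
      intro c
      rw [coeff_shift_five, coeff_evalAt_zero, coeff_evalAt_one, coeff_evalAt_two g hw0 hw1,
        coeff_evalAt_three g hw0 hw1, coeff_evalAt_four g hw0 hw1]
      simp [hg1, hg2, totalDeriv_zero]
    have hb5 : coeff 5 (evalAt h g w) - coeff 5 (shift δ (-1) (evalAt h g w)) =
        (120⁻¹ : ℂ) • T (T (T (T (T (MvPolynomial.C (g 0)))))) := by
      rw [← neg_sub, hg5]
      module
    interval_cases n <;>
    simp only [map_add, PowerSeries.coeff_mul, sum_antidiagonal_one, sum_antidiagonal_two,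
      sum_antidiagonal_three, sum_antidiagonal_four, Finset.Nat.antidiagonal_zero,
      Finset.sum_singleton, coeff_flowDeriv, coeff_forwardDiff, coeff_backwardDiff,
      coeff_evenSeries_zero, coeff_evenSeries_one, coeff_evenSeries_two, coeff_evenSeries_three,
      coeff_evenSeries_four, hw0, hw1, hw2, hw3, hw4, coeff_evalAt_zero, coeff_evalAt_one,
      coeff_evalAt_two _ hw0 hw1, coeff_evalAt_three _ hw0 hw1, coeff_evalAt_four _ hw0 hw1,
      hψ0, hψ1, hψ2, hη0, hη1, hη2, hf1, hf2, hg1, hg2, flowBy_zero, flowBy_zero_left, map_zero,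
      zero_mul, mul_zero, add_zero, zero_add, smul_zero, map_one, one_mul, Nat.reduceAdd,
      coeff_shift_one, coeff_shift_two, coeff_shift_three, coeff_shift_four, totalDeriv_zero,
      hg5, hb5, sub_zero, zero_sub]
    · rw [hfl, totalDeriv_C, hl, map_add, ← hp1]
      simp only [map_mul, map_ofNat]
      rw [neg_one_smul, neg_neg, one_smul]
      ring
    -- At odd orders only even derivatives of g are left, and they enter the forward and the
    -- backward difference with opposite signs.
    · simp only [mul_neg, mul_smul_comm]
      module
    · simp only [mul_smul_comm, smul_mul_assoc, flowBy_smul, flowBy_C, hμ, hZ2,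
        hG3', mul_neg]
      module
    · simp only [mul_neg, mul_smul_comm]
      module
    · simp only [mul_smul_comm, smul_mul_assoc, flowBy_smul, flowBy_smul_left, flowBy_C, hμ, hZ4,
        hG5']
      module
  · intro n hn
    -- Odd orders are closed by the simplification, as odd coefficients vanish. Order zero is the
    -- commutation of two flows of first order; the hypotheses on commutators are used at orders two
    -- and four.
    interval_cases n <;>
    simp only [coeff_flowDeriv, sum_antidiagonal_one, sum_antidiagonal_two,
      sum_antidiagonal_three, sum_antidiagonal_four, Finset.Nat.antidiagonal_zero,
      Finset.sum_singleton, coeff_evenSeries_zero, coeff_evenSeries_one, coeff_evenSeries_two,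
      coeff_evenSeries_three, coeff_evenSeries_four, flowBy_zero, flowBy_zero_left, add_zero,
      zero_add, flowBy_smul, flowBy_smul_left]
    · exact flowBy_X_zero_comm δ _ _
    · linear_combination (norm := module) (24⁻¹ : ℂ) • h2
    · rw [← ofNat_smul_diffPoly] at h4
      linear_combination (norm := module) (5760⁻¹ : ℂ) • h4

/-- The coefficients of the flows become opaque variables, tied to the q's by `IsFormCoeffs` alone,
so that later computations never unfold them. The two commutators are then all that is left to
verify. -/
theorem exists_isDeformation_of_commutators {h μ s K b p l : A} {ψ η f g : ℕ → A} (hμ : δ h = μ)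
    (hψ0 : ψ 0 = s) (hψ1 : ψ 1 = K) (hψ2 : ψ 2 = 0) (hη0 : η 0 = 1) (hη1 : η 1 = 0) (hη2 : η 2 = 0)
    (hf1 : f 1 = 0) (hf2 : f 2 = 0) (hg1 : g 1 = 0) (hg2 : g 2 = 0)
    (hp1 : 2 * f 0 * δ (g 0) = p) (hp2 : 2 * f 0 * δ (δ (g 0)) = b * p)
    (hp3 : 2 * f 0 * δ (δ (δ (g 0))) = b ^ 2 * p) (hp4 : 2 * f 0 * δ (δ (δ (δ (g 0)))) = b ^ 3 * p)
    (hp5 : 2 * f 0 * δ (δ (δ (δ (δ (g 0))))) = b ^ 4 * p) (hl : l = μ * μ + p)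
    (q2 q11 q4 q31 q22 q211 q1111 : A)
    (H : ∀ y3 y21 y111 y5 y41 y32 y311 y221 y2111 y11111
      z3 z21 z111 z5 z41 z32 z311 z221 z2111 z11111 : A,
      IsFormCoeffs δ μ K b p q2 q11 q4 q31 q22 q211 q1111 y3 y21 y111 y5 y41 y32 y311 y221 y2111 y11111
        z3 z21 z111 z5 z41 z32 z311 z221 z2111 z11111 →
      flowBy δ (MvPolynomial.C (s * μ + l) * MvPolynomial.X 0) (form3 y3 y21 y111) +
      flowBy δ (form3 (s * y3 + z3) (s * y21 + z21) (s * y111 + z111))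
        (MvPolynomial.C μ * MvPolynomial.X 0) -
      flowBy δ (MvPolynomial.C μ * MvPolynomial.X 0)
        (form3 (s * y3 + z3) (s * y21 + z21) (s * y111 + z111)) -
      flowBy δ (form3 y3 y21 y111) (MvPolynomial.C (s * μ + l) * MvPolynomial.X 0) = 0 ∧
      flowBy δ (MvPolynomial.C (s * μ + l) * MvPolynomial.X 0) (form5 y5 y41 y32 y311 y221 y2111 y11111) +
      flowBy δ (form5 (s * y5 + z5) (s * y41 + z41) (s * y32 + z32) (s * y311 + z311) (s * y221 + z221) (s *
        y2111 + z2111) (s * y11111 + z11111))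
        (MvPolynomial.C μ * MvPolynomial.X 0) -
      flowBy δ (MvPolynomial.C μ * MvPolynomial.X 0)
        (form5 (s * y5 + z5) (s * y41 + z41) (s * y32 + z32) (s * y311 + z311) (s * y221 + z221) (s *
        y2111 + z2111) (s * y11111 + z11111)) -
      flowBy δ (form5 y5 y41 y32 y311 y221 y2111 y11111)
        (MvPolynomial.C (s * μ + l) * MvPolynomial.X 0) +
      10 * (flowBy δ (form3 (s * y3 + z3) (s * y21 + z21) (s * y111 + z111)) (form3 y3 y21 y111) -
      flowBy δ (form3 y3 y21 y111) (form3 (s * y3 + z3) (s * y21 + z21) (s * y111 + z111))) = 0) :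
    ∃ w Y Z : EpsSeries A, IsDeformation δ 4 h ψ η f g f g w Y Z := by
  -- The twenty coefficients are found by unification with the right-hand sides of their equations.
  have F : IsFormCoeffs δ μ K b p q2 q11 q4 q31 q22 q211 q1111 _ _ _ _ _ _ _ _ _ _ _ _ _ _ _ _ _ _ _ _ :=
    ⟨rfl, rfl, rfl, rfl, rfl, rfl, rfl, rfl, rfl, rfl, rfl, rfl, rfl, rfl, rfl, rfl, rfl, rfl, rfl, rfl⟩
  have H' := H _ _ _ _ _ _ _ _ _ _ _ _ _ _ _ _ _ _ _ _ F
  exact exists_isDeformation_of_forms δ hμ hψ0 hψ1 hψ2 hη0 hη1 hη2 hf1 hf2 hg1 hg2 hp1 hp2 hp3 hp4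
    hp5 hl F H'.1 H'.2

end Forms

end Even

/-! ### Verified computation in a ring with a derivation

Polynomials with integer coefficients in finitely many elements `ρ` of a ring, on which a derivation
acts by polynomials, are stored as lists of monomials; the exponents are the digits to the base `64`
of the code of a monomial, and the coefficients are differences of natural numbers. -/

/-- Sparse polynomials: `cons m a b p` is `(a - b) x ^ m + p`; the value `bad` records an overflow. -/
inductive SparsePoly
  | bad
  | nil
  | cons (m a b : ℕ) (p : SparsePoly)

/-- The value of a monomial. -/
def monomialVal {A : Type} [CommRing A] : List A → ℕ → A
  | [], _ => 1
  | x :: l, m => x ^ (m % 64) * monomialVal l (m / 64)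

/-- All digits are smaller than `32`. -/
def smallDigits : ℕ → ℕ → Bool :=
  Nat.rec (fun _ => true) fun _ ih m => and (Nat.blt (m % 64) 32) (ih (m / 64))

namespace SparsePoly

/-- The value of a polynomial. -/
def val {A : Type} [CommRing A] (ρ : List A) : SparsePoly → A
  | bad => 0
  | nil => 0
  | cons m a b p => ((a : A) - b) * monomialVal ρ m + val ρ p

/-- Add a monomial in front, unless it is zero. -/
def consNonzero (m a b : ℕ) (p : SparsePoly) : SparsePoly :=
  cond (Nat.beq a b) p (cons m a b p)

/-- Addition, by merging. -/
def add (p : SparsePoly) : SparsePoly → SparsePoly :=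
  SparsePoly.rec (motive := fun _ => SparsePoly → SparsePoly) (fun _ => bad) (fun q => q)
    (fun m a b p ih q => SparsePoly.rec (motive := fun _ => SparsePoly) bad (cons m a b p)
      (fun m' a' b' q' ih' => cond (Nat.blt m' m) (cons m a b (ih (cons m' a' b' q')))
        (cond (Nat.blt m m') (cons m' a' b' ih') (consNonzero m (a + a') (b + b') (ih q')))) q) p

/-- Multiplication by a monomial. -/
def mulMonomial (m a b : ℕ) (p : SparsePoly) : SparsePoly :=
  SparsePoly.rec (motive := fun _ => SparsePoly) bad nil
    (fun m' a' b' _ ih => cons (m + m') (a * a' + b * b') (a * b' + b * a') ih) p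

/-- No exponent is large. -/
def small (n : ℕ) (p : SparsePoly) : Bool :=
  SparsePoly.rec (motive := fun _ => Bool) false true (fun m _ _ _ ih => and (smallDigits n m) ih) p

/-- Multiplication, without a check for overflow. -/
def mulUnchecked (p q : SparsePoly) : SparsePoly :=
  SparsePoly.rec (motive := fun _ => SparsePoly) bad nil
    (fun m a b _ ih => add (mulMonomial m a b q) ih) p

/-- Multiplication. -/
def mul (n : ℕ) (p q : SparsePoly) : SparsePoly :=
  cond (and (small n p) (small n q)) (mulUnchecked p q) bad

/-- The derivative of a monomial with code `M` and coefficient `a - b`: `m` are the digits of `M`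
from the place `w` on, and `D` are the derivatives of the corresponding elements. -/
def derivMonomial (M a b : ℕ) (D : List SparsePoly) : ℕ → ℕ → SparsePoly :=
  List.rec (motive := fun _ => ℕ → ℕ → SparsePoly) (fun _ _ => nil)
    (fun d _ ih w m => cond (Nat.beq (m % 64) 0) (ih (w * 64) (m / 64))
      (add (mulMonomial (M - w) (a * (m % 64)) (b * (m % 64)) d) (ih (w * 64) (m / 64)))) D

/-- The derivative, without a check for overflow. -/
def derivUnchecked (D : List SparsePoly) (p : SparsePoly) : SparsePoly :=
  SparsePoly.rec (motive := fun _ => SparsePoly) bad nil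
    (fun m a b _ ih => add (derivMonomial m a b D 1 m) ih) p

/-- Test for overflow at the beginning. -/
def isBad (p : SparsePoly) : Bool :=
  SparsePoly.rec (motive := fun _ => Bool) true false (fun _ _ _ _ _ => false) p

/-- No exponent is large in the entries of a list, except for entries equal to `bad`. -/
def allSmall (n : ℕ) (D : List SparsePoly) : Bool :=
  List.rec (motive := fun _ => Bool) true (fun d _ ih => and (or (isBad d) (small n d)) ih) D

/-- The derivative. -/
def der (n : ℕ) (D : List SparsePoly) (p : SparsePoly) : SparsePoly :=
  cond (and (small n p) (allSmall n D)) (derivUnchecked D p) bad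

/-- Test for zero. -/
def isZero (p : SparsePoly) : Bool :=
  SparsePoly.rec (motive := fun _ => Bool) false true (fun _ _ _ _ _ => false) p

/-- No overflow is recorded. -/
def Good : SparsePoly → Prop
  | bad => False
  | nil => True
  | cons _ _ _ p => Good p

/-- `a` is the value of `p`, unless there was an overflow. -/
def Represents {A : Type} [CommRing A] (ρ : List A) (a : A) (p : SparsePoly) : Prop :=
  Good p → a = val ρ p

section

variable {A : Type} [CommRing A] {ρ : List A}

/-- The test accepts only `nil`, for which `Good` is trivial, so it never relies on a value lost in
an overflow. -/
theorem Represents.eq_zero {a : A} {p : SparsePoly} (h : Represents ρ a p) (hp : isZero p = true) :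
    a = 0 := by
  cases p with
  | bad => exact absurd hp Bool.false_ne_true
  | nil => exact h trivial
  | cons m a b p => exact absurd hp Bool.false_ne_true

theorem val_consNonzero (m a b : ℕ) (p : SparsePoly) :
    val ρ (consNonzero m a b p) = ((a : A) - b) * monomialVal ρ m + val ρ p := by
  unfold consNonzero
  cases h : Nat.beq a b with
  | false => rfl
  | true => rw [Nat.eq_of_beq_eq_true h, sub_self, zero_mul, zero_add]; rfl

theorem good_consNonzero {m a b : ℕ} {p : SparsePoly} : Good (consNonzero m a b p) ↔ Good p := by
  unfold consNonzero
  cases Nat.beq a b <;> rfl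

theorem good_add (p : SparsePoly) : ∀ q, Good (add p q) →
    Good p ∧ Good q ∧ val ρ (add p q) = val ρ p + val ρ q := by
  induction p with
  | bad => exact fun q h => h.elim
  | nil => exact fun q h => ⟨trivial, h, (zero_add _).symm⟩
  | cons m a b p ih =>
    intro q
    induction q with
    | bad => exact fun h => h.elim
    | nil => exact fun h => ⟨h, trivial, (add_zero _).symm⟩
    | cons m' a' b' q ih' =>
      have e : add (cons m a b p) (cons m' a' b' q) =
        cond (Nat.blt m' m) (cons m a b (add p (cons m' a' b' q)))
          (cond (Nat.blt m m') (cons m' a' b' (add (cons m a b p) q))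
            (consNonzero m (a + a') (b + b') (add p q))) := rfl
      rw [e]
      cases h1 : Nat.blt m' m with
      | true =>
        intro h
        obtain ⟨g1, g2, g3⟩ := ih _ h
        refine ⟨g1, g2, ?_⟩
        change _ + val ρ (add p (cons m' a' b' q)) = (_ + _) + _
        rw [g3, add_assoc]
      | false =>
        cases h2 : Nat.blt m m' with
        | true =>
          intro h
          obtain ⟨g1, g2, g3⟩ := ih' h
          refine ⟨g1, g2, ?_⟩
          change _ + val ρ (add (cons m a b p) q) = _ + (_ + _)
          rw [g3, add_left_comm]
        | false =>
          intro h
          have hm : m' = m := by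
            have h3 := Bool.eq_false_iff.1 h1
            have h4 := Bool.eq_false_iff.1 h2
            rw [Ne, Nat.blt_eq] at h3 h4
            omega
          obtain ⟨g1, g2, g3⟩ := ih _ (good_consNonzero.1 h)
          refine ⟨g1, g2, ?_⟩
          change val ρ (consNonzero _ _ _ _) = (_ + _) + (_ + _)
          rw [val_consNonzero, g3, hm]
          push_cast
          ring

theorem Represents.add {a b : A} {p q : SparsePoly} (ha : Represents ρ a p)
    (hb : Represents ρ b q) : Represents ρ (a + b) (p.add q) := fun h => by
  obtain ⟨g1, g2, g3⟩ := good_add (ρ := ρ) p q h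
  rw [g3, ha g1, hb g2]

/-- A monomial whose digits are smaller than `32`. -/
def HasSmallDigits : ℕ → ℕ → Prop
  | 0, _ => True
  | n + 1, m => m % 64 < 32 ∧ HasSmallDigits n (m / 64)

theorem smallDigits_iff (n : ℕ) : ∀ m, smallDigits n m = true ↔ HasSmallDigits n m := by
  induction n with
  | zero => exact fun m => ⟨fun _ => trivial, fun _ => rfl⟩
  | succ n ih =>
    intro m
    change and (Nat.blt (m % 64) 32) (smallDigits n (m / 64)) = true ↔ _
    rw [Bool.and_eq_true, ih, HasSmallDigits, Nat.blt_eq]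

/-- Digits below 32 add without a carry to the base 64, so adding the codes adds the exponents. -/
theorem monomialVal_add : ∀ (ρ : List A) (m n : ℕ), HasSmallDigits ρ.length m →
    HasSmallDigits ρ.length n → monomialVal ρ (m + n) = monomialVal ρ m * monomialVal ρ n
  | [], _, _, _, _ => (one_mul _).symm
  | x :: ρ, m, n, hm, hn => by
    have h1 : (m + n) % 64 = m % 64 + n % 64 := by
      have := hm.1
      have := hn.1
      omega
    have h2 : (m + n) / 64 = m / 64 + n / 64 := by
      have := hm.1
      have := hn.1
      omega
    rw [monomialVal, monomialVal, monomialVal, h1, h2, pow_add,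
      monomialVal_add ρ _ _ hm.2 hn.2]
    ring

/-- All exponents are small. -/
def Small (n : ℕ) : SparsePoly → Prop
  | bad => False
  | nil => True
  | cons m _ _ p => HasSmallDigits n m ∧ Small n p

theorem small_iff (n : ℕ) (p : SparsePoly) : small n p = true ↔ Small n p := by
  induction p with
  | bad => exact ⟨fun h => absurd h Bool.false_ne_true, fun h => h.elim⟩
  | nil => exact ⟨fun _ => trivial, fun _ => rfl⟩
  | cons m a b p ih =>
    change and (smallDigits n m) (small n p) = true ↔ _
    rw [Bool.and_eq_true, ih, smallDigits_iff, Small]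

theorem Small.good {n : ℕ} {p : SparsePoly} (h : Small n p) : Good p := by
  induction p with
  | bad => exact h
  | nil => trivial
  | cons m a b p ih => exact ih h.2

theorem val_mulMonomial {m : ℕ} (a b : ℕ) (hm : HasSmallDigits ρ.length m) {p : SparsePoly}
    (hp : Small ρ.length p) :
    val ρ (mulMonomial m a b p) = ((a : A) - b) * monomialVal ρ m * val ρ p := by
  induction p with
  | bad => exact hp.elim
  | nil => exact (mul_zero _).symm
  | cons m' a' b' p ih =>
    change ((_ : ℕ) - (_ : ℕ) : A) * monomialVal ρ (m + m') + val ρ (mulMonomial m a b p) = _ * (_ + _)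
    rw [ih hp.2, monomialVal_add _ _ _ hm hp.1]
    push_cast
    ring

theorem val_mulUnchecked {p q : SparsePoly} (hp : Small ρ.length p) (hq : Small ρ.length q)
    (h : Good (mulUnchecked p q)) : val ρ (mulUnchecked p q) = val ρ p * val ρ q := by
  induction p with
  | bad => exact hp.elim
  | nil => exact (zero_mul _).symm
  | cons m a b p ih =>
    obtain ⟨-, g2, g3⟩ := good_add (ρ := ρ) (mulMonomial m a b q) (mulUnchecked p q) h
    change val ρ (SparsePoly.add (mulMonomial m a b q) (mulUnchecked p q)) = (_ + _) * _
    rw [g3, ih hp.2 g2, val_mulMonomial a b hp.1 hq]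
    ring

theorem Represents.mul {a b : A} {p q : SparsePoly} (ha : Represents ρ a p)
    (hb : Represents ρ b q) : Represents ρ (a * b) (mul ρ.length p q) := fun h => by
  unfold SparsePoly.mul at h ⊢
  cases h1 : and (small ρ.length p) (small ρ.length q) with
  | false => rw [h1] at h; exact h.elim
  | true =>
    rw [h1] at h
    rw [Bool.and_eq_true, small_iff, small_iff] at h1
    rw [ha h1.1.good, hb h1.2.good]
    exact (val_mulUnchecked h1.1 h1.2 h).symm

theorem HasSmallDigits.sub_one {n m : ℕ} (h : HasSmallDigits (n + 1) m) (h0 : m % 64 ≠ 0) :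
    HasSmallDigits (n + 1) (m - 1) :=
  ⟨by have := h.1; omega, by rw [show (m - 1) / 64 = m / 64 by omega]; exact h.2⟩

theorem monomialVal_cons_sub_one (x : A) (ρ : List A) {m : ℕ} (h0 : m % 64 ≠ 0) :
    monomialVal (x :: ρ) (m - 1) = x ^ (m % 64 - 1) * monomialVal ρ (m / 64) := by
  rw [monomialVal, show (m - 1) / 64 = m / 64 by omega, show (m - 1) % 64 = m % 64 - 1 by omega]

/-- The sum over the remaining places of the contributions to the derivative of a monomial. -/
theorem val_derivMonomial [Algebra ℂ A] (δ : Derivation ℂ A A) (M a b : ℕ) (c : A) :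
    ∀ (l : List A) (D : List SparsePoly), List.Forall₂ (fun x d => Represents ρ (δ x) d) l D →
      ∀ w m, (∀ m', HasSmallDigits l.length m' → m' ≤ m →
        monomialVal ρ (M - w * (m - m')) = c * monomialVal l m' ∧
          HasSmallDigits ρ.length (M - w * (m - m'))) →
      HasSmallDigits l.length m → (∀ d ∈ D, d = bad ∨ Small ρ.length d) → Good (derivMonomial M a b D w m) →
      val ρ (derivMonomial M a b D w m) = ((a : A) - b) * c * δ (monomialVal l m)
  | [], _, .nil, w, m, _, _, _, _ => by
    change 0 = _ * δ 1
    rw [Derivation.map_one_eq_zero, mul_zero]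
  | x :: l, d :: D, .cons hx hl, w, m, H, hm, hD, hg => by
    -- The current power of x joins the part of the monomial that has been passed, collected in c,
    -- and the place value w is multiplied by 64.
    have hH : ∀ m', HasSmallDigits l.length m' → m' ≤ m / 64 →
        monomialVal ρ (M - w * 64 * (m / 64 - m')) = c * x ^ (m % 64) * monomialVal l m' ∧
          HasSmallDigits ρ.length (M - w * 64 * (m / 64 - m')) := by
      intro m' h1 h2
      have h3 := H (m % 64 + 64 * m') ⟨by have := hm.1; omega, by
        rw [show (m % 64 + 64 * m') / 64 = m' by omega]; exact h1⟩ (by omega)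
      rw [monomialVal, show (m % 64 + 64 * m') / 64 = m' by omega,
        show (m % 64 + 64 * m') % 64 = m % 64 by omega,
        show m - (m % 64 + 64 * m') = 64 * (m / 64 - m') by omega, ← mul_assoc, ← mul_assoc] at h3
      exact h3
    have e : derivMonomial M a b (d :: D) w m = cond (Nat.beq (m % 64) 0)
        (derivMonomial M a b D (w * 64) (m / 64)) (SparsePoly.add
          (mulMonomial (M - w) (a * (m % 64)) (b * (m % 64)) d)
          (derivMonomial M a b D (w * 64) (m / 64))) := rfl
    have hD' : ∀ d ∈ D, d = bad ∨ Small ρ.length d := fun d' h' => hD d' (List.mem_cons_of_mem _ h')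
    rw [e] at hg ⊢
    cases h0 : Nat.beq (m % 64) 0 with
    | true =>
      rw [h0] at hg
      have h1 := Nat.eq_of_beq_eq_true h0
      have h2 := val_derivMonomial δ M a b _ l D hl (w * 64) (m / 64) hH hm.2 hD' hg
      change val ρ (derivMonomial M a b D (w * 64) (m / 64)) = _
      rw [h2, monomialVal, h1, pow_zero, one_mul, mul_one]
    | false =>
      rw [h0] at hg
      have h1 := Nat.ne_of_beq_eq_false h0
      obtain ⟨g1, g2, g3⟩ := good_add (ρ := ρ) _ _ hg
      have hd : d ≠ bad := fun hd => by rw [hd] at g1; exact g1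
      have hd' := (hD d (List.mem_cons_self ..)).resolve_left hd
      have hx := hx hd'.good
      have h2 := val_derivMonomial δ M a b _ l D hl (w * 64) (m / 64) hH hm.2 hD' g2
      -- Subtracting the place value w from the code M lowers the current exponent by one, as in
      -- d(xⁿ) = n xⁿ⁻¹ dx.
      have h3 := H (m - 1) (hm.sub_one h1) (by omega)
      rw [show m - (m - 1) = 1 by omega, mul_one, monomialVal_cons_sub_one x l h1] at h3
      change val ρ (SparsePoly.add _ _) = _
      rw [g3, h2, val_mulMonomial _ _ h3.2 hd', h3.1, monomialVal,
        Derivation.leibniz, Derivation.leibniz_pow, hx]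
      simp only [smul_eq_mul, nsmul_eq_mul]
      push_cast
      ring

theorem isBad_iff (p : SparsePoly) : isBad p = true ↔ p = bad := by
  cases p with
  | bad => exact ⟨fun _ => rfl, fun _ => rfl⟩
  | nil => exact ⟨fun h => absurd h Bool.false_ne_true, fun h => by cases h⟩
  | cons m a b p => exact ⟨fun h => absurd h Bool.false_ne_true, fun h => by cases h⟩

theorem allSmall_iff (n : ℕ) (D : List SparsePoly) :
    allSmall n D = true ↔ ∀ d ∈ D, d = bad ∨ Small n d := by
  induction D with
  | nil => exact ⟨fun _ d h => absurd h (List.not_mem_nil), fun _ => rfl⟩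
  | cons d D ih =>
    change and (or (isBad d) (small n d)) (allSmall n D) = true ↔ _
    rw [Bool.and_eq_true, Bool.or_eq_true, ih, small_iff, isBad_iff, List.forall_mem_cons]

theorem val_derivUnchecked [Algebra ℂ A] (δ : Derivation ℂ A A) {D : List SparsePoly}
    (hδ : List.Forall₂ (fun x d => Represents ρ (δ x) d) ρ D) (hD : ∀ d ∈ D, d = bad ∨ Small ρ.length d)
    {p : SparsePoly} (hp : Small ρ.length p) (h : Good (derivUnchecked D p)) :
    δ (val ρ p) = val ρ (derivUnchecked D p) := by
  induction p with
  | bad => exact hp.elim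
  | nil => exact map_zero δ
  | cons m a b p ih =>
    obtain ⟨g1, g2, g3⟩ := good_add (ρ := ρ) (derivMonomial m a b D 1 m) (derivUnchecked D p) h
    change δ (_ + val ρ p) = val ρ (SparsePoly.add (derivMonomial m a b D 1 m) (derivUnchecked D p))
    have h1 := val_derivMonomial δ m a b 1 ρ D hδ 1 m (fun m' h1 h2 => by
      rw [show m - 1 * (m - m') = m' by omega, one_mul]
      exact ⟨rfl, h1⟩) hp.1 hD g1
    rw [g3, map_add, ih hp.2 g2, h1, Derivation.leibniz, map_sub, Derivation.map_natCast,
      Derivation.map_natCast, sub_zero, smul_zero, add_zero, smul_eq_mul, mul_one]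

theorem Represents.der [Algebra ℂ A] {δ : Derivation ℂ A A} {D : List SparsePoly}
    (hδ : List.Forall₂ (fun x d => Represents ρ (δ x) d) ρ D) {a : A} {p : SparsePoly}
    (ha : Represents ρ a p) : Represents ρ (δ a) (der ρ.length D p) := fun h => by
  unfold SparsePoly.der at h ⊢
  cases h1 : and (small ρ.length p) (allSmall ρ.length D) with
  | false => rw [h1] at h; exact h.elim
  | true =>
    rw [h1] at h
    rw [Bool.and_eq_true, small_iff, allSmall_iff] at h1
    rw [ha h1.1.good]
    exact val_derivUnchecked δ hδ h1.2 h1.1 h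

/-- Natural numbers. -/
def ofNatural (n : ℕ) : SparsePoly := consNonzero 0 n 0 nil

theorem monomialVal_zero : ∀ ρ : List A, monomialVal ρ 0 = 1
  | [] => rfl
  | x :: ρ => by rw [monomialVal, Nat.zero_mod, Nat.zero_div, pow_zero, one_mul, monomialVal_zero]

theorem represents_natCast (n : ℕ) : Represents ρ (n : A) (ofNatural n) := fun _ => by
  rw [ofNatural, val_consNonzero, monomialVal_zero, val]
  simp

/-- The negative. -/
def neg (p : SparsePoly) : SparsePoly :=
  SparsePoly.rec (motive := fun _ => SparsePoly) bad nil (fun m a b _ ih => cons m b a ih) p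

theorem good_neg {p : SparsePoly} (h : Good (neg p)) : Good p ∧ val ρ (neg p) = -val ρ p := by
  induction p with
  | bad => exact h.elim
  | nil => exact ⟨trivial, neg_zero.symm⟩
  | cons m a b p ih =>
    obtain ⟨g1, g2⟩ := ih h
    refine ⟨g1, ?_⟩
    change _ + val ρ (neg p) = -(_ + _)
    rw [g2]
    ring

theorem Represents.neg {a : A} {p : SparsePoly} (ha : Represents ρ a p) :
    Represents ρ (-a) p.neg := fun h => by
  obtain ⟨g1, g2⟩ := good_neg (ρ := ρ) h
  rw [g2, ha g1]

end

end SparsePoly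

/-! ### Differential expressions -/

/-- Differential expressions in a list of elements. -/
inductive DiffExpr
  | var (i : ℕ)
  | num (n : ℕ)
  | add (x y : DiffExpr)
  | sub (x y : DiffExpr)
  | mul (x y : DiffExpr)
  | neg (x : DiffExpr)
  | der (x : DiffExpr)

namespace DiffExpr

instance : Add DiffExpr := ⟨add⟩
instance : Sub DiffExpr := ⟨sub⟩
instance : Mul DiffExpr := ⟨mul⟩
instance : Neg DiffExpr := ⟨neg⟩
instance (n : ℕ) : OfNat DiffExpr n := ⟨num n⟩

/-- The element described by an expression. -/
def val {A : Type} [CommRing A] [Algebra ℂ A] (δ : Derivation ℂ A A) (l : List A) : DiffExpr → A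
  | var i => l.getD i 0
  | num n => n
  | add x y => val δ l x + val δ l y
  | sub x y => val δ l x - val δ l y
  | mul x y => val δ l x * val δ l y
  | neg x => -val δ l x
  | der x => δ (val δ l x)

/-- The polynomial described by an expression. -/
def poly (n : ℕ) (D l : List SparsePoly) (x : DiffExpr) : SparsePoly :=
  DiffExpr.rec (motive := fun _ => SparsePoly) (fun i => l.getD i .nil) .ofNatural
    (fun _ _ p q => p.add q) (fun _ _ p q => p.add q.neg) (fun _ _ p q => .mul n p q)
    (fun _ p => p.neg) (fun _ p => .der n D p) x

variable {A : Type} [CommRing A] [Algebra ℂ A] {δ : Derivation ℂ A A} {ρ : List A}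
  {D : List SparsePoly}

theorem represents_poly (hδ : List.Forall₂ (fun x d => SparsePoly.Represents ρ (δ x) d) ρ D) {l : List A}
    {L : List SparsePoly} (hl : List.Forall₂ (SparsePoly.Represents ρ) l L) :
    ∀ x : DiffExpr, SparsePoly.Represents ρ (val δ l x) (poly ρ.length D L x)
  | var i => by
    change SparsePoly.Represents ρ (l.getD i 0) (L.getD i .nil)
    induction hl generalizing i with
    | nil => exact fun _ => rfl
    | cons h1 h2 ih =>
      cases i with
      | zero => exact h1
      | succ i => exact ih i
  | num n => SparsePoly.represents_natCast n
  | add x y => (represents_poly hδ hl x).add (represents_poly hδ hl y)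
  | sub x y => by
    have h := (represents_poly hδ hl x).add (represents_poly hδ hl y).neg
    rw [← sub_eq_add_neg] at h
    exact h
  | mul x y => (represents_poly hδ hl x).mul (represents_poly hδ hl y)
  | neg x => (represents_poly hδ hl x).neg
  | der x => (represents_poly hδ hl x).der hδ

@[simp] theorem val_var (l : List A) (i : ℕ) : val δ l (var i) = l.getD i 0 := rfl

@[simp] theorem val_add (l : List A) (x y : DiffExpr) : val δ l (x + y) = val δ l x + val δ l y := rfl

@[simp] theorem val_sub (l : List A) (x y : DiffExpr) : val δ l (x - y) = val δ l x - val δ l y := rfl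

@[simp] theorem val_mul (l : List A) (x y : DiffExpr) : val δ l (x * y) = val δ l x * val δ l y := rfl

@[simp] theorem val_neg (l : List A) (x : DiffExpr) : val δ l (-x) = -val δ l x := rfl

@[simp] theorem val_der (l : List A) (x : DiffExpr) : val δ l (der x) = δ (val δ l x) := rfl

@[simp] theorem val_zero (l : List A) : val δ l 0 = 0 := Nat.cast_zero

@[simp] theorem val_one (l : List A) : val δ l 1 = 1 := Nat.cast_one

@[simp] theorem val_ofNat (l : List A) (n : ℕ) [n.AtLeastTwo] :
    val δ l ofNat(n) = OfNat.ofNat n := rfl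

/-- `r` are the values of successive expressions, in which the values of the preceding ones may be
used. -/
def IsRun (δ : Derivation ℂ A A) : List A → List DiffExpr → List A → Prop
  | _, [], r => r = []
  | _, _ :: _, [] => False
  | l, x :: xs, a :: r => a = val δ l x ∧ IsRun δ (l ++ [a]) xs r

/-- The polynomials of successive expressions. -/
def run (n : ℕ) (D : List SparsePoly) (xs : List DiffExpr) : List SparsePoly → List SparsePoly :=
  List.rec (motive := fun _ => List SparsePoly → List SparsePoly) (fun L => L)
    (fun x _ ih L => ih (L ++ [poly n D L x])) xs

/-- Each value is appended to the list available to the later expressions. In this way the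
coefficients are expanded once, and the commutators refer to them by index. -/
theorem represents_run (hδ : List.Forall₂ (fun x d => SparsePoly.Represents ρ (δ x) d) ρ D) :
    ∀ {xs : List DiffExpr} {l r : List A} {L : List SparsePoly},
      List.Forall₂ (SparsePoly.Represents ρ) l L → IsRun δ l xs r →
      List.Forall₂ (SparsePoly.Represents ρ) (l ++ r) (run ρ.length D xs L)
  | [], l, r, _, hl, h => by
    cases r with
    | nil =>
      rw [List.append_nil]
      exact hl
    | cons a r => cases h
  | _ :: _, _, [], _, _, h => h.elim
  | x :: xs, l, a :: r, L, hl, h => by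
    have h1 : SparsePoly.Represents ρ a (poly ρ.length D L x) := h.1 ▸ represents_poly hδ hl x
    have h2 : List.Forall₂ (SparsePoly.Represents ρ) (l ++ [a]) (L ++ [poly ρ.length D L x]) :=
      List.rel_append hl (.cons h1 .nil)
    have h3 := represents_run hδ h2 h.2
    rw [List.append_assoc] at h3
    exact h3

/-- All expressions vanish. -/
def allZero (n : ℕ) (D L : List SparsePoly) (xs : List DiffExpr) : Bool :=
  List.rec (motive := fun _ => Bool) true (fun x _ ih => and (poly n D L x).isZero ih) xs

/-- The values of all expressions vanish. -/
def AllZero (δ : Derivation ℂ A A) (l : List A) : List DiffExpr → Prop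
  | [] => True
  | x :: xs => val δ l x = 0 ∧ AllZero δ l xs

/-- Soundness of the computation: a Boolean evaluated by reduction yields identities in an arbitrary
ring with derivation. -/
theorem allZero_of_allZero (hδ : List.Forall₂ (fun x d => SparsePoly.Represents ρ (δ x) d) ρ D)
    {l : List A} {L : List SparsePoly} (hl : List.Forall₂ (SparsePoly.Represents ρ) l L)
    {xs : List DiffExpr} (h : allZero ρ.length D L xs = true) : AllZero δ l xs := by
  induction xs with
  | nil => trivial
  | cons y xs ih =>
    change and (poly ρ.length D L y).isZero (allZero ρ.length D L xs) = true at h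
    rw [Bool.and_eq_true] at h
    exact ⟨(represents_poly hδ hl y).eq_zero h.1, ih h.2⟩

end DiffExpr

theorem add_eq_zero_of_eq_zero {A : Type} [CommRing A] {P Q : DiffPoly A} (hP : P = 0) (hQ : Q = 0) :
    P + Q = 0 := by rw [hP, hQ, add_zero]

theorem C_mul_eq_zero_of_eq_zero {A : Type} [CommRing A] {a : A} {P : DiffPoly A} (ha : a = 0) :
    MvPolynomial.C a * P = 0 := by rw [ha, map_zero, zero_mul]

/-! ### Two finitely generated systems closed under differentiation -/

namespace DiffExpr

/-- The polynomials given by the ten atoms. -/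
def atoms : List SparsePoly :=
  [.cons 1 1 0 .nil, .cons 64 1 0 .nil, .cons (64 ^ 2) 1 0 .nil, .cons (64 ^ 3) 1 0 .nil,
    .cons (64 ^ 4) 1 0 .nil, .cons (64 ^ 5) 1 0 .nil, .cons (64 ^ 6) 1 0 .nil,
    .cons (64 ^ 7) 1 0 .nil, .cons (64 ^ 8) 1 0 .nil, .cons (64 ^ 9) 1 0 .nil]

theorem represents_atoms {A : Type} [CommRing A] (t x m0 m1 m2 m3 m4 m5 K s : A) :
    List.Forall₂ (SparsePoly.Represents [t, x, m0, m1, m2, m3, m4, m5, K, s])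
      [t, x, m0, m1, m2, m3, m4, m5, K, s] atoms := by
  simp [List.forall₂_cons, SparsePoly.Represents, SparsePoly.val, monomialVal, atoms]

/-- The polynomial in the atoms given by an expression without derivatives. -/
def atomPoly (x : DiffExpr) : SparsePoly := poly 10 (List.replicate 10 .bad) atoms x

theorem represents_atomPoly {A : Type} [CommRing A] [Algebra ℂ A] (δ : Derivation ℂ A A)
    {t x m0 m1 m2 m3 m4 m5 K s a : A} {e : DiffExpr}
    (h : a = val δ [t, x, m0, m1, m2, m3, m4, m5, K, s] e) :
    SparsePoly.Represents [t, x, m0, m1, m2, m3, m4, m5, K, s] a (atomPoly e) := by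
  rw [h]
  -- All derivatives in the table are `bad`, so nothing has to be known about δ here; an expression
  -- containing a derivative of an atom would evaluate to `bad`.
  refine represents_poly (ρ := [t, x, m0, m1, m2, m3, m4, m5, K, s]) ?_
    (represents_atoms t x m0 m1 m2 m3 m4 m5 K s) e
  simp [List.replicate, SparsePoly.Represents, SparsePoly.Good]

/-- The derivatives of the atoms. -/
def hydrodynamicDerivs : List SparsePoly :=
  let t : DiffExpr := var 0
  let x : DiffExpr := var 1
  let m0 : DiffExpr := var 2
  let m1 : DiffExpr := var 3
  let m2 : DiffExpr := var 4
  let m3 : DiffExpr := var 5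
  let m4 : DiffExpr := var 6
  let m5 : DiffExpr := var 7
  let K : DiffExpr := var 8
  [atomPoly (K * t * (1 - K * x + m0)), atomPoly (m0 - K * x * (1 - K * x + m0)), atomPoly (m1), atomPoly (m2), atomPoly (m3), atomPoly (m4), atomPoly (m5), .bad, atomPoly (0), atomPoly (t)]

theorem represents_hydrodynamicDerivs {A : Type} [CommRing A] [Algebra ℂ A] {δ : Derivation ℂ A A}
    {K s t x m0 m1 m2 m3 m4 m5 : A} (hK : δ K = 0) (hs : δ s = t) (ht : δ t = K * t * (1 - K * x + m0))
    (hx : δ x = m0 - K * x * (1 - K * x + m0)) (hm0 : δ m0 = m1) (hm1 : δ m1 = m2) (hm2 : δ m2 = m3)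
    (hm3 : δ m3 = m4) (hm4 : δ m4 = m5) :
    List.Forall₂ (fun a d => SparsePoly.Represents [t, x, m0, m1, m2, m3, m4, m5, K, s] (δ a) d)
      [t, x, m0, m1, m2, m3, m4, m5, K, s] hydrodynamicDerivs := by
  refine .cons (represents_atomPoly δ ?_) ?_
  · rw [ht]
    simp
  refine .cons (represents_atomPoly δ ?_) ?_
  · rw [hx]
    simp
  refine .cons (represents_atomPoly δ ?_) ?_
  · rw [hm0]
    simp
  refine .cons (represents_atomPoly δ ?_) ?_
  · rw [hm1]
    simp
  refine .cons (represents_atomPoly δ ?_) ?_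
  · rw [hm2]
    simp
  refine .cons (represents_atomPoly δ ?_) ?_
  · rw [hm3]
    simp
  refine .cons (represents_atomPoly δ ?_) ?_
  · rw [hm4]
    simp
  -- The derivative of m5 is not expressible in the atoms. The entry `bad` makes its claim vacuous,
  -- and a computation in which it occurs is not accepted.
  refine .cons (fun h => h.elim) ?_
  refine .cons (represents_atomPoly δ ?_) ?_
  · rw [hK]
    simp
  refine .cons (represents_atomPoly δ ?_) ?_
  · rw [hs]
    simp
  exact .nil

/-- The derivatives of the atoms. -/
def ellipticDerivs : List SparsePoly :=
  let t : DiffExpr := var 0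
  let x : DiffExpr := var 1
  let m0 : DiffExpr := var 2
  let m1 : DiffExpr := var 3
  let m2 : DiffExpr := var 4
  let m3 : DiffExpr := var 5
  let m4 : DiffExpr := var 6
  let m5 : DiffExpr := var 7
  let K : DiffExpr := var 8
  [atomPoly (K * t * (1 - x * x + x * m0)), atomPoly (K * (m0 - x * (1 - x * x + x * m0))), atomPoly (K * m1), atomPoly (K * m2), atomPoly (K * m3), atomPoly (K * m4), atomPoly (K * m5), .bad, atomPoly (0), atomPoly (K * (2 * t * x))]

theorem represents_ellipticDerivs {A : Type} [CommRing A] [Algebra ℂ A] {δ : Derivation ℂ A A}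
    {K s t x m0 m1 m2 m3 m4 m5 : A} (hK : δ K = 0) (hs : δ s = K * (2 * t * x)) (ht : δ t = K * t * (1 - x * x + x * m0))
    (hx : δ x = K * (m0 - x * (1 - x * x + x * m0))) (hm0 : δ m0 = K * m1) (hm1 : δ m1 = K * m2)
    (hm2 : δ m2 = K * m3) (hm3 : δ m3 = K * m4) (hm4 : δ m4 = K * m5) :
    List.Forall₂ (fun a d => SparsePoly.Represents [t, x, m0, m1, m2, m3, m4, m5, K, s] (δ a) d)
      [t, x, m0, m1, m2, m3, m4, m5, K, s] ellipticDerivs := by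
  refine .cons (represents_atomPoly δ ?_) ?_
  · rw [ht]
    simp
  refine .cons (represents_atomPoly δ ?_) ?_
  · rw [hx]
    simp
  refine .cons (represents_atomPoly δ ?_) ?_
  · rw [hm0]
    simp
  refine .cons (represents_atomPoly δ ?_) ?_
  · rw [hm1]
    simp
  refine .cons (represents_atomPoly δ ?_) ?_
  · rw [hm2]
    simp
  refine .cons (represents_atomPoly δ ?_) ?_
  · rw [hm3]
    simp
  refine .cons (represents_atomPoly δ ?_) ?_
  · rw [hm4]
    simp
  refine .cons (fun h => h.elim) ?_
  refine .cons (represents_atomPoly δ ?_) ?_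
  · rw [hK]
    simp
  refine .cons (represents_atomPoly δ ?_) ?_
  · rw [hs]
    simp
  exact .nil

end DiffExpr

/-! ### Flow coefficients and commutators as symbolic expressions -/

namespace DiffExpr

/-- The coefficients described by `IsFormCoeffs`. -/
def formCoeffs : List DiffExpr :=
  let δ := der
  let K : DiffExpr := var 8
  let μ : DiffExpr := var 10
  let b : DiffExpr := var 11
  let p : DiffExpr := var 12
  let q2 : DiffExpr := var 14
  let q11 : DiffExpr := var 15
  let q4 : DiffExpr := var 16
  let q31 : DiffExpr := var 17
  let q22 : DiffExpr := var 18
  let q211 : DiffExpr := var 19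
  let q1111 : DiffExpr := var 20
  [-2 * μ + q2,
   -6 * (δ μ) + 2 * q11 + (δ q2),
   -2 * (δ (δ μ)) + (δ q11),
   48 * μ - 20 * q2 + q4,
   240 * (δ μ) - 40 * q11 - 60 * (δ q2) + q31 + (δ q4),
   480 * (δ μ) - 120 * q11 + 2 * q22 - 80 * (δ q2) + q31,
   480 * (δ (δ μ)) - 140 * (δ q11) + q211 - 60 * (δ (δ q2)) + (δ q31),
   720 * (δ (δ μ)) - 240 * (δ q11) + 2 * q211 + (δ q22) - 60 * (δ (δ q2)),
   480 * (δ (δ (δ μ))) + 4 * q1111 - 180 * (δ (δ q11)) + (δ q211) - 20 * (δ (δ (δ q2))),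
   48 * (δ (δ (δ (δ μ)))) + (δ q1111) - 20 * (δ (δ (δ q11))),
   2 * μ * q2 - 2 * μ * μ + 4 * p,
   -6 * μ * (δ μ) + 4 * μ * q11 + μ * q2 * K + 2 * μ * (δ q2) + 12 * p * b + 3 * q2 * (δ μ),
   -2 * μ * (δ (δ μ)) + μ * q11 * K + 2 * μ * (δ q11) + 4 * p * b * b + 2 * q11 * (δ μ) + q2 * (δ
    (δ μ)),
   -40 * μ * q2 + 2 * μ * q4 + 48 * μ * μ + 48 * p + 10 * q2 * q2,
   240 * μ * (δ μ) - 80 * μ * q11 - 60 * μ * (δ q2) + 2 * μ * q31 + μ * q4 * K + 2 * μ * (δ q4) +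
    240 * p * b - 100 * q2 * (δ μ) + 40 * q2 * q11 + 30 * q2 * (δ q2) + 5 * q4 * (δ μ),
   480 * μ * (δ μ) - 120 * μ * q11 + 4 * μ * q22 - 20 * μ * q2 * K - 100 * μ * (δ q2) + 2 * μ *
    q31 + 480 * p * b - 200 * q2 * (δ μ) + 60 * q2 * q11 + 50 * q2 * (δ q2) + 10 * q2 * q2 * K + 10
    * q4 * (δ μ),
   480 * μ * (δ (δ μ)) - 20 * μ * q11 * K - 160 * μ * (δ q11) + 2 * μ * q211 - 60 * μ * (δ (δ q2))
    + μ * q31 * K + 2 * μ * (δ q31) + 480 * p * b * b - 160 * q11 * (δ μ) + 40 * q11 * (δ q2) + 40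
    * q11 * q11 - 200 * q2 * (δ (δ μ)) + 10 * q2 * q11 * K + 80 * q2 * (δ q11) + 30 * q2 * (δ (δ
    q2)) + 5 * q31 * (δ μ) + 10 * q4 * (δ (δ μ)),
   720 * μ * (δ (δ μ)) - 240 * μ * (δ q11) + 4 * μ * q211 + μ * q22 * K + 2 * μ * (δ q22) - 60 * μ
    * (δ (δ q2)) + 720 * p * b * b - 120 * q11 * (δ μ) + 40 * q11 * (δ q2) + 40 * q11 * q11 + 6 *
    q22 * (δ μ) - 60 * q2 * (δ μ) * K - 300 * q2 * (δ (δ μ)) + 20 * q2 * q11 * K + 120 * q2 * (δ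
    q11) + 10 * q2 * (δ q2) * K + 30 * q2 * (δ (δ q2)) - 60 * (δ q2) * (δ μ) + 10 * (δ q2) * (δ q2)
    + 3 * q31 * (δ μ) + 15 * q4 * (δ (δ μ)),
   480 * μ * (δ (δ (δ μ))) + 8 * μ * q1111 - 180 * μ * (δ (δ q11)) + μ * q211 * K + 2 * μ * (δ
    q211) - 20 * μ * (δ (δ (δ q2))) + 480 * p * b * b * b - 60 * q11 * (δ μ) * K - 240 * q11 * (δ
    (δ μ)) + 120 * q11 * (δ q11) + 10 * q11 * (δ q2) * K + 20 * q11 * (δ (δ q2)) + 20 * q11 * q11 *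
    K - 60 * (δ q11) * (δ μ) + 20 * (δ q11) * (δ q2) + 5 * q211 * (δ μ) + 2 * q22 * (δ (δ μ)) - 20
    * q2 * (δ (δ μ)) * K - 200 * q2 * (δ (δ (δ μ))) + 10 * q2 * (δ q11) * K + 90 * q2 * (δ (δ q11))
    + 10 * q2 * (δ (δ (δ q2))) - 20 * (δ q2) * (δ (δ μ)) + 6 * q31 * (δ (δ μ)) + 10 * q4 * (δ (δ (δ
    μ))),
   48 * μ * (δ (δ (δ (δ μ)))) + μ * q1111 * K + 2 * μ * (δ q1111) - 20 * μ * (δ (δ (δ q11))) + 48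
    * p * b * b * b * b + 4 * q1111 * (δ μ) - 20 * q11 * (δ (δ μ)) * K - 40 * q11 * (δ (δ (δ μ))) +
    10 * q11 * (δ q11) * K + 20 * q11 * (δ (δ q11)) - 20 * (δ q11) * (δ (δ μ)) + 10 * (δ q11) * (δ
    q11) + q211 * (δ (δ μ)) - 20 * q2 * (δ (δ (δ (δ μ)))) + 10 * q2 * (δ (δ (δ q11))) + q31 * (δ (δ
    (δ μ))) + q4 * (δ (δ (δ (δ μ))))]

/-- The coefficients of the commutators of the flows, as given by `commutator_two_add_mul`. -/
def commutatorTwo : List DiffExpr :=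
  let δ := der
  let s : DiffExpr := var 9
  let μ : DiffExpr := var 10
  let l : DiffExpr := var 13
  let y3 : DiffExpr := var 21
  let y21 : DiffExpr := var 22
  let y111 : DiffExpr := var 23
  let z3 : DiffExpr := var 31
  let z21 : DiffExpr := var 32
  let z111 : DiffExpr := var 33
  [3 * μ * y3 * (δ s) + 3 * y3 * (δ l) - 3 * z3 * (δ μ),
   3 * μ * y21 * (δ s) + 6 * μ * y3 * (δ (δ s)) + 3 * y21 * (δ l) + 6 * y3 * (δ (δ l)) + 12 * y3 *
    (δ μ) * (δ s) - 3 * z21 * (δ μ) - 6 * z3 * (δ (δ μ)),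
   3 * μ * y3 * (δ s) + 3 * y3 * (δ l) - 3 * z3 * (δ μ),
   2 * μ * y111 * (δ s) + μ * y21 * (δ (δ s)) + μ * y3 * (δ (δ (δ s))) + 2 * y111 * (δ l) + y21 *
    (δ (δ l)) + 2 * y21 * (δ μ) * (δ s) + y3 * (δ (δ (δ l))) + 3 * y3 * (δ μ) * (δ (δ s)) + 3 * y3
    * (δ (δ μ)) * (δ s) - 2 * z111 * (δ μ) - z21 * (δ (δ μ)) - z3 * (δ (δ (δ μ)))]

/-- The coefficients of the commutators of the flows, as given by `commutator_four_add_mul`. -/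
def commutatorFour : List DiffExpr :=
  let δ := der
  let s : DiffExpr := var 9
  let μ : DiffExpr := var 10
  let l : DiffExpr := var 13
  let y3 : DiffExpr := var 21
  let y21 : DiffExpr := var 22
  let y111 : DiffExpr := var 23
  let y5 : DiffExpr := var 24
  let y41 : DiffExpr := var 25
  let y32 : DiffExpr := var 26
  let y311 : DiffExpr := var 27
  let y221 : DiffExpr := var 28
  let y2111 : DiffExpr := var 29
  let y11111 : DiffExpr := var 30
  let z3 : DiffExpr := var 31
  let z21 : DiffExpr := var 32
  let z111 : DiffExpr := var 33
  let z5 : DiffExpr := var 34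
  let z41 : DiffExpr := var 35
  let z32 : DiffExpr := var 36
  let z311 : DiffExpr := var 37
  let z221 : DiffExpr := var 38
  let z2111 : DiffExpr := var 39
  let z11111 : DiffExpr := var 40
  [3 * μ * y32 * (δ s) + 15 * μ * y5 * (δ (δ s)) - 60 * y111 * z3 + 3 * y32 * (δ l) + 30 * y3 *
    y21 * (δ s) + 60 * y3 * z111 + 30 * y3 * (δ z21) + 15 * y5 * (δ (δ l)) + 30 * y5 * (δ μ) * (δ
    s) - 3 * z32 * (δ μ) - 30 * z3 * (δ y21) - 15 * z5 * (δ (δ μ)),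
   6 * μ * y221 * (δ s) + 3 * μ * y311 * (δ s) + 6 * μ * y32 * (δ (δ s)) + 15 * μ * y41 * (δ (δ
    s)) + 45 * μ * y5 * (δ (δ (δ s))) - 60 * y111 * z21 + 60 * y21 * z111 + 30 * y21 * (δ z21) + 30
    * y21 * y21 * (δ s) + 6 * y221 * (δ l) + 3 * y311 * (δ l) + 6 * y32 * (δ (δ l)) + 12 * y32 * (δ
    μ) * (δ s) + 270 * y3 * y111 * (δ s) + 60 * y3 * y21 * (δ (δ s)) + 120 * y3 * (δ y21) * (δ s) +
    270 * y3 * (δ z111) + 60 * y3 * (δ (δ z21)) + 15 * y41 * (δ (δ l)) + 30 * y41 * (δ μ) * (δ s) +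
    45 * y5 * (δ (δ (δ l))) + 135 * y5 * (δ μ) * (δ (δ s)) + 135 * y5 * (δ (δ μ)) * (δ s) - 30 *
    z21 * (δ y21) - 6 * z221 * (δ μ) - 3 * z311 * (δ μ) - 6 * z32 * (δ (δ μ)) - 270 * z3 * (δ y111)
    - 60 * z3 * (δ (δ y21)) - 15 * z41 * (δ (δ μ)) - 45 * z5 * (δ (δ (δ μ))),
   15 * μ * y5 * (δ s) - 30 * y21 * z3 + 30 * y3 * z21 + 30 * y3 * (δ z3) + 30 * y3 * y3 * (δ s) +
    15 * y5 * (δ l) - 30 * z3 * (δ y3) - 15 * z5 * (δ μ),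
   6 * μ * y32 * (δ s) + 10 * μ * y41 * (δ s) + 60 * μ * y5 * (δ (δ s)) - 180 * y111 * z3 + 10 *
    y21 * (δ z3) + 6 * y32 * (δ l) + 130 * y3 * y21 * (δ s) + 60 * y3 * (δ y3) * (δ s) + 180 * y3 *
    z111 + 120 * y3 * (δ z21) + 30 * y3 * (δ (δ z3)) + 30 * y3 * y3 * (δ (δ s)) + 10 * y41 * (δ l)
    + 60 * y5 * (δ (δ l)) + 120 * y5 * (δ μ) * (δ s) - 10 * z21 * (δ y3) - 6 * z32 * (δ μ) - 120 *
    z3 * (δ y21) - 30 * z3 * (δ (δ y3)) - 10 * z41 * (δ μ) - 60 * z5 * (δ (δ μ)),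
   5 * μ * y2111 * (δ s) + 2 * μ * y221 * (δ (δ s)) + 6 * μ * y311 * (δ (δ s)) + μ * y32 * (δ (δ
    (δ s))) + 10 * μ * y41 * (δ (δ (δ s))) + 15 * μ * y5 * (δ (δ (δ (δ s)))) + 20 * y111 * (δ z21)
    + 5 * y2111 * (δ l) + 90 * y21 * y111 * (δ s) + 20 * y21 * (δ y21) * (δ s) + 70 * y21 * (δ
    z111) + 10 * y21 * (δ (δ z21)) + 10 * y21 * y21 * (δ (δ s)) + 2 * y221 * (δ (δ l)) + 4 * y221 *
    (δ μ) * (δ s) + 6 * y311 * (δ (δ l)) + 12 * y311 * (δ μ) * (δ s) + y32 * (δ (δ (δ l))) + 3 *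
    y32 * (δ μ) * (δ (δ s)) + 3 * y32 * (δ (δ μ)) * (δ s) + 120 * y3 * y111 * (δ (δ s)) + 240 * y3
    * (δ y111) * (δ s) + 10 * y3 * y21 * (δ (δ (δ s))) + 30 * y3 * (δ y21) * (δ (δ s)) + 30 * y3 *
    (δ (δ y21)) * (δ s) + 120 * y3 * (δ (δ z111)) + 10 * y3 * (δ (δ (δ z21))) + 10 * y41 * (δ (δ (δ
    l))) + 30 * y41 * (δ μ) * (δ (δ s)) + 30 * y41 * (δ (δ μ)) * (δ s) + 15 * y5 * (δ (δ (δ (δ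
    l)))) + 60 * y5 * (δ μ) * (δ (δ (δ s))) + 90 * y5 * (δ (δ μ)) * (δ (δ s)) + 60 * y5 * (δ (δ (δ
    μ))) * (δ s) - 20 * z111 * (δ y21) - 5 * z2111 * (δ μ) - 70 * z21 * (δ y111) - 10 * z21 * (δ (δ
    y21)) - 2 * z221 * (δ (δ μ)) - 6 * z311 * (δ (δ μ)) - z32 * (δ (δ (δ μ))) - 120 * z3 * (δ (δ
    y111)) - 10 * z3 * (δ (δ (δ y21))) - 10 * z41 * (δ (δ (δ μ))) - 15 * z5 * (δ (δ (δ (δ μ)))),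
   5 * μ * y41 * (δ s) + 15 * μ * y5 * (δ (δ s)) + 20 * y21 * (δ z3) + 50 * y3 * y21 * (δ s) + 60
    * y3 * (δ y3) * (δ s) + 30 * y3 * (δ z21) + 30 * y3 * (δ (δ z3)) + 30 * y3 * y3 * (δ (δ s)) + 5
    * y41 * (δ l) + 15 * y5 * (δ (δ l)) + 30 * y5 * (δ μ) * (δ s) - 20 * z21 * (δ y3) - 30 * z3 *
    (δ y21) - 30 * z3 * (δ (δ y3)) - 5 * z41 * (δ μ) - 15 * z5 * (δ (δ μ)),
   10 * μ * y5 * (δ s) - 30 * y21 * z3 + 30 * y3 * z21 + 10 * y5 * (δ l) - 10 * z5 * (δ μ),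
   5 * μ * y311 * (δ s) + μ * y32 * (δ (δ s)) + 10 * μ * y41 * (δ (δ s)) + 20 * μ * y5 * (δ (δ (δ
    s))) + 20 * y111 * (δ z3) + 20 * y21 * (δ y3) * (δ s) + 20 * y21 * (δ z21) + 10 * y21 * (δ (δ
    z3)) + 20 * y21 * y21 * (δ s) + 5 * y311 * (δ l) + y32 * (δ (δ l)) + 2 * y32 * (δ μ) * (δ s) +
    110 * y3 * y111 * (δ s) + 40 * y3 * y21 * (δ (δ s)) + 60 * y3 * (δ y21) * (δ s) + 30 * y3 * (δ
    y3) * (δ (δ s)) + 30 * y3 * (δ (δ y3)) * (δ s) + 90 * y3 * (δ z111) + 30 * y3 * (δ (δ z21)) +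
    10 * y3 * (δ (δ (δ z3))) + 10 * y3 * y3 * (δ (δ (δ s))) + 10 * y41 * (δ (δ l)) + 20 * y41 * (δ
    μ) * (δ s) + 20 * y5 * (δ (δ (δ l))) + 60 * y5 * (δ μ) * (δ (δ s)) + 60 * y5 * (δ (δ μ)) * (δ
    s) - 20 * z111 * (δ y3) - 20 * z21 * (δ y21) - 10 * z21 * (δ (δ y3)) - 5 * z311 * (δ μ) - z32 *
    (δ (δ μ)) - 90 * z3 * (δ y111) - 30 * z3 * (δ (δ y21)) - 10 * z3 * (δ (δ (δ y3))) - 10 * z41 *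
    (δ (δ μ)) - 20 * z5 * (δ (δ (δ μ))),
   5 * μ * y5 * (δ s) + 30 * y3 * (δ z3) + 30 * y3 * y3 * (δ s) + 5 * y5 * (δ l) - 30 * z3 * (δ
    y3) - 5 * z5 * (δ μ),
   4 * μ * y11111 * (δ s) + μ * y2111 * (δ (δ s)) + μ * y311 * (δ (δ (δ s))) + μ * y41 * (δ (δ (δ
    (δ s)))) + μ * y5 * (δ (δ (δ (δ (δ s))))) + 4 * y11111 * (δ l) + 20 * y111 * (δ z111) + 20 *
    y111 * y111 * (δ s) + y2111 * (δ (δ l)) + 2 * y2111 * (δ μ) * (δ s) + 10 * y21 * y111 * (δ (δ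
    s)) + 20 * y21 * (δ y111) * (δ s) + 10 * y21 * (δ (δ z111)) + y311 * (δ (δ (δ l))) + 3 * y311 *
    (δ μ) * (δ (δ s)) + 3 * y311 * (δ (δ μ)) * (δ s) + 10 * y3 * y111 * (δ (δ (δ s))) + 30 * y3 *
    (δ y111) * (δ (δ s)) + 30 * y3 * (δ (δ y111)) * (δ s) + 10 * y3 * (δ (δ (δ z111))) + y41 * (δ
    (δ (δ (δ l)))) + 4 * y41 * (δ μ) * (δ (δ (δ s))) + 6 * y41 * (δ (δ μ)) * (δ (δ s)) + 4 * y41 *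
    (δ (δ (δ μ))) * (δ s) + y5 * (δ (δ (δ (δ (δ l))))) + 5 * y5 * (δ μ) * (δ (δ (δ (δ s)))) + 10 *
    y5 * (δ (δ μ)) * (δ (δ (δ s))) + 10 * y5 * (δ (δ (δ μ))) * (δ (δ s)) + 5 * y5 * (δ (δ (δ (δ
    μ)))) * (δ s) - 4 * z11111 * (δ μ) - 20 * z111 * (δ y111) - z2111 * (δ (δ μ)) - 10 * z21 * (δ
    (δ y111)) - z311 * (δ (δ (δ μ))) - 10 * z3 * (δ (δ (δ y111))) - z41 * (δ (δ (δ (δ μ)))) - z5 *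
    (δ (δ (δ (δ (δ μ)))))]

end DiffExpr


/-! ### Explicit deformation for ψ = κw + Θ(u) without difference terms -/

namespace DiffExpr

/-- A coefficient of an explicit deformation. -/
def hydrodynamicCoeff2 : DiffExpr :=
  let t : DiffExpr := var 0
  let x : DiffExpr := var 1
  let m0 : DiffExpr := var 2
  t * (x*(2*m0 + 2))

/-- A coefficient of an explicit deformation. -/
def hydrodynamicCoeff11 : DiffExpr :=
  let t : DiffExpr := var 0
  let x : DiffExpr := var 1
  let m0 : DiffExpr := var 2
  let m1 : DiffExpr := var 3
  let K : DiffExpr := var 8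
  t * (m0*(m0*(K*x + 1 - m0) + K*x + 2) + m1*x)

/-- A coefficient of an explicit deformation. -/
def hydrodynamicCoeff4 : DiffExpr :=
  let t : DiffExpr := var 0
  let x : DiffExpr := var 1
  let m0 : DiffExpr := var 2
  let m1 : DiffExpr := var 3
  t * (x*(m0*(m0*(32 - 8*m0) + 32) + 24*m1*x - 8))

/-- A coefficient of an explicit deformation. -/
def hydrodynamicCoeff31 : DiffExpr :=
  let t : DiffExpr := var 0
  let x : DiffExpr := var 1
  let m0 : DiffExpr := var 2
  let m1 : DiffExpr := var 3
  let m2 : DiffExpr := var 4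
  let K : DiffExpr := var 8
  t * (-m0*(m0*(m0*(m0*(8*K*x + 64 - 8*m0) - 32*K*x - 56) - x*(72*K - 152*m1) - 96) -
    x*(K*(16*m1*x + 32) + 232*m1) + 32) - x*(m1*(K*x*(8 - 48*K*x) - 104) - 48*m2*x))

/-- A coefficient of an explicit deformation. -/
def hydrodynamicCoeff22 : DiffExpr :=
  let t : DiffExpr := var 0
  let x : DiffExpr := var 1
  let m0 : DiffExpr := var 2
  let m1 : DiffExpr := var 3
  let m2 : DiffExpr := var 4
  let K : DiffExpr := var 8
  t * (-m0*(m0*(m0*(m0*(16*K*x + 48 - 16*m0) - 24*K*x - 12) - x*(84*K - 64*m1) - 52) +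
    x*(K*(28*m1*x - 44) - 184*m1) + 24) - x*(m1*(K*x*(16 - 36*K*x) - 68) - 36*m2*x))

/-- A coefficient of an explicit deformation. -/
def hydrodynamicCoeff211 : DiffExpr :=
  let t : DiffExpr := var 0
  let x : DiffExpr := var 1
  let m0 : DiffExpr := var 2
  let m1 : DiffExpr := var 3
  let m2 : DiffExpr := var 4
  let m3 : DiffExpr := var 5
  let K : DiffExpr := var 8
  t * (K*(x*(K*(m0*(m0*(m0*(m0*(116 - 32*m0) + 16) - 56*m1*x - 84) - m1*x*(8 + 16*K*x) + 48) -
    x*(m1*(K*x*(40 - 72*K*x) + 8) - 72*m2*x)) + m1*(m0*(m0*(296 - 176*m0) + 460) + 84 + 32*m1*x) +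
    m2*x*(12*m0 - 12)) - m0*(m0*(m0*(m0*(m0*(116 - 32*m0) + 64) - 276) - 144) + 48)) -
    m0*(m1*(m0*(m0*(620 - 208*m0) - 160) - 340 + 336*m1*x) - m2*x*(300 - 196*m0)) + x*(220*m1*m1 +
    124*m2 + 44*m3*x) - 48*m1)

/-- A coefficient of an explicit deformation. -/
def hydrodynamicCoeff1111 : DiffExpr :=
  let t : DiffExpr := var 0
  let x : DiffExpr := var 1
  let m0 : DiffExpr := var 2
  let m1 : DiffExpr := var 3
  let m2 : DiffExpr := var 4
  let m3 : DiffExpr := var 5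
  let m4 : DiffExpr := var 6
  let K : DiffExpr := var 8
  t * (K*(x*(K*(m0*(K*(m0*(m0*(m0*(m0*(21 - 7*m0) + 19) - 4*m1*x - 41) - m1*x*(8 + 12*K*x) - 24)
    + x*x*(K*m1*(8 - 10*K*x) - 3*m2) + 8) + m1*(m0*(m0*(210 - 70*m0) + 59) - 59 + 20*m1*x) -
    m2*x*(1 + 13*m0)) - x*(x*(K*(K*x*(K*m1*(16 - 18*K*x) - 18*m2) - 2*m1*m1 + 9*m2) - 11*m3) +
    14*m1*m1 + 2*m2) + 14*m1) + m0*(m0*(m2*(63 - 46*m0) - 188*m1*m1) + 82*m1*m1 + 98*m2 + 4*m3*x) +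
    m1*(19*m2*x + 98*m1) + 16*m2 - m3*x) - m0*(m0*(m0*(m0*(K*(m0*(m0*(21 - 7*m0) + 19) - 33) +
    m1*(208 - 85*m0)) + 164*m1 - 56*K) - 251*m1 - 24*K) - 106*m1 + 8*K) - 16*m1) -
    m0*(m0*(m0*(m2*(132 - 51*m0) - 216*m1*m1) + 302*m1*m1 - 28*m2 + 32*m3*x) + m1*(146*m2*x + 3*m1)
    - 68*m2 - 43*m3*x) + x*(m1*(83*m2 - 44*m1*m1) + 18*m3 + 5*m4*x) + 50*m1*m1 - 8*m2)

/-- Coefficients of an explicit deformation. -/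
def hydrodynamicCoeffs : List DiffExpr :=
  let t : DiffExpr := var 0
  let x : DiffExpr := var 1
  let μ : DiffExpr := var 10
  let p : DiffExpr := var 12
  [t * x,
   0,
   0,
   μ * μ + p, hydrodynamicCoeff2, hydrodynamicCoeff11, hydrodynamicCoeff4, hydrodynamicCoeff31, hydrodynamicCoeff22, hydrodynamicCoeff211, hydrodynamicCoeff1111]

end DiffExpr

/-- The candidate coefficients of w satisfy all fourteen compatibility conditions; these are
polynomial identities in the ten atoms. -/
theorem hydrodynamic_allZero : DiffExpr.allZero 10 DiffExpr.hydrodynamicDerivs (DiffExpr.run 10 DiffExpr.hydrodynamicDerivs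
    (DiffExpr.hydrodynamicCoeffs ++ DiffExpr.formCoeffs) DiffExpr.atoms)
    (DiffExpr.commutatorTwo ++ DiffExpr.commutatorFour) = true := by
  -- The polynomial operations are defined by recursors with natural numbers as codes and
  -- coefficients, so the kernel can evaluate them by reduction.
  decide +kernel

-- Here t is the derivative of s = κh + Θ, and x, m0 are the quotients of h', h'' by t. They are
-- supplied as elements of the ring with their derivatives, so no division takes place.
set_option maxHeartbeats 2000000 in
theorem exists_isDeformation_of_hydrodynamic {A : Type} [CommRing A] [Algebra ℂ A]
    (δ : Derivation ℂ A A) {K s t x m0 m1 m2 m3 m4 m5 h : A} {ψ η f g : ℕ → A}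
    (hK : δ K = 0) (hs : δ s = t) (ht : δ t = K * t * (1 - K * x + m0))
    (hx : δ x = m0 - K * x * (1 - K * x + m0)) (hm0 : δ m0 = m1) (hm1 : δ m1 = m2) (hm2 : δ m2 = m3)
    (hm3 : δ m3 = m4) (hm4 : δ m4 = m5)
    (hμ : δ h = t * x)
    (hψ0 : ψ 0 = s) (hψ1 : ψ 1 = K) (hψ2 : ψ 2 = 0) (hη0 : η 0 = 1) (hη1 : η 1 = 0) (hη2 : η 2 = 0)
    (hf1 : f 1 = 0) (hf2 : f 2 = 0) (hg1 : g 1 = 0) (hg2 : g 2 = 0)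
    (hf0 : f 0 = 0) :
    ∃ w Y Z : EpsSeries A, IsDeformation δ 4 h ψ η f g f g w Y Z := by
  -- Introducing each quantity through an existential keeps it opaque; only its defining equation is
  -- passed to the symbolic computation.
  obtain ⟨μ, eμ⟩ : ∃ a, a = t * x := ⟨_, rfl⟩
  rw [← eμ] at hμ
  obtain ⟨b, eb⟩ : ∃ a, a = (0 : A) := ⟨_, rfl⟩
  obtain ⟨p, ep⟩ : ∃ a, a = (0 : A) := ⟨_, rfl⟩
  obtain ⟨l, el⟩ : ∃ a, a = μ * μ + p := ⟨_, rfl⟩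
  have hl := el
  obtain ⟨q2, eq2⟩ : ∃ a, a = DiffExpr.val δ [t, x, m0, m1, m2, m3, m4, m5, K, s, μ, b, p, l]
      DiffExpr.hydrodynamicCoeff2 := ⟨_, rfl⟩
  obtain ⟨q11, eq11⟩ : ∃ a, a = DiffExpr.val δ [t, x, m0, m1, m2, m3, m4, m5, K, s, μ, b, p, l, q2]
      DiffExpr.hydrodynamicCoeff11 := ⟨_, rfl⟩
  obtain ⟨q4, eq4⟩ : ∃ a, a = DiffExpr.val δ [t, x, m0, m1, m2, m3, m4, m5, K, s, μ, b, p, l, q2, q11]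
      DiffExpr.hydrodynamicCoeff4 := ⟨_, rfl⟩
  obtain ⟨q31, eq31⟩ : ∃ a, a = DiffExpr.val δ [t, x, m0, m1, m2, m3, m4, m5, K, s, μ, b, p, l, q2, q11, q4]
      DiffExpr.hydrodynamicCoeff31 := ⟨_, rfl⟩
  obtain ⟨q22, eq22⟩ : ∃ a, a = DiffExpr.val δ [t, x, m0, m1, m2, m3, m4, m5, K, s, μ, b, p, l, q2, q11, q4, q31]
      DiffExpr.hydrodynamicCoeff22 := ⟨_, rfl⟩
  obtain ⟨q211, eq211⟩ : ∃ a, a = DiffExpr.val δ [t, x, m0, m1, m2, m3, m4, m5, K, s, μ, b, p, l, q2, q11, q4, q31, q22]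
      DiffExpr.hydrodynamicCoeff211 := ⟨_, rfl⟩
  obtain ⟨q1111, eq1111⟩ : ∃ a, a = DiffExpr.val δ [t, x, m0, m1, m2, m3, m4, m5, K, s, μ, b, p, l, q2, q11, q4, q31, q22, q211]
      DiffExpr.hydrodynamicCoeff1111 := ⟨_, rfl⟩
  -- Without a difference term p = 0, so the conditions on the higher derivatives of g hold for any
  -- b; the value b = 0 has been taken.
  have hz : ∀ a c : A, 2 * f 0 * a = c * p := fun a c => by
    rw [hf0, ep]
    ring
  refine exists_isDeformation_of_commutators δ hμ hψ0 hψ1 hψ2 hη0 hη1 hη2 hf1 hf2 hg1 hg2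
    (by rw [hf0, ep]; ring) (hz _ b) (hz _ _) (hz _ _) (hz _ _) hl q2 q11 q4 q31 q22 q211 q1111 ?_
  intro y3 y21 y111 y5 y41 y32 y311 y221 y2111 y11111
    z3 z21 z111 z5 z41 z32 z311 z221 z2111 z11111 F
  obtain ⟨hy3, hy21, hy111, hy5, hy41, hy32, hy311, hy221, hy2111, hy11111,
    hz3, hz21, hz111, hz5, hz41, hz32, hz311, hz221, hz2111, hz11111⟩ := F
  have hδ := DiffExpr.represents_hydrodynamicDerivs hK hs ht hx hm0 hm1 hm2 hm3 hm4
  have h0 := DiffExpr.represents_run hδ (DiffExpr.represents_atoms t x m0 m1 m2 m3 m4 m5 K s)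
    (xs := DiffExpr.hydrodynamicCoeffs ++ DiffExpr.formCoeffs)
    (r := [μ, b, p, l, q2, q11, q4, q31, q22, q211, q1111, y3, y21, y111, y5, y41, y32, y311, y221,
      y2111, y11111, z3, z21, z111, z5, z41, z32, z311, z221, z2111, z11111]) (by
      simp only [DiffExpr.hydrodynamicCoeffs, DiffExpr.formCoeffs, List.cons_append, List.nil_append, DiffExpr.IsRun]
      refine ⟨?_, ?_, ?_, ?_, eq2, eq11, eq4, eq31, eq22, eq211, eq1111, ?_, ?_, ?_, ?_, ?_, ?_, ?_, ?_,
      ?_, ?_, ?_, ?_, ?_, ?_, ?_, ?_, ?_, ?_, ?_, ?_, trivial⟩ <;>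
        simp only [DiffExpr.val_var, DiffExpr.val_add, DiffExpr.val_sub, DiffExpr.val_mul, DiffExpr.val_neg, DiffExpr.val_der, DiffExpr.val_zero, DiffExpr.val_ofNat, List.getD_cons_zero, List.getD_cons_succ]
      exacts [eμ, eb, ep, el, hy3, hy21, hy111, hy5, hy41, hy32, hy311, hy221, hy2111, hy11111, hz3, hz21,
      hz111, hz5, hz41, hz32, hz311, hz221, hz2111, hz11111])
  have h1 := DiffExpr.allZero_of_allZero hδ h0 (xs := DiffExpr.commutatorTwo ++ DiffExpr.commutatorFour)
    hydrodynamic_allZero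
  obtain ⟨c0, c1, c2, c3, c4, c5, c6, c7, c8, c9, c10, c11, c12, c13, -⟩ := h1
  constructor
  · rw [commutator_two_add_mul]
    -- The sum is split into its terms; the goals for the coefficients come in the order of the list
    -- `commutatorTwo`.
    repeat' first | apply add_eq_zero_of_eq_zero | apply C_mul_eq_zero_of_eq_zero
    exacts [c0, c1, c2, c3]
  · rw [commutator_four_add_mul]
    repeat' first | apply add_eq_zero_of_eq_zero | apply C_mul_eq_zero_of_eq_zero
    exacts [c4, c5, c6, c7, c8, c9, c10, c11, c12, c13]


/-! ### Explicit deformation with constant f -/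

namespace DiffExpr

/-- A coefficient of an explicit deformation. -/
def phiConstCoeff2 : DiffExpr :=
  let t : DiffExpr := var 0
  let x : DiffExpr := var 1
  let m0 : DiffExpr := var 2
  t * (4*m0 + 4*x)

/-- A coefficient of an explicit deformation. -/
def phiConstCoeff11 : DiffExpr :=
  let t : DiffExpr := var 0
  let x : DiffExpr := var 1
  let m0 : DiffExpr := var 2
  let m1 : DiffExpr := var 3
  let K : DiffExpr := var 8
  K * t * (m0*(m0*(4*x - 2*m0) + 10 - 4*x*x) + 2*m1)

/-- A coefficient of an explicit deformation. -/
def phiConstCoeff4 : DiffExpr :=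
  let t : DiffExpr := var 0
  let x : DiffExpr := var 1
  let m0 : DiffExpr := var 2
  let m1 : DiffExpr := var 3
  t * (m0*(m0*(64*x - 16*m0) + 80 - 16*x*x) + 48*m1 - 16*x)

/-- A coefficient of an explicit deformation. -/
def phiConstCoeff31 : DiffExpr :=
  let t : DiffExpr := var 0
  let x : DiffExpr := var 1
  let m0 : DiffExpr := var 2
  let m1 : DiffExpr := var 3
  let m2 : DiffExpr := var 4
  let K : DiffExpr := var 8
  K * t * (-m0*(m0*(m0*(m0*(144*x - 16*m0) - 96 - 80*x*x) - x*(352 - 16*x*x) + 304*m1) +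
    x*(x*(256 + 112*x*x) - 496*m1) - 368) + m1*(496 - 208*x*x) + 96*m2)

/-- A coefficient of an explicit deformation. -/
def phiConstCoeff22 : DiffExpr :=
  let t : DiffExpr := var 0
  let x : DiffExpr := var 1
  let m0 : DiffExpr := var 2
  let m1 : DiffExpr := var 3
  let m2 : DiffExpr := var 4
  let K : DiffExpr := var 8
  K * t * (-m0*(m0*(m0*(m0*(128*x - 32*m0) + 48 - 120*x*x) - x*(344 - 72*x*x) + 128*m1) +
    x*(x*(232 + 64*x*x) - 312*m1) - 336) + m1*(312 - 136*x*x) + 72*m2)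

/-- A coefficient of an explicit deformation. -/
def phiConstCoeff211 : DiffExpr :=
  let t : DiffExpr := var 0
  let x : DiffExpr := var 1
  let m0 : DiffExpr := var 2
  let m1 : DiffExpr := var 3
  let m2 : DiffExpr := var 4
  let m3 : DiffExpr := var 5
  let K : DiffExpr := var 8
  K * K * t * (m0*(x*(m0*(m0*(m0*(m0*(32*x + 64*m0) + 384 - 280*x*x) - x*(760 - 648*x*x) -
    1592*m1) + x*(x*(88 + 192*x*x) + 1120*m1) - 160) - x*(x*(x*(88 + 432*x*x) + 40*m1) + 200) +
    1592*m1 + 624*m2) + m0*(m0*(m0*(416*m1 - 328*m0) + 696) - 320*m1 - 392*m2) - 672*m1*m1 + 720) -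
    m1*(x*(x*(888 + 376*x*x) - 504*m1) - 1384) + m2*(688 - 320*x*x) + 88*m3)

/-- A coefficient of an explicit deformation. -/
def phiConstCoeff1111 : DiffExpr :=
  let t : DiffExpr := var 0
  let x : DiffExpr := var 1
  let m0 : DiffExpr := var 2
  let m1 : DiffExpr := var 3
  let m2 : DiffExpr := var 4
  let m3 : DiffExpr := var 5
  let m4 : DiffExpr := var 6
  let K : DiffExpr := var 8
  K * K * K * t * (m0*(x*(x*(x*(m0*(m0*(m0*(m0*(182*x - 34*m0) + 1124 - 696*x*x) - x*(892 -
    528*x*x) - 644*m1) - x*(x*(104 - 308*x*x) - 856*m1) - 286) + x*(x*(x*(136 - 288*x*x) + 92*m1) +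
    130) + 144*m1 - 6*m2) + m0*(m0*(m0*(64*m1 - 200*m0) + 304) - 808*m1 + 280*m2) + 524*m1*m1 -
    112) + m0*(m0*(m0*(m0*(170*m1 - 22*m0) - 324) + 728*m1 - 356*m2) - 980*m1*m1 + 82) - 146*m1 +
    330*m2 + 94*m3) + m0*(m0*(m0*(m0*(22 + 14*m0*m0) - 620*m1 + 102*m2) + 432*m1*m1 + 90) + 532*m1
    - 124*m2 - 64*m3) - m1*(292*m2 + 326*m1) + 134) - x*(x*(m1*(x*(x*(80 + 200*x*x) + 28*m1) + 92)
    + m2*(224 + 82*x*x) + 52*m3) - m1*(204*m2 + 300*m1)) + m1*(372 - 88*m1*m1) + 336*m2 + 108*m3 +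
    10*m4)

/-- Coefficients of an explicit deformation. -/
def phiConstCoeffs : List DiffExpr :=
  let t : DiffExpr := var 0
  let x : DiffExpr := var 1
  let K : DiffExpr := var 8
  let μ : DiffExpr := var 10
  let p : DiffExpr := var 12
  [2 * t * x,
   2 * K,
   2 * (t * t * (1 - x * x)),
   μ * μ + p, phiConstCoeff2, phiConstCoeff11, phiConstCoeff4, phiConstCoeff31, phiConstCoeff22, phiConstCoeff211, phiConstCoeff1111]

end DiffExpr

/-- The same fourteen identities, now in the elliptic atoms, with b = 2K since g'' = 2Kg'. -/
theorem phiConst_allZero : DiffExpr.allZero 10 DiffExpr.ellipticDerivs (DiffExpr.run 10 DiffExpr.ellipticDerivs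
    (DiffExpr.phiConstCoeffs ++ DiffExpr.formCoeffs) DiffExpr.atoms)
    (DiffExpr.commutatorTwo ++ DiffExpr.commutatorFour) = true := by
  decide +kernel

-- The parametrization h' = 2tx, p = 2t²(1 - x²) makes 2p + h'² the square 4t², so the dependence on
-- its square root becomes polynomial.
set_option maxHeartbeats 2000000 in
theorem exists_isDeformation_of_phi_const {A : Type} [CommRing A] [Algebra ℂ A]
    (δ : Derivation ℂ A A) {K s t x m0 m1 m2 m3 m4 m5 h p : A} {ψ η f g : ℕ → A}
    (hK : δ K = 0) (hs : δ s = K * (2 * t * x)) (ht : δ t = K * t * (1 - x * x + x * m0))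
    (hx : δ x = K * (m0 - x * (1 - x * x + x * m0))) (hm0 : δ m0 = K * m1) (hm1 : δ m1 = K * m2)
    (hm2 : δ m2 = K * m3) (hm3 : δ m3 = K * m4) (hm4 : δ m4 = K * m5)
    (hμ : δ h = 2 * t * x)
    (hψ0 : ψ 0 = s) (hψ1 : ψ 1 = K) (hψ2 : ψ 2 = 0) (hη0 : η 0 = 1) (hη1 : η 1 = 0) (hη2 : η 2 = 0)
    (hf1 : f 1 = 0) (hf2 : f 2 = 0) (hg1 : g 1 = 0) (hg2 : g 2 = 0)
    (hp1 : 2 * f 0 * δ (g 0) = p) (hp2 : 2 * f 0 * δ (δ (g 0)) = (2 * K) * p)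
    (hp3 : 2 * f 0 * δ (δ (δ (g 0))) = (2 * K) ^ 2 * p)
    (hp4 : 2 * f 0 * δ (δ (δ (δ (g 0)))) = (2 * K) ^ 3 * p)
    (hp5 : 2 * f 0 * δ (δ (δ (δ (δ (g 0))))) = (2 * K) ^ 4 * p)
    (hp : p = 2 * (t * t * (1 - x * x))) :
    ∃ w Y Z : EpsSeries A, IsDeformation δ 4 h ψ η f g f g w Y Z := by
  obtain ⟨μ, eμ⟩ : ∃ a, a = 2 * t * x := ⟨_, rfl⟩
  rw [← eμ] at hμ
  obtain ⟨b, eb⟩ : ∃ a, a = (2 * K : A) := ⟨_, rfl⟩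
  rw [← eb] at hp2 hp3 hp4 hp5
  obtain ⟨l, el⟩ : ∃ a, a = μ * μ + p := ⟨_, rfl⟩
  have hl := el
  obtain ⟨q2, eq2⟩ : ∃ a, a = DiffExpr.val δ [t, x, m0, m1, m2, m3, m4, m5, K, s, μ, b, p, l]
      DiffExpr.phiConstCoeff2 := ⟨_, rfl⟩
  obtain ⟨q11, eq11⟩ : ∃ a, a = DiffExpr.val δ [t, x, m0, m1, m2, m3, m4, m5, K, s, μ, b, p, l, q2]
      DiffExpr.phiConstCoeff11 := ⟨_, rfl⟩
  obtain ⟨q4, eq4⟩ : ∃ a, a = DiffExpr.val δ [t, x, m0, m1, m2, m3, m4, m5, K, s, μ, b, p, l, q2, q11]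
      DiffExpr.phiConstCoeff4 := ⟨_, rfl⟩
  obtain ⟨q31, eq31⟩ : ∃ a, a = DiffExpr.val δ [t, x, m0, m1, m2, m3, m4, m5, K, s, μ, b, p, l, q2, q11, q4]
      DiffExpr.phiConstCoeff31 := ⟨_, rfl⟩
  obtain ⟨q22, eq22⟩ : ∃ a, a = DiffExpr.val δ [t, x, m0, m1, m2, m3, m4, m5, K, s, μ, b, p, l, q2, q11, q4, q31]
      DiffExpr.phiConstCoeff22 := ⟨_, rfl⟩
  obtain ⟨q211, eq211⟩ : ∃ a, a = DiffExpr.val δ [t, x, m0, m1, m2, m3, m4, m5, K, s, μ, b, p, l, q2, q11, q4, q31, q22]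
      DiffExpr.phiConstCoeff211 := ⟨_, rfl⟩
  obtain ⟨q1111, eq1111⟩ : ∃ a, a = DiffExpr.val δ [t, x, m0, m1, m2, m3, m4, m5, K, s, μ, b, p, l, q2, q11, q4, q31, q22, q211]
      DiffExpr.phiConstCoeff1111 := ⟨_, rfl⟩
  refine exists_isDeformation_of_commutators δ hμ hψ0 hψ1 hψ2 hη0 hη1 hη2 hf1 hf2 hg1 hg2
    hp1 hp2 hp3 hp4 hp5 hl q2 q11 q4 q31 q22 q211 q1111 ?_
  intro y3 y21 y111 y5 y41 y32 y311 y221 y2111 y11111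
    z3 z21 z111 z5 z41 z32 z311 z221 z2111 z11111 F
  obtain ⟨hy3, hy21, hy111, hy5, hy41, hy32, hy311, hy221, hy2111, hy11111,
    hz3, hz21, hz111, hz5, hz41, hz32, hz311, hz221, hz2111, hz11111⟩ := F
  have hδ := DiffExpr.represents_ellipticDerivs hK hs ht hx hm0 hm1 hm2 hm3 hm4
  have h0 := DiffExpr.represents_run hδ (DiffExpr.represents_atoms t x m0 m1 m2 m3 m4 m5 K s)
    (xs := DiffExpr.phiConstCoeffs ++ DiffExpr.formCoeffs)
    (r := [μ, b, p, l, q2, q11, q4, q31, q22, q211, q1111, y3, y21, y111, y5, y41, y32, y311, y221,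
      y2111, y11111, z3, z21, z111, z5, z41, z32, z311, z221, z2111, z11111]) (by
      simp only [DiffExpr.phiConstCoeffs, DiffExpr.formCoeffs, List.cons_append, List.nil_append, DiffExpr.IsRun]
      refine ⟨?_, ?_, ?_, ?_, eq2, eq11, eq4, eq31, eq22, eq211, eq1111, ?_, ?_, ?_, ?_, ?_, ?_, ?_, ?_,
      ?_, ?_, ?_, ?_, ?_, ?_, ?_, ?_, ?_, ?_, ?_, ?_, trivial⟩ <;>
        simp only [DiffExpr.val_var, DiffExpr.val_add, DiffExpr.val_sub, DiffExpr.val_mul, DiffExpr.val_neg, DiffExpr.val_der, DiffExpr.val_one, DiffExpr.val_ofNat, List.getD_cons_zero, List.getD_cons_succ]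
      exacts [eμ, eb, hp, el, hy3, hy21, hy111, hy5, hy41, hy32, hy311, hy221, hy2111, hy11111, hz3, hz21,
      hz111, hz5, hz41, hz32, hz311, hz221, hz2111, hz11111])
  have h1 := DiffExpr.allZero_of_allZero hδ h0 (xs := DiffExpr.commutatorTwo ++ DiffExpr.commutatorFour)
    phiConst_allZero
  obtain ⟨c0, c1, c2, c3, c4, c5, c6, c7, c8, c9, c10, c11, c12, c13, -⟩ := h1
  constructor
  · rw [commutator_two_add_mul]
    repeat' first | apply add_eq_zero_of_eq_zero | apply C_mul_eq_zero_of_eq_zero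
    exacts [c0, c1, c2, c3]
  · rw [commutator_four_add_mul]
    repeat' first | apply add_eq_zero_of_eq_zero | apply C_mul_eq_zero_of_eq_zero
    exacts [c4, c5, c6, c7, c8, c9, c10, c11, c12, c13]


/-! ### Explicit deformation with exponential f -/

namespace DiffExpr

/-- A coefficient of an explicit deformation. -/
def phiExpCoeff2 : DiffExpr :=
  let t : DiffExpr := var 0
  let x : DiffExpr := var 1
  let m0 : DiffExpr := var 2
  t * (4*m0 + 4*x)

/-- A coefficient of an explicit deformation. -/
def phiExpCoeff11 : DiffExpr :=
  let t : DiffExpr := var 0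
  let x : DiffExpr := var 1
  let m0 : DiffExpr := var 2
  let m1 : DiffExpr := var 3
  let K : DiffExpr := var 8
  K * t * (m0*(m0*(4*x - 2*m0) + 4 + 2*x*x) + 2*m1)

/-- A coefficient of an explicit deformation. -/
def phiExpCoeff4 : DiffExpr :=
  let t : DiffExpr := var 0
  let x : DiffExpr := var 1
  let m0 : DiffExpr := var 2
  let m1 : DiffExpr := var 3
  t * (m0*(m0*(64*x - 16*m0) + 80 - 16*x*x) + 48*m1 - 16*x)

/-- A coefficient of an explicit deformation. -/
def phiExpCoeff31 : DiffExpr :=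
  let t : DiffExpr := var 0
  let x : DiffExpr := var 1
  let m0 : DiffExpr := var 2
  let m1 : DiffExpr := var 3
  let m2 : DiffExpr := var 4
  let K : DiffExpr := var 8
  K * t * (-m0*(m0*(m0*(m0*(144*x - 16*m0) - 96 - 80*x*x) - x*(352 - 16*x*x) + 304*m1) +
    x*(x*(256 - 128*x*x) - 496*m1) - 128) + m1*(256 + 32*x*x) + 96*m2)

/-- A coefficient of an explicit deformation. -/
def phiExpCoeff22 : DiffExpr :=
  let t : DiffExpr := var 0
  let x : DiffExpr := var 1
  let m0 : DiffExpr := var 2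
  let m1 : DiffExpr := var 3
  let m2 : DiffExpr := var 4
  let K : DiffExpr := var 8
  K * t * (-m0*(m0*(m0*(m0*(128*x - 32*m0) - 72) - x*(104 + 168*x*x) + 128*m1) + x*(x*(112 -
    56*x*x) - 312*m1) - 96) + m1*(192 - 16*x*x) + 72*m2)

/-- A coefficient of an explicit deformation. -/
def phiExpCoeff211 : DiffExpr :=
  let t : DiffExpr := var 0
  let x : DiffExpr := var 1
  let m0 : DiffExpr := var 2
  let m1 : DiffExpr := var 3
  let m2 : DiffExpr := var 4
  let m3 : DiffExpr := var 5
  let K : DiffExpr := var 8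
  K * K * t * (m0*(x*(m0*(m0*(m0*(m0*(32*x + 64*m0) + 144 - 40*x*x) + x*(800 - 552*x*x) -
    1592*m1) + x*(x*(928 - 408*x*x) + 400*m1) - 400) - x*(x*(x*(808 - 648*x*x) - 80*m1) - 160) +
    1472*m1 + 624*m2) + m0*(m0*(m0*(416*m1 - 328*m0) + 336) + 400*m1 - 392*m2) - 672*m1*m1) -
    m1*(x*(x*(528 - 344*x*x) - 504*m1) - 304) + m2*(328 + 40*x*x) + 88*m3)

/-- A coefficient of an explicit deformation. -/
def phiExpCoeff1111 : DiffExpr :=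
  let t : DiffExpr := var 0
  let x : DiffExpr := var 1
  let m0 : DiffExpr := var 2
  let m1 : DiffExpr := var 3
  let m2 : DiffExpr := var 4
  let m3 : DiffExpr := var 5
  let m4 : DiffExpr := var 6
  let K : DiffExpr := var 8
  K * K * K * t * (m0*(x*(x*(x*(m0*(m0*(m0*(m0*(62*x - 34*m0) - 1036 + 564*x*x) + x*(398 -
    372*x*x) + 16*m1) + x*(x*(1426 - 742*x*x) - 584*m1) - 676) - x*(x*(x*(824 - 522*x*x) + 238*m1)
    - 310) + 504*m1 - 6*m2) + m0*(m0*(m0*(64*m1 - 20*m0) + 4) + 812*m1 + 100*m2) + 164*m1*m1 + 8) +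
    m0*(m0*(m0*(m0*(170*m1 - 22*m0) + 576) + 68*m1 - 356*m2) - 980*m1*m1 - 8) - 176*m1 + 330*m2 +
    94*m3) - m0*(m0*(m0*(m0*(38 - 14*m0*m0) + 620*m1 - 102*m2) - 432*m1*m1) - 352*m1 - 56*m2 +
    64*m3) - m1*(292*m2 - 34*m1) - 16) - x*(x*(m1*(x*(x*(320 - 280*x*x) - 32*m1) - 28) + m2*(104 -
    68*x*x) - 8*m3) - m1*(204*m2 + 240*m1)) + m1*(12 - 88*m1*m1) + 66*m2 + 48*m3 + 10*m4)

/-- Coefficients of an explicit deformation. -/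
def phiExpCoeffs : List DiffExpr :=
  let t : DiffExpr := var 0
  let x : DiffExpr := var 1
  let K : DiffExpr := var 8
  let μ : DiffExpr := var 10
  let p : DiffExpr := var 12
  [2 * t * x,
   K,
   2 * (t * t * (1 - x * x)),
   μ * μ + p, phiExpCoeff2, phiExpCoeff11, phiExpCoeff4, phiExpCoeff31, phiExpCoeff22, phiExpCoeff211, phiExpCoeff1111]

end DiffExpr

/-- The atoms and their derivatives are those of the case of constant f, because p' = 2Kp there too;
only b = K and some coefficients of w are different. -/
theorem phiExp_allZero : DiffExpr.allZero 10 DiffExpr.ellipticDerivs (DiffExpr.run 10 DiffExpr.ellipticDerivs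
    (DiffExpr.phiExpCoeffs ++ DiffExpr.formCoeffs) DiffExpr.atoms)
    (DiffExpr.commutatorTwo ++ DiffExpr.commutatorFour) = true := by
  decide +kernel

set_option maxHeartbeats 2000000 in
theorem exists_isDeformation_of_phi_exp {A : Type} [CommRing A] [Algebra ℂ A]
    (δ : Derivation ℂ A A) {K s t x m0 m1 m2 m3 m4 m5 h p : A} {ψ η f g : ℕ → A}
    (hK : δ K = 0) (hs : δ s = K * (2 * t * x)) (ht : δ t = K * t * (1 - x * x + x * m0))
    (hx : δ x = K * (m0 - x * (1 - x * x + x * m0))) (hm0 : δ m0 = K * m1) (hm1 : δ m1 = K * m2)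
    (hm2 : δ m2 = K * m3) (hm3 : δ m3 = K * m4) (hm4 : δ m4 = K * m5)
    (hμ : δ h = 2 * t * x)
    (hψ0 : ψ 0 = s) (hψ1 : ψ 1 = K) (hψ2 : ψ 2 = 0) (hη0 : η 0 = 1) (hη1 : η 1 = 0) (hη2 : η 2 = 0)
    (hf1 : f 1 = 0) (hf2 : f 2 = 0) (hg1 : g 1 = 0) (hg2 : g 2 = 0)
    (hp1 : 2 * f 0 * δ (g 0) = p) (hp2 : 2 * f 0 * δ (δ (g 0)) = K * p)
    (hp3 : 2 * f 0 * δ (δ (δ (g 0))) = K ^ 2 * p)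
    (hp4 : 2 * f 0 * δ (δ (δ (δ (g 0)))) = K ^ 3 * p)
    (hp5 : 2 * f 0 * δ (δ (δ (δ (δ (g 0))))) = K ^ 4 * p)
    (hp : p = 2 * (t * t * (1 - x * x))) :
    ∃ w Y Z : EpsSeries A, IsDeformation δ 4 h ψ η f g f g w Y Z := by
  obtain ⟨μ, eμ⟩ : ∃ a, a = 2 * t * x := ⟨_, rfl⟩
  rw [← eμ] at hμ
  obtain ⟨b, eb⟩ : ∃ a, a = (K : A) := ⟨_, rfl⟩
  rw [← eb] at hp2 hp3 hp4 hp5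
  obtain ⟨l, el⟩ : ∃ a, a = μ * μ + p := ⟨_, rfl⟩
  have hl := el
  obtain ⟨q2, eq2⟩ : ∃ a, a = DiffExpr.val δ [t, x, m0, m1, m2, m3, m4, m5, K, s, μ, b, p, l]
      DiffExpr.phiExpCoeff2 := ⟨_, rfl⟩
  obtain ⟨q11, eq11⟩ : ∃ a, a = DiffExpr.val δ [t, x, m0, m1, m2, m3, m4, m5, K, s, μ, b, p, l, q2]
      DiffExpr.phiExpCoeff11 := ⟨_, rfl⟩
  obtain ⟨q4, eq4⟩ : ∃ a, a = DiffExpr.val δ [t, x, m0, m1, m2, m3, m4, m5, K, s, μ, b, p, l, q2, q11]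
      DiffExpr.phiExpCoeff4 := ⟨_, rfl⟩
  obtain ⟨q31, eq31⟩ : ∃ a, a = DiffExpr.val δ [t, x, m0, m1, m2, m3, m4, m5, K, s, μ, b, p, l, q2, q11, q4]
      DiffExpr.phiExpCoeff31 := ⟨_, rfl⟩
  obtain ⟨q22, eq22⟩ : ∃ a, a = DiffExpr.val δ [t, x, m0, m1, m2, m3, m4, m5, K, s, μ, b, p, l, q2, q11, q4, q31]
      DiffExpr.phiExpCoeff22 := ⟨_, rfl⟩
  obtain ⟨q211, eq211⟩ : ∃ a, a = DiffExpr.val δ [t, x, m0, m1, m2, m3, m4, m5, K, s, μ, b, p, l, q2, q11, q4, q31, q22]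
      DiffExpr.phiExpCoeff211 := ⟨_, rfl⟩
  obtain ⟨q1111, eq1111⟩ : ∃ a, a = DiffExpr.val δ [t, x, m0, m1, m2, m3, m4, m5, K, s, μ, b, p, l, q2, q11, q4, q31, q22, q211]
      DiffExpr.phiExpCoeff1111 := ⟨_, rfl⟩
  refine exists_isDeformation_of_commutators δ hμ hψ0 hψ1 hψ2 hη0 hη1 hη2 hf1 hf2 hg1 hg2
    hp1 hp2 hp3 hp4 hp5 hl q2 q11 q4 q31 q22 q211 q1111 ?_
  intro y3 y21 y111 y5 y41 y32 y311 y221 y2111 y11111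
    z3 z21 z111 z5 z41 z32 z311 z221 z2111 z11111 F
  obtain ⟨hy3, hy21, hy111, hy5, hy41, hy32, hy311, hy221, hy2111, hy11111,
    hz3, hz21, hz111, hz5, hz41, hz32, hz311, hz221, hz2111, hz11111⟩ := F
  have hδ := DiffExpr.represents_ellipticDerivs hK hs ht hx hm0 hm1 hm2 hm3 hm4
  have h0 := DiffExpr.represents_run hδ (DiffExpr.represents_atoms t x m0 m1 m2 m3 m4 m5 K s)
    (xs := DiffExpr.phiExpCoeffs ++ DiffExpr.formCoeffs)
    (r := [μ, b, p, l, q2, q11, q4, q31, q22, q211, q1111, y3, y21, y111, y5, y41, y32, y311, y221,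
      y2111, y11111, z3, z21, z111, z5, z41, z32, z311, z221, z2111, z11111]) (by
      simp only [DiffExpr.phiExpCoeffs, DiffExpr.formCoeffs, List.cons_append, List.nil_append, DiffExpr.IsRun]
      refine ⟨?_, ?_, ?_, ?_, eq2, eq11, eq4, eq31, eq22, eq211, eq1111, ?_, ?_, ?_, ?_, ?_, ?_, ?_, ?_,
      ?_, ?_, ?_, ?_, ?_, ?_, ?_, ?_, ?_, ?_, ?_, ?_, trivial⟩ <;>
        simp only [DiffExpr.val_var, DiffExpr.val_add, DiffExpr.val_sub, DiffExpr.val_mul, DiffExpr.val_neg, DiffExpr.val_der, DiffExpr.val_one, DiffExpr.val_ofNat, List.getD_cons_zero, List.getD_cons_succ]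
      exacts [eμ, eb, hp, el, hy3, hy21, hy111, hy5, hy41, hy32, hy311, hy221, hy2111, hy11111, hz3, hz21,
      hz111, hz5, hz41, hz32, hz311, hz221, hz2111, hz11111])
  have h1 := DiffExpr.allZero_of_allZero hδ h0 (xs := DiffExpr.commutatorTwo ++ DiffExpr.commutatorFour)
    phiExp_allZero
  obtain ⟨c0, c1, c2, c3, c4, c5, c6, c7, c8, c9, c10, c11, c12, c13, -⟩ := h1
  constructor
  · rw [commutator_two_add_mul]
    repeat' first | apply add_eq_zero_of_eq_zero | apply C_mul_eq_zero_of_eq_zero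
    exacts [c0, c1, c2, c3]
  · rw [commutator_four_add_mul]
    repeat' first | apply add_eq_zero_of_eq_zero | apply C_mul_eq_zero_of_eq_zero
    exacts [c4, c5, c6, c7, c8, c9, c10, c11, c12, c13]

/-! ### Arithmetic of analytic germs -/

section Germs

variable {r : ℂ} {f g : ℂ → ℂ}

theorem coe_germOf (hf : AnalyticAt ℂ f r) :
    (germOf r f : Filter.Germ (𝓝 r) ℂ) = (f : Filter.Germ (𝓝 r) ℂ) := by
  rw [germOf, dif_pos hf]

theorem germOf_congr (hf : AnalyticAt ℂ f r) (h : f =ᶠ[𝓝 r] g) : germOf r f = germOf r g := by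
  refine Subtype.ext ?_
  rw [coe_germOf hf, coe_germOf (hf.congr h)]
  exact Filter.Germ.coe_eq.2 h

theorem exists_germOf (a : AnalyticGerm r) : ∃ f, AnalyticAt ℂ f r ∧ a = germOf r f := by
  obtain ⟨_, f, hf, rfl⟩ := a
  exact ⟨f, hf, Subtype.ext (coe_germOf hf).symm⟩

theorem germOf_add (hf : AnalyticAt ℂ f r) (hg : AnalyticAt ℂ g r) :
    germOf r (fun z => f z + g z) = germOf r f + germOf r g :=
  Subtype.ext ((coe_germOf (hf.add hg)).trans (by
    change _ = (germOf r f : Filter.Germ (𝓝 r) ℂ) + germOf r g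
    rw [coe_germOf hf, coe_germOf hg]
    rfl))

theorem germOf_mul (hf : AnalyticAt ℂ f r) (hg : AnalyticAt ℂ g r) :
    germOf r (fun z => f z * g z) = germOf r f * germOf r g :=
  Subtype.ext ((coe_germOf (hf.mul hg)).trans (by
    change _ = (germOf r f : Filter.Germ (𝓝 r) ℂ) * germOf r g
    rw [coe_germOf hf, coe_germOf hg]
    rfl))

theorem germOf_const (c : ℂ) : germOf r (fun _ => c) = algebraMap ℂ _ c :=
  Subtype.ext (coe_germOf analyticAt_const)

theorem germDerivation_germOf (hf : AnalyticAt ℂ f r) :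
    germDerivation r (germOf r f) = germOf r (deriv f) := by
  refine Subtype.ext ?_
  change germDeriv r (germOf r f : Filter.Germ (𝓝 r) ℂ) = _
  rw [coe_germOf hf, coe_germOf hf.deriv, germDeriv_coe]

/-- The value of a germ at the point. -/
def germEval (r : ℂ) : AnalyticGerm r →+* ℂ :=
  (Filter.Germ.valueRingHom (x := r)).comp (analyticGermSubring r).subtype

theorem germEval_germOf (hf : AnalyticAt ℂ f r) : germEval r (germOf r f) = f r := by
  change Filter.Germ.value (germOf r f : Filter.Germ (𝓝 r) ℂ) = _
  rw [coe_germOf hf]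
  rfl

theorem germEval_algebraMap (c : ℂ) : germEval r (algebraMap ℂ _ c) = c := rfl

theorem isUnit_of_germEval_ne_zero {a : AnalyticGerm r} (ha : germEval r a ≠ 0) : IsUnit a := by
  obtain ⟨f, hf, rfl⟩ := exists_germOf a
  rw [germEval_germOf hf] at ha
  refine IsUnit.of_mul_eq_one (germOf r fun z => (f z)⁻¹) ?_
  have h1 : AnalyticAt ℂ (fun z => (f z)⁻¹) r := hf.inv ha
  rw [← germOf_mul hf h1, ← (algebraMap ℂ (AnalyticGerm r)).map_one, ← germOf_const]
  refine germOf_congr (hf.mul h1) ?_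
  filter_upwards [hf.continuousAt.eventually_ne ha] with z hz
  exact mul_inv_cancel₀ hz

/-- The quotient f / f(r) is near 1, hence away from the branch cut, so half its logarithm plus half
of log f(r) gives an analytic square root. -/
theorem exists_mul_self_eq {a : AnalyticGerm r} (ha : germEval r a ≠ 0) : ∃ b, b * b = a := by
  obtain ⟨f, hf, rfl⟩ := exists_germOf a
  rw [germEval_germOf hf] at ha
  have h1 : AnalyticAt ℂ (fun z => f z / f r) r := hf.div analyticAt_const ha
  have h2 : AnalyticAt ℂ (fun z => Complex.log (f z / f r)) r := by
    refine h1.clog ?_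
    rw [div_self ha]
    exact Complex.one_mem_slitPlane
  have h3 : AnalyticAt ℂ (fun z => Complex.exp ((Complex.log (f z / f r) + Complex.log (f r)) / 2)) r :=
    ((h2.add analyticAt_const).div analyticAt_const two_ne_zero).cexp
  refine ⟨germOf r fun z => Complex.exp ((Complex.log (f z / f r) + Complex.log (f r)) / 2), ?_⟩
  rw [← germOf_mul h3 h3]
  refine germOf_congr (h3.mul h3) ?_
  filter_upwards [hf.continuousAt.eventually_ne ha] with z hz
  rw [← Complex.exp_add, add_halves, Complex.exp_add, Complex.exp_log (div_ne_zero hz ha),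
    Complex.exp_log ha, div_mul_cancel₀ _ ha]

end Germs

/-! ### Calculus of the two partial derivatives -/

section Partial

variable {F G : ℂ × ℂ → ℂ} {P : ℂ × ℂ}

theorem hasDerivAt_fst (hF : AnalyticAt ℂ F P) :
    HasDerivAt (fun z => F (z, P.2)) (fderiv ℂ F P (1, 0)) P.1 := by
  have h2 : HasDerivAt (fun z : ℂ => (z, P.2)) ((1 : ℂ), (0 : ℂ)) P.1 :=
    (hasDerivAt_id _).prodMk (hasDerivAt_const _ _)
  exact HasFDerivAt.comp_hasDerivAt (f := fun z : ℂ => (z, P.2)) P.1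
    hF.differentiableAt.hasFDerivAt h2

theorem hasDerivAt_snd (hF : AnalyticAt ℂ F P) :
    HasDerivAt (fun z => F (P.1, z)) (fderiv ℂ F P (0, 1)) P.2 := by
  have h2 : HasDerivAt (fun z : ℂ => (P.1, z)) ((0 : ℂ), (1 : ℂ)) P.2 :=
    (hasDerivAt_const _ _).prodMk (hasDerivAt_id _)
  exact HasFDerivAt.comp_hasDerivAt (f := fun z : ℂ => (P.1, z)) P.2
    hF.differentiableAt.hasFDerivAt h2

theorem du_eq_fderiv (hF : AnalyticAt ℂ F P) : du F P = fderiv ℂ F P (1, 0) :=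
  (hasDerivAt_fst hF).deriv

theorem dw_eq_fderiv (hF : AnalyticAt ℂ F P) : dw F P = fderiv ℂ F P (0, 1) :=
  (hasDerivAt_snd hF).deriv

theorem fderiv_eq (hF : AnalyticAt ℂ F P) (v : ℂ × ℂ) :
    fderiv ℂ F P v = v.1 * du F P + v.2 * dw F P := by
  have e : v = v.1 • ((1 : ℂ), (0 : ℂ)) + v.2 • ((0 : ℂ), (1 : ℂ)) := by
    ext <;> simp
  rw [du_eq_fderiv hF, dw_eq_fderiv hF]
  conv_lhs => rw [e, map_add, map_smul, map_smul]
  rfl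

theorem analyticAt_fderiv_apply (hF : AnalyticAt ℂ F P) (v : ℂ × ℂ) :
    AnalyticAt ℂ (fun Q => fderiv ℂ F Q v) P :=
  ((ContinuousLinearMap.apply ℂ ℂ v).analyticAt _).comp hF.fderiv

theorem du_eventuallyEq (hF : AnalyticAt ℂ F P) : du F =ᶠ[𝓝 P] fun Q => fderiv ℂ F Q (1, 0) := by
  filter_upwards [hF.eventually_analyticAt] with Q hQ
  exact du_eq_fderiv hQ

theorem dw_eventuallyEq (hF : AnalyticAt ℂ F P) : dw F =ᶠ[𝓝 P] fun Q => fderiv ℂ F Q (0, 1) := by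
  filter_upwards [hF.eventually_analyticAt] with Q hQ
  exact dw_eq_fderiv hQ

theorem analyticAt_du (hF : AnalyticAt ℂ F P) : AnalyticAt ℂ (du F) P :=
  (analyticAt_fderiv_apply hF _).congr (du_eventuallyEq hF).symm

theorem du_congr (h : F =ᶠ[𝓝 P] G) : du F P = du G P := by
  refine Filter.EventuallyEq.deriv_eq ?_
  have h1 : Filter.Tendsto (fun z : ℂ => (z, P.2)) (𝓝 P.1) (𝓝 P) :=
    (Continuous.prodMk continuous_id continuous_const).continuousAt.tendsto
  exact h1.eventually h

theorem dw_congr (h : F =ᶠ[𝓝 P] G) : dw F P = dw G P := by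
  refine Filter.EventuallyEq.deriv_eq ?_
  have h1 : Filter.Tendsto (fun z : ℂ => (P.1, z)) (𝓝 P.2) (𝓝 P) :=
    (Continuous.prodMk continuous_const continuous_id).continuousAt.tendsto
  exact h1.eventually h

theorem dw_du (hF : AnalyticAt ℂ F P) : dw (du F) P = du (dw F) P := by
  rw [dw_congr (du_eventuallyEq hF), du_congr (dw_eventuallyEq hF),
    dw_eq_fderiv (analyticAt_fderiv_apply hF _), du_eq_fderiv (analyticAt_fderiv_apply hF _)]
  have h1 : HasFDerivAt (fderiv ℂ F) (fderiv ℂ (fderiv ℂ F) P) P :=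
    hF.fderiv.differentiableAt.hasFDerivAt
  have h2 (v : ℂ × ℂ) : fderiv ℂ (fun Q => fderiv ℂ F Q v) P =
      (fderiv ℂ (fderiv ℂ F) P).flip v :=
    (((ContinuousLinearMap.apply ℂ ℂ v).hasFDerivAt.comp P h1).fderiv).trans (by ext <;> rfl)
  rw [h2, h2]
  have h3 : ContDiffAt ℂ 2 F P := hF.contDiffAt
  exact (h3.isSymmSndFDerivAt (by simp)).eq _ _

theorem du_add (hF : AnalyticAt ℂ F P) (hG : AnalyticAt ℂ G P) :
    du (fun Q => F Q + G Q) P = du F P + du G P :=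
  deriv_fun_add (hasDerivAt_fst hF).differentiableAt (hasDerivAt_fst hG).differentiableAt

theorem dw_add (hF : AnalyticAt ℂ F P) (hG : AnalyticAt ℂ G P) :
    dw (fun Q => F Q + G Q) P = dw F P + dw G P :=
  deriv_fun_add (hasDerivAt_snd hF).differentiableAt (hasDerivAt_snd hG).differentiableAt

theorem du_sub (hF : AnalyticAt ℂ F P) (hG : AnalyticAt ℂ G P) :
    du (fun Q => F Q - G Q) P = du F P - du G P :=
  deriv_fun_sub (hasDerivAt_fst hF).differentiableAt (hasDerivAt_fst hG).differentiableAt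

theorem dw_sub (hF : AnalyticAt ℂ F P) (hG : AnalyticAt ℂ G P) :
    dw (fun Q => F Q - G Q) P = dw F P - dw G P :=
  deriv_fun_sub (hasDerivAt_snd hF).differentiableAt (hasDerivAt_snd hG).differentiableAt

theorem du_mul (hF : AnalyticAt ℂ F P) (hG : AnalyticAt ℂ G P) :
    du (fun Q => F Q * G Q) P = du F P * G P + F P * du G P :=
  deriv_fun_mul (hasDerivAt_fst hF).differentiableAt (hasDerivAt_fst hG).differentiableAt

theorem dw_mul (hF : AnalyticAt ℂ F P) (hG : AnalyticAt ℂ G P) :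
    dw (fun Q => F Q * G Q) P = dw F P * G P + F P * dw G P :=
  deriv_fun_mul (hasDerivAt_snd hF).differentiableAt (hasDerivAt_snd hG).differentiableAt

theorem du_const (c : ℂ) : du (fun _ => c) P = 0 := deriv_const _ _

theorem dw_const (c : ℂ) : dw (fun _ => c) P = 0 := deriv_const _ _

theorem du_const_mul (c : ℂ) : du (fun Q => c * F Q) P = c * du F P := by
  simp only [du]
  exact deriv_const_mul_field c

theorem dw_const_mul (c : ℂ) : dw (fun Q => c * F Q) P = c * dw F P := by
  simp only [dw]
  exact deriv_const_mul_field c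

end Partial

/-! ### Restriction to the graph of h -/

section Along

variable {r : ℂ} {h : ℂ → ℂ} {F G : ℂ × ℂ → ℂ}

/-- The germ at `r` of the restriction of a function to the graph of `h`. -/
def along (r : ℂ) (h : ℂ → ℂ) (F : ℂ × ℂ → ℂ) : AnalyticGerm r := germOf r fun z => F (z, h z)

theorem jet_eq_along (j : ℕ) : jet r h F j = along r h (dw^[j] F) := rfl

theorem analyticAt_along (hh : AnalyticAt ℂ h r) (hF : AnalyticAt ℂ F (r, h r)) :
    AnalyticAt ℂ (fun z => F (z, h z)) r := analyticAt_jet hh hF 0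

theorem along_congr (hh : AnalyticAt ℂ h r) (hF : AnalyticAt ℂ F (r, h r))
    (H : F =ᶠ[𝓝 (r, h r)] G) : along r h F = along r h G := by
  refine germOf_congr (analyticAt_along hh hF) ?_
  have h1 : Filter.Tendsto (fun z : ℂ => (z, h z)) (𝓝 r) (𝓝 (r, h r)) :=
    (continuousAt_id.prodMk hh.continuousAt).tendsto
  exact h1.eventually H

theorem along_add (hh : AnalyticAt ℂ h r) (hF : AnalyticAt ℂ F (r, h r))
    (hG : AnalyticAt ℂ G (r, h r)) : along r h (fun P => F P + G P) = along r h F + along r h G :=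
  germOf_add (analyticAt_along hh hF) (analyticAt_along hh hG)

theorem along_mul (hh : AnalyticAt ℂ h r) (hF : AnalyticAt ℂ F (r, h r))
    (hG : AnalyticAt ℂ G (r, h r)) : along r h (fun P => F P * G P) = along r h F * along r h G :=
  germOf_mul (analyticAt_along hh hF) (analyticAt_along hh hG)

theorem along_const (c : ℂ) : along r h (fun _ => c) = algebraMap ℂ _ c := germOf_const c

theorem germEval_along (hh : AnalyticAt ℂ h r) (hF : AnalyticAt ℂ F (r, h r)) :
    germEval r (along r h F) = F (r, h r) := germEval_germOf (analyticAt_along hh hF)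

/-- The chain rule. -/
theorem germDerivation_along (hh : AnalyticAt ℂ h r) (hF : AnalyticAt ℂ F (r, h r)) :
    germDerivation r (along r h F) =
      along r h (du F) + germDerivation r (germOf r h) * along r h (dw F) := by
  have h1 : Filter.Tendsto (fun z : ℂ => (z, h z)) (𝓝 r) (𝓝 (r, h r)) :=
    (continuousAt_id.prodMk hh.continuousAt).tendsto
  have h0 : AnalyticAt ℂ (fun z => deriv h z * dw F (z, h z)) r :=
    hh.deriv.mul (analyticAt_along hh (analyticAt_dw hF))
  rw [along, germDerivation_germOf (analyticAt_along hh hF), germDerivation_germOf hh, along, along,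
    ← germOf_mul hh.deriv (analyticAt_along hh (analyticAt_dw hF)),
    ← germOf_add (analyticAt_along hh (analyticAt_du hF)) h0]
  refine germOf_congr (analyticAt_along hh hF).deriv ?_
  filter_upwards [hh.eventually_analyticAt, h1.eventually hF.eventually_analyticAt] with z hz hFz
  have h2 : HasDerivAt (fun z : ℂ => (z, h z)) ((1 : ℂ), deriv h z) z :=
    (hasDerivAt_id _).prodMk hz.differentiableAt.hasDerivAt
  have h3 := HasFDerivAt.comp_hasDerivAt (f := fun z : ℂ => (z, h z)) z
    hFz.differentiableAt.hasFDerivAt h2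
  rw [fderiv_eq hFz, one_mul] at h3
  exact h3.deriv

end Along

/-! ### Linearity of the operations on series, and invariance of deformations -/

section Linearity

variable {A : Type} [CommRing A] [Algebra ℂ A] (δ : Derivation ℂ A A)

open PowerSeries (coeff)

theorem evalAt_smul (h : A) (k : ℂ) (F : ℕ → A) (w : EpsSeries A) :
    evalAt h (fun j => k • F j) w = k • evalAt h F w := by
  ext1 n
  simp only [evalAt, PowerSeries.coeff_mk, PowerSeries.coeff_smul, Finset.smul_sum]
  refine Finset.sum_congr rfl fun j _ => ?_
  rw [Algebra.smul_def k (F j), map_mul, ← algebraMap_diffPoly, mul_assoc, ← Algebra.smul_def,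
    smul_comm]

theorem evalAt_add (h : A) (F G : ℕ → A) (w : EpsSeries A) :
    evalAt h (fun j => F j + G j) w = evalAt h F w + evalAt h G w := by
  ext1 n
  simp only [evalAt, PowerSeries.coeff_mk, map_add, add_mul, smul_add, Finset.sum_add_distrib]

theorem evalAt_single (h a : A) (w : EpsSeries A) :
    evalAt h (fun j => if j = 0 then a else 0) w = ofFun a := by
  ext1 n
  simp only [evalAt, PowerSeries.coeff_mk]
  rw [Finset.sum_eq_single 0]
  · rcases n with - | n
    · simp [coeff_zero_ofFun]
    · rw [coeff_ofFun_succ]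
      simp [PowerSeries.coeff_one]
  · intro j _ hj
    simp [hj]
  · simp

theorem evalAt_zero (h : A) (w : EpsSeries A) : evalAt h (fun _ => 0) w = 0 := by
  ext1 n
  simp [evalAt]

theorem shift_add (c : ℂ) (P Q : EpsSeries A) : shift δ c (P + Q) = shift δ c P + shift δ c Q := by
  ext1 n
  simp only [shift, PowerSeries.coeff_mk, map_add, iterate_totalDeriv_add, smul_add,
    Finset.sum_add_distrib]

theorem shift_smul (c k : ℂ) (P : EpsSeries A) : shift δ c (k • P) = k • shift δ c P := by
  ext1 n
  simp only [shift, PowerSeries.coeff_mk, PowerSeries.coeff_smul, iterate_totalDeriv_smul,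
    Finset.smul_sum]
  exact Finset.sum_congr rfl fun _ _ => smul_comm _ _ _

theorem totalDeriv_algebraMap (c : ℂ) :
    totalDeriv δ (MvPolynomial.C (algebraMap ℂ A c)) = 0 := by
  rw [totalDeriv_C, Derivation.map_algebraMap, map_zero, zero_mul]

theorem shift_ofFun_algebraMap (c k : ℂ) :
    shift δ c (ofFun (algebraMap ℂ A k)) = ofFun (algebraMap ℂ A k) := by
  ext1 n
  simp only [shift, PowerSeries.coeff_mk]
  rw [Finset.sum_eq_single (0, n)]
  · simp
  · rintro ⟨i, j⟩ hij hne
    rw [Finset.HasAntidiagonal.mem_antidiagonal] at hij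
    rcases i with - | i
    · have hj : 0 + j = n := hij
      rw [zero_add] at hj
      exact absurd (by rw [hj]) hne
    · rcases j with - | j
      · rw [coeff_zero_ofFun, Function.iterate_succ_apply, totalDeriv_algebraMap,
          iterate_totalDeriv_zero, smul_zero]
      · rw [coeff_ofFun_succ, iterate_totalDeriv_zero, smul_zero]
  · intro hne
    exact absurd (by simp) hne

theorem divEps_add {A : Type} [CommRing A] (P Q : EpsSeries A) : divEps (P + Q) = divEps P + divEps Q := by
  ext1 n
  simp [divEps]

theorem divEps_smul (k : ℂ) (P : EpsSeries A) : divEps (k • P) = k • divEps P := by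
  ext1 n
  simp [divEps]

theorem forwardDiff_add (P Q : EpsSeries A) :
    forwardDiff δ (P + Q) = forwardDiff δ P + forwardDiff δ Q := by
  rw [forwardDiff, shift_add, add_sub_add_comm, divEps_add]
  rfl

theorem forwardDiff_smul (k : ℂ) (P : EpsSeries A) :
    forwardDiff δ (k • P) = k • forwardDiff δ P := by
  rw [forwardDiff, shift_smul, ← smul_sub, divEps_smul]
  rfl

theorem forwardDiff_algebraMap (k : ℂ) : forwardDiff δ (ofFun (algebraMap ℂ A k)) = 0 := by
  rw [forwardDiff, shift_ofFun_algebraMap, sub_self]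
  ext1 n
  simp [divEps]

theorem backwardDiff_add (P Q : EpsSeries A) :
    backwardDiff δ (P + Q) = backwardDiff δ P + backwardDiff δ Q := by
  rw [backwardDiff, shift_add, add_sub_add_comm, divEps_add]
  rfl

theorem backwardDiff_smul (k : ℂ) (P : EpsSeries A) :
    backwardDiff δ (k • P) = k • backwardDiff δ P := by
  rw [backwardDiff, shift_smul, ← smul_sub, divEps_smul]
  rfl

theorem backwardDiff_algebraMap (k : ℂ) : backwardDiff δ (ofFun (algebraMap ℂ A k)) = 0 := by
  rw [backwardDiff, shift_ofFun_algebraMap, sub_self]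
  ext1 n
  simp [divEps]

variable {δ}

/-- Replacing the discrete terms by equal ones. -/
theorem IsDeformation.congr {m : ℕ} {h : A} {ψ η f g p q f' g' p' q' : ℕ → A} {w Y Z : EpsSeries A}
    (H : IsDeformation δ m h ψ η f g p q w Y Z)
    (hf : evalAt h f w * forwardDiff δ (evalAt h g w) =
      evalAt h f' w * forwardDiff δ (evalAt h g' w))
    (hp : evalAt h p w * backwardDiff δ (evalAt h q w) =
      evalAt h p' w * backwardDiff δ (evalAt h q' w)) :
    IsDeformation δ m h ψ η f' g' p' q' w Y Z where
  homogeneous_w := H.homogeneous_w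
  homogeneous_Y := H.homogeneous_Y
  homogeneous_Z := H.homogeneous_Z
  leading_w := H.leading_w
  leading_Y := H.leading_Y
  nonlocality := H.nonlocality
  equation n hn := by rw [H.equation n hn, hf, hp]
  compatibility := H.compatibility

/-- Rescaling of time. -/
theorem IsDeformation.smul {m : ℕ} {h : A} {ψ η f g p q : ℕ → A} {w Y Z : EpsSeries A}
    (H : IsDeformation δ m h ψ η f g p q w Y Z) (s : ℂ) :
    IsDeformation δ m h (fun j => s • ψ j) (fun j => s • η j) (fun j => s • f j) g
      (fun j => s • p j) q w Y (s • Z) where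
  homogeneous_w := H.homogeneous_w
  homogeneous_Y := H.homogeneous_Y
  homogeneous_Z n := by
    rw [PowerSeries.coeff_smul]
    exact isWeightedHomogeneous_smul s (H.homogeneous_Z n)
  leading_w := H.leading_w
  leading_Y := H.leading_Y
  nonlocality := H.nonlocality
  equation n hn := by
    rw [PowerSeries.coeff_smul, H.equation n hn, ← PowerSeries.coeff_smul]
    simp only [evalAt_smul, smul_add, smul_mul_assoc]
  compatibility n hn := by
    rw [flowDeriv_smul_left, flowDeriv_smul, PowerSeries.coeff_smul, PowerSeries.coeff_smul,
      H.compatibility n hn]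

end Linearity

/-! ### Independence of the choice of the six functions -/

section Transfer

variable {Ω : Set (ℂ × ℂ)} {f g f' g' : ℂ × ℂ → ℂ} {r : ℂ} {h : ℂ → ℂ}

theorem dw_eventuallyEq_dw {F G : ℂ × ℂ → ℂ} {P : ℂ × ℂ} (H : F =ᶠ[𝓝 P] G) :
    dw F =ᶠ[𝓝 P] dw G := by
  filter_upwards [H.eventually_nhds] with Q hQ
  exact dw_congr hQ

theorem analyticAt_iterate_dw {F : ℂ × ℂ → ℂ} {P : ℂ × ℂ} (hF : AnalyticAt ℂ F P) (j : ℕ) :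
    AnalyticAt ℂ (dw^[j] F) P := by
  induction j with
  | zero => exact hF
  | succ j ih =>
    rw [Function.iterate_succ_apply']
    exact analyticAt_dw ih

theorem jet_congr (hh : AnalyticAt ℂ h r) (hf : AnalyticAt ℂ f (r, h r))
    (H : f =ᶠ[𝓝 (r, h r)] g) (j : ℕ) : jet r h f j = jet r h g j := by
  rw [jet_eq_along, jet_eq_along]
  refine along_congr hh (analyticAt_iterate_dw hf j) ?_
  induction j with
  | zero => exact H
  | succ j ih =>
    simp only [Function.iterate_succ_apply']
    exact dw_eventuallyEq_dw ih

theorem iterate_dw_const_mul_add (k c : ℂ) (F : ℂ × ℂ → ℂ) (j : ℕ) :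
    dw^[j] (fun P => k * F P + c) = fun P => k * (dw^[j] F) P + if j = 0 then c else 0 := by
  induction j with
  | zero => simp
  | succ j ih =>
    rw [Function.iterate_succ_apply', Function.iterate_succ_apply', ih]
    funext P
    simp only [dw, deriv_add_const, Nat.add_eq_zero_iff, one_ne_zero, and_false, if_false, add_zero]
    exact deriv_const_mul_field k

theorem jet_const_mul_add (hh : AnalyticAt ℂ h r) (hf : AnalyticAt ℂ f (r, h r)) (k c : ℂ) :
    jet r h (fun P => k * f P + c) =
      fun j => k • jet r h f j + if j = 0 then algebraMap ℂ _ c else 0 := by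
  funext j
  have h1 := analyticAt_iterate_dw hf j
  have h2 : AnalyticAt ℂ (fun _ : ℂ × ℂ => if j = 0 then c else 0) (r, h r) := analyticAt_const
  have h3 : AnalyticAt ℂ (fun P => k * (dw^[j] f) P) (r, h r) := analyticAt_const.mul h1
  rw [jet_eq_along, iterate_dw_const_mul_add, along_add hh h3 h2,
    along_mul hh analyticAt_const h1, along_const, along_const, ← Algebra.smul_def]
  split_ifs
  · rfl
  · rw [map_zero]
    rfl

theorem jet_const_mul (hh : AnalyticAt ℂ h r) (hf : AnalyticAt ℂ f (r, h r)) (k : ℂ) :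
    jet r h (fun P => k * f P) = fun j => k • jet r h f j := by
  have := jet_const_mul_add hh hf k 0
  simpa using this

theorem jet_const (c : ℂ) : jet r h (fun _ => c) = fun j => if j = 0 then algebraMap ℂ _ c else 0 := by
  funext j
  have h1 := iterate_dw_const_mul_add 0 c (fun _ => 0) j
  simp only [zero_mul, zero_add] at h1
  rw [jet_eq_along, h1, along_const]
  split_ifs <;> simp

/-- The products `f △ g` and `f' △ g'` agree for all difference operators `△`. -/
def PairEquiv (Ω : Set (ℂ × ℂ)) (f g f' g' : ℂ × ℂ → ℂ) : Prop :=
  (∃ k c : ℂ, ∀ P ∈ Ω, f' P = k * f P ∧ g P = k * g' P + c) ∨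
    ((∀ P ∈ Ω, f P = 0) ∨ ∃ c, ∀ P ∈ Ω, g P = c) ∧ ((∀ P ∈ Ω, f' P = 0) ∨ ∃ c, ∀ P ∈ Ω, g' P = c)

/-- If the common product is nonzero for some pair P₀, P₁, setting P = P₀ makes g an affine function
of g' with slope k = f'(P₀)/f(P₀). Since g' differs at P₀ and P₁, comparison at an arbitrary P
forces f' = kf. Otherwise both products vanish, and then each has f = 0 or g constant. -/
theorem pairEquiv_of_mul_sub_eq
    (H : ∀ P ∈ Ω, ∀ Q ∈ Ω, f P * (g Q - g P) = f' P * (g' Q - g' P)) : PairEquiv Ω f g f' g' := by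
  by_cases h0 : ∀ P ∈ Ω, ∀ Q ∈ Ω, f P * (g Q - g P) = 0
  · have key : ∀ {a b : ℂ × ℂ → ℂ}, (∀ P ∈ Ω, ∀ Q ∈ Ω, a P * (b Q - b P) = 0) →
        (∀ P ∈ Ω, a P = 0) ∨ ∃ c, ∀ P ∈ Ω, b P = c := by
      intro a b hab
      by_cases ha : ∀ P ∈ Ω, a P = 0
      · exact .inl ha
      · push Not at ha
        obtain ⟨P, hP, haP⟩ := ha
        refine .inr ⟨b P, fun Q hQ => ?_⟩
        exact sub_eq_zero.1 ((mul_eq_zero.1 (hab P hP Q hQ)).resolve_left haP)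
    exact .inr ⟨key h0, key fun P hP Q hQ => (H P hP Q hQ).symm.trans (h0 P hP Q hQ)⟩
  · push Not at h0
    obtain ⟨P₀, hP₀, P₁, hP₁, h0⟩ := h0
    have hf0 : f P₀ ≠ 0 := left_ne_zero_of_mul h0
    have h1 := H P₀ hP₀ P₁ hP₁
    have hg1 : g' P₁ - g' P₀ ≠ 0 := right_ne_zero_of_mul (h1 ▸ h0)
    have hg : ∀ Q ∈ Ω, g Q = f' P₀ / f P₀ * g' Q + (g P₀ - f' P₀ / f P₀ * g' P₀) := by
      intro Q hQ
      have h2 := H P₀ hP₀ Q hQ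
      field_simp
      linear_combination h2
    refine .inl ⟨f' P₀ / f P₀, g P₀ - f' P₀ / f P₀ * g' P₀, fun P hP => ⟨?_, hg P hP⟩⟩
    have h3 : ∀ Q ∈ Ω, (f' P - f' P₀ / f P₀ * f P) * (g' Q - g' P) = 0 := by
      intro Q hQ
      have h2 := H P hP Q hQ
      rw [hg P hP, hg Q hQ] at h2
      linear_combination -h2
    have h4 : f' P - f' P₀ / f P₀ * f P = 0 := by
      by_contra hne
      have h5 := (mul_eq_zero.1 (h3 P₀ hP₀)).resolve_left hne
      have h6 := (mul_eq_zero.1 (h3 P₁ hP₁)).resolve_left hne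
      exact hg1 (by linear_combination h6 - h5)
    exact sub_eq_zero.1 h4

/-- Only linearity of the operator and the vanishing on constants matter, so one argument serves for
the forward and for the backward difference. -/
theorem mul_diff_eq_of_pairEquiv (hΩ : IsOpen Ω) (H : PairEquiv Ω f g f' g')
    (hf : AnalyticOnNhd ℂ f Ω) (hg : AnalyticOnNhd ℂ g Ω) (hf' : AnalyticOnNhd ℂ f' Ω)
    (hg' : AnalyticOnNhd ℂ g' Ω)
    (hh : AnalyticAt ℂ h r) (hr : (r, h r) ∈ Ω) (a : AnalyticGerm r) (w : EpsSeries (AnalyticGerm r))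
    (D : EpsSeries (AnalyticGerm r) → EpsSeries (AnalyticGerm r))
    (hadd : ∀ P Q, D (P + Q) = D P + D Q) (hsmul : ∀ (k : ℂ) P, D (k • P) = k • D P)
    (hconst : ∀ k : ℂ, D (ofFun (algebraMap ℂ _ k)) = 0) :
    evalAt a (jet r h f) w * D (evalAt a (jet r h g) w) =
      evalAt a (jet r h f') w * D (evalAt a (jet r h g') w) := by
  have ev {F G : ℂ × ℂ → ℂ} (hF : AnalyticOnNhd ℂ F Ω) (hFG : ∀ P ∈ Ω, F P = G P) :
      jet r h F = jet r h G := by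
    funext j
    refine jet_congr hh (hF _ hr) ?_ j
    filter_upwards [hΩ.mem_nhds hr] with Q hQ using hFG Q hQ
  rcases H with ⟨k, c, H⟩ | ⟨H, H'⟩
  · rw [ev hf' (G := fun P => k * f P) fun P hP => (H P hP).1,
      ev hg (G := fun P => k * g' P + c) fun P hP => (H P hP).2,
      jet_const_mul hh (hf _ hr), jet_const_mul_add hh (hg' _ hr), evalAt_add, evalAt_smul,
      evalAt_smul, evalAt_single, hadd, hsmul, hconst, add_zero, smul_mul_assoc, mul_smul_comm]
  · have key {F G : ℂ × ℂ → ℂ} (hF : AnalyticOnNhd ℂ F Ω) (hG : AnalyticOnNhd ℂ G Ω)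
        (hFG : (∀ P ∈ Ω, F P = 0) ∨ ∃ c, ∀ P ∈ Ω, G P = c) :
        evalAt a (jet r h F) w * D (evalAt a (jet r h G) w) = 0 := by
      rcases hFG with h0 | ⟨c, h0⟩
      · rw [ev hF (G := fun _ => 0) h0, jet_const]
        simp only [map_zero, ite_self, evalAt_zero, zero_mul]
      · rw [ev hG (G := fun _ => c) h0, jet_const, evalAt_single, hconst, mul_zero]
    rw [key hf hg H, key hf' hg' H']

namespace Equation

variable {E E' : Equation} {m : ℕ}

theorem InheritsAt.congr (hΩ : IsOpen Ω) (hE : E.IsAnalyticOn Ω) (hE' : E'.IsAnalyticOn Ω)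
    (hψ : ∀ P ∈ Ω, E.psi P = E'.psi P) (hη : ∀ P ∈ Ω, E.eta P = E'.eta P)
    (hfg : PairEquiv Ω E.f E.g E'.f E'.g) (hpq : PairEquiv Ω E.p E.q E'.p E'.q)
    (hh : AnalyticAt ℂ h r) (hr : (r, h r) ∈ Ω) (H : E.InheritsAt m r h) : E'.InheritsAt m r h := by
  obtain ⟨w, Y, Z, H⟩ := H
  obtain ⟨a1, a2, a3, a4, a5, a6⟩ := hE
  obtain ⟨b1, b2, b3, b4, b5, b6⟩ := hE'
  have ev {F G : ℂ × ℂ → ℂ} (hF : AnalyticOnNhd ℂ F Ω) (hFG : ∀ P ∈ Ω, F P = G P) :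
      jet r h F = jet r h G := by
    funext j
    refine jet_congr hh (hF _ hr) ?_ j
    filter_upwards [hΩ.mem_nhds hr] with Q hQ using hFG Q hQ
  rw [ev a1 hψ, ev a2 hη] at H
  exact ⟨w, Y, Z, H.congr
    (mul_diff_eq_of_pairEquiv hΩ hfg a3 a4 b3 b4 hh hr _ w _ (forwardDiff_add _)
      (forwardDiff_smul _) (forwardDiff_algebraMap _))
    (mul_diff_eq_of_pairEquiv hΩ hpq a5 a6 b5 b6 hh hr _ w _ (backwardDiff_add _)
      (backwardDiff_smul _) (backwardDiff_algebraMap _))⟩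

/-- The equation with rescaled time. -/
def scale (E : Equation) (s : ℂ) : Equation where
  psi P := s * E.psi P
  eta P := s * E.eta P
  f P := s * E.f P
  g := E.g
  p P := s * E.p P
  q := E.q

theorem InheritsAt.scale (hE : E.IsAnalyticOn Ω) (hh : AnalyticAt ℂ h r) (hr : (r, h r) ∈ Ω)
    (H : E.InheritsAt m r h) (s : ℂ) : (E.scale s).InheritsAt m r h := by
  obtain ⟨w, Y, Z, H⟩ := H
  refine ⟨w, Y, s • Z, ?_⟩
  have h1 := H.smul s
  rwa [← jet_const_mul hh (hE.1 _ hr), ← jet_const_mul hh (hE.2.1 _ hr),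
    ← jet_const_mul hh (hE.2.2.1 _ hr), ← jet_const_mul hh (hE.2.2.2.2.1 _ hr)] at h1

/-- When the previous lattice value equals the current one the backward term vanishes, which
isolates the forward term. -/
theorem SameOn.pairEquiv_fg (H : E.SameOn E' Ω) : PairEquiv Ω E.f E.g E'.f E'.g := by
  refine pairEquiv_of_mul_sub_eq fun P hP Q hQ => ?_
  have h1 := H.2.2 P hP Q hQ P hP
  simpa only [discretePart, sub_self, mul_zero, add_zero] using h1

theorem SameOn.pairEquiv_pq (H : E.SameOn E' Ω) : PairEquiv Ω E.p E.q E'.p E'.q := by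
  refine pairEquiv_of_mul_sub_eq fun P hP Q hQ => ?_
  have h1 := H.2.2 P hP P hP Q hQ
  simp only [discretePart, sub_self, mul_zero, zero_add] at h1
  linear_combination -h1

theorem PairEquiv.mul_du (hΩ : IsOpen Ω) (H : PairEquiv Ω f g f' g') {P : ℂ × ℂ} (hP : P ∈ Ω) :
    f P * du g P = f' P * du g' P := by
  have ev {F G : ℂ × ℂ → ℂ} (hFG : ∀ P ∈ Ω, F P = G P) : F =ᶠ[𝓝 P] G := by
    filter_upwards [hΩ.mem_nhds hP] with Q hQ using hFG Q hQ
  rcases H with ⟨k, c, H⟩ | ⟨H, H'⟩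
  · have h1 : du (fun P => k * g' P + c) P = k * du g' P := by
      simp only [du, deriv_add_const]
      exact deriv_const_mul_field k
    rw [du_congr (ev fun P hP => (H P hP).2), h1, (H P hP).1]
    ring
  · have key {F G : ℂ × ℂ → ℂ} (hFG : (∀ P ∈ Ω, F P = 0) ∨ ∃ c, ∀ P ∈ Ω, G P = c) :
        F P * du G P = 0 := by
      rcases hFG with h0 | ⟨c, h0⟩
      · rw [h0 P hP, zero_mul]
      · rw [du_congr (ev (G := fun _ => c) h0), du_const, mul_zero]
    rw [key H, key H']

theorem PairEquiv.mul_dw (hΩ : IsOpen Ω) (H : PairEquiv Ω f g f' g') {P : ℂ × ℂ} (hP : P ∈ Ω) :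
    f P * dw g P = f' P * dw g' P := by
  have ev {F G : ℂ × ℂ → ℂ} (hFG : ∀ P ∈ Ω, F P = G P) : F =ᶠ[𝓝 P] G := by
    filter_upwards [hΩ.mem_nhds hP] with Q hQ using hFG Q hQ
  rcases H with ⟨k, c, H⟩ | ⟨H, H'⟩
  · have h1 : dw (fun P => k * g' P + c) P = k * dw g' P := by
      simp only [dw, deriv_add_const]
      exact deriv_const_mul_field k
    rw [dw_congr (ev fun P hP => (H P hP).2), h1, (H P hP).1]
    ring
  · have key {F G : ℂ × ℂ → ℂ} (hFG : (∀ P ∈ Ω, F P = 0) ∨ ∃ c, ∀ P ∈ Ω, G P = c) :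
        F P * dw G P = 0 := by
      rcases hFG with h0 | ⟨c, h0⟩
      · rw [h0 P hP, zero_mul]
      · rw [dw_congr (ev (G := fun _ => c) h0), dw_const, mul_zero]
    rw [key H, key H']

/-- Apart from ψ and η the cubic depends only on the products f g_u, f g_w, p q_u, p q_w, and
`PairEquiv` preserves these. -/
theorem degeneracyCubic_congr (hΩ : IsOpen Ω)
    (hψ : ∀ P ∈ Ω, E.psi P = E'.psi P) (hη : ∀ P ∈ Ω, E.eta P = E'.eta P)
    (hfg : PairEquiv Ω E.f E.g E'.f E'.g) (hpq : PairEquiv Ω E.p E.q E'.p E'.q)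
    {P : ℂ × ℂ} (hP : P ∈ Ω) (μ : ℂ) : E.degeneracyCubic P μ = E'.degeneracyCubic P μ := by
  have h1 : E.limPhi =ᶠ[𝓝 P] E'.limPhi := by
    filter_upwards [hΩ.mem_nhds hP] with Q hQ
    rw [limPhi, limPhi, PairEquiv.mul_du hΩ hfg hQ, PairEquiv.mul_du hΩ hpq hQ]
  have h2 : E.limPsi =ᶠ[𝓝 P] E'.limPsi := by
    filter_upwards [hΩ.mem_nhds hP] with Q hQ
    rw [limPsi, limPsi, PairEquiv.mul_dw hΩ hfg hQ, PairEquiv.mul_dw hΩ hpq hQ, hψ Q hQ]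
  have h3 : E.eta =ᶠ[𝓝 P] E'.eta := by
    filter_upwards [hΩ.mem_nhds hP] with Q hQ using hη Q hQ
  rw [degeneracyCubic, degeneracyCubic, du_congr h1, dw_congr h1, du_congr h2, dw_congr h2,
    du_congr h3, dw_congr h3]

end Equation

end Transfer

/-! ### Passage from generic germs to the explicit deformations -/

section GermFamilies

variable {r : ℂ}

local notation "δ" => germDerivation r

/-- T stands for Θ'. Genericity makes t = Θ' + κh' invertible, so the quotients x = h'/t and m0 =
h''/t are germs, and T' = κT closes the system of derivatives. -/
theorem exists_isDeformation_of_linear_psi {κ : ℂ} {h s T : AnalyticGerm r}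
    {ψ η f g : ℕ → AnalyticGerm r} (hs : δ s = T + algebraMap ℂ _ κ * δ h)
    (hT : δ T = algebraMap ℂ _ κ * T)
    (hne : germEval r (T + algebraMap ℂ _ κ * δ h) ≠ 0)
    (hψ0 : ψ 0 = s) (hψ1 : ψ 1 = algebraMap ℂ _ κ) (hψ2 : ψ 2 = 0) (hη0 : η 0 = 1) (hη1 : η 1 = 0)
    (hη2 : η 2 = 0) (hf0 : f 0 = 0) (hf1 : f 1 = 0) (hf2 : f 2 = 0) (hg1 : g 1 = 0) (hg2 : g 2 = 0) :
    ∃ w Y Z : EpsSeries (AnalyticGerm r), IsDeformation δ 4 h ψ η f g f g w Y Z := by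
  obtain ⟨K, hK⟩ : ∃ K, K = algebraMap ℂ (AnalyticGerm r) κ := ⟨_, rfl⟩
  have dK : δ K = 0 := by rw [hK, Derivation.map_algebraMap]
  rw [← hK] at hs hT hne hψ1
  obtain ⟨t, ht⟩ : ∃ t, t = T + K * δ h := ⟨_, rfl⟩
  rw [← ht] at hs hne
  obtain ⟨u, hu⟩ := (isUnit_of_germEval_ne_zero hne).exists_right_inv
  obtain ⟨x, hx⟩ : ∃ x, x = δ h * u := ⟨_, rfl⟩
  obtain ⟨m0, hm0⟩ : ∃ m, m = δ (δ h) * u := ⟨_, rfl⟩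
  have h1 : t * x = δ h := by rw [hx]; linear_combination δ h * hu
  have h2 : t * m0 = δ (δ h) := by rw [hm0]; linear_combination δ (δ h) * hu
  have h3 : δ t = K * t * (1 - K * x + m0) := by
    rw [ht, map_add, Derivation.leibniz, dK, hT, smul_eq_mul, smul_zero, add_zero, ← ht]
    linear_combination K * h2.symm + K * K * h1 - K * ht
  have h4 : δ x = m0 - K * x * (1 - K * x + m0) := by
    have h5 := congrArg δ h1
    rw [Derivation.leibniz, h3, smul_eq_mul, smul_eq_mul, ← h2] at h5
    linear_combination u * h5 - (δ x - m0 + x * (K * (1 - K * x + m0))) * hu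
  exact exists_isDeformation_of_hydrodynamic δ dK hs h3 h4 rfl rfl rfl rfl rfl h1.symm hψ0 hψ1 hψ2
    hη0 hη1 hη2 hf1 hf2 hg1 hg2 hf0

/-- The parametrization by an elliptic substitution. -/
theorem exists_elliptic {κ : ℂ} (hκ : κ ≠ 0) {h s p : AnalyticGerm r}
    (hs : δ s = algebraMap ℂ _ κ * δ h) (hp : δ p = 2 * algebraMap ℂ _ κ * p)
    (hne : germEval r (2 * p + δ h * δ h) ≠ 0) :
    ∃ t x m0 m1 m2 m3 m4 m5 : AnalyticGerm r, δ s = algebraMap ℂ _ κ * (2 * t * x) ∧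
      δ t = algebraMap ℂ _ κ * t * (1 - x * x + x * m0) ∧
      δ x = algebraMap ℂ _ κ * (m0 - x * (1 - x * x + x * m0)) ∧ δ m0 = algebraMap ℂ _ κ * m1 ∧
      δ m1 = algebraMap ℂ _ κ * m2 ∧ δ m2 = algebraMap ℂ _ κ * m3 ∧ δ m3 = algebraMap ℂ _ κ * m4 ∧
      δ m4 = algebraMap ℂ _ κ * m5 ∧ δ h = 2 * t * x ∧ p = 2 * (t * t * (1 - x * x)) := by
  obtain ⟨K, hK⟩ : ∃ K, K = algebraMap ℂ (AnalyticGerm r) κ := ⟨_, rfl⟩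
  obtain ⟨k, hk⟩ : ∃ k, k = algebraMap ℂ (AnalyticGerm r) κ⁻¹ := ⟨_, rfl⟩
  have hKk : K * k = 1 := by rw [hK, hk, ← map_mul, mul_inv_cancel₀ hκ, map_one]
  obtain ⟨c, hc⟩ : ∃ c, c = algebraMap ℂ (AnalyticGerm r) 2⁻¹ := ⟨_, rfl⟩
  have h2c : 2 * c = 1 := by
    rw [hc, ← map_ofNat (algebraMap ℂ (AnalyticGerm r)) 2, ← map_mul, mul_inv_cancel₀ two_ne_zero,
      map_one]
  rw [← hK] at hs hp ⊢
  have hT : germEval r (c * c * (2 * p + δ h * δ h)) ≠ 0 := by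
    rw [map_mul, map_mul, hc, germEval_algebraMap]
    exact mul_ne_zero (by norm_num) hne
  -- This is 4t² = 2p + h'²; the right-hand side is the cubic divided by κ for the equations to
  -- which the lemma is applied.
  obtain ⟨t, ht⟩ := exists_mul_self_eq hT
  have htne : germEval r t ≠ 0 := by
    intro h0
    rw [← ht, map_mul, h0, mul_zero] at hT
    exact hT rfl
  obtain ⟨u, hu⟩ := (isUnit_of_germEval_ne_zero htne).exists_right_inv
  obtain ⟨x, hx⟩ : ∃ x, x = c * δ h * u := ⟨_, rfl⟩
  -- The factor k = 1/κ normalizes m0 = h''/(2κt), and likewise the m's below, so that every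
  -- derivative of an atom carries the factor κ.
  obtain ⟨m0, hm0⟩ : ∃ m, m = c * k * δ (δ h) * u := ⟨_, rfl⟩
  have h1 : 2 * t * x = δ h := by
    rw [hx]
    linear_combination δ h * hu + t * u * δ h * h2c
  have h2 : 2 * t * (K * m0) = δ (δ h) := by
    rw [hm0]
    linear_combination δ (δ h) * hu + t * u * δ (δ h) * h2c + 2 * t * c * δ (δ h) * u * hKk
  have h4t : 4 * (t * t) = 2 * p + δ h * δ h := by
    rw [ht]
    linear_combination (2 * c + 1) * (2 * p + δ h * δ h) * h2c
  have h2' : ∀ {a b : AnalyticGerm r}, 2 * a = 2 * b → a = b := fun {a b} hab => by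
    linear_combination c * hab - (a - b) * h2c
  have hpt : p = 2 * (t * t * (1 - x * x)) := by
    refine h2' ?_
    linear_combination -h4t + (2 * t * x + δ h) * h1
  have hut : ∀ {a b : AnalyticGerm r}, t * a = t * b → a = b := fun {a b} hab => by
    linear_combination u * hab - (a - b) * hu
  have h3 : δ t = K * t * (1 - x * x + x * m0) := by
    have h5 := congrArg δ h4t
    rw [← map_ofNat (algebraMap ℂ (AnalyticGerm r)) 4, ← map_ofNat (algebraMap ℂ (AnalyticGerm r)) 2] at h5
    simp only [map_add, Derivation.leibniz, Derivation.map_algebraMap, smul_eq_mul, add_zero, hp, mul_zero] at h5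
    simp only [map_ofNat] at h5
    refine hut (h2' (h2' (h2' ?_)))
    linear_combination h5 + 4 * K * hpt - 2 * δ h * h2 - 4 * t * K * m0 * h1
  have h4 : δ x = K * (m0 - x * (1 - x * x + x * m0)) := by
    have h5 := congrArg δ h1
    rw [← map_ofNat (algebraMap ℂ (AnalyticGerm r)) 2] at h5
    simp only [Derivation.leibniz, Derivation.map_algebraMap, smul_eq_mul, h3]
      at h5
    simp only [map_ofNat] at h5
    refine hut (h2' ?_)
    linear_combination h5 - h2
  have hm : ∀ m : AnalyticGerm r, δ m = K * (k * δ m) := fun m => by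
    linear_combination -δ m * hKk
  exact ⟨t, x, m0, _, _, _, _, _, by rw [hs, h1], h3, h4, hm _, hm _, hm _, hm _, hm _, h1.symm, hpt⟩

/-- For constant f the law p' = 2κp of p = 2fg', needed for the elliptic substitution, comes
entirely from g'' = 2κg'. -/
theorem exists_isDeformation_of_const_f {κ : ℂ} (hκ : κ ≠ 0) {h s : AnalyticGerm r}
    {ψ η f g : ℕ → AnalyticGerm r} (hs : δ s = algebraMap ℂ _ κ * δ h)
    (hne : germEval r (2 * (2 * f 0 * δ (g 0)) + δ h * δ h) ≠ 0)
    (hψ0 : ψ 0 = s) (hψ1 : ψ 1 = algebraMap ℂ _ κ) (hψ2 : ψ 2 = 0) (hη0 : η 0 = 1) (hη1 : η 1 = 0)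
    (hη2 : η 2 = 0) (hf1 : f 1 = 0) (hf2 : f 2 = 0) (hg1 : g 1 = 0) (hg2 : g 2 = 0)
    (hf0 : δ (f 0) = 0)
    (hg0 : δ (δ (g 0)) = 2 * algebraMap ℂ _ κ * δ (g 0)) :
    ∃ w Y Z : EpsSeries (AnalyticGerm r), IsDeformation δ 4 h ψ η f g f g w Y Z := by
  have dK : δ (algebraMap ℂ _ κ) = 0 := Derivation.map_algebraMap _ _
  have d2 : δ 2 = 0 := by rw [← map_ofNat (algebraMap ℂ (AnalyticGerm r)) 2, Derivation.map_algebraMap]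
  have hp : δ (2 * f 0 * δ (g 0)) = 2 * algebraMap ℂ _ κ * (2 * f 0 * δ (g 0)) := by
    simp only [Derivation.leibniz, d2, hf0, hg0, smul_eq_mul]
    ring
  obtain ⟨t, x, m0, m1, m2, m3, m4, m5, h1, h2, h3, h4, h5, h6, h7, h8, h9, h10⟩ :=
    exists_elliptic hκ hs hp hne
  have e3 : δ (δ (δ (g 0))) = (2 * algebraMap ℂ _ κ) ^ 2 * δ (g 0) := by
    rw [hg0]
    simp only [Derivation.leibniz, d2, dK, hg0, smul_eq_mul]
    ring
  have e4 : δ (δ (δ (δ (g 0)))) = (2 * algebraMap ℂ _ κ) ^ 3 * δ (g 0) := by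
    rw [hg0]
    simp only [Derivation.leibniz, d2, dK, hg0, smul_eq_mul, mul_zero, add_zero]
    ring
  have e5 : δ (δ (δ (δ (δ (g 0))))) = (2 * algebraMap ℂ _ κ) ^ 4 * δ (g 0) := by
    rw [hg0]
    simp only [Derivation.leibniz, d2, dK, hg0, smul_eq_mul, mul_zero, add_zero]
    ring
  exact exists_isDeformation_of_phi_const δ dK h1 h2 h3 h4 h5 h6 h7 h8 h9 hψ0 hψ1 hψ2 hη0 hη1 hη2
    hf1 hf2 hg1 hg2 rfl (by rw [hg0]; ring) (by rw [e3]; ring) (by rw [e4]; ring) (by rw [e5]; ring)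
    h10

/-- Here f and g' each contribute κ to the logarithmic derivative of p = 2fg', so again p' = 2κp. -/
theorem exists_isDeformation_of_exp_f {κ : ℂ} (hκ : κ ≠ 0) {h s : AnalyticGerm r}
    {ψ η f g : ℕ → AnalyticGerm r} (hs : δ s = algebraMap ℂ _ κ * δ h)
    (hne : germEval r (2 * (2 * f 0 * δ (g 0)) + δ h * δ h) ≠ 0)
    (hψ0 : ψ 0 = s) (hψ1 : ψ 1 = algebraMap ℂ _ κ) (hψ2 : ψ 2 = 0) (hη0 : η 0 = 1) (hη1 : η 1 = 0)
    (hη2 : η 2 = 0) (hf1 : f 1 = 0) (hf2 : f 2 = 0) (hg1 : g 1 = 0) (hg2 : g 2 = 0)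
    (hf0 : δ (f 0) = algebraMap ℂ _ κ * f 0)
    (hg0 : δ (δ (g 0)) = algebraMap ℂ _ κ * δ (g 0)) :
    ∃ w Y Z : EpsSeries (AnalyticGerm r), IsDeformation δ 4 h ψ η f g f g w Y Z := by
  have dK : δ (algebraMap ℂ _ κ) = 0 := Derivation.map_algebraMap _ _
  have d2 : δ 2 = 0 := by rw [← map_ofNat (algebraMap ℂ (AnalyticGerm r)) 2, Derivation.map_algebraMap]
  have hp : δ (2 * f 0 * δ (g 0)) = 2 * algebraMap ℂ _ κ * (2 * f 0 * δ (g 0)) := by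
    simp only [Derivation.leibniz, d2, hf0, hg0, smul_eq_mul]
    ring
  obtain ⟨t, x, m0, m1, m2, m3, m4, m5, h1, h2, h3, h4, h5, h6, h7, h8, h9, h10⟩ :=
    exists_elliptic hκ hs hp hne
  have e3 : δ (δ (δ (g 0))) = (algebraMap ℂ _ κ) ^ 2 * δ (g 0) := by
    rw [hg0]
    simp only [Derivation.leibniz, dK, hg0, smul_eq_mul]
    ring
  have e4 : δ (δ (δ (δ (g 0)))) = (algebraMap ℂ _ κ) ^ 3 * δ (g 0) := by
    rw [hg0]
    simp only [Derivation.leibniz, dK, hg0, smul_eq_mul, mul_zero, add_zero]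
    ring
  have e5 : δ (δ (δ (δ (δ (g 0))))) = (algebraMap ℂ _ κ) ^ 4 * δ (g 0) := by
    rw [hg0]
    simp only [Derivation.leibniz, dK, hg0, smul_eq_mul, mul_zero, add_zero]
    ring
  exact exists_isDeformation_of_phi_exp δ dK h1 h2 h3 h4 h5 h6 h7 h8 h9 hψ0 hψ1 hψ2 hη0 hη1 hη2
    hf1 hf2 hg1 hg2 rfl (by rw [hg0]; ring) (by rw [e3]; ring) (by rw [e4]; ring) (by rw [e5]; ring)
    h10

end GermFamilies

/-! ### Normal forms and sufficiency -/

section Models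

variable {r : ℂ} {h : ℂ → ℂ}

theorem dw_linear_add (κ : ℂ) (Θ : ℂ → ℂ) :
    dw (fun P => κ * P.2 + Θ P.1) = fun _ => κ := by
  funext P
  simp [dw]

theorem dw_fst (a : ℂ → ℂ) : dw (fun P => a P.1) = fun _ => 0 := by
  funext P
  simp [dw]

theorem du_fst (a : ℂ → ℂ) : du (fun P => a P.1) = fun P => deriv a P.1 := rfl

theorem jet_fst_succ (a : ℂ → ℂ) (j : ℕ) : jet r h (fun P => a P.1) (j + 1) = 0 := by
  have h1 := iterate_dw_const_mul_add 0 0 (fun _ => 0) j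
  simp only [zero_mul, zero_add, ite_self] at h1
  rw [jet_eq_along, Function.iterate_succ_apply, dw_fst, h1, along_const, map_zero]

theorem jet_linear_zero (hh : AnalyticAt ℂ h r) (κ : ℂ) {Θ : ℂ → ℂ} (hΘ : AnalyticAt ℂ Θ r) :
    jet r h (fun P => κ * P.2 + Θ P.1) 0 = algebraMap ℂ _ κ * germOf r h + germOf r Θ := by
  have h1 : AnalyticAt ℂ (fun z => κ * h z) r := analyticAt_const.mul hh
  rw [← germOf_const, ← germOf_mul analyticAt_const hh, ← germOf_add h1 hΘ]
  rfl

theorem jet_linear_one (κ : ℂ) (Θ : ℂ → ℂ) :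
    jet r h (fun P => κ * P.2 + Θ P.1) 1 = algebraMap ℂ _ κ := by
  rw [jet_eq_along, Function.iterate_one, dw_linear_add, along_const]

theorem jet_linear_two (κ : ℂ) (Θ : ℂ → ℂ) : jet r h (fun P => κ * P.2 + Θ P.1) 2 = 0 := by
  rw [jet_eq_along, Function.iterate_succ_apply, Function.iterate_one, dw_linear_add]
  have h1 : dw (fun _ : ℂ × ℂ => κ) = fun _ => 0 := funext fun P => dw_const κ
  rw [h1, along_const, map_zero]

namespace Equation

/-- Equations `u_t = (κ w + Θ(u)) u_y + w_y`. -/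
def linearPsi (κ : ℂ) (Θ : ℂ → ℂ) : Equation where
  psi P := κ * P.2 + Θ P.1
  eta _ := 1
  f _ := 0
  g _ := 0
  p _ := 0
  q _ := 0

/-- Equations `u_t = (κ w + c) u_y + w_y + a(u) (△_x^+ + △_x^-) b(u)`. -/
def symmetricDiff (κ c : ℂ) (a b : ℂ → ℂ) : Equation where
  psi P := κ * P.2 + c
  eta _ := 1
  f P := a P.1
  g P := b P.1
  p P := a P.1
  q P := b P.1

/-- The cubic factors as h'(Θ' + κh'); its second factor is the quantity that has to be invertible.
-/
theorem linearPsi_inheritsAt {κ : ℂ} {Θ : ℂ → ℂ} (hΘ : Differentiable ℂ Θ)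
    (hT : ∀ u, deriv (deriv Θ) u = κ * deriv Θ u) (hh : AnalyticAt ℂ h r)
    (hc : (linearPsi κ Θ).degeneracyCubic (r, h r) (deriv h r) ≠ 0) :
    (linearPsi κ Θ).InheritsAt 4 r h := by
  have aΘ : AnalyticAt ℂ Θ r := hΘ.analyticAt r
  have e1 : (linearPsi κ Θ).limPhi = fun _ => 0 := by
    funext P
    simp [limPhi, linearPsi]
  have e2 : (linearPsi κ Θ).limPsi = fun P => κ * P.2 + Θ P.1 := by
    funext P
    simp [limPsi, linearPsi]
  have e3 : du (fun P => κ * P.2 + Θ P.1) (r, h r) = deriv Θ r := by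
    simp [du]
  have e4 : (linearPsi κ Θ).degeneracyCubic (r, h r) (deriv h r) =
      deriv h r * (deriv Θ r + κ * deriv h r) := by
    rw [degeneracyCubic, e1, e2, e3, dw_linear_add, du_const, dw_const]
    change 0 + (0 + _) * _ + (κ + du (fun _ => 1) _) * _ + dw (fun _ => 1) _ * _ = _
    rw [du_const, dw_const]
    ring
  refine exists_isDeformation_of_linear_psi (κ := κ)
    (s := algebraMap ℂ _ κ * germOf r h + germOf r Θ) (T := germOf r (deriv Θ)) ?_ ?_ ?_
    (jet_linear_zero hh κ aΘ) (jet_linear_one κ Θ) (jet_linear_two κ Θ)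
    ?_ ?_ ?_ ?_ ?_ ?_ ?_ ?_
  · rw [map_add, Derivation.leibniz, Derivation.map_algebraMap, germDerivation_germOf aΘ, smul_zero,
      add_zero, smul_eq_mul, add_comm]
  · rw [germDerivation_germOf aΘ.deriv, ← germOf_const, ← germOf_mul analyticAt_const aΘ.deriv]
    exact germOf_congr aΘ.deriv.deriv (Filter.Eventually.of_forall hT)
  · rw [map_add, map_mul, germEval_germOf aΘ.deriv, germEval_algebraMap, germDerivation_germOf hh,
      germEval_germOf hh.deriv]
    rw [e4] at hc
    exact right_ne_zero_of_mul hc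
  · exact (congrFun (jet_const 1) 0).trans (map_one _)
  · exact congrFun (jet_const 1) 1
  · exact congrFun (jet_const 1) 2
  · exact (congrFun (jet_const 0) 0).trans (map_zero _)
  all_goals exact congrFun (jet_const 0) _

/-- With p = 2ab' both alternatives give p' = 2κp, so the cubic is κ(2p + h'²) and genericity is the
condition of the elliptic substitution. -/
theorem symmetricDiff_inheritsAt {κ c : ℂ} {a b : ℂ → ℂ} (hκ : κ ≠ 0) (ha : Differentiable ℂ a)
    (hb : Differentiable ℂ b)
    (hab : (∀ u, deriv a u = 0) ∧ (∀ u, deriv (deriv b) u = 2 * κ * deriv b u) ∨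
      (∀ u, deriv a u = κ * a u) ∧ (∀ u, deriv (deriv b) u = κ * deriv b u))
    (hh : AnalyticAt ℂ h r)
    (hc : (symmetricDiff κ c a b).degeneracyCubic (r, h r) (deriv h r) ≠ 0) :
    (symmetricDiff κ c a b).InheritsAt 4 r h := by
  have aa : AnalyticAt ℂ a r := ha.analyticAt r
  have ab : AnalyticAt ℂ b r := hb.analyticAt r
  have hb' : Differentiable ℂ (deriv b) := fun z => (hb.analyticAt z).deriv.differentiableAt
  have e1 : (symmetricDiff κ c a b).limPhi = fun P => a P.1 * deriv b P.1 + a P.1 * deriv b P.1 := rfl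
  have e2 : (symmetricDiff κ c a b).limPsi = fun P => κ * P.2 + (fun _ => c) P.1 := by
    funext P
    simp only [limPsi, symmetricDiff, dw_fst, mul_zero, add_zero]
  have e3 : deriv (fun u => a u * deriv b u + a u * deriv b u) r = 2 * κ * (2 * a r * deriv b r) := by
    have hd : DifferentiableAt ℂ (fun u => a u * deriv b u) r := (ha r).mul (hb' r)
    rw [deriv_fun_add hd hd, deriv_fun_mul (ha r) (hb' r)]
    rcases hab with ⟨h1, h2⟩ | ⟨h1, h2⟩
    · rw [h1, h2]
      ring
    · rw [h1, h2]
      ring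
  have e4 : (symmetricDiff κ c a b).degeneracyCubic (r, h r) (deriv h r) =
      κ * (2 * (2 * a r * deriv b r) + deriv h r * deriv h r) := by
    rw [degeneracyCubic, e1, e2, du_fst fun u => a u * deriv b u + a u * deriv b u,
      dw_fst fun u => a u * deriv b u + a u * deriv b u, dw_linear_add κ fun _ => c]
    change deriv (fun u => a u * deriv b u + a u * deriv b u) r + (0 + du _ _) * _ +
      (κ + du (fun _ => 1) _) * _ + dw (fun _ => 1) _ * _ = _
    rw [e3]
    rw [du_const, dw_const, show du (fun P : ℂ × ℂ => κ * P.2 + c) (r, h r) = 0 by simp [du]]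
    ring
  have hne : germEval r (2 * (2 * jet r h (fun P => a P.1) 0 *
      germDerivation r (jet r h (fun P => b P.1) 0)) +
        germDerivation r (germOf r h) * germDerivation r (germOf r h)) ≠ 0 := by
    change germEval r (2 * (2 * germOf r a * germDerivation r (germOf r b)) + _) ≠ 0
    rw [germDerivation_germOf ab, germDerivation_germOf hh]
    simp only [map_add, map_mul, map_ofNat, germEval_germOf aa, germEval_germOf ab.deriv,
      germEval_germOf hh.deriv]
    rw [e4] at hc
    exact right_ne_zero_of_mul hc
  have hs : germDerivation r (algebraMap ℂ _ κ * germOf r h + germOf r fun _ => c) =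
      algebraMap ℂ _ κ * germDerivation r (germOf r h) := by
    rw [map_add, Derivation.leibniz, Derivation.map_algebraMap, germOf_const,
      Derivation.map_algebraMap, smul_zero, add_zero, add_zero, smul_eq_mul]
  have h0 : jet r h (symmetricDiff κ c a b).psi 0 = algebraMap ℂ _ κ * germOf r h + germOf r fun _ => c :=
    jet_linear_zero hh κ analyticAt_const
  have h1 : jet r h (symmetricDiff κ c a b).psi 1 = algebraMap ℂ _ κ := jet_linear_one κ fun _ => c
  have h2 : jet r h (symmetricDiff κ c a b).psi 2 = 0 := jet_linear_two κ fun _ => c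
  have hη : jet r h (symmetricDiff κ c a b).eta = fun j => if j = 0 then algebraMap ℂ _ 1 else 0 :=
    jet_const 1
  have hη0 : jet r h (symmetricDiff κ c a b).eta 0 = 1 := (congrFun hη 0).trans (map_one _)
  have hη1 : jet r h (symmetricDiff κ c a b).eta 1 = 0 := congrFun hη 1
  have hη2 : jet r h (symmetricDiff κ c a b).eta 2 = 0 := congrFun hη 2
  rcases hab with ⟨k1, k2⟩ | ⟨k1, k2⟩
  · refine exists_isDeformation_of_const_f hκ hs hne h0 h1 h2 hη0 hη1 hη2 (jet_fst_succ a 0)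
      (jet_fst_succ a 1) (jet_fst_succ b 0) (jet_fst_succ b 1) ?_ ?_
    · change germDerivation r (germOf r a) = 0
      rw [germDerivation_germOf aa, funext k1, germOf_const, map_zero]
    · change germDerivation r (germDerivation r (germOf r b)) = _ * germDerivation r (germOf r b)
      have h3 : AnalyticAt ℂ (fun u => 2 * κ * deriv b u) r := analyticAt_const.mul ab.deriv
      rw [germDerivation_germOf ab, germDerivation_germOf ab.deriv, funext k2,
        germOf_mul (f := fun _ => 2 * κ) analyticAt_const ab.deriv, germOf_const, map_mul, map_ofNat]
  · refine exists_isDeformation_of_exp_f hκ hs hne h0 h1 h2 hη0 hη1 hη2 (jet_fst_succ a 0)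
      (jet_fst_succ a 1) (jet_fst_succ b 0) (jet_fst_succ b 1) ?_ ?_
    · change germDerivation r (germOf r a) = _ * germOf r a
      rw [germDerivation_germOf aa, funext k1, germOf_mul (f := fun _ => κ) analyticAt_const aa,
        germOf_const]
    · change germDerivation r (germDerivation r (germOf r b)) = _ * germDerivation r (germOf r b)
      rw [germDerivation_germOf ab, germDerivation_germOf ab.deriv, funext k2,
        germOf_mul (f := fun _ => κ) analyticAt_const ab.deriv, germOf_const]

variable {E : Equation} {Ω : Set (ℂ × ℂ)}

theorem degeneracyCubic_scale (s : ℂ) (P : ℂ × ℂ) (μ : ℂ) :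
    (E.scale s).degeneracyCubic P μ = s * E.degeneracyCubic P μ := by
  have h1 : (E.scale s).limPhi = fun P => s * E.limPhi P := by
    funext Q
    simp only [limPhi, scale]
    ring
  have h2 : (E.scale s).limPsi = fun P => s * E.limPsi P := by
    funext Q
    simp only [limPsi, scale]
    ring
  have h3 : (E.scale s).eta = fun P => s * E.eta P := rfl
  rw [degeneracyCubic, degeneracyCubic, h1, h2, h3, du_const_mul, dw_const_mul, du_const_mul,
    dw_const_mul, du_const_mul, dw_const_mul]
  ring

theorem linearPsi_isAnalyticOn {κ : ℂ} {Θ : ℂ → ℂ} (hΘ : Differentiable ℂ Θ) (Ω : Set (ℂ × ℂ)) :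
    (linearPsi κ Θ).IsAnalyticOn Ω := by
  refine ⟨fun P _ => ?_, fun P _ => analyticAt_const, fun P _ => analyticAt_const,
    fun P _ => analyticAt_const, fun P _ => analyticAt_const, fun P _ => analyticAt_const⟩
  exact (analyticAt_const.mul analyticAt_snd).add ((hΘ.analyticAt _).comp analyticAt_fst)

theorem symmetricDiff_isAnalyticOn {κ c : ℂ} {a b : ℂ → ℂ} (ha : Differentiable ℂ a)
    (hb : Differentiable ℂ b) (Ω : Set (ℂ × ℂ)) : (symmetricDiff κ c a b).IsAnalyticOn Ω := by
  have h1 : AnalyticOnNhd ℂ (fun P : ℂ × ℂ => a P.1) Ω :=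
    fun P _ => (ha.analyticAt P.1).comp analyticAt_fst
  have h2 : AnalyticOnNhd ℂ (fun P : ℂ × ℂ => b P.1) Ω :=
    fun P _ => (hb.analyticAt P.1).comp analyticAt_fst
  exact ⟨fun P _ => (analyticAt_const.mul analyticAt_snd).add analyticAt_const,
    fun P _ => analyticAt_const, h1, h2, h1, h2⟩

/-- The equations in the classification, up to the rescaling of time. -/
inductive IsNormal : Equation → Prop
  | linearPsi {κ : ℂ} {Θ : ℂ → ℂ} (hΘ : Differentiable ℂ Θ)
      (hT : ∀ u, deriv (deriv Θ) u = κ * deriv Θ u) : IsNormal (linearPsi κ Θ)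
  | symmetricDiff {κ c : ℂ} {a b : ℂ → ℂ} (hκ : κ ≠ 0) (ha : Differentiable ℂ a)
      (hb : Differentiable ℂ b)
      (hab : (∀ u, deriv a u = 0) ∧ (∀ u, deriv (deriv b) u = 2 * κ * deriv b u) ∨
        (∀ u, deriv a u = κ * a u) ∧ (∀ u, deriv (deriv b) u = κ * deriv b u)) :
      IsNormal (symmetricDiff κ c a b)

theorem IsNormal.isAnalyticOn (H : IsNormal E) (Ω : Set (ℂ × ℂ)) : E.IsAnalyticOn Ω := by
  cases H with
  | linearPsi hΘ hT => exact linearPsi_isAnalyticOn hΘ Ω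
  | symmetricDiff hκ ha hb hab => exact symmetricDiff_isAnalyticOn ha hb Ω

theorem IsNormal.inheritsAt (H : IsNormal E) (hh : AnalyticAt ℂ h r)
    (hc : E.degeneracyCubic (r, h r) (deriv h r) ≠ 0) : E.InheritsAt 4 r h := by
  cases H with
  | linearPsi hΘ hT => exact linearPsi_inheritsAt hΘ hT hh hc
  | symmetricDiff hκ ha hb hab => exact symmetricDiff_inheritsAt hκ ha hb hab hh hc

theorem transform_eqn1 {s : ℂ} (hs : s ≠ 0) (c α β γ : ℂ) :
    ∃ N, IsNormal N ∧ eqn1.transform s c α β γ = N.scale s := by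
  refine ⟨Equation.linearPsi 0 fun u => α * u + β + c / s, .linearPsi (by fun_prop) fun u => ?_, ?_⟩
  · have h1 : deriv (fun u : ℂ => α * u + β + c / s) = fun _ => α := by
      funext u
      simp
    rw [h1, deriv_const, zero_mul]
  · simp only [transform, eqn1, scale, Equation.linearPsi, mul_zero, mk.injEq, and_true]
    refine funext fun P => ?_
    field_simp
    ring

theorem transform_eqn2 {s : ℂ} (hs : s ≠ 0) (a c α β γ : ℂ) :
    ∃ N, IsNormal N ∧ (eqn2 a).transform s c α β γ = N.scale s := by
  refine ⟨Equation.linearPsi α fun u => a * Complex.exp (α * u + β) + (γ + c / s),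
    .linearPsi (by fun_prop) fun u => ?_, ?_⟩
  · have h0 (u : ℂ) : HasDerivAt (fun u => Complex.exp (α * u + β)) (Complex.exp (α * u + β) * α) u := by
      have := (((hasDerivAt_id u).const_mul α).add_const β).cexp
      simpa using this
    have h1 : deriv (fun u : ℂ => a * Complex.exp (α * u + β) + (γ + c / s)) =
        fun u => a * (Complex.exp (α * u + β) * α) := by
      funext u
      exact (((h0 u).const_mul a).add_const _).deriv
    rw [h1, (((h0 u).mul_const α).const_mul a).deriv]
    ring
  · simp only [transform, eqn2, scale, Equation.linearPsi, mul_zero, mk.injEq, and_true]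
    refine funext fun P => ?_
    field_simp
    ring

theorem transform_eqn3 {s α : ℂ} (hs : s ≠ 0) (hα : α ≠ 0) (c β γ : ℂ) :
    ∃ N, IsNormal N ∧ eqn3.transform s c α β γ = N.scale s := by
  refine ⟨Equation.symmetricDiff α (γ + c / s) (fun _ => 1 / (2 * α))
    fun u => Complex.exp (2 * (α * u + β)), .symmetricDiff hα (by fun_prop) (by fun_prop)
      (.inl ⟨fun u => deriv_const _ _, fun u => ?_⟩), ?_⟩
  · have h0 (u : ℂ) : HasDerivAt (fun u => Complex.exp (2 * (α * u + β)))
        (Complex.exp (2 * (α * u + β)) * (2 * α)) u := by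
      have := ((((hasDerivAt_id u).const_mul α).add_const β).const_mul 2).cexp
      simpa using this
    have h1 : deriv (fun u : ℂ => Complex.exp (2 * (α * u + β))) =
        fun u => Complex.exp (2 * (α * u + β)) * (2 * α) := funext fun u => (h0 u).deriv
    rw [h1, ((h0 u).mul_const (2 * α)).deriv]
    ring
  · simp only [transform, eqn3, scale, Equation.symmetricDiff, mk.injEq, and_true, true_and]
    refine ⟨funext fun P => ?_, ?_⟩
    · field_simp
      ring
    · field_simp
      exact ⟨trivial, trivial⟩

theorem transform_eqn4 {s α : ℂ} (hs : s ≠ 0) (hα : α ≠ 0) (c β γ : ℂ) :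
    ∃ N, IsNormal N ∧ eqn4.transform s c α β γ = N.scale s := by
  have h0 (u : ℂ) : HasDerivAt (fun u => Complex.exp (α * u + β)) (Complex.exp (α * u + β) * α) u := by
    have := (((hasDerivAt_id u).const_mul α).add_const β).cexp
    simpa using this
  refine ⟨Equation.symmetricDiff α (γ + c / s) (fun u => α⁻¹ * Complex.exp (α * u + β))
    fun u => Complex.exp (α * u + β), .symmetricDiff hα (by fun_prop) (by fun_prop)
      (.inr ⟨fun u => ?_, fun u => ?_⟩), ?_⟩
  · rw [((h0 u).const_mul α⁻¹).deriv]
    ring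
  · have h1 : deriv (fun u : ℂ => Complex.exp (α * u + β)) =
        fun u => Complex.exp (α * u + β) * α := funext fun u => (h0 u).deriv
    rw [h1, ((h0 u).mul_const α).deriv]
    ring
  · simp only [transform, eqn4, scale, Equation.symmetricDiff, mk.injEq, and_true, true_and]
    refine ⟨funext fun P => ?_, ?_⟩
    · field_simp
      ring
    · field_simp
      exact ⟨trivial, trivial⟩

/-- Once the factor s is pulled out, the Galilean constant appears as c/s and joins the additive
constant of ψ. The scaling α of u becomes κ, except for the first equation, where κ = 0. -/
theorem exists_isNormal_transform {M : Equation} (hM : IsListed M) {s α : ℂ} (hs : s ≠ 0)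
    (hα : α ≠ 0) (c β γ : ℂ) : ∃ N, IsNormal N ∧ M.transform s c α β γ = N.scale s := by
  cases hM with
  | eqn1 => exact transform_eqn1 hs c α β γ
  | eqn2 a => exact transform_eqn2 hs a c α β γ
  | eqn3 => exact transform_eqn3 hs hα c β γ
  | eqn4 => exact transform_eqn4 hs hα c β γ

theorem IsAnalyticOn.scale (hE : E.IsAnalyticOn Ω) (s : ℂ) : (E.scale s).IsAnalyticOn Ω := by
  obtain ⟨a1, a2, a3, a4, a5, a6⟩ := hE
  exact ⟨analyticOnNhd_const.mul a1, analyticOnNhd_const.mul a2, analyticOnNhd_const.mul a3, a4,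
    analyticOnNhd_const.mul a5, a6⟩

/-- Sufficiency: equations equivalent to the listed ones are integrable. -/
theorem integrable_of_equivalentOn (hΩ : IsOpen Ω) (hE : E.IsAnalyticOn Ω) {M : Equation}
    (hM : IsListed M) (H : E.EquivalentOn M Ω) : E.Integrable Ω := by
  obtain ⟨s, c, α, β, γ, hs, hα, H⟩ := H
  obtain ⟨N, hN, e⟩ := exists_isNormal_transform hM hs hα c β γ
  rw [e] at H
  intro r h hh hr hc
  have hNa := hN.isAnalyticOn Ω
  have hNs := hNa.scale s
  rw [degeneracyCubic_congr hΩ H.1 H.2.1 H.pairEquiv_fg H.pairEquiv_pq hr, degeneracyCubic_scale] at hc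
  have h1 := (hN.inheritsAt hh (right_ne_zero_of_mul hc)).scale hNa hh hr s
  have H' : (N.scale s).SameOn E Ω :=
    ⟨fun P hP => (H.1 P hP).symm, fun P hP => (H.2.1 P hP).symm,
      fun P hP Q hQ R hR => (H.2.2 P hP Q hQ R hR).symm⟩
  exact h1.congr hΩ hNs hE H'.1 H'.2.1 H'.pairEquiv_fg H'.pairEquiv_pq hh hr

/-- The listed equations are analytic, non-degenerate and integrable. -/
theorem IsListed.isAnalyticOn_nonDegenerate_integrable {M : Equation} (hM : IsListed M) :
    M.IsAnalyticOn Set.univ ∧ M.NonDegenerate Set.univ ∧ M.Integrable Set.univ := by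
  have e0 : M.transform 1 0 1 0 0 = M := by
    simp [transform]
  obtain ⟨N, hN, e⟩ := exists_isNormal_transform hM one_ne_zero one_ne_zero 0 0 0
  have hM' : M.IsAnalyticOn Set.univ := by
    rw [← e0, e]
    exact (hN.isAnalyticOn Set.univ).scale 1
  refine ⟨hM', ?_, integrable_of_equivalentOn isOpen_univ hM' hM
    ⟨1, 0, 1, 0, 0, one_ne_zero, one_ne_zero, by rw [e0]; exact ⟨fun _ _ => rfl, fun _ _ => rfl,
      fun _ _ _ _ _ _ => rfl⟩⟩⟩
  cases hM with
  | eqn1 =>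
    refine ⟨⟨(0, 0), trivial, one_ne_zero⟩, fun H => ?_⟩
    have h1 := (H (0, 0) trivial).2.2.1
    have e1 : ILW.eqn1.limPhi = fun _ => 0 := by
      funext P
      simp [limPhi, ILW.eqn1]
    have e2 : ILW.eqn1.limPsi = fun P => P.1 := by
      funext P
      simp [limPsi, ILW.eqn1]
    rw [e1, e2, dw_const, du_fst fun u => u] at h1
    simp at h1
  | eqn2 a =>
    refine ⟨⟨(0, 0), trivial, one_ne_zero⟩, fun H => ?_⟩
    have h1 := (H (0, 0) trivial).2.1
    have e2 : (ILW.eqn2 a).limPsi = fun P => P.2 + a * Complex.exp P.1 := by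
      funext P
      simp [limPsi, ILW.eqn2]
    rw [e2, show (ILW.eqn2 a).eta = fun _ => 1 from rfl, du_const] at h1
    simp [dw] at h1
  | eqn3 =>
    refine ⟨⟨(0, 0), trivial, one_ne_zero⟩, fun H => ?_⟩
    have h1 := (H (0, 0) trivial).2.1
    have e2 : ILW.eqn3.limPsi = fun P => P.2 := by
      funext P
      simp [limPsi, ILW.eqn3, dw]
    rw [e2, show ILW.eqn3.eta = fun _ => 1 from rfl, du_const] at h1
    simp [dw] at h1
  | eqn4 =>
    refine ⟨⟨(0, 0), trivial, one_ne_zero⟩, fun H => ?_⟩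
    have h1 := (H (0, 0) trivial).2.1
    have e2 : ILW.eqn4.limPsi = fun P => P.2 := by
      funext P
      simp [limPsi, ILW.eqn4, dw]
    rw [e2, show ILW.eqn4.eta = fun _ => 1 from rfl, du_const] at h1
    simp [dw] at h1

end Equation

end Models

/-! ### Homogeneous polynomials of low degree and comparison of coefficients -/

section Homogeneous

variable {A : Type} [CommRing A]

/-- A variable X k with k ≥ 4 has weight above 4 and cannot occur, so four exponents describe the
monomial. -/
theorem exists_monomial_eq {n : ℕ} (hn : n ≤ 4) {m : ℕ →₀ ℕ}
    (hm : Finsupp.weight (fun k : ℕ => k + 1) m = n) (r : A) : ∃ a b c d : ℕ,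
    a + 2 * b + 3 * c + 4 * d = n ∧ (MvPolynomial.monomial m r : DiffPoly A) =
      MvPolynomial.C r * (MvPolynomial.X 0 ^ a * MvPolynomial.X 1 ^ b * MvPolynomial.X 2 ^ c *
        MvPolynomial.X 3 ^ d) := by
  have hs : m.support ⊆ Finset.range 4 := by
    intro k hk
    rw [Finset.mem_range]
    by_contra hk4
    have h1 : m k * (k + 1) ≤ n := by
      rw [← hm, Finsupp.weight_apply, Finsupp.sum]
      exact Finset.single_le_sum (f := fun i => m i • (i + 1)) (fun _ _ => Nat.zero_le _) hk
    have h2 : 1 ≤ m k := Nat.one_le_iff_ne_zero.2 (Finsupp.mem_support_iff.1 hk)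
    nlinarith
  refine ⟨m 0, m 1, m 2, m 3, ?_, ?_⟩
  · rw [← hm, Finsupp.weight_apply, Finsupp.sum_of_support_subset m hs _ (by simp)]
    simp only [Finset.sum_range_succ, Finset.sum_range_zero, smul_eq_mul]
    ring
  · rw [MvPolynomial.monomial_eq, Finsupp.prod_of_support_subset m hs _ (by simp)]
    simp only [Finset.prod_range_succ, Finset.prod_range_zero, one_mul]

theorem induction_of_isWeightedHomogeneous {n : ℕ} (hn : n ≤ 4) {Q : DiffPoly A → Prop}
    (h0 : Q 0) (hadd : ∀ P P', Q P → Q P' → Q (P + P'))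
    (hX : ∀ (r : A) (a b c d : ℕ), a + 2 * b + 3 * c + 4 * d = n →
      Q (MvPolynomial.C r * (MvPolynomial.X 0 ^ a * MvPolynomial.X 1 ^ b * MvPolynomial.X 2 ^ c *
        MvPolynomial.X 3 ^ d)))
    {P : DiffPoly A} (hP : MvPolynomial.IsWeightedHomogeneous (fun k : ℕ => k + 1) P n) : Q P := by
  rw [P.as_sum]
  refine Finset.sum_induction _ Q hadd h0 fun m hm => ?_
  obtain ⟨a, b, c, d, hs, e⟩ := exists_monomial_eq hn (hP (MvPolynomial.mem_support_iff.1 hm))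
    (P.coeff m)
  rw [e]
  exact hX _ a b c d hs

theorem exists_eq_C_mul_X {P : DiffPoly A}
    (hP : MvPolynomial.IsWeightedHomogeneous (fun k : ℕ => k + 1) P 1) :
    ∃ a, P = MvPolynomial.C a * MvPolynomial.X 0 := by
  refine induction_of_isWeightedHomogeneous (Q := fun P => ∃ a, P = MvPolynomial.C a * MvPolynomial.X 0)
    (by norm_num) ⟨0, by simp⟩ ?_ ?_ hP
  · rintro _ _ ⟨a, rfl⟩ ⟨b, rfl⟩
    exact ⟨a + b, by rw [map_add]; ring⟩
  · intro r a b c d h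
    obtain ⟨rfl, rfl, rfl, rfl⟩ : a = 1 ∧ b = 0 ∧ c = 0 ∧ d = 0 := by omega
    exact ⟨r, by ring⟩

theorem exists_eq_form2 {P : DiffPoly A}
    (hP : MvPolynomial.IsWeightedHomogeneous (fun k : ℕ => k + 1) P 2) :
    ∃ a b, P = form2 a b := by
  refine induction_of_isWeightedHomogeneous (Q := fun P => ∃ a b, P = form2 a b)
    (by norm_num) ⟨0, 0, by simp [form2]⟩ ?_ ?_ hP
  · rintro _ _ ⟨a, b, rfl⟩ ⟨a', b', rfl⟩
    exact ⟨a + a', b + b', by simp only [form2, map_add]; ring⟩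
  · intro r a b c d h
    obtain ⟨rfl, rfl⟩ : c = 0 ∧ d = 0 := by omega
    obtain ⟨rfl, rfl⟩ | ⟨rfl, rfl⟩ : (a = 0 ∧ b = 1) ∨ (a = 2 ∧ b = 0) := by omega
    · exact ⟨r, 0, by simp only [form2, map_zero]; ring⟩
    · exact ⟨0, r, by simp only [form2, map_zero]; ring⟩

theorem exists_eq_form4 {P : DiffPoly A}
    (hP : MvPolynomial.IsWeightedHomogeneous (fun k : ℕ => k + 1) P 4) :
    ∃ a b c d e, P = form4 a b c d e := by
  refine induction_of_isWeightedHomogeneous (Q := fun P => ∃ a b c d e, P = form4 a b c d e)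
    le_rfl ⟨0, 0, 0, 0, 0, by simp [form4]⟩ ?_ ?_ hP
  · rintro _ _ ⟨a, b, c, d, e, rfl⟩ ⟨a', b', c', d', e', rfl⟩
    exact ⟨a + a', b + b', c + c', d + d', e + e', by simp only [form4, map_add]; ring⟩
  · intro r a b c d h
    have h5 : (a = 0 ∧ b = 0 ∧ c = 0 ∧ d = 1) ∨ (a = 1 ∧ b = 0 ∧ c = 1 ∧ d = 0) ∨
        (a = 0 ∧ b = 2 ∧ c = 0 ∧ d = 0) ∨ (a = 2 ∧ b = 1 ∧ c = 0 ∧ d = 0) ∨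
        (a = 4 ∧ b = 0 ∧ c = 0 ∧ d = 0) := by
      have hd : d ≤ 1 := by omega
      have hc : c ≤ 1 := by omega
      have hb : b ≤ 2 := by omega
      interval_cases d <;> interval_cases c <;> interval_cases b <;> omega
    obtain ⟨rfl, rfl, rfl, rfl⟩ | ⟨rfl, rfl, rfl, rfl⟩ | ⟨rfl, rfl, rfl, rfl⟩ |
      ⟨rfl, rfl, rfl, rfl⟩ | ⟨rfl, rfl, rfl, rfl⟩ := h5
    · exact ⟨r, 0, 0, 0, 0, by simp only [form4, map_zero]; ring⟩
    · exact ⟨0, r, 0, 0, 0, by simp only [form4, map_zero]; ring⟩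
    · exact ⟨0, 0, r, 0, 0, by simp only [form4, map_zero]; ring⟩
    · exact ⟨0, 0, 0, r, 0, by simp only [form4, map_zero]; ring⟩
    · exact ⟨0, 0, 0, 0, r, by simp only [form4, map_zero]; ring⟩

/-- Evaluation at points with entries 0 and 1 separates the monomials over any coefficient ring. -/
theorem eq_zero_of_order_three {a b : A}
    (h : (MvPolynomial.C a * (MvPolynomial.X 1 * MvPolynomial.X 0) +
      MvPolynomial.C b * MvPolynomial.X 0 ^ 3 : DiffPoly A) = 0) : a = 0 ∧ b = 0 := by
  have h1 := congrArg (MvPolynomial.eval fun k : ℕ => if k = 0 then (1 : A) else 0) h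
  have h2 := congrArg (MvPolynomial.eval fun _ : ℕ => (1 : A)) h
  simp at h1 h2
  exact ⟨by simpa [h1] using h2, h1⟩

theorem eq_zero_of_order_four {a b c d : A}
    (h : (MvPolynomial.C a * (MvPolynomial.X 1) ^ 2 +
      MvPolynomial.C b * (MvPolynomial.X 1 * (MvPolynomial.X 0) ^ 2) +
      MvPolynomial.C c * (MvPolynomial.X 2 * MvPolynomial.X 0) +
      MvPolynomial.C d * (MvPolynomial.X 0) ^ 4 : DiffPoly A) = 0) :
    b = 0 ∧ c = 0 ∧ d = 0 := by
  have h1 : d = 0 := by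
    simpa using congrArg (MvPolynomial.eval fun k : ℕ => if k = 0 then (1 : A) else 0) h
  have h2 : a = 0 := by
    simpa using congrArg (MvPolynomial.eval fun k : ℕ => if k = 1 then (1 : A) else 0) h
  have h3 : c + d = 0 := by
    simpa using congrArg (MvPolynomial.eval fun k : ℕ => if k = 1 then (0 : A) else 1) h
  have h4 : a + b + c + d = 0 := by
    simpa using congrArg (MvPolynomial.eval fun _ : ℕ => (1 : A)) h
  exact ⟨by linear_combination h4 - h3 - h2, by linear_combination h3 - h1, h1⟩

theorem sum_antidiagonal_zero {M : Type*} [AddCommMonoid M] (f : ℕ × ℕ → M) :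
    ∑ ij ∈ Finset.HasAntidiagonal.antidiagonal 0, f ij = f (0, 0) := by
  rw [Finset.Nat.sum_antidiagonal_eq_sum_range_succ_mk]
  simp

end Homogeneous

/-! ### Compatibility at order ε -/

section OrderOne

variable {A : Type} [CommRing A] [Algebra ℂ A] {δ : Derivation ℂ A A}

open PowerSeries (coeff)



variable {h : A} {ψ η f g p q : ℕ → A} {w Y Z : EpsSeries A}

theorem smul_diffPoly (c : ℂ) (P : DiffPoly A) :
    c • P = MvPolynomial.C (algebraMap ℂ A c) * P := by
  rw [Algebra.smul_def, algebraMap_diffPoly]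

theorem two_mul_algebraMap : (2 : A) * algebraMap ℂ A 2⁻¹ = 1 := by
  rw [← map_ofNat (algebraMap ℂ A) 2, ← map_mul]
  norm_num

theorem flowBy_X_zero_X_zero (a b : A) :
    flowBy δ (MvPolynomial.C a * MvPolynomial.X 0) (MvPolynomial.C b * MvPolynomial.X 0) =
      form2 (a * b) (a * δ b + b * δ a) := by
  simp only [flowBy, form2, prolong_mul, prolong_C, prolong_X,
    Function.iterate_succ_apply', Function.iterate_zero_apply, totalDeriv_mul,
    totalDeriv_C, totalDeriv_X, map_add, map_mul]
  ring

theorem IsDeformation.order_zero (H : IsDeformation δ 4 h ψ η f g p q w Y Z) :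
    coeff 0 Z = MvPolynomial.C (ψ 0 * δ h + η 0 * δ h ^ 2 + f 0 * δ (g 0) + p 0 * δ (q 0)) *
      MvPolynomial.X 0 := by
  rw [H.equation 0 (by norm_num)]
  simp only [map_add, PowerSeries.coeff_mul, sum_antidiagonal_zero,
    coeff_evalAt_zero, coeff_flowDeriv, coeff_forwardDiff, coeff_backwardDiff, coeff_shift_one,
    H.leading_w, H.leading_Y, flowBy_C, totalDeriv_C, zero_add, one_smul, neg_smul]
  simp only [map_mul, map_pow]
  ring

/-- The formulas are doubled to avoid fractions. The differences of f- and p-terms come from the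
corrections ±(ε/2)∂² of the forward and the backward difference. -/
theorem IsDeformation.order_one (H : IsDeformation δ 4 h ψ η f g p q w Y Z) :
    ∃ a z2 z11 : A, coeff 1 w = MvPolynomial.C a * MvPolynomial.X 0 ∧ coeff 1 Y = form2 a (δ a) ∧
      coeff 1 Z = form2 z2 z11 ∧
      2 * z2 = 2 * (ψ 0 + 2 * η 0 * δ h + f 0 * g 1 + p 0 * q 1) * a +
        (f 0 * δ (g 0) - p 0 * δ (q 0)) ∧
      2 * z11 = 2 * (ψ 0 + 2 * η 0 * δ h + f 0 * g 1 + p 0 * q 1) * δ a +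
        2 * a * (ψ 1 * δ h + η 0 * δ (δ h) + η 1 * δ h ^ 2 + f 0 * δ (g 1) + p 0 * δ (q 1) +
          f 1 * δ (g 0) + p 1 * δ (q 0)) + (f 0 * δ (δ (g 0)) - p 0 * δ (δ (q 0))) := by
  obtain ⟨a, ha⟩ := exists_eq_C_mul_X (H.homogeneous_w 1)
  have hY : coeff 1 Y = form2 a (δ a) := by
    rw [((nonlocality_iff δ w Y).1 H.nonlocality).2.1, ha, totalDeriv_C_mul_X_zero]
  have hZ := H.equation 1 (by norm_num)
  have t : algebraMap ℂ A (1 ^ 2 / 2) = algebraMap ℂ A 2⁻¹ := by norm_num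
  have t' : algebraMap ℂ A ((-1) ^ 2 / 2) = algebraMap ℂ A 2⁻¹ := by norm_num
  have t2 := two_mul_algebraMap (A := A)
  simp only [map_add, PowerSeries.coeff_mul, sum_antidiagonal_one, sum_antidiagonal_zero, coeff_evalAt_zero,
    coeff_evalAt_one, coeff_flowDeriv, coeff_forwardDiff, coeff_backwardDiff, coeff_shift_one,
    coeff_shift_two, zero_add, Nat.reduceAdd,
    H.leading_w, H.leading_Y, ha, hY, flowBy_C, flowBy_X_zero_X_zero, one_smul, neg_smul,
    smul_diffPoly, t, t', totalDeriv_mul, totalDeriv_C, totalDeriv_X] at hZ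
  refine ⟨a, (ψ 0 + 2 * η 0 * δ h + f 0 * g 1 + p 0 * q 1) * a +
        algebraMap ℂ A 2⁻¹ * (f 0 * δ (g 0) - p 0 * δ (q 0)), (ψ 0 + 2 * η 0 * δ h + f 0 * g 1 + p 0 * q 1) * δ a +
        a * (ψ 1 * δ h + η 0 * δ (δ h) + η 1 * δ h ^ 2 + f 0 * δ (g 1) + p 0 * δ (q 1) +
          f 1 * δ (g 0) + p 1 * δ (q 0)) +
        algebraMap ℂ A 2⁻¹ * (f 0 * δ (δ (g 0)) - p 0 * δ (δ (q 0))),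
    ha, hY, hZ.trans ?_, ?_, ?_⟩
  rotate_left
  · linear_combination (f 0 * δ (g 0) - p 0 * δ (q 0)) * t2
  · linear_combination (f 0 * δ (δ (g 0)) - p 0 * δ (δ (q 0))) * t2
  · simp only [form2, map_add, map_sub, map_mul, map_pow, map_ofNat]
    ring

/-- The compatibility condition at the first order. -/
theorem IsDeformation.compatibility_one (H : IsDeformation δ 4 h ψ η f g p q w Y Z) :
    ∃ a : A, coeff 1 w = MvPolynomial.C a * MvPolynomial.X 0 ∧
      ∀ σ c S S2 B, σ = ψ 0 + 2 * η 0 * δ h + f 0 * g 1 + p 0 * q 1 →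
        δ (ψ 0 * δ h + η 0 * δ h ^ 2 + f 0 * δ (g 0) + p 0 * δ (q 0)) = σ * δ (δ h) + c →
        S = f 0 * δ (g 0) - p 0 * δ (q 0) → S2 = f 0 * δ (δ (g 0)) - p 0 * δ (δ (q 0)) →
        B = ψ 1 * δ h + η 0 * δ (δ h) + η 1 * δ h ^ 2 + f 0 * δ (g 1) + p 0 * δ (q 1) +
          f 1 * δ (g 0) + p 1 * δ (q 0) →
        2 * a * c = S * δ (δ h) ∧ δ (δ h) * (δ S - S2 + 2 * a * (δ σ - B)) = 0 := by
  obtain ⟨a, z2, z11, ha, hY, hZ, h2, h11⟩ := H.order_one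
  refine ⟨a, ha, fun σ c S S2 B hσ hc hS hS2 hB => ?_⟩
  have hC := H.compatibility 1 (by norm_num)
  have hZ0 := H.order_zero
  set l := ψ 0 * δ h + η 0 * δ h ^ 2 + f 0 * δ (g 0) + p 0 * δ (q 0) with hl
  rw [coeff_flowDeriv, coeff_flowDeriv, sum_antidiagonal_one, sum_antidiagonal_one, hY, hZ, hZ0,
    H.leading_Y] at hC
  have h3 := commutator_one δ (δ h) l a (δ a) z2 z11
  rw [sub_sub, hC, sub_self] at h3
  obtain ⟨e1, e2⟩ := eq_zero_of_order_three h3.symm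
  rw [← hσ, ← hS] at h2
  rw [← hσ, ← hS2, ← hB] at h11
  have d2 : δ (δ l) = δ σ * δ (δ h) + σ * δ (δ (δ h)) + δ c := by
    rw [hc, map_add, Derivation.leibniz, smul_eq_mul, smul_eq_mul]
    ring
  have e3 : 2 * a * c = S * δ (δ h) := by
    rw [hc] at e1
    linear_combination e1 + δ (δ h) * h2
  -- The derivative of the first relation removes the derivative of a from the second one.
  have e4 := congrArg δ e3
  simp only [Derivation.leibniz, smul_eq_mul, derivation_ofNat, mul_zero, add_zero] at e4
  refine ⟨e3, ?_⟩
  rw [d2, hc] at e2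
  linear_combination 2 * e2 - e4 + h11 * δ (δ h) + h2 * δ (δ (δ h))

end OrderOne

/-! ### Test functions with vanishing third derivative -/

section Quadratic

variable {r : ℂ}

/-- As the point, the slope μ and the second derivative H are arbitrary, conditions along such h
become polynomial identities in H and μ at each point of the domain. -/
theorem exists_quadratic (r w₀ μ H : ℂ) : ∃ h : ℂ → ℂ, AnalyticAt ℂ h r ∧ h r = w₀ ∧ deriv h r = μ ∧
    germEval r (germDerivation r (germOf r h)) = μ ∧
    germEval r (germDerivation r (germDerivation r (germOf r h))) = H ∧
    germDerivation r (germDerivation r (germDerivation r (germOf r h))) = 0 := by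
  have h0 (z : ℂ) : HasDerivAt (fun z => w₀ + μ * (z - r) + H / 2 * (z - r) ^ 2)
      (μ + H * (z - r)) z := by
    have h1 : HasDerivAt (fun z : ℂ => z - r) 1 z := (hasDerivAt_id z).sub_const r
    have := ((h1.const_mul μ).const_add w₀).add ((h1.pow 2).const_mul (H / 2))
    refine this.congr_deriv ?_
    push_cast
    ring
  have h2 (z : ℂ) : HasDerivAt (fun z => μ + H * (z - r)) H z := by
    have h1 : HasDerivAt (fun z : ℂ => z - r) 1 z := (hasDerivAt_id z).sub_const r
    simpa using (h1.const_mul H).const_add μ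
  have e1 : deriv (fun z => w₀ + μ * (z - r) + H / 2 * (z - r) ^ 2) = fun z => μ + H * (z - r) :=
    funext fun z => (h0 z).deriv
  have e2 : deriv (fun z => μ + H * (z - r)) = fun _ => H := funext fun z => (h2 z).deriv
  have a0 : AnalyticAt ℂ (fun z => w₀ + μ * (z - r) + H / 2 * (z - r) ^ 2) r := by fun_prop
  have a1 : AnalyticAt ℂ (fun z => μ + H * (z - r)) r := by fun_prop
  refine ⟨_, a0, by simp, by rw [e1]; simp, ?_, ?_, ?_⟩
  · rw [germDerivation_germOf a0, e1, germEval_germOf a1]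
    simp
  · rw [germDerivation_germOf a0, e1, germDerivation_germOf a1, e2, germOf_const,
      germEval_algebraMap]
  · rw [germDerivation_germOf a0, e1, germDerivation_germOf a1, e2, germOf_const,
      Derivation.map_algebraMap]

theorem germEval_derivation_along {h : ℂ → ℂ} {F : ℂ × ℂ → ℂ} (hh : AnalyticAt ℂ h r)
    (hF : AnalyticAt ℂ F (r, h r)) :
    germEval r (germDerivation r (along r h F)) = du F (r, h r) +
      germEval r (germDerivation r (germOf r h)) * dw F (r, h r) := by
  rw [germDerivation_along hh hF, map_add, map_mul, germEval_along hh (analyticAt_du hF),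
    germEval_along hh (analyticAt_dw hF)]

theorem germEval_derivation_derivation_along {h : ℂ → ℂ} {F : ℂ × ℂ → ℂ} (hh : AnalyticAt ℂ h r)
    (hF : AnalyticAt ℂ F (r, h r)) :
    germEval r (germDerivation r (germDerivation r (along r h F))) =
      du (du F) (r, h r) + 2 * germEval r (germDerivation r (germOf r h)) * du (dw F) (r, h r) +
        germEval r (germDerivation r (germOf r h)) ^ 2 * dw (dw F) (r, h r) +
        germEval r (germDerivation r (germDerivation r (germOf r h))) * dw F (r, h r) := by
  rw [germDerivation_along hh hF, map_add, map_add, Derivation.leibniz, smul_eq_mul, smul_eq_mul,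
    map_add, map_mul, map_mul, germEval_derivation_along hh (analyticAt_du hF),
    germEval_derivation_along hh (analyticAt_dw hF), germEval_along hh (analyticAt_dw hF), dw_du hF]
  ring

end Quadratic

/-- If an entire function vanishes wherever another one, not identically zero, does not, then it
vanishes. -/
theorem eq_zero_of_ne_zero_imp {c q : ℂ → ℂ} (hc : Differentiable ℂ c) (hq : Differentiable ℂ q)
    (hne : ∃ x, c x ≠ 0) (H : ∀ x, c x ≠ 0 → q x = 0) (x : ℂ) : q x = 0 := by
  have h1 : ∀ z ∈ (Set.univ : Set ℂ), c z * q z = 0 := fun z _ => by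
    by_cases hz : c z = 0
    · rw [hz, zero_mul]
    · rw [H z hz, mul_zero]
  rcases AnalyticOnNhd.eq_zero_or_eq_zero_of_mul_eq_zero (fun z _ => hc.analyticAt z)
    (fun z _ => hq.analyticAt z) h1 isPreconnected_univ with h2 | h2
  · obtain ⟨y, hy⟩ := hne
    exact absurd (h2 y trivial) hy
  · exact h2 x trivial

/-- Interpolation at ±1, ±2: the point 0 is unavailable because the conditions are obtained only for
h''(r) ≠ 0. -/
theorem coeffs_eq_zero_of_cubic {a b c d : ℂ} (H : ∀ x : ℂ, x ≠ 0 → a + b * x + c * x ^ 2 + d * x ^ 3 = 0) :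
    a = 0 ∧ b = 0 ∧ c = 0 ∧ d = 0 := by
  have h1 := H 1 one_ne_zero
  have h2 := H (-1) (by norm_num)
  have h3 := H 2 (by norm_num)
  have h4 := H (-2) (by norm_num)
  refine ⟨?_, ?_, ?_, ?_⟩
  · linear_combination (2 / 3) * h1 + (2 / 3) * h2 - h3 / 6 - h4 / 6
  · linear_combination (2 / 3) * h1 - (2 / 3) * h2 - h3 / 12 + h4 / 12
  · linear_combination -h1 / 6 - h2 / 6 + h3 / 6 + h4 / 6
  · linear_combination -h1 / 6 + h2 / 6 + h3 / 12 - h4 / 12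

theorem coeffs_eq_zero_of_quartic {a b c d e : ℂ}
    (H : ∀ x : ℂ, a + b * x + c * x ^ 2 + d * x ^ 3 + e * x ^ 4 = 0) :
    a = 0 ∧ b = 0 ∧ c = 0 ∧ d = 0 ∧ e = 0 := by
  have h0 : a = 0 := by simpa using H 0
  obtain ⟨h1, h2, h3, h4⟩ := coeffs_eq_zero_of_cubic (a := b) (b := c) (c := d) (d := e) fun x hx => by
    refine mul_left_cancel₀ hx ?_
    linear_combination H x - h0
  exact ⟨h0, h1, h2, h3, h4⟩

/-! ### Symmetry of the difference terms from order ε -/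

section OrderOne

variable {E : Equation} {Ω : Set (ℂ × ℂ)}

namespace Equation

/-- The four coefficients of the degeneracy cubic in terms of the functions in the equation. -/
theorem degeneracyCubic_eq (hE : E.IsAnalyticOn Ω) {P : ℂ × ℂ} (hP : P ∈ Ω) (μ : ℂ) :
    E.degeneracyCubic P μ =
      (du E.f P * du E.g P + E.f P * du (du E.g) P + du E.p P * du E.q P + E.p P * du (du E.q) P) +
      ((dw E.f P * du E.g P + E.f P * du (dw E.g) P + dw E.p P * du E.q P + E.p P * du (dw E.q) P) +
        (du E.psi P + (du E.f P * dw E.g P + E.f P * du (dw E.g) P) +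
          (du E.p P * dw E.q P + E.p P * du (dw E.q) P))) * μ +
      (dw E.psi P + (dw E.f P * dw E.g P + E.f P * dw (dw E.g) P) +
          (dw E.p P * dw E.q P + E.p P * dw (dw E.q) P) + du E.eta P) * μ ^ 2 +
      dw E.eta P * μ ^ 3 := by
  obtain ⟨aψ, aη, af, ag, ap, aq⟩ := hE
  replace aψ := aψ P hP
  replace af := af P hP
  replace ag := ag P hP
  replace ap := ap P hP
  replace aq := aq P hP
  have agu := analyticAt_du ag
  have agw := analyticAt_dw ag
  have aqu := analyticAt_du aq
  have aqw := analyticAt_dw aq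
  have d1 : du E.limPhi P = _ := (du_add (af.mul agu) (ap.mul aqu)).trans
    (congrArg₂ (· + ·) (du_mul af agu) (du_mul ap aqu))
  have d2 : dw E.limPhi P = _ := (dw_add (af.mul agu) (ap.mul aqu)).trans
    (congrArg₂ (· + ·) (dw_mul af agu) (dw_mul ap aqu))
  have d3 : du E.limPsi P = _ := (du_add (aψ.add (af.mul agw)) (ap.mul aqw)).trans
    (congrArg₂ (· + ·) ((du_add aψ (af.mul agw)).trans (congrArg _ (du_mul af agw))) (du_mul ap aqw))
  have d4 : dw E.limPsi P = _ := (dw_add (aψ.add (af.mul agw)) (ap.mul aqw)).trans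
    (congrArg₂ (· + ·) ((dw_add aψ (af.mul agw)).trans (congrArg _ (dw_mul af agw))) (dw_mul ap aqw))
  rw [degeneracyCubic, d1, d2, d3, d4, dw_du ag, dw_du aq]
  ring

/-- The unknown coefficient a of ε in w is eliminated between the two compatibility conditions. What
matters is that e does not depend on H, so the identity is an explicit quadratic in H. -/
theorem order_one_identity (hE : E.IsAnalyticOn Ω) (hI : E.Integrable Ω) {P : ℂ × ℂ} (hP : P ∈ Ω)
    {μ : ℂ} (hc : E.degeneracyCubic P μ ≠ 0) : ∃ e, ∀ H, H ≠ 0 →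
    E.degeneracyCubic P μ * ((du E.f P + μ * dw E.f P) * (du E.g P + μ * dw E.g P) -
        (du E.p P + μ * dw E.p P) * (du E.q P + μ * dw E.q P)) +
      ((E.f P * du E.g P - E.p P * du E.q P) + μ * (E.f P * dw E.g P - E.p P * dw E.q P)) * H *
        (E.eta P * H + e) = 0 := by
  obtain ⟨e, he⟩ : ∃ e, e = du E.psi P + du E.f P * dw E.g P + E.f P * du (dw E.g) P + du E.p P * dw E.q P +
    E.p P * du (dw E.q) P + μ * (dw E.psi P + dw E.f P * dw E.g P + E.f P * dw (dw E.g) P +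
      dw E.p P * dw E.q P + E.p P * dw (dw E.q) P) + 2 * μ * (du E.eta P + μ * dw E.eta P) -
    (μ * dw E.psi P + μ ^ 2 * dw E.eta P + E.f P * (du (dw E.g) P + μ * dw (dw E.g) P) +
      E.p P * (du (dw E.q) P + μ * dw (dw E.q) P) + dw E.f P * (du E.g P + μ * dw E.g P) +
      dw E.p P * (du E.q P + μ * dw E.q P)) := ⟨_, rfl⟩
  refine ⟨e, fun H hH => ?_⟩
  obtain ⟨r, w₀⟩ := P
  obtain ⟨h, hh, rfl, hd, e1, e2, e3⟩ := exists_quadratic r w₀ μ H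
  obtain ⟨w, Y, Z, hD⟩ := hI r h hh hP (by rwa [hd])
  have hcub := degeneracyCubic_eq hE hP μ
  obtain ⟨aψ, aη, af, ag, ap, aq⟩ := hE
  replace aψ := aψ _ hP
  replace aη := aη _ hP
  replace af := af _ hP
  replace ag := ag _ hP
  replace ap := ap _ hP
  replace aq := aq _ hP
  obtain ⟨a, -, hD⟩ := hD.compatibility_one
  obtain ⟨k1, k2⟩ := hD _ _ _ _ _ rfl (add_sub_cancel _ _).symm rfl rfl rfl
  have j0 (F : ℂ × ℂ → ℂ) : jet r h F 0 = along r h F := rfl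
  have j1 (F : ℂ × ℂ → ℂ) : jet r h F 1 = along r h (dw F) := rfl
  replace k1 := congrArg (germEval r) k1
  replace k2 := congrArg (germEval r) k2
  simp only [j0, j1, map_add, map_sub, map_mul, map_pow, map_zero, map_ofNat, Derivation.leibniz,
    Derivation.leibniz_pow, smul_eq_mul, nsmul_eq_mul, Nat.cast_ofNat, derivation_ofNat, e1, e2, germEval_along hh aψ,
    germEval_along hh aη, germEval_along hh af,
    germEval_along hh ap, germEval_along hh (analyticAt_dw aψ), germEval_along hh (analyticAt_dw aη),
    germEval_along hh (analyticAt_dw af), germEval_along hh (analyticAt_dw ag),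
    germEval_along hh (analyticAt_dw ap), germEval_along hh (analyticAt_dw aq),
    germEval_derivation_along hh aψ, germEval_derivation_along hh aη, germEval_derivation_along hh af,
    germEval_derivation_along hh ag, germEval_derivation_along hh ap, germEval_derivation_along hh aq,
    germEval_derivation_along hh (analyticAt_dw ag), germEval_derivation_along hh (analyticAt_dw aq),
    germEval_derivation_derivation_along hh ag, germEval_derivation_derivation_along hh aq] at k1 k2
  -- The second condition carries the factor h''(r) = H, which is cancelled; this is where H ≠ 0 is
  -- needed.
  replace k2 := (mul_eq_zero.1 k2).resolve_left hH
  have k3 : 2 * germEval r a * E.degeneracyCubic (r, h r) μ =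
      (E.f (r, h r) * (du E.g (r, h r) + μ * dw E.g (r, h r)) -
        E.p (r, h r) * (du E.q (r, h r) + μ * dw E.q (r, h r))) * H := by
    rw [hcub]
    linear_combination k1
  have k4 : (du E.f (r, h r) + μ * dw E.f (r, h r)) * (du E.g (r, h r) + μ * dw E.g (r, h r)) -
        (du E.p (r, h r) + μ * dw E.p (r, h r)) * (du E.q (r, h r) + μ * dw E.q (r, h r)) +
      2 * germEval r a * (E.eta (r, h r) * H + e) = 0 := by
    rw [he]
    linear_combination k2
  linear_combination E.degeneracyCubic (r, h r) μ * k4 - (E.eta (r, h r) * H + e) * k3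

/-- The leading coefficients of the two difference terms agree. -/
theorem mul_eq_mul_of_integrable (hE : E.IsAnalyticOn Ω) (hI : E.Integrable Ω) {P : ℂ × ℂ}
    (hP : P ∈ Ω) (hη : E.eta P ≠ 0) (hne : ∃ μ, E.degeneracyCubic P μ ≠ 0) :
    (E.f P * du E.g P = E.p P * du E.q P ∧ E.f P * dw E.g P = E.p P * dw E.q P) ∧
      du E.f P * du E.g P = du E.p P * du E.q P ∧ dw E.f P * dw E.g P = dw E.p P * dw E.q P ∧
      du E.f P * dw E.g P + dw E.f P * du E.g P = du E.p P * dw E.q P + dw E.p P * du E.q P := by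
  have hS (μ : ℂ) (hc : E.degeneracyCubic P μ ≠ 0) :
      (E.f P * du E.g P - E.p P * du E.q P) + μ * (E.f P * dw E.g P - E.p P * dw E.q P) = 0 ∧
      (du E.f P + μ * dw E.f P) * (du E.g P + μ * dw E.g P) -
        (du E.p P + μ * dw E.p P) * (du E.q P + μ * dw E.q P) = 0 := by
    obtain ⟨e, he⟩ := order_one_identity hE hI hP hc
    have h1 := he 1 one_ne_zero
    have h2 := he (-1) (by norm_num)
    have h3 := he 2 two_ne_zero
    have h4 : (E.f P * du E.g P - E.p P * du E.q P) +
        μ * (E.f P * dw E.g P - E.p P * dw E.q P) = 0 := by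
      refine (mul_eq_zero.1 (?_ : E.eta P * _ = 0)).resolve_left hη
      -- The combination of the values at H = 2, 1, -1 that extracts the coefficient of H².
      linear_combination h3 / 3 - h1 / 2 + h2 / 6
    refine ⟨h4, (mul_eq_zero.1 (?_ : E.degeneracyCubic P μ * _ = 0)).resolve_left hc⟩
    linear_combination h1 - (E.eta P + e) * h4
  have hd : Differentiable ℂ (E.degeneracyCubic P) := by
    unfold degeneracyCubic
    fun_prop
  have h1 := eq_zero_of_ne_zero_imp (q := fun μ => (E.f P * du E.g P - E.p P * du E.q P) +
    μ * (E.f P * dw E.g P - E.p P * dw E.q P)) hd (by fun_prop) hne fun μ hμ => (hS μ hμ).1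
  have h2 := eq_zero_of_ne_zero_imp (q := fun μ => (du E.f P + μ * dw E.f P) *
    (du E.g P + μ * dw E.g P) - (du E.p P + μ * dw E.p P) * (du E.q P + μ * dw E.q P)) hd
    (by fun_prop) hne fun μ hμ => (hS μ hμ).2
  have h3 := coeffs_eq_zero_of_quartic
    (a := E.f P * du E.g P - E.p P * du E.q P) (b := E.f P * dw E.g P - E.p P * dw E.q P)
    (c := 0) (d := 0) (e := 0) fun μ => by linear_combination h1 μ
  have h4 := coeffs_eq_zero_of_quartic (a := du E.f P * du E.g P - du E.p P * du E.q P)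
    (b := du E.f P * dw E.g P + dw E.f P * du E.g P - (du E.p P * dw E.q P + dw E.p P * du E.q P))
    (c := dw E.f P * dw E.g P - dw E.p P * dw E.q P) (d := 0) (e := 0)
    fun μ => by linear_combination h2 μ
  exact ⟨⟨sub_eq_zero.1 h3.1, sub_eq_zero.1 h3.2.1⟩, sub_eq_zero.1 h4.1, sub_eq_zero.1 h4.2.2.1,
    sub_eq_zero.1 h4.2.1⟩

end Equation

end OrderOne

/-! ### Convex open sets and integration of first order relations -/

section Regular

variable {Ω U : Set (ℂ × ℂ)} {F G : ℂ × ℂ → ℂ} {P : ℂ × ℂ}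

/-- Nonempty convex open sets. -/
structure IsRegular (U : Set (ℂ × ℂ)) : Prop where
  isOpen : IsOpen U
  convex : Convex ℝ U
  nonempty : U.Nonempty

theorem exists_isRegular_ne_zero (hΩ : IsOpen Ω) (hF : AnalyticOnNhd ℂ F Ω) (hP : P ∈ Ω)
    (h : F P ≠ 0) : ∃ U ⊆ Ω, IsRegular U ∧ ∀ Q ∈ U, F Q ≠ 0 := by
  obtain ⟨ε, hε, hb⟩ := Metric.mem_nhds_iff.1
    (Filter.inter_mem (hΩ.mem_nhds hP) ((hF P hP).continuousAt.eventually_ne h))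
  exact ⟨Metric.ball P ε, fun Q hQ => (hb hQ).1, ⟨Metric.isOpen_ball, convex_ball P ε,
    ⟨P, Metric.mem_ball_self hε⟩⟩, fun Q hQ => (hb hQ).2⟩

theorem IsRegular.eq_zero_or (hΩ : IsRegular Ω) (hF : AnalyticOnNhd ℂ F Ω) :
    (∀ P ∈ Ω, F P = 0) ∨ ∃ U ⊆ Ω, IsRegular U ∧ ∀ Q ∈ U, F Q ≠ 0 := by
  by_cases h : ∀ P ∈ Ω, F P = 0
  · exact .inl h
  · push Not at h
    obtain ⟨P, hP, h⟩ := h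
    exact .inr (exists_isRegular_ne_zero hΩ.isOpen hF hP h)

theorem du_eq_of_eqOn (hΩ : IsOpen Ω) (h : ∀ P ∈ Ω, F P = G P) (hP : P ∈ Ω) : du F P = du G P :=
  du_congr (Filter.eventually_of_mem (hΩ.mem_nhds hP) h)

theorem dw_eq_of_eqOn (hΩ : IsOpen Ω) (h : ∀ P ∈ Ω, F P = G P) (hP : P ∈ Ω) : dw F P = dw G P :=
  dw_congr (Filter.eventually_of_mem (hΩ.mem_nhds hP) h)

theorem du_eq_zero_of_eqOn (hΩ : IsOpen Ω) {c : ℂ} (h : ∀ P ∈ Ω, F P = c) (hP : P ∈ Ω) :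
    du F P = 0 := (du_eq_of_eqOn (G := fun _ => c) hΩ h hP).trans (du_const c)

theorem dw_eq_zero_of_eqOn (hΩ : IsOpen Ω) {c : ℂ} (h : ∀ P ∈ Ω, F P = c) (hP : P ∈ Ω) :
    dw F P = 0 := (dw_eq_of_eqOn (G := fun _ => c) hΩ h hP).trans (dw_const c)

theorem IsRegular.exists_eq_const (hΩ : IsRegular Ω) (hF : AnalyticOnNhd ℂ F Ω)
    (hu : ∀ P ∈ Ω, du F P = 0) (hw : ∀ P ∈ Ω, dw F P = 0) : ∃ c, ∀ P ∈ Ω, F P = c := by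
  obtain ⟨P, hP⟩ := hΩ.nonempty
  refine ⟨F P, fun Q hQ => hΩ.isOpen.is_const_of_fderiv_eq_zero (𝕜 := ℂ)
    hΩ.convex.isPreconnected hF.differentiableOn (fun R hR => ?_) hQ hP⟩
  ext
  · simp [fderiv_eq (hF R hR), hu R hR]
  · simp [fderiv_eq (hF R hR), hw R hR]

/-- If `p` and `f` have the same logarithmic derivative then they are proportional. -/
theorem IsRegular.exists_eq_const_mul (hΩ : IsRegular Ω) (hF : AnalyticOnNhd ℂ F Ω)
    (hG : AnalyticOnNhd ℂ G Ω) (h0 : ∀ P ∈ Ω, F P ≠ 0)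
    (hu : ∀ P ∈ Ω, F P * du G P = du F P * G P) (hw : ∀ P ∈ Ω, F P * dw G P = dw F P * G P) :
    ∃ k, ∀ P ∈ Ω, G P = k * F P := by
  have hK : AnalyticOnNhd ℂ (fun P => G P / F P) Ω := hG.div hF h0
  have h1 : ∀ P ∈ Ω, G P = G P / F P * F P := fun P hP => (div_mul_cancel₀ _ (h0 P hP)).symm
  have h2 : ∀ P ∈ Ω, du (fun P => G P / F P) P = 0 := fun P hP => by
    have h2 := (du_eq_of_eqOn hΩ.isOpen h1 hP).trans (du_mul (hK P hP) (hF P hP))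
    refine (mul_eq_zero.1 (?_ : F P ^ 2 * _ = 0)).resolve_left (pow_ne_zero 2 (h0 P hP))
    linear_combination hu P hP - F P * h2 + du F P * h1 P hP
  have h3 : ∀ P ∈ Ω, dw (fun P => G P / F P) P = 0 := fun P hP => by
    have h2 := (dw_eq_of_eqOn hΩ.isOpen h1 hP).trans (dw_mul (hK P hP) (hF P hP))
    refine (mul_eq_zero.1 (?_ : F P ^ 2 * _ = 0)).resolve_left (pow_ne_zero 2 (h0 P hP))
    linear_combination hw P hP - F P * h2 + dw F P * h1 P hP
  obtain ⟨k, hk⟩ := hΩ.exists_eq_const hK h2 h3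
  exact ⟨k, fun P hP => by rw [← hk P hP]; exact h1 P hP⟩

end Regular

/-! ### Localization, analytic continuation and reduction to symmetric differences -/

namespace Equation

variable {E E' M : Equation} {Ω U : Set (ℂ × ℂ)}

theorem IsAnalyticOn.mono (hE : E.IsAnalyticOn Ω) (hU : U ⊆ Ω) : E.IsAnalyticOn U :=
  ⟨hE.1.mono hU, hE.2.1.mono hU, hE.2.2.1.mono hU, hE.2.2.2.1.mono hU, hE.2.2.2.2.1.mono hU,
    hE.2.2.2.2.2.mono hU⟩

theorem Integrable.mono (hI : E.Integrable Ω) (hU : U ⊆ Ω) : E.Integrable U :=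
  fun r h hh hr hc => hI r h hh (hU hr) hc

theorem SameOn.trans (H : E.SameOn E' Ω) (H' : E'.SameOn M Ω) : E.SameOn M Ω :=
  ⟨fun P hP => (H.1 P hP).trans (H'.1 P hP), fun P hP => (H.2.1 P hP).trans (H'.2.1 P hP),
    fun P hP Q hQ R hR => (H.2.2 P hP Q hQ R hR).trans (H'.2.2 P hP Q hQ R hR)⟩

theorem SameOn.mono (H : E.SameOn E' Ω) (hU : U ⊆ Ω) : E.SameOn E' U :=
  ⟨fun P hP => H.1 P (hU hP), fun P hP => H.2.1 P (hU hP),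
    fun P hP Q hQ R hR => H.2.2 P (hU hP) Q (hU hQ) R (hU hR)⟩

theorem SameOn.degeneracyCubic_eq (hΩ : IsOpen Ω) (H : E.SameOn E' Ω) {P : ℂ × ℂ} (hP : P ∈ Ω)
    (μ : ℂ) : E.degeneracyCubic P μ = E'.degeneracyCubic P μ :=
  degeneracyCubic_congr hΩ H.1 H.2.1 H.pairEquiv_fg H.pairEquiv_pq hP μ

theorem SameOn.integrable (hΩ : IsOpen Ω) (H : E.SameOn E' Ω) (hE : E.IsAnalyticOn Ω)
    (hE' : E'.IsAnalyticOn Ω) (hI : E.Integrable Ω) : E'.Integrable Ω := fun r h hh hr hc =>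
  (hI r h hh hr (by rwa [H.degeneracyCubic_eq hΩ hr])).congr hΩ hE hE' H.1 H.2.1 H.pairEquiv_fg
    H.pairEquiv_pq hh hr

theorem Integrable.scale (hI : E.Integrable Ω) (hE : E.IsAnalyticOn Ω) (s : ℂ) :
    (E.scale s).Integrable Ω := fun r h hh hr hc => by
  rw [degeneracyCubic_scale] at hc
  exact (hI r h hh hr (right_ne_zero_of_mul hc)).scale hE hh hr s

/-- Analytic continuation of the equality of the right-hand sides. -/
theorem SameOn.of_subset (hΩ : IsPreconnected Ω) (hE : E.IsAnalyticOn Ω) (hM : M.IsAnalyticOn Ω)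
    (hU : IsOpen U) (hne : U.Nonempty) (hUΩ : U ⊆ Ω) (H : E.SameOn M U) : E.SameOn M Ω := by
  obtain ⟨P₀, hP₀⟩ := hne
  have key {F G : ℂ × ℂ → ℂ} (hF : AnalyticOnNhd ℂ F Ω) (hG : AnalyticOnNhd ℂ G Ω)
      (h : ∀ P ∈ U, F P = G P) : ∀ P ∈ Ω, F P = G P :=
    hF.eqOn_of_preconnected_of_eventuallyEq hG hΩ (hUΩ hP₀)
      (Filter.eventually_of_mem (hU.mem_nhds hP₀) h)
  obtain ⟨a1, a2, a3, a4, a5, a6⟩ := hE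
  obtain ⟨b1, b2, b3, b4, b5, b6⟩ := hM
  refine ⟨key a1 b1 H.1, key a2 b2 H.2.1, ?_⟩
  -- The three lattice values are released from U to Ω one at a time, each by the identity theorem
  -- in that variable.
  have h1 : ∀ Q ∈ U, ∀ R ∈ U, ∀ P ∈ Ω, E.discretePart P Q R = M.discretePart P Q R :=
    fun Q hQ R hR => key
      ((a3.mul (analyticOnNhd_const.sub a4)).add (a5.mul (a6.sub analyticOnNhd_const)))
      ((b3.mul (analyticOnNhd_const.sub b4)).add (b5.mul (b6.sub analyticOnNhd_const)))
      fun P hP => H.2.2 P hP Q hQ R hR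
  have h2 : ∀ R ∈ U, ∀ P ∈ Ω, ∀ Q ∈ Ω, E.discretePart P Q R = M.discretePart P Q R :=
    fun R hR P hP => key
      ((analyticOnNhd_const.mul (a4.sub analyticOnNhd_const)).add analyticOnNhd_const)
      ((analyticOnNhd_const.mul (b4.sub analyticOnNhd_const)).add analyticOnNhd_const)
      fun Q hQ => h1 Q hQ R hR P hP
  exact fun P hP Q hQ => key
    (analyticOnNhd_const.add (analyticOnNhd_const.mul (analyticOnNhd_const.sub a6)))
    (analyticOnNhd_const.add (analyticOnNhd_const.mul (analyticOnNhd_const.sub b6)))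
    fun R hR => h2 R hR P hP Q hQ

theorem analyticOnNhd_limPhi (hE : E.IsAnalyticOn Ω) : AnalyticOnNhd ℂ E.limPhi Ω := fun P hP =>
  ((hE.2.2.1 P hP).mul (analyticAt_du (hE.2.2.2.1 P hP))).add
    ((hE.2.2.2.2.1 P hP).mul (analyticAt_du (hE.2.2.2.2.2 P hP)))

theorem analyticOnNhd_limPsi (hE : E.IsAnalyticOn Ω) : AnalyticOnNhd ℂ E.limPsi Ω := fun P hP =>
  ((hE.1 P hP).add ((hE.2.2.1 P hP).mul (analyticAt_dw (hE.2.2.2.1 P hP)))).add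
    ((hE.2.2.2.2.1 P hP).mul (analyticAt_dw (hE.2.2.2.2.2 P hP)))

theorem exists_degeneracyCubic_ne_zero {P : ℂ × ℂ} (H : ¬ (dw E.eta P = 0 ∧
    dw E.limPsi P + du E.eta P = 0 ∧ dw E.limPhi P + du E.limPsi P = 0 ∧ du E.limPhi P = 0)) :
    ∃ μ, E.degeneracyCubic P μ ≠ 0 := by
  by_contra! h
  obtain ⟨h0, h1, h2, h3, -⟩ := coeffs_eq_zero_of_quartic (a := du E.limPhi P)
    (b := dw E.limPhi P + du E.limPsi P) (c := dw E.limPsi P + du E.eta P) (d := dw E.eta P) (e := 0)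
    fun μ => by rw [zero_mul, add_zero]; exact h μ
  exact H ⟨h3, h2, h1, h0⟩

/-- One of the four coefficients of the cubic is nonzero somewhere in Ω. By the identity theorem it
cannot vanish on a whole ball where η ≠ 0, so both are nonzero on a smaller ball. -/
theorem NonDegenerate.exists_isRegular (hn : E.NonDegenerate Ω) (hΩ : IsOpen Ω)
    (hc : IsPreconnected Ω) (hE : E.IsAnalyticOn Ω) : ∃ U ⊆ Ω, IsRegular U ∧
      (∀ P ∈ U, E.eta P ≠ 0) ∧ ∀ P ∈ U, ∃ μ, E.degeneracyCubic P μ ≠ 0 := by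
  obtain ⟨⟨P, hP, hη⟩, ht⟩ := hn
  have key {C : ℂ × ℂ → ℂ} (hC : AnalyticOnNhd ℂ C Ω) {Q : ℂ × ℂ} (hQ : Q ∈ Ω) (hQ0 : C Q ≠ 0) :
      ∃ U ⊆ Ω, IsRegular U ∧ (∀ P ∈ U, E.eta P ≠ 0) ∧ ∀ P ∈ U, C P ≠ 0 := by
    obtain ⟨U, hU, hUr, hU0⟩ := exists_isRegular_ne_zero hΩ hE.2.1 hP hη
    rcases hUr.eq_zero_or (hC.mono hU) with h | ⟨V, hV, hVr, hV0⟩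
    · obtain ⟨R, hR⟩ := hUr.nonempty
      exact absurd (hC.eqOn_of_preconnected_of_eventuallyEq (g := fun _ => 0) analyticOnNhd_const hc
        (hU hR) (Filter.eventually_of_mem (hUr.isOpen.mem_nhds hR) h) hQ) hQ0
    · exact ⟨V, hV.trans hU, hVr, fun R hR => hU0 R (hV hR), hV0⟩
  have hΦ := analyticOnNhd_limPhi hE
  have hΨ := analyticOnNhd_limPsi hE
  have hη := hE.2.1
  rw [TotallyLinearlyDegenerate] at ht
  push Not at ht
  obtain ⟨Q, hQ, ht⟩ := ht
  have : ∃ C : ℂ × ℂ → ℂ, AnalyticOnNhd ℂ C Ω ∧ C Q ≠ 0 ∧ ∀ P, C P ≠ 0 → ¬ (dw E.eta P = 0 ∧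
      dw E.limPsi P + du E.eta P = 0 ∧ dw E.limPhi P + du E.limPsi P = 0 ∧ du E.limPhi P = 0) := by
    by_cases h3 : dw E.eta Q = 0
    · by_cases h2 : dw E.limPsi Q + du E.eta Q = 0
      · by_cases h1 : dw E.limPhi Q + du E.limPsi Q = 0
        · exact ⟨_, fun P hP => analyticAt_du (hΦ P hP), ht h3 h2 h1, fun P h H => h H.2.2.2⟩
        · exact ⟨_, fun P hP => (analyticAt_dw (hΦ P hP)).add (analyticAt_du (hΨ P hP)), h1,
            fun P h H => h H.2.2.1⟩
      · exact ⟨_, fun P hP => (analyticAt_dw (hΨ P hP)).add (analyticAt_du (hη P hP)), h2,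
            fun P h H => h H.2.1⟩
    · exact ⟨_, fun P hP => analyticAt_dw (hη P hP), h3, fun P h H => h H.1⟩
  obtain ⟨C, hC, hCQ, hC'⟩ := this
  obtain ⟨U, hU, hUr, hU1, hU2⟩ := key hC hQ hCQ
  exact ⟨U, hU, hUr, hU1, fun P hP => exists_degeneracyCubic_ne_zero (hC' P (hU2 P hP))⟩

/-- On some nonempty open subset of `Ω` the equation is equivalent to one of the listed ones. -/
def LocallyListed (E : Equation) (Ω : Set (ℂ × ℂ)) : Prop :=
  ∃ U ⊆ Ω, IsOpen U ∧ U.Nonempty ∧ ∃ M, IsListed M ∧ E.EquivalentOn M U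

theorem LocallyListed.mono (H : E.LocallyListed U) (hU : U ⊆ Ω) : E.LocallyListed Ω := by
  obtain ⟨V, hV, H⟩ := H
  exact ⟨V, hV.trans hU, H⟩

theorem LocallyListed.congr (H : E'.LocallyListed Ω) (h : E.SameOn E' Ω) : E.LocallyListed Ω := by
  obtain ⟨V, hV, ho, hne, M, hM, s, c, α, β, γ, hs, hα, H⟩ := H
  exact ⟨V, hV, ho, hne, M, hM, s, c, α, β, γ, hs, hα, (h.mono hV).trans H⟩

theorem LocallyListed.of_scale {k : ℂ} (hk : k ≠ 0) (H : (E.scale k).LocallyListed Ω) :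
    E.LocallyListed Ω := by
  obtain ⟨V, hV, ho, hne, M, hM, s, c, α, β, γ, hs, hα, h1, h2, h3⟩ := H
  refine ⟨V, hV, ho, hne, M, hM, s / k, c / k, α, β, γ, div_ne_zero hs hk, hα,
    fun P hP => mul_left_cancel₀ hk ?_, fun P hP => mul_left_cancel₀ hk ?_,
    fun P hP Q hQ R hR => mul_left_cancel₀ hk ?_⟩
  · refine (h1 P hP).trans ?_
    simp only [transform]
    field_simp
  · refine (h2 P hP).trans ?_
    simp only [transform]
    field_simp
  · refine Eq.trans ?_ ((h3 P hP Q hQ R hR).trans ?_)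
    · simp only [discretePart, scale]
      ring
    · simp only [discretePart, transform]
      field_simp

/-- The constants found locally serve on all of Ω, because the transformed listed equation has
entire coefficients. -/
theorem LocallyListed.exists_equivalentOn (hΩ : IsPreconnected Ω) (hE : E.IsAnalyticOn Ω)
    (H : E.LocallyListed Ω) : ∃ M, IsListed M ∧ E.EquivalentOn M Ω := by
  obtain ⟨V, hV, ho, hne, M, hM, s, c, α, β, γ, hs, hα, H⟩ := H
  refine ⟨M, hM, s, c, α, β, γ, hs, hα, H.of_subset hΩ hE ?_ ho hne hV⟩
  obtain ⟨N, hN, e⟩ := exists_isNormal_transform hM hs hα c β γ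
  rw [e]
  exact (hN.isAnalyticOn Ω).scale s

/-- The equation with the symmetric difference term `f (△_x^+ + △_x^-) g`. -/
def even (ψ η f g : ℂ × ℂ → ℂ) : Equation := ⟨ψ, η, f, g, f, g⟩

theorem discretePart_eq_zero {P Q R : ℂ × ℂ} (hP : P ∈ U) (hQ : Q ∈ U) (hR : R ∈ U)
    (h1 : (∀ P ∈ U, E.f P = 0) ∨ ∃ c, ∀ P ∈ U, E.g P = c)
    (h2 : (∀ P ∈ U, E.p P = 0) ∨ ∃ c, ∀ P ∈ U, E.q P = c) : E.discretePart P Q R = 0 := by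
  rw [discretePart]
  rcases h1 with h1 | ⟨c, h1⟩ <;> rcases h2 with h2 | ⟨c', h2⟩ <;> simp [h1, h2, hP, hQ, hR]

/-- Where p is nonzero, both partial derivatives of q vanish; hence after shrinking, p = 0 or q is
constant. -/
theorem exists_trivial (hU : IsRegular U) {p q : ℂ × ℂ → ℂ} (hp : AnalyticOnNhd ℂ p U)
    (hq : AnalyticOnNhd ℂ q U) (h : ∀ P ∈ U, p P * du q P = 0 ∧ p P * dw q P = 0) :
    ∃ V ⊆ U, IsRegular V ∧ ((∀ P ∈ V, p P = 0) ∨ ∃ c, ∀ P ∈ V, q P = c) := by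
  rcases hU.eq_zero_or hp with h0 | ⟨V, hV, hVr, h0⟩
  · exact ⟨U, subset_rfl, hU, .inl h0⟩
  · exact ⟨V, hV, hVr, .inr (hVr.exists_eq_const (hq.mono hV)
      (fun P hP => (mul_eq_zero.1 (h P (hV hP)).1).resolve_left (h0 P hP))
      (fun P hP => (mul_eq_zero.1 (h P (hV hP)).2).resolve_left (h0 P hP)))⟩

/-- The two difference terms of an integrable equation are proportional. -/
theorem exists_sameOn_even (hΩ : IsRegular Ω) (hE : E.IsAnalyticOn Ω) (hI : E.Integrable Ω)
    (hη : ∀ P ∈ Ω, E.eta P ≠ 0) (hne : ∀ P ∈ Ω, ∃ μ, E.degeneracyCubic P μ ≠ 0) :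
    ∃ U ⊆ Ω, IsRegular U ∧ (E.SameOn (even E.psi E.eta (fun _ => 0) fun _ => 0) U ∨
      ((∀ P ∈ U, E.f P ≠ 0) ∧ (∀ P ∈ U, du E.g P ≠ 0 ∨ dw E.g P ≠ 0) ∧
        E.SameOn (even E.psi E.eta E.f E.g) U)) := by
  have h1 := fun P hP => mul_eq_mul_of_integrable hE hI hP (hη P hP) (hne P hP)
  have hE0 := hE
  obtain ⟨-, -, af, ag, ap, aq⟩ := hE
  -- Order ε supplies only the sum f_u g_w + f_w g_u. The difference follows from f g_u = p q_u and
  -- f g_w = p q_w, differentiated by w and u, as the mixed derivatives g_uw and q_uw cancel.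
  have h2 : ∀ P ∈ Ω, dw E.f P * du E.g P = dw E.p P * du E.q P ∧
      du E.f P * dw E.g P = du E.p P * dw E.q P := by
    intro P hP
    have e1 := dw_eq_of_eqOn hΩ.isOpen (fun P hP => (h1 P hP).1.1) hP
    have e2 := du_eq_of_eqOn hΩ.isOpen (fun P hP => (h1 P hP).1.2) hP
    rw [dw_mul (af P hP) (analyticAt_du (ag P hP)), dw_mul (ap P hP) (analyticAt_du (aq P hP)),
      dw_du (ag P hP), dw_du (aq P hP)] at e1
    rw [du_mul (af P hP) (analyticAt_dw (ag P hP)), du_mul (ap P hP) (analyticAt_dw (aq P hP))] at e2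
    have e3 := (h1 P hP).2.2.2
    constructor
    · linear_combination (e3 + e1 - e2) / 2
    · linear_combination (e3 - e1 + e2) / 2
  have trivial_case (U : Set (ℂ × ℂ)) (hU : U ⊆ Ω) (hUr : IsRegular U)
      (h : (∀ P ∈ U, E.f P = 0) ∨ ∃ c, ∀ P ∈ U, E.g P = c) : ∃ V ⊆ Ω, IsRegular V ∧
        E.SameOn (even E.psi E.eta (fun _ => 0) fun _ => 0) V := by
    obtain ⟨V, hV, hVr, h'⟩ := exists_trivial hUr (ap.mono hU) (aq.mono hU) fun P hP => by
      rw [← (h1 P (hU hP)).1.1, ← (h1 P (hU hP)).1.2]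
      rcases h with h | ⟨c, h⟩
      · rw [h P hP, zero_mul, zero_mul]
        exact ⟨rfl, rfl⟩
      · rw [du_eq_zero_of_eqOn hUr.isOpen h hP, dw_eq_zero_of_eqOn hUr.isOpen h hP, mul_zero]
        exact ⟨rfl, rfl⟩
    refine ⟨V, hV.trans hU, hVr, fun P hP => rfl, fun P hP => rfl, fun P hP Q hQ R hR => ?_⟩
    rw [discretePart_eq_zero hP hQ hR (h.imp (fun h P hP => h P (hV hP))
      fun ⟨c, h⟩ => ⟨c, fun P hP => h P (hV hP)⟩) h']
    simp [discretePart, even]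
  -- Dividing the relations for first derivatives by f g_u = p q_u, or by f g_w = p q_w, shows that
  -- f and p have equal logarithmic derivatives. So p = kf, and then g - kq is constant.
  have main_case (U : Set (ℂ × ℂ)) (hU : U ⊆ Ω) (hUr : IsRegular U) (hf : ∀ P ∈ U, E.f P ≠ 0)
      (hg : (∀ P ∈ U, du E.g P ≠ 0) ∨ ∀ P ∈ U, dw E.g P ≠ 0) :
      E.SameOn (even E.psi E.eta E.f E.g) U := by
    have h3 : ∀ P ∈ U, E.p P ≠ 0 ∧ E.f P * du E.p P = du E.f P * E.p P ∧
        E.f P * dw E.p P = dw E.f P * E.p P := by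
      intro P hP
      obtain ⟨⟨a1, a2⟩, b1, b2, -⟩ := h1 P (hU hP)
      obtain ⟨b3, b4⟩ := h2 P (hU hP)
      rcases hg with hg | hg
      · have h4 : E.p P * du E.q P ≠ 0 := by
          rw [← a1]
          exact mul_ne_zero (hf P hP) (hg P hP)
        refine ⟨left_ne_zero_of_mul h4, mul_right_cancel₀ (right_ne_zero_of_mul h4) ?_,
          mul_right_cancel₀ (right_ne_zero_of_mul h4) ?_⟩
        · linear_combination du E.f P * a1 - E.f P * b1
        · linear_combination dw E.f P * a1 - E.f P * b3
      · have h4 : E.p P * dw E.q P ≠ 0 := by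
          rw [← a2]
          exact mul_ne_zero (hf P hP) (hg P hP)
        refine ⟨left_ne_zero_of_mul h4, mul_right_cancel₀ (right_ne_zero_of_mul h4) ?_,
          mul_right_cancel₀ (right_ne_zero_of_mul h4) ?_⟩
        · linear_combination du E.f P * a2 - E.f P * b4
        · linear_combination dw E.f P * a2 - E.f P * b2
    obtain ⟨k, hk⟩ := hUr.exists_eq_const_mul (af.mono hU) (ap.mono hU) hf
      (fun P hP => (h3 P hP).2.1) (fun P hP => (h3 P hP).2.2)
    have hkq : AnalyticOnNhd ℂ (fun P => k * E.q P) U := analyticOnNhd_const.mul (aq.mono hU)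
    obtain ⟨c, hc⟩ := hUr.exists_eq_const ((ag.mono hU).sub hkq) (fun P hP => by
        refine (du_sub (ag P (hU hP)) (hkq P hP)).trans (mul_left_cancel₀ (hf P hP) ?_)
        rw [du_const_mul]
        linear_combination (h1 P (hU hP)).1.1 + du E.q P * hk P hP) (fun P hP => by
        refine (dw_sub (ag P (hU hP)) (hkq P hP)).trans (mul_left_cancel₀ (hf P hP) ?_)
        rw [dw_const_mul]
        linear_combination (h1 P (hU hP)).1.2 + dw E.q P * hk P hP)
    refine ⟨fun P hP => rfl, fun P hP => rfl, fun P hP Q hQ R hR => ?_⟩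
    have e1 : E.g P - k * E.q P = c := hc P hP
    have e2 : E.g R - k * E.q R = c := hc R hR
    simp only [discretePart, even]
    rw [hk P hP]
    linear_combination E.f P * (e2 - e1)
  rcases hΩ.eq_zero_or af with h | ⟨U, hU, hUr, h⟩
  · obtain ⟨V, hV, hVr, hs⟩ := trivial_case Ω subset_rfl hΩ (.inl h)
    exact ⟨V, hV, hVr, .inl hs⟩
  rcases hUr.eq_zero_or (F := du E.g) (fun P hP => analyticAt_du (ag P (hU hP))) with
    hu | ⟨V, hV, hVr, hu⟩
  · rcases hUr.eq_zero_or (F := dw E.g) (fun P hP => analyticAt_dw (ag P (hU hP))) with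
      hw | ⟨V, hV, hVr, hw⟩
    · obtain ⟨V, hV, hVr, hs⟩ := trivial_case U hU hUr
        (.inr (hUr.exists_eq_const (ag.mono hU) hu hw))
      exact ⟨V, hV, hVr, .inl hs⟩
    · exact ⟨V, hV.trans hU, hVr, .inr ⟨fun P hP => h P (hV hP), fun P hP => .inr (hw P hP),
        main_case V (hV.trans hU) hVr (fun P hP => h P (hV hP)) (.inr hw)⟩⟩
  · exact ⟨V, hV.trans hU, hVr, .inr ⟨fun P hP => h P (hV hP), fun P hP => .inl (hu P hP),
      main_case V (hV.trans hU) hVr (fun P hP => h P (hV hP)) (.inl hu)⟩⟩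

end Equation

/-! ### Compatibility at order ε² -/

section OrderTwo

variable {A : Type} [CommRing A] [Algebra ℂ A] {δ : Derivation ℂ A A}

open PowerSeries (coeff)

variable {h : A} {ψ η f g : ℕ → A} {w Y Z : EpsSeries A}

theorem eq_zero_of_two_mul_eq_zero {a : A} (h : 2 * a = 0) : a = 0 := by
  linear_combination algebraMap ℂ A 2⁻¹ * h - a * two_mul_algebraMap (A := A)

/-- If the first correction of `w` vanishes for an equation with a symmetric difference term, so do
those of the flows. -/
theorem IsDeformation.coeff_one_eq_zero (H : IsDeformation δ 4 h ψ η f g f g w Y Z)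
    (hw : coeff 1 w = 0) : coeff 1 Y = 0 ∧ coeff 1 Z = 0 := by
  obtain ⟨a, z2, z11, ha, hY, hZ, h2, h11⟩ := H.order_one
  have ha0 : a = 0 := by
    have := congrArg (MvPolynomial.eval fun _ : ℕ => (1 : A)) (ha.symm.trans hw)
    simpa using this
  subst ha0
  rw [sub_self, mul_zero, zero_add] at h2
  rw [sub_self, map_zero, mul_zero, mul_zero, zero_mul, zero_add, zero_add] at h11
  rw [hY, hZ, eq_zero_of_two_mul_eq_zero h2, eq_zero_of_two_mul_eq_zero h11, map_zero]
  simp [form2]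

theorem totalDeriv_totalDeriv_totalDeriv_C (a : A) :
    totalDeriv δ (totalDeriv δ (totalDeriv δ (MvPolynomial.C a))) =
      form3 (δ a) (3 * δ (δ a)) (δ (δ (δ a))) := by
  rw [totalDeriv_C, totalDeriv_C_mul_X_zero, totalDeriv_form2]
  congr 1
  ring

theorem flowBy_X_zero_form2 (m a b : A) :
    flowBy δ (MvPolynomial.C m * MvPolynomial.X 0) (form2 a b) =
      form3 (m * a) (3 * a * δ m + m * (δ a + 2 * b)) (a * δ (δ m) + 2 * b * δ m + m * δ b) := by
  simp only [flowBy, form2, form3, pow_succ, pow_zero, one_mul, prolong_add, prolong_mul, prolong_C,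
    prolong_X, Function.iterate_succ_apply', Function.iterate_zero_apply, totalDeriv_add,
    totalDeriv_mul, totalDeriv_C, totalDeriv_X, map_add, map_mul, map_ofNat]
  ring

/-- All rational constants are multiples of t = 1/12, which is kept as one symbol to make the
identities integral. Terms with h''' are dropped at once. -/
theorem IsDeformation.order_two (H : IsDeformation δ 4 h ψ η f g f g w Y Z) (hw : coeff 1 w = 0)
    (hq : δ (δ (δ h)) = 0) {t : A} (ht : t = algebraMap ℂ A 12⁻¹) :
    ∃ a b z3 z21 z111,
      coeff 2 Y = form3 (a - t * δ h) (δ a + 2 * b - 3 * t * δ (δ h)) (δ b) ∧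
      coeff 2 Z = form3 z3 z21 z111 ∧
      z3 = (ψ 0 + 2 * f 0 * g 1 + 2 * η 0 * δ h) * a +
        t * (4 * f 0 * δ (g 0) - ψ 0 * δ h - η 0 * δ h ^ 2) ∧
      z21 = (ψ 0 + 2 * f 0 * g 1 + 2 * η 0 * δ h) * (δ a + 2 * b) +
        a * (ψ 1 * δ h + η 1 * δ h ^ 2 + 3 * η 0 * δ (δ h) + 2 * f 0 * δ (g 1) +
          2 * f 1 * δ (g 0)) - 3 * t * δ (δ h) * (ψ 0 + η 0 * δ h) + 12 * t * f 0 * δ (δ (g 0)) ∧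
      z111 = (ψ 0 + 2 * f 0 * g 1 + 2 * η 0 * δ h) * δ b +
        b * (ψ 1 * δ h + η 1 * δ h ^ 2 + 2 * η 0 * δ (δ h) + 2 * f 0 * δ (g 1) +
          2 * f 1 * δ (g 0)) + 4 * t * f 0 * δ (δ (δ (g 0))) := by
  obtain ⟨hY1, -⟩ := H.coeff_one_eq_zero hw
  obtain ⟨a, b, hab⟩ := exists_eq_form2 (H.homogeneous_w 2)
  have hC (c k : ℂ) (e : c = k * 12⁻¹) : algebraMap ℂ A c = algebraMap ℂ A k * t := by
    rw [ht, e, map_mul]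
  have hY : coeff 2 Y = form3 (a - t * δ h) (δ a + 2 * b - 3 * t * δ (δ h)) (δ b) := by
    rw [((nonlocality_iff δ w Y).1 H.nonlocality).2.2.1, hab, H.leading_w,
      totalDeriv_totalDeriv_totalDeriv_C, totalDeriv_form2, smul_diffPoly, ← ht, hq]
    simp only [form3, map_add, map_sub, map_mul, map_ofNat, map_zero]
    ring
  refine ⟨a, b, _, _, _, hY, ?_, rfl, rfl, rfl⟩
  have c1 : algebraMap ℂ A (1 ^ 2 / 2) = 6 * t := by
    rw [hC _ 6 (by norm_num), map_ofNat]
  have c2 : algebraMap ℂ A ((-1) ^ 2 / 2) = 6 * t := by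
    rw [hC _ 6 (by norm_num), map_ofNat]
  have c3 : algebraMap ℂ A (1 ^ 3 / 6) = 2 * t := by
    rw [hC _ 2 (by norm_num), map_ofNat]
  have c4 : algebraMap ℂ A ((-1) ^ 3 / 6) = -(2 * t) := by
    rw [hC _ (-2) (by norm_num), map_neg, map_ofNat, neg_mul]
  rw [H.equation 2 (by norm_num)]
  simp only [map_add, PowerSeries.coeff_mul, sum_antidiagonal_two, sum_antidiagonal_one,
    sum_antidiagonal_zero, coeff_evalAt_zero, coeff_evalAt_one, coeff_evalAt_two _ H.leading_w hw,
    coeff_flowDeriv, coeff_forwardDiff, coeff_backwardDiff, coeff_shift_one, coeff_shift_two,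
    coeff_shift_three, zero_add, Nat.reduceAdd, H.leading_w, H.leading_Y, hab, hY1, hY, hw,
    flowBy_zero, flowBy_C, flowBy_X_zero_form2, mul_zero, zero_mul, totalDeriv_zero,
    smul_zero, one_smul, neg_smul, totalDeriv_mul, totalDeriv_add, totalDeriv_X,
    totalDeriv_form2, smul_diffPoly, c1, c2, c3, c4, totalDeriv_C, hq]
  simp only [form2, form3, map_add, map_sub, map_mul, map_ofNat, map_pow, map_neg]
  ring

/-- The compatibility condition at the second order, along a quadratic function `h`. -/
theorem IsDeformation.compatibility_two (H : IsDeformation δ 4 h ψ η f g f g w Y Z)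
    (hw : coeff 1 w = 0) (hq : δ (δ (δ h)) = 0) : ∃ y β : A, ∀ σ c N B Z21 Z111,
      σ = ψ 0 + 2 * f 0 * g 1 + 2 * η 0 * δ h →
      δ (ψ 0 * δ h + η 0 * δ h ^ 2 + 2 * f 0 * δ (g 0)) = σ * δ (δ h) + c →
      N = η 0 * δ h ^ 2 + 2 * f 0 * g 1 * δ h + 4 * f 0 * δ (g 0) →
      B = ψ 1 * δ h + η 1 * δ h ^ 2 + 2 * η 0 * δ (δ h) + 2 * f 0 * δ (g 1) + 2 * f 1 * δ (g 0) →
      Z21 = (12 * y + δ h) * (B + η 0 * δ (δ h)) +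
        3 * δ (δ h) * (2 * f 0 * g 1 + η 0 * δ h) + 12 * f 0 * δ (δ (g 0)) →
      Z111 = (6 * β - 6 * δ y + δ (δ h)) * B + 4 * f 0 * δ (δ (δ (g 0))) →
      12 * y * c = N * δ (δ h) ∧
      12 * β * c - Z21 * δ (δ h) + 24 * y * (δ (δ h) * δ σ + δ c) = 0 ∧
      δ (δ h) * (δ Z21 - δ (δ N) - 2 * Z111 + 12 * δ σ * (β - 2 * δ y) - 12 * y * δ (δ σ)) = 0 := by
  obtain ⟨t, ht⟩ : ∃ t : A, t = algebraMap ℂ A 12⁻¹ := ⟨_, rfl⟩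
  have ht1 : 12 * t = 1 := by
    rw [ht, ← map_ofNat (algebraMap ℂ A) 12, ← map_mul]
    norm_num
  have htd : δ t = 0 := by rw [ht, Derivation.map_algebraMap]
  obtain ⟨hY1, hZ1⟩ := H.coeff_one_eq_zero hw
  obtain ⟨a, b, z3, z21, z111, hY, hZ, hz3, hz21, hz111⟩ := H.order_two hw hq ht
  -- The new unknowns y and β are the coefficients of R_xxx and R_xx R_x in Y at order ε²; they
  -- replace the coefficients a, b of w.
  refine ⟨a - t * δ h, δ a + 2 * b - 3 * t * δ (δ h), fun σ c N B Z21 Z111 hσ hc hN hB h21 h111 => ?_⟩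
  have hC := H.compatibility 2 (by norm_num)
  have hZ0 := H.order_zero
  have hl : ψ 0 * δ h + η 0 * δ h ^ 2 + f 0 * δ (g 0) + f 0 * δ (g 0) =
    ψ 0 * δ h + η 0 * δ h ^ 2 + 2 * f 0 * δ (g 0) := by ring
  rw [hl] at hZ0
  set l := ψ 0 * δ h + η 0 * δ h ^ 2 + 2 * f 0 * δ (g 0) with hl
  rw [coeff_flowDeriv, coeff_flowDeriv, sum_antidiagonal_two, sum_antidiagonal_two, hY1, hZ1, hZ0,
    hY, hZ, H.leading_Y, flowBy_zero, add_zero, add_zero] at hC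
  have hy : δ (a - t * δ h) = δ a - t * δ (δ h) := by
    rw [map_sub, Derivation.leibniz, htd, smul_zero, add_zero, smul_eq_mul]
  have hy2 : δ (δ (a - t * δ h)) = δ (δ a) := by
    rw [hy, map_sub, Derivation.leibniz, htd, smul_zero, add_zero, smul_eq_mul, hq, mul_zero, sub_zero]
  have hβ : δ (δ a + 2 * b - 3 * t * δ (δ h)) = δ (δ a) + 2 * δ b := by
    simp only [map_sub, map_add, Derivation.leibniz, derivation_ofNat, htd, hq, smul_eq_mul]
    ring
  have d2 : δ (δ l) = δ (δ h) * δ σ + δ c := by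
    rw [hc, map_add, Derivation.leibniz, hq, smul_zero, zero_add, smul_eq_mul]
  have d3 : δ (δ (δ l)) = δ (δ h) * δ (δ σ) + δ (δ c) := by
    rw [d2, map_add, Derivation.leibniz, hq, smul_zero, add_zero, smul_eq_mul]
  set y := a - t * δ h with hy0
  set β := δ a + 2 * b - 3 * t * δ (δ h) with hβ0
  have h3 := commutator_two δ (δ h) l y β (δ b) z3 z21 z111
  rw [sub_sub, hC, sub_self] at h3
  obtain ⟨e2, e1, e4⟩ := eq_zero_of_order_four h3.symm
  rw [hq, map_zero] at e4
  rw [hq] at e2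
  rw [d2, hc] at e2
  rw [d3, d2, hc] at e4
  rw [hc] at e1
  have k3 : 12 * z3 = 12 * σ * y + N := by
    rw [hz3, hσ, hN, hy0]
    linear_combination (η 0 * δ h ^ 2 + 2 * f 0 * g 1 * δ h + 4 * f 0 * δ (g 0)) * ht1
  have k21 : 12 * z21 = 12 * σ * β + Z21 := by
    rw [hz21, hσ, h21, hβ0, hy0, hB]
    linear_combination (δ h * (ψ 1 * δ h + η 1 * δ h ^ 2 + 3 * η 0 * δ (δ h) + 2 * f 0 * δ (g 1) +
      2 * f 1 * δ (g 0)) + 3 * δ (δ h) * (2 * f 0 * g 1 + η 0 * δ h) + 12 * f 0 * δ (δ (g 0))) * ht1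
  have k111 : 12 * z111 = 12 * σ * δ b + Z111 := by
    rw [hz111, hσ, h111, hy, hβ0, hB]
    linear_combination (δ (δ h) * (ψ 1 * δ h + η 1 * δ h ^ 2 + 2 * η 0 * δ (δ h) +
      2 * f 0 * δ (g 1) + 2 * f 1 * δ (g 0)) + 4 * f 0 * δ (δ (δ (g 0)))) * ht1
  have kb : 2 * δ b = δ β - δ (δ y) := by
    rw [hβ, hy2]
    ring
  have f1 : 12 * y * c = N * δ (δ h) := by
    linear_combination 4 * e1 + δ (δ h) * k3
  have f2 : 12 * β * c - Z21 * δ (δ h) + 24 * y * (δ (δ h) * δ σ + δ c) = 0 := by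
    linear_combination 4 * e2 + δ (δ h) * k21
  -- The two derivatives of the first relation and the one of the second remove δδy and δβ, which
  -- enter the last condition through the derivative of b.
  have f3 := congrArg δ (congrArg δ f1)
  have f4 := congrArg δ f2
  clear_value y β l
  clear hz3 hz21 hz111 hσ hN hB h21 h111 hZ hY
  simp only [map_add, map_sub, map_zero, Derivation.leibniz, smul_eq_mul, derivation_ofNat, hq,
    mul_zero, add_zero, zero_add] at f3 f4
  refine ⟨f1, f2, ?_⟩
  linear_combination 12 * e4 - f4 + f3 + 2 * δ (δ h) * k111 - 12 * c * kb

end OrderTwo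

/-! ### Elimination of the unknown coefficients of order ε² -/

section Elimination

/-- Elimination of the coefficients `y`, `β` of the second order correction, of the derivative `y₁`
of `y`, and of the second derivative `H` of `h`. -/
theorem elimination {μ c c₀ cμ N N₀ Nμ Nww κ dκ κμ s d2Ψ Ψw η dη ηw d2η χ dχ e k dNμ Nw d2N : ℂ}
    (hk : κμ = Ψw + 2 * μ * ηw) (hww : Nww = 2 * η)
    (h : ∀ H : ℂ, H ≠ 0 → ∃ y y₁ β : ℂ, 12 * y * c = N * H ∧
      12 * (y₁ * c + y * (c₀ + cμ * H)) = H * (N₀ + Nμ * H) ∧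
      12 * β * c - ((12 * y + μ) * (κ + 3 * η * H) + 3 * H * (3 * χ + η * μ) + 12 * e) * H +
        24 * y * (H * (s + 2 * η * H) + (c₀ + cμ * H)) = 0 ∧
      (12 * y₁ + H) * (κ + 3 * η * H) + (12 * y + μ) * (dκ + H * κμ + 3 * dη * H) +
        3 * H * (dχ + dη * μ + η * H) + (k + 6 * H * dχ) -
        2 * ((6 * β - 6 * y₁ + H) * (κ + 2 * η * H)) -
        (d2N + 2 * H * dNμ + Nww * H ^ 2 + H * Nw) + 12 * (s + 2 * η * H) * (β - 2 * y₁) -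
        12 * y * (d2Ψ + H * Ψw + 2 * μ * (d2η + H * ηw) + 4 * dη * H) = 0) :
    c ^ 2 * (μ * dκ + k - d2N) = 0 ∧
    (s - κ) * (c * μ * κ + 12 * c * e - 2 * N * c₀) - 2 * (s - κ) * (c * N₀ - N * c₀) +
      c * N * (dκ - d2Ψ - 2 * μ * d2η) +
      c ^ 2 * (μ * (κμ + 3 * dη) + 9 * dχ + 3 * μ * dη - κ - 2 * dNμ - Nw) = 0 ∧
    (s - κ) * (κ * N + 3 * η * c * μ + 3 * c * (3 * χ + η * μ) - 2 * N * s - 2 * N * cμ) +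
      η * (c * N₀ - N * c₀) - 2 * (s - κ) * (c * Nμ - N * cμ) - c * N * dη = 0 ∧
    η * (c * Nμ - N * cμ - (s - κ) * N) = 0 := by
  -- After multiplication by c², the first relation gives y, its derivative y₁, and the third β,
  -- without division. What remains is a cubic polynomial in H whose coefficients are the four
  -- claims.
  refine coeffs_eq_zero_of_cubic fun H hH => ?_
  obtain ⟨y, y₁, β, e1, e2, e3, e4⟩ := h H hH
  rw [hk] at e4 ⊢
  rw [hww] at e4
  linear_combination c ^ 2 * e4 - c * (s - κ) * e3 -
    (s - κ) * ((κ + 3 * η * H) * H - 2 * (H * (s + 2 * η * H) + c₀ + cμ * H)) * e1 -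
    c * (η * H - 2 * (s - κ)) * e2 + (η * H - 2 * (s - κ)) * (c₀ + cμ * H) * e1 -
    c * (dκ + H * (Ψw + 2 * μ * ηw) + 3 * dη * H -
      (d2Ψ + H * Ψw + 2 * μ * (d2η + H * ηw) + 4 * dη * H)) * e1

end Elimination

/-! ### Derivatives in the direction (1, μ) -/

section Directional

/-- The derivative of `F` at `P` in the direction `(1, μ)`. -/
def dir (F : ℂ × ℂ → ℂ) (P : ℂ × ℂ) (μ : ℂ) : ℂ := du F P + μ * dw F P

/-- The second derivative of `F` at `P` in the direction `(1, μ)`. -/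
def dir2 (F : ℂ × ℂ → ℂ) (P : ℂ × ℂ) (μ : ℂ) : ℂ :=
  du (du F) P + 2 * μ * du (dw F) P + μ ^ 2 * dw (dw F) P

/-- The third derivative of `F` at `P` in the direction `(1, μ)`. -/
def dir3 (F : ℂ × ℂ → ℂ) (P : ℂ × ℂ) (μ : ℂ) : ℂ :=
  dir2 (du F) P μ + μ * dir2 (dw F) P μ

variable {r : ℂ} {h : ℂ → ℂ} {F G : ℂ × ℂ → ℂ} {μ H : ℂ}

theorem germEval_delta (hh : AnalyticAt ℂ h r) (hF : AnalyticAt ℂ F (r, h r))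
    (h1 : germEval r (germDerivation r (germOf r h)) = μ) :
    germEval r (germDerivation r (along r h F)) = dir F (r, h r) μ := by
  rw [germEval_derivation_along hh hF, h1, dir]

theorem germEval_delta_two (hh : AnalyticAt ℂ h r) (hF : AnalyticAt ℂ F (r, h r))
    (h1 : germEval r (germDerivation r (germOf r h)) = μ)
    (h2 : germEval r (germDerivation r (germDerivation r (germOf r h))) = H) :
    germEval r (germDerivation r (germDerivation r (along r h F))) =
      dir2 F (r, h r) μ + H * dw F (r, h r) := by
  rw [germEval_derivation_derivation_along hh hF, h1, h2, dir2]

theorem germEval_delta_three (hh : AnalyticAt ℂ h r) (hF : AnalyticAt ℂ F (r, h r))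
    (h1 : germEval r (germDerivation r (germOf r h)) = μ)
    (h2 : germEval r (germDerivation r (germDerivation r (germOf r h))) = H)
    (h3 : germDerivation r (germDerivation r (germDerivation r (germOf r h))) = 0) :
    germEval r (germDerivation r (germDerivation r (germDerivation r (along r h F)))) =
      dir3 F (r, h r) μ + 3 * H * dir (dw F) (r, h r) μ := by
  have hu := analyticAt_du hF
  have hw := analyticAt_dw hF
  rw [germDerivation_along hh hF, map_add, map_add, map_add, germEval_delta_two hh hu h1 h2]
  simp only [Derivation.leibniz, smul_eq_mul, map_add, map_mul, h3, map_zero, h1, h2,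
    germEval_delta_two hh hw h1 h2, germEval_delta hh hw h1]
  rw [dw_du hF, dir3, dir]
  ring

theorem eventually_analyticAt_prod (hF : AnalyticAt ℂ F (r, h r)) (hG : AnalyticAt ℂ G (r, h r)) :
    ∀ᶠ Q in 𝓝 (r, h r), AnalyticAt ℂ F Q ∧ AnalyticAt ℂ G Q :=
  hF.eventually_analyticAt.and hG.eventually_analyticAt

theorem along_dw_mul (hh : AnalyticAt ℂ h r) (hF : AnalyticAt ℂ F (r, h r))
    (hG : AnalyticAt ℂ G (r, h r)) : along r h (dw fun P => F P * G P) =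
      along r h (dw F) * along r h G + along r h F * along r h (dw G) := by
  rw [← along_mul hh (analyticAt_dw hF) hG, ← along_mul hh hF (analyticAt_dw hG),
    ← along_add hh ((analyticAt_dw hF).fun_mul hG) (hF.fun_mul (analyticAt_dw hG))]
  refine along_congr hh (analyticAt_dw (hF.mul hG)) ?_
  filter_upwards [eventually_analyticAt_prod hF hG] with Q hQ
  exact dw_mul hQ.1 hQ.2

theorem along_dw_add (hh : AnalyticAt ℂ h r) (hF : AnalyticAt ℂ F (r, h r))
    (hG : AnalyticAt ℂ G (r, h r)) : along r h (dw fun P => F P + G P) =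
      along r h (dw F) + along r h (dw G) := by
  rw [← along_add hh (analyticAt_dw hF) (analyticAt_dw hG)]
  refine along_congr hh (analyticAt_dw (hF.add hG)) ?_
  filter_upwards [eventually_analyticAt_prod hF hG] with Q hQ
  exact dw_add hQ.1 hQ.2

theorem along_dw_du (hh : AnalyticAt ℂ h r) (hF : AnalyticAt ℂ F (r, h r)) :
    along r h (dw (du F)) = along r h (du (dw F)) := by
  refine along_congr hh (analyticAt_dw (analyticAt_du hF)) ?_
  filter_upwards [hF.eventually_analyticAt] with Q hQ
  exact dw_du hQ

end Directional

/-! ### The conditions of order ε² at a point -/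

namespace Equation

variable {Ω : Set (ℂ × ℂ)} {ψ η f g : ℂ × ℂ → ℂ}

/-- The compatibility conditions are evaluated at R = r along a quadratic h, with y₁ the value of
the derivative of y. The functions f, g, ψ are mostly replaced by φ, χ = 2f g_w and Ψ, which makes
visible that σ = Ψ + 2ημ and that c is the degeneracy cubic. -/
theorem order_two_numeric (hE : (even ψ η f g).IsAnalyticOn Ω) (hI : (even ψ η f g).Integrable Ω)
    {φ χ Ψ : ℂ × ℂ → ℂ} (hφ : φ = (even ψ η f g).limPhi) (hΨ : Ψ = (even ψ η f g).limPsi)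
    (hχ : χ = fun P => f P * dw g P + f P * dw g P)
    {P : ℂ × ℂ} (hP : P ∈ Ω) {μ : ℂ} (hc : (even ψ η f g).degeneracyCubic P μ ≠ 0) {H : ℂ} (hH : H ≠ 0) :
    ∃ y y₁ β : ℂ,
      12 * y * (even ψ η f g).degeneracyCubic P μ =
        (η P * μ ^ 2 + 3 * χ P * μ + 2 * φ P) * H ∧
      12 * (y₁ * (even ψ η f g).degeneracyCubic P μ + y * ((dir (du φ) P μ +
          μ * (dir (dw φ) P μ + dir (du Ψ) P μ) + μ ^ 2 * (dir (dw Ψ) P μ + dir (du η) P μ) +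
          μ ^ 3 * dir (dw η) P μ) + (dw φ P + du Ψ P + 2 * μ * (dw Ψ P + du η P) +
          3 * μ ^ 2 * dw η P) * H)) =
        H * ((dir η P μ * μ ^ 2 + 3 * dir χ P μ * μ + 2 * dir φ P μ) + (2 * η P * μ + 3 * χ P) * H) ∧
      12 * β * (even ψ η f g).degeneracyCubic P μ -
        ((12 * y + μ) * ((μ * dw Ψ P + μ ^ 2 * dw η P + dw φ P) + 3 * η P * H) +
          3 * H * (3 * χ P + η P * μ) + 12 * (f P * dir2 g P μ)) * H +
        24 * y * (H * ((dir Ψ P μ + 2 * μ * dir η P μ) + 2 * η P * H) + ((dir (du φ) P μ +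
          μ * (dir (dw φ) P μ + dir (du Ψ) P μ) + μ ^ 2 * (dir (dw Ψ) P μ + dir (du η) P μ) +
          μ ^ 3 * dir (dw η) P μ) + (dw φ P + du Ψ P + 2 * μ * (dw Ψ P + du η P) +
          3 * μ ^ 2 * dw η P) * H)) = 0 ∧
      (12 * y₁ + H) * ((μ * dw Ψ P + μ ^ 2 * dw η P + dw φ P) + 3 * η P * H) +
        (12 * y + μ) * ((μ * dir (dw Ψ) P μ + μ ^ 2 * dir (dw η) P μ + dir (dw φ) P μ) +
          H * (dw Ψ P + 2 * μ * dw η P) + 3 * dir η P μ * H) +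
        3 * H * (dir χ P μ + dir η P μ * μ + η P * H) +
        ((12 * dir f P μ * dir2 g P μ + 4 * f P * dir3 g P μ) + 6 * H * dir χ P μ) -
        2 * ((6 * β - 6 * y₁ + H) * ((μ * dw Ψ P + μ ^ 2 * dw η P + dw φ P) + 2 * η P * H)) -
        ((μ ^ 2 * dir2 η P μ + 3 * μ * dir2 χ P μ + 2 * dir2 φ P μ) +
          2 * H * (2 * μ * dir η P μ + 3 * dir χ P μ) + 2 * η P * H ^ 2 +
          H * (μ ^ 2 * dw η P + 3 * μ * dw χ P + 2 * dw φ P)) +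
        12 * ((dir Ψ P μ + 2 * μ * dir η P μ) + 2 * η P * H) * (β - 2 * y₁) -
        12 * y * (dir2 Ψ P μ + H * dw Ψ P + 2 * μ * (dir2 η P μ + H * dw η P) +
          4 * dir η P μ * H) = 0 := by
  obtain ⟨r, w₀⟩ := P
  obtain ⟨h, hh, rfl, hd, e1, e2, e3⟩ := exists_quadratic r w₀ μ H
  obtain ⟨w, Y, Z, hD⟩ := hI r h hh hP (by rwa [hd])
  obtain ⟨aψ, aη, af, ag, -, -⟩ := hE
  replace aψ : AnalyticAt ℂ ψ (r, h r) := aψ _ hP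
  replace aη : AnalyticAt ℂ η (r, h r) := aη _ hP
  replace af : AnalyticAt ℂ f (r, h r) := af _ hP
  replace ag : AnalyticAt ℂ g (r, h r) := ag _ hP
  have agu := analyticAt_du ag
  have agw := analyticAt_dw ag
  have afu : AnalyticAt ℂ (fun P => f P * du g P) (r, h r) := af.mul agu
  have afw : AnalyticAt ℂ (fun P => f P * dw g P) (r, h r) := af.mul agw
  have hφ' : φ = fun P => (fun P => f P * du g P) P + (fun P => f P * du g P) P := hφ
  have hχ' : χ = fun P => (fun P => f P * dw g P) P + (fun P => f P * dw g P) P := hχ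
  have hΨ' : Ψ = fun P => ψ P + χ P := by
    rw [hΨ, hχ]
    funext P
    exact add_assoc _ _ _
  have aφ : AnalyticAt ℂ φ (r, h r) := by
    rw [hφ']
    exact afu.add afu
  have aχ : AnalyticAt ℂ χ (r, h r) := by
    rw [hχ']
    exact afw.add afw
  have aΨ : AnalyticAt ℂ Ψ (r, h r) := by
    rw [hΨ']
    exact aψ.add aχ
  set m := germDerivation r (germOf r h) with hm
  have b1 : 2 * along r h f * along r h (dw g) = along r h χ := by
    rw [hχ', along_add hh afw afw, along_mul hh af agw]
    ring
  have b2 : along r h Ψ = along r h ψ + along r h χ := by rw [hΨ', along_add hh aψ aχ]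
  have b3 : 2 * along r h f * germDerivation r (along r h g) = along r h φ + m * along r h χ := by
    rw [hφ', hχ', along_add hh afw afw, along_mul hh af agw, along_add hh afu afu,
      along_mul hh af agu, germDerivation_along hh ag]
    ring
  have b4 : along r h (dw Ψ) = along r h (dw ψ) + along r h (dw χ) := by
    rw [hΨ', along_dw_add hh aψ aχ]
  have b5 : 2 * along r h f * germDerivation r (along r h (dw g)) +
      2 * along r h (dw f) * germDerivation r (along r h g) =
        along r h (dw φ) + m * along r h (dw χ) := by
    rw [hφ', hχ', along_dw_add hh afw afw, along_dw_add hh afu afu, along_dw_mul hh af agu,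
      along_dw_mul hh af agw, germDerivation_along hh ag, germDerivation_along hh agw,
      along_dw_du hh ag]
    ring
  have n1 : χ (r, h r) = 2 * (f (r, h r) * dw g (r, h r)) := by
    rw [hχ]
    ring
  have n2 : dir χ (r, h r) μ = 2 * (dir f (r, h r) μ * dw g (r, h r) +
      f (r, h r) * dir (dw g) (r, h r) μ) := by
    rw [hχ', dir, du_add afw afw, dw_add afw afw, du_mul af agw, dw_mul af agw, dir, dir]
    ring
  have hcub : (even ψ η f g).degeneracyCubic (r, h r) μ = du φ (r, h r) +
      (dw φ (r, h r) + du Ψ (r, h r)) * μ + (dw Ψ (r, h r) + du η (r, h r)) * μ ^ 2 +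
      dw η (r, h r) * μ ^ 3 := by
    rw [degeneracyCubic, ← hφ, ← hΨ]
    rfl
  obtain ⟨c, hcdef⟩ : ∃ c, c = along r h (du φ) + (along r h (dw φ) + along r h (du Ψ)) * m +
    (along r h (dw Ψ) + along r h (du η)) * m ^ 2 + along r h (dw η) * m ^ 3 := ⟨_, rfl⟩
  have dφ := germDerivation_along hh aφ
  have dΨ := germDerivation_along hh aΨ
  have dη := germDerivation_along hh aη
  rw [← hm] at dφ dΨ dη
  have hl : germDerivation r (along r h ψ * m + along r h η * m ^ 2 +
      2 * along r h f * germDerivation r (along r h g)) =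
        (along r h Ψ + 2 * along r h η * m) * germDerivation r m + c := by
    rw [show along r h ψ * m + along r h η * m ^ 2 +
      2 * along r h f * germDerivation r (along r h g) =
        along r h Ψ * m + along r h η * (m * m) + along r h φ by rw [b2, b3]; ring]
    simp only [map_add, Derivation.leibniz, smul_eq_mul, dφ, dΨ, dη, hcdef]
    ring
  have ev0 {F : ℂ × ℂ → ℂ} (aF : AnalyticAt ℂ F (r, h r)) := germEval_along hh aF
  have ev1 {F : ℂ × ℂ → ℂ} (aF : AnalyticAt ℂ F (r, h r)) := germEval_delta hh aF e1
  have ev2 {F : ℂ × ℂ → ℂ} (aF : AnalyticAt ℂ F (r, h r)) := germEval_delta_two hh aF e1 e2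
  have ev3 {F : ℂ × ℂ → ℂ} (aF : AnalyticAt ℂ F (r, h r)) := germEval_delta_three hh aF e1 e2 e3
  have evc : germEval r c = (even ψ η f g).degeneracyCubic (r, h r) μ := by
    rw [hcdef, hcub]
    simp only [map_add, map_mul, map_pow, e1, ev0 (analyticAt_du aφ), ev0 (analyticAt_dw aφ),
      ev0 (analyticAt_du aΨ), ev0 (analyticAt_dw aΨ), ev0 (analyticAt_du aη), ev0 (analyticAt_dw aη)]
  -- For a symmetric difference term the right-hand side of the first order relation vanishes, and c
  -- is a unit, so there is no correction of order ε.
  have hw : PowerSeries.coeff 1 w = 0 := by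
    obtain ⟨a, ha, hD1⟩ := hD.compatibility_one
    have k := (hD1 (along r h Ψ + 2 * along r h η * m) c 0 _ _ (by
      change _ = along r h ψ + 2 * along r h η * m + along r h f * along r h (dw g) +
        along r h f * along r h (dw g)
      linear_combination b2 - b1) (by
      rw [← hl]
      congr 1
      change along r h ψ * m + along r h η * m ^ 2 + along r h f * germDerivation r (along r h g) +
        along r h f * germDerivation r (along r h g) = _
      ring) (sub_self _).symm rfl rfl).1
    rw [zero_mul] at k
    have ha0 : a = 0 := eq_zero_of_two_mul_eq_zero
      ((isUnit_of_germEval_ne_zero (by rwa [evc] : germEval r c ≠ 0)).mul_left_eq_zero.1 k)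
    rw [ha, ha0, map_zero, zero_mul]
  obtain ⟨y, β, hD2⟩ := hD.compatibility_two hw e3
  obtain ⟨k1, k2, k3⟩ := hD2 (along r h Ψ + 2 * along r h η * m) c
    (along r h η * m ^ 2 + 3 * along r h χ * m + 2 * along r h φ)
    (m * along r h (dw Ψ) + m ^ 2 * along r h (dw η) + 2 * along r h η * germDerivation r m +
      along r h (dw φ))
    ((12 * y + m) * (m * along r h (dw Ψ) + m ^ 2 * along r h (dw η) +
      3 * along r h η * germDerivation r m + along r h (dw φ)) +
      3 * germDerivation r m * (along r h χ + along r h η * m) +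
      12 * along r h f * germDerivation r (germDerivation r (along r h g)))
    ((6 * β - 6 * germDerivation r y + germDerivation r m) * (m * along r h (dw Ψ) +
      m ^ 2 * along r h (dw η) + 2 * along r h η * germDerivation r m + along r h (dw φ)) +
      4 * along r h f * germDerivation r (germDerivation r (germDerivation r (along r h g))))
    (by
      change _ = along r h ψ + 2 * along r h f * along r h (dw g) + 2 * along r h η * m
      linear_combination b2 - b1) hl (by
      change _ = along r h η * m ^ 2 + 2 * along r h f * along r h (dw g) * m +
        4 * along r h f * germDerivation r (along r h g)
      linear_combination -m * b1 - 2 * b3) (by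
      change _ = along r h (dw ψ) * m + along r h (dw η) * m ^ 2 +
        2 * along r h η * germDerivation r m + 2 * along r h f * germDerivation r (along r h (dw g)) +
        2 * along r h (dw f) * germDerivation r (along r h g)
      linear_combination m * b4 - b5) (by
      change _ = (12 * y + m) * (_ + along r h η * germDerivation r m) +
        3 * germDerivation r m * (2 * along r h f * along r h (dw g) + along r h η * m) +
        12 * along r h f * germDerivation r (germDerivation r (along r h g))
      linear_combination -3 * germDerivation r m * b1) rfl
  rw [← hm] at k1 k2
  -- The second equation of the conclusion is the derivative of the first.
  have k4 := congrArg (fun a => germEval r (germDerivation r a)) k1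
  replace k1 := congrArg (germEval r) k1
  replace k2 := congrArg (germEval r) k2
  replace k3 := congrArg (germEval r) k3
  rw [map_mul, map_zero, e2] at k3
  replace k3 := (mul_eq_zero.1 k3).resolve_left hH
  have evc' : germEval r (germDerivation r c) = dir (du φ) (r, h r) μ +
      μ * (dir (dw φ) (r, h r) μ + dir (du Ψ) (r, h r) μ) +
      μ ^ 2 * (dir (dw Ψ) (r, h r) μ + dir (du η) (r, h r) μ) + μ ^ 3 * dir (dw η) (r, h r) μ +
      (dw φ (r, h r) + du Ψ (r, h r) + 2 * μ * (dw Ψ (r, h r) + du η (r, h r)) +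
          3 * μ ^ 2 * dw η (r, h r)) * H := by
    rw [hcdef]
    simp only [map_add, map_mul, map_pow, Derivation.leibniz, Derivation.leibniz_pow, smul_eq_mul,
      nsmul_eq_mul, Nat.cast_ofNat, map_ofNat, e1, e2, ev0 (analyticAt_dw aφ),
      ev0 (analyticAt_du aΨ), ev0 (analyticAt_dw aΨ), ev0 (analyticAt_du aη), ev0 (analyticAt_dw aη),
      ev1 (analyticAt_du aφ), ev1 (analyticAt_dw aφ), ev1 (analyticAt_du aΨ),
      ev1 (analyticAt_dw aΨ), ev1 (analyticAt_du aη), ev1 (analyticAt_dw aη)]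
    ring
  clear hcdef hl hD2 hD
  simp only [map_add, map_sub, map_mul, map_pow, map_zero, map_ofNat, Derivation.leibniz,
    Derivation.leibniz_pow, smul_eq_mul, nsmul_eq_mul, Nat.cast_ofNat, derivation_ofNat, e1, e2, e3,
    Nat.add_one_sub_one, pow_one, evc, evc', ev0 aφ, ev0 aχ, ev0 aη, ev0 af, ev0 (analyticAt_dw aφ), ev0 (analyticAt_dw aΨ),
    ev0 (analyticAt_dw aη), ev1 aφ, ev1 aχ, ev1 aΨ, ev1 aη, ev1 af, ev1 (analyticAt_dw aφ),
    ev1 (analyticAt_dw aΨ), ev1 (analyticAt_dw aη), ev2 aφ, ev2 aχ, ev2 aΨ, ev2 aη, ev2 ag, ev3 ag]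
    at k1 k2 k3 k4
  refine ⟨germEval r y, germEval r (germDerivation r y), germEval r β, ?_, ?_, ?_, ?_⟩
  · linear_combination k1
  · linear_combination k4
  · linear_combination k2 - 6 * H ^ 2 * n1
  · linear_combination k3 + 6 * H * n2

end Equation

/-! ### Rules for directional derivatives -/

section Directional

variable {Ω : Set (ℂ × ℂ)} {F G : ℂ × ℂ → ℂ} {P : ℂ × ℂ} {μ : ℂ}

theorem analyticOnNhd_du (hF : AnalyticOnNhd ℂ F Ω) : AnalyticOnNhd ℂ (du F) Ω :=
  fun P hP => analyticAt_du (hF P hP)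

theorem analyticOnNhd_dw (hF : AnalyticOnNhd ℂ F Ω) : AnalyticOnNhd ℂ (dw F) Ω :=
  fun P hP => analyticAt_dw (hF P hP)

theorem dir_congr (hΩ : IsOpen Ω) (h : ∀ P ∈ Ω, F P = G P) (hP : P ∈ Ω) : dir F P μ = dir G P μ := by
  rw [dir, dir, du_eq_of_eqOn hΩ h hP, dw_eq_of_eqOn hΩ h hP]

theorem dir_const (c : ℂ) : dir (fun _ => c) P μ = 0 := by
  rw [dir, du_const, dw_const, mul_zero, add_zero]

theorem dir_add (hF : AnalyticAt ℂ F P) (hG : AnalyticAt ℂ G P) :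
    dir (fun P => F P + G P) P μ = dir F P μ + dir G P μ := by
  rw [dir, du_add hF hG, dw_add hF hG, dir, dir]
  ring

theorem dir_mul (hF : AnalyticAt ℂ F P) (hG : AnalyticAt ℂ G P) :
    dir (fun P => F P * G P) P μ = dir F P μ * G P + F P * dir G P μ := by
  rw [dir, du_mul hF hG, dw_mul hF hG, dir, dir]
  ring

theorem dir_mul_const (c : ℂ) : dir (fun P => F P * c) P μ = dir F P μ * c := by
  have h : (fun P => F P * c) = fun P => c * F P := funext fun _ => mul_comm _ _
  rw [h, dir, du_const_mul, dw_const_mul, dir]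
  ring

theorem dir_const_mul (c : ℂ) : dir (fun P => c * F P) P μ = c * dir F P μ := by
  rw [dir, du_const_mul, dw_const_mul, dir]
  ring

theorem dir_eq_zero_of_eqOn (hΩ : IsOpen Ω) {c : ℂ} (h : ∀ P ∈ Ω, F P = c) (hP : P ∈ Ω) :
    dir F P μ = 0 := (dir_congr hΩ h hP).trans (dir_const c)

end Directional

/-! ### Constancy of η and the remaining conditions of order ε² -/

namespace Equation

variable {Ω : Set (ℂ × ℂ)} {ψ η f g : ℂ × ℂ → ℂ}

theorem differentiable_degeneracyCubic (E : Equation) (P : ℂ × ℂ) :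
    Differentiable ℂ (E.degeneracyCubic P) := by
  unfold degeneracyCubic
  fun_prop

theorem limPhi_even : (even ψ η f g).limPhi = fun P => 2 * (f P * du g P) :=
  funext fun _ => (two_mul _).symm

theorem limPsi_even : (even ψ η f g).limPsi = fun P => ψ P + 2 * (f P * dw g P) :=
  funext fun _ => by rw [two_mul, ← add_assoc]; rfl

/-- For an integrable equation with symmetric difference term the coefficient `η` is constant. -/
theorem order_two_relations (hE : (even ψ η f g).IsAnalyticOn Ω)
    (hI : (even ψ η f g).Integrable Ω)
    {φ χ Ψ : ℂ × ℂ → ℂ} (hφ : φ = (even ψ η f g).limPhi) (hΨ : Ψ = (even ψ η f g).limPsi)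
    (hχ : χ = fun P => 2 * (f P * dw g P))
    {P : ℂ × ℂ} (hP : P ∈ Ω) (hη : η P ≠ 0) (hne : ∃ μ, (even ψ η f g).degeneracyCubic P μ ≠ 0) :
    dw η P = 0 ∧ du η P = 0 ∧ 3 * χ P * dw Ψ P = 2 * η P * dw φ P ∧
      2 * η P * du φ P - 4 * φ P * dw Ψ P = 3 * χ P * (du Ψ P - dw φ P) ∧
      3 * χ P * du φ P = 4 * φ P * du Ψ P := by
  -- This is the coefficient of H³ divided by η. It vanishes for generic μ, hence for all μ; it is a
  -- quartic in μ, and its two highest coefficients give η_w = 0 and η_u = 0.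
  have key := eq_zero_of_ne_zero_imp (q := fun μ =>
    (even ψ η f g).degeneracyCubic P μ * (2 * η P * μ + 3 * χ P) -
      (η P * μ ^ 2 + 3 * χ P * μ + 2 * φ P) * (dw φ P + du Ψ P + 2 * μ * (dw Ψ P + du η P) +
        3 * μ ^ 2 * dw η P) - (du Ψ P + μ * dw Ψ P + 2 * μ * (du η P + μ * dw η P) -
        (μ * dw Ψ P + μ ^ 2 * dw η P + dw φ P)) * (η P * μ ^ 2 + 3 * χ P * μ + 2 * φ P))
    ((even ψ η f g).differentiable_degeneracyCubic P) (by
      have := (even ψ η f g).differentiable_degeneracyCubic P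
      fun_prop) hne fun μ hμ => by
    refine (mul_eq_zero.1 ?_).resolve_left hη
    exact (elimination rfl rfl fun H hH => order_two_numeric hE hI hφ hΨ
      (hχ.trans (funext fun P => two_mul _)) hP hμ hH).2.2.2
  simp only [degeneracyCubic, ← hφ, ← hΨ] at key
  obtain ⟨k0, k1, k2, k3, k4⟩ := coeffs_eq_zero_of_quartic
    (a := 3 * χ P * du φ P - 2 * φ P * (dw φ P + du Ψ P) - 2 * φ P * (du Ψ P - dw φ P))
    (b := 2 * η P * du φ P - 4 * φ P * (dw Ψ P + du η P) - 3 * χ P * (du Ψ P - dw φ P) -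
      4 * φ P * du η P)
    (c := 2 * η P * dw φ P - 3 * χ P * (dw Ψ P + du η P) - 6 * χ P * du η P -
      8 * φ P * dw η P)
    (d := -2 * η P * du η P - 9 * χ P * dw η P) (e := -2 * η P * dw η P) fun μ => by
      have := key μ
      change (_ + _ + (_ + du η P) * _ + dw η P * _) * _ - _ - _ = (0 : ℂ) at this
      linear_combination this
  have hw : dw η P = 0 := by
    refine (mul_eq_zero.1 k4).resolve_left (mul_ne_zero (by norm_num) hη)
  have hu : du η P = 0 := by
    rw [hw, mul_zero, sub_zero] at k3
    exact (mul_eq_zero.1 k3).resolve_left (mul_ne_zero (by norm_num) hη)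
  rw [hu] at k1 k2
  rw [hw] at k2
  refine ⟨hw, hu, ?_, ?_, ?_⟩
  · linear_combination -k2
  · linear_combination k1
  · linear_combination k0

/-- The conditions at the second order for constant `η`. -/
theorem order_two_conditions (hΩ : IsOpen Ω) (hE : (even ψ (fun _ => 1) f g).IsAnalyticOn Ω)
    (hI : (even ψ (fun _ => 1) f g).Integrable Ω)
    {φ χ Ψ : ℂ × ℂ → ℂ} (hφ : φ = (even ψ (fun _ => 1) f g).limPhi)
    (hΨ : Ψ = (even ψ (fun _ => 1) f g).limPsi) (hχ : χ = fun P => 2 * (f P * dw g P))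
    {P : ℂ × ℂ} (hP : P ∈ Ω) {μ : ℂ} {C N : ℂ × ℂ → ℂ}
    (hC : ∀ Q ∈ Ω, C Q = du φ Q + (dw φ Q + du Ψ Q) * μ + dw Ψ Q * μ ^ 2)
    (hN : ∀ Q ∈ Ω, N Q = μ ^ 2 + 3 * χ Q * μ + 2 * φ Q) (hc : C P ≠ 0) {D κ : ℂ}
    (hD : D = du Ψ P - dw φ P) (hκ : κ = μ * dw Ψ P + dw φ P) :
    μ * (μ * dir (dw Ψ) P μ + dir (dw φ) P μ) + 12 * dir f P μ * dir2 g P μ +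
      4 * f P * dir3 g P μ - (3 * μ * dir2 χ P μ + 2 * dir2 φ P μ) = 0 ∧
    D * (C P * μ * κ + 12 * C P * (f P * dir2 g P μ)) - 2 * D * (C P * dir N P μ) +
      C P * N P * (μ * dir (dw Ψ) P μ + dir (dw φ) P μ - dir2 Ψ P μ) +
      C P ^ 2 * (3 * dir χ P μ - 3 * dw φ P - 3 * μ * dw χ P) = 0 ∧
    D * (κ * N P + 6 * C P * μ + 9 * C P * χ P - 2 * N P * (D + κ) - 2 * C P * (2 * μ + 3 * χ P)) +
      (C P * dir N P μ - N P * dir C P μ) = 0 := by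
  have hE' := hE
  obtain ⟨aψ, -, af, ag, -, -⟩ := hE'
  replace aψ : AnalyticOnNhd ℂ ψ Ω := aψ
  replace af : AnalyticOnNhd ℂ f Ω := af
  replace ag : AnalyticOnNhd ℂ g Ω := ag
  have aφ : AnalyticOnNhd ℂ φ Ω := hφ ▸ analyticOnNhd_limPhi hE
  have aΨ : AnalyticOnNhd ℂ Ψ Ω := hΨ ▸ analyticOnNhd_limPsi hE
  have aχ : AnalyticOnNhd ℂ χ Ω := by
    rw [hχ]
    exact analyticOnNhd_const.mul (af.mul (analyticOnNhd_dw ag))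
  have z1 : du (fun _ : ℂ × ℂ => (1 : ℂ)) = fun _ => 0 := funext fun _ => du_const 1
  have z2 : dw (fun _ : ℂ × ℂ => (1 : ℂ)) = fun _ => 0 := funext fun _ => dw_const 1
  have z3 : du (fun _ : ℂ × ℂ => (0 : ℂ)) P = 0 := du_const 0
  have z4 : dw (fun _ : ℂ × ℂ => (0 : ℂ)) P = 0 := dw_const 0
  have e0 : (even ψ (fun _ => 1) f g).degeneracyCubic P μ = C P := by
    rw [degeneracyCubic, ← hφ, ← hΨ, hC P hP]
    change _ + _ + (_ + du (fun _ => 1) P) * _ + dw (fun _ => 1) P * _ = _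
    rw [z1, z2]
    ring
  have e1 : dir C P μ = dir (du φ) P μ + μ * (dir (dw φ) P μ + dir (du Ψ) P μ) +
      μ ^ 2 * dir (dw Ψ) P μ := by
    have a1 := analyticAt_du (aφ P hP)
    have a2 := analyticAt_dw (aφ P hP)
    have a3 := analyticAt_du (aΨ P hP)
    have a4 := analyticAt_dw (aΨ P hP)
    rw [dir_congr hΩ hC hP, dir_add (a1.fun_add ((a2.fun_add a3).fun_mul analyticAt_const))
      (a4.fun_mul analyticAt_const), dir_add a1 ((a2.fun_add a3).fun_mul analyticAt_const),
      dir_mul_const, dir_mul_const, dir_add a2 a3]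
    ring
  have e2 : dir N P μ = 3 * dir χ P μ * μ + 2 * dir φ P μ := by
    have a1 := aφ P hP
    have a2 := aχ P hP
    rw [dir_congr hΩ hN hP, dir_add (analyticAt_const.fun_add
      ((analyticAt_const.fun_mul a2).fun_mul analyticAt_const)) (analyticAt_const.fun_mul a1),
      dir_add analyticAt_const ((analyticAt_const.fun_mul a2).fun_mul analyticAt_const), dir_const,
      dir_mul_const, dir_const_mul, dir_const_mul]
    ring
  obtain ⟨q0, q1, q2, -⟩ := elimination rfl rfl fun H hH => order_two_numeric hE hI hφ hΨ
      (hχ.trans (funext fun P => two_mul _)) hP (by rwa [e0]) (μ := μ) hH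
  have e3 : dir Ψ P μ = D + κ := by
    rw [hD, hκ, dir]
    ring
  have z5 : dir2 (fun _ => (1 : ℂ)) P μ = 0 := by
    rw [dir2, z1, z2, z3, z4]
    ring_nf
    try simp [z3, z4]
  have z6 : dw (fun _ => (1 : ℂ)) P = 0 := dw_const 1
  have z7 : du (fun _ => (1 : ℂ)) P = 0 := du_const 1
  simp only [e0, e3, dir_const, z1, z2, z5] at q0 q1 q2
  rw [hκ] at q1 q2 ⊢
  rw [hN P hP]
  refine ⟨mul_left_cancel₀ (pow_ne_zero 2 hc) ?_, ?_, ?_⟩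
  · linear_combination q0
  · rw [e2]
    linear_combination q1
  · rw [e2, e1]
    linear_combination q2

end Equation

/-! ### Equations without difference terms, and exclusion of a degenerate branch -/

namespace Equation

variable {U : Set (ℂ × ℂ)} {ψ f g : ℂ × ℂ → ℂ}

theorem degeneracyCubic_even_one {φ Ψ : ℂ × ℂ → ℂ}
    (hφ : φ = (even ψ (fun _ => 1) f g).limPhi) (hΨ : Ψ = (even ψ (fun _ => 1) f g).limPsi)
    (P : ℂ × ℂ) (μ : ℂ) : (even ψ (fun _ => 1) f g).degeneracyCubic P μ =
      du φ P + (dw φ P + du Ψ P) * μ + dw Ψ P * μ ^ 2 := by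
  rw [degeneracyCubic, ← hφ, ← hΨ]
  change _ + _ + (_ + du (fun _ => 1) P) * _ + dw (fun _ => 1) P * _ = _
  rw [du_const, dw_const]
  ring

/-- The coefficient of H⁰ makes ψ_w a constant κ, and that of H¹ gives ψ_uu = κψ_u. Integration
yields ψ = Cu + c for κ = 0 and κw + (C/κ)e^{κu} + c otherwise. -/
theorem locallyListed_of_trivial (hU : IsRegular U)
    (hE : (even ψ (fun _ => 1) (fun _ => 0) fun _ => 0).IsAnalyticOn U)
    (hI : (even ψ (fun _ => 1) (fun _ => 0) fun _ => 0).Integrable U)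
    (hne : ∀ P ∈ U, ∃ μ, (even ψ (fun _ => 1) (fun _ => 0) fun _ => 0).degeneracyCubic P μ ≠ 0) :
    (even ψ (fun _ => 1) (fun _ => 0) fun _ => 0).LocallyListed U := by
  have hφ : (fun _ => 0) = (even ψ (fun _ => 1) (fun _ => 0) fun _ => 0).limPhi := by
    funext P
    simp [limPhi, even]
  have hΨ : ψ = (even ψ (fun _ => 1) (fun _ => 0) fun _ => 0).limPsi := by
    funext P
    simp [limPsi, even]
  have hcub := degeneracyCubic_even_one hφ hΨ
  have aψ : AnalyticOnNhd ℂ ψ U := hE.1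
  have z1 : du (fun _ : ℂ × ℂ => (0 : ℂ)) = fun _ => 0 := funext fun _ => du_const 0
  have z2 : dw (fun _ : ℂ × ℂ => (0 : ℂ)) = fun _ => 0 := funext fun _ => dw_const 0
  have cond {P : ℂ × ℂ} (hP : P ∈ U) {μ : ℂ} (hμ : du ψ P * μ + dw ψ P * μ ^ 2 ≠ 0) :=
    order_two_conditions hU.isOpen hE hI hφ hΨ (χ := fun _ => 0) (by funext; simp) hP (μ := μ)
      (C := fun Q => du ψ Q * μ + dw ψ Q * μ ^ 2) (N := fun Q => μ ^ 2)
      (fun Q hQ => by rw [z1, z2]; ring) (fun Q hQ => by ring) hμ rfl rfl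
  simp only [dir_const, z1, z2, dir2, dir3] at cond
  have hcd (P : ℂ × ℂ) : Differentiable ℂ fun μ => du ψ P * μ + dw ψ P * μ ^ 2 := by fun_prop
  have hne' {P : ℂ × ℂ} (hP : P ∈ U) : ∃ μ, du ψ P * μ + dw ψ P * μ ^ 2 ≠ 0 := by
    obtain ⟨μ, hμ⟩ := hne P hP
    refine ⟨μ, fun h => hμ ?_⟩
    simp only [hcub, z1, z2]
    linear_combination h
  have h1 : ∀ P ∈ U, du (dw ψ) P = 0 ∧ dw (dw ψ) P = 0 := fun P hP => by
    have h := eq_zero_of_ne_zero_imp (q := fun μ => μ ^ 2 * dir (dw ψ) P μ) (hcd P)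
      (by unfold dir; fun_prop) (hne' hP) fun μ hμ => by
        linear_combination (cond hP hμ).1
    obtain ⟨-, -, h2, h3, -⟩ := coeffs_eq_zero_of_quartic (a := 0) (b := 0) (c := du (dw ψ) P)
      (d := dw (dw ψ) P) (e := 0) fun μ => by
        have := h μ
        simp only [dir] at this
        linear_combination this
    exact ⟨h2, h3⟩
  have h2 : ∀ P ∈ U, du (du ψ) P = dw ψ P * du ψ P := fun P hP => by
    have h := eq_zero_of_ne_zero_imp (q := fun μ => μ ^ 2 * (du ψ P * dw ψ P - du (du ψ) P)) (hcd P)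
      (by fun_prop) (hne' hP) fun μ hμ => by
        obtain ⟨-, k, -⟩ := cond hP hμ
        have hd : dir (dw ψ) P μ = 0 := by
          rw [dir, (h1 P hP).1, (h1 P hP).2]
          ring
        rw [hd, (h1 P hP).1, (h1 P hP).2] at k
        refine mul_left_cancel₀ hμ ?_
        linear_combination k
    linear_combination -h 1
  obtain ⟨κ, hκ⟩ := hU.exists_eq_const (analyticOnNhd_dw aψ) (fun P hP => (h1 P hP).1)
    fun P hP => (h1 P hP).2
  have hwu : ∀ P ∈ U, dw (du ψ) P = 0 := fun P hP => (dw_du (aψ P hP)).trans (h1 P hP).1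
  obtain ⟨P₀, hP₀⟩ := hU.nonempty
  refine ⟨U, subset_rfl, hU.isOpen, hU.nonempty, ?_⟩
  by_cases hκ0 : κ = 0
  · obtain ⟨C, hC⟩ := hU.exists_eq_const (analyticOnNhd_du aψ)
      (fun P hP => by rw [h2 P hP, hκ P hP, hκ0, zero_mul]) hwu
    obtain ⟨c, hc⟩ := hU.exists_eq_const (F := fun P => ψ P - C * P.1)
      (fun P hP => (aψ P hP).fun_sub (analyticAt_const.fun_mul analyticAt_fst))
      (fun P hP => by
        rw [du_sub (aψ P hP) (analyticAt_const.fun_mul analyticAt_fst), hC P hP]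
        simp [du])
      (fun P hP => by
        rw [dw_sub (aψ P hP) (analyticAt_const.fun_mul analyticAt_fst), hκ P hP, hκ0]
        simp [dw])
    -- For C = κ = 0 the cubic would vanish identically in μ.
    have hC0 : C ≠ 0 := by
      rintro rfl
      obtain ⟨μ, hμ⟩ := hne' hP₀
      exact hμ (by rw [hC _ hP₀, hκ _ hP₀, hκ0]; ring)
    refine ⟨_, .eqn1, 1, c, C, 0, 0, one_ne_zero, hC0, fun P hP => ?_, fun P hP => ?_,
      fun P hP Q hQ R hR => ?_⟩
    · have := hc P hP
      simp only [even, transform, eqn1]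
      linear_combination this
    · simp [even, transform, eqn1]
    · simp [even, transform, eqn1, discretePart]
  · have he : ∀ P, AnalyticAt ℂ (fun P : ℂ × ℂ => Complex.exp (-κ * P.1)) P :=
      fun P => (analyticAt_const.fun_mul analyticAt_fst).cexp'
    have he' : ∀ P, AnalyticAt ℂ (fun P : ℂ × ℂ => Complex.exp (κ * P.1)) P :=
      fun P => (analyticAt_const.fun_mul analyticAt_fst).cexp'
    have hdu (a : ℂ) (P : ℂ × ℂ) : du (fun P : ℂ × ℂ => Complex.exp (a * P.1)) P =
        a * Complex.exp (a * P.1) := by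
      have : HasDerivAt (fun z : ℂ => Complex.exp (a * z)) (Complex.exp (a * P.1) * (a * 1)) P.1 :=
        ((hasDerivAt_id _).const_mul a).cexp
      rw [du, this.deriv]
      ring
    have hdw (a : ℂ) (P : ℂ × ℂ) : dw (fun P : ℂ × ℂ => Complex.exp (a * P.1)) P = 0 := by simp [dw]
    obtain ⟨C, hC⟩ := hU.exists_eq_const (F := fun P => du ψ P * Complex.exp (-κ * P.1))
      (fun P hP => (analyticAt_du (aψ P hP)).fun_mul (he P))
      (fun P hP => by
        rw [du_mul (analyticAt_du (aψ P hP)) (he P), hdu, h2 P hP, hκ P hP]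
        ring)
      (fun P hP => by
        rw [dw_mul (analyticAt_du (aψ P hP)) (he P), hdw, hwu P hP]
        ring)
    have hC' : ∀ P ∈ U, du ψ P = C * Complex.exp (κ * P.1) := fun P hP => by
      rw [← hC P hP, mul_assoc, ← Complex.exp_add]
      simp
    have a1 (P : ℂ × ℂ) : AnalyticAt ℂ (fun P : ℂ × ℂ => κ * P.2) P :=
      analyticAt_const.fun_mul analyticAt_snd
    have a2 (P : ℂ × ℂ) : AnalyticAt ℂ (fun P : ℂ × ℂ => C / κ * Complex.exp (κ * P.1)) P :=
      analyticAt_const.fun_mul (he' P)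
    obtain ⟨c, hc⟩ := hU.exists_eq_const
      (F := fun P => ψ P - (κ * P.2 + C / κ * Complex.exp (κ * P.1)))
      (fun P hP => (aψ P hP).fun_sub ((a1 P).fun_add (a2 P)))
      (fun P hP => by
        rw [du_sub (aψ P hP) ((a1 P).fun_add (a2 P)), du_add (a1 P) (a2 P), du_const_mul (C / κ), hdu,
          hC' P hP]
        simp only [du, deriv_const]
        field_simp
        ring)
      (fun P hP => by
        rw [dw_sub (aψ P hP) ((a1 P).fun_add (a2 P)), dw_add (a1 P) (a2 P), dw_const_mul (C / κ),
          hdw, hκ P hP]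
        simp [dw])
    refine ⟨_, .eqn2 (C / κ), 1, c, κ, 0, 0, one_ne_zero, hκ0, fun P hP => ?_, fun P hP => ?_,
      fun P hP Q hQ R hR => ?_⟩
    · have := hc P hP
      simp only [even, transform, eqn2, add_zero]
      linear_combination this
    · simp [even, transform, eqn2]
    · simp [even, transform, eqn2, discretePart]

/-- The coefficient of `u_y` and the coefficient of `u_x` of the dispersionless limit cannot be in the
relation for which the second order obstruction has a double root. -/
theorem eq_zero_of_relations (hU : IsRegular U) (hE : (even ψ (fun _ => 1) f g).IsAnalyticOn U)
    (hI : (even ψ (fun _ => 1) f g).Integrable U)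
    {φ χ Ψ : ℂ × ℂ → ℂ} (hφ : φ = (even ψ (fun _ => 1) f g).limPhi)
    (hΨ : Ψ = (even ψ (fun _ => 1) f g).limPsi) (hχ : χ = fun P => 2 * (f P * dw g P))
    (hne : ∀ P ∈ U, ∃ μ, (even ψ (fun _ => 1) f g).degeneracyCubic P μ ≠ 0)
    (hφ0 : ∀ P ∈ U, φ P ≠ 0) (hD : ∀ P ∈ U, du Ψ P - dw φ P ≠ 0) : False := by
  have aφ : AnalyticOnNhd ℂ φ U := hφ ▸ analyticOnNhd_limPhi hE
  have aΨ : AnalyticOnNhd ℂ Ψ U := hΨ ▸ analyticOnNhd_limPsi hE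
  have aχ : AnalyticOnNhd ℂ χ U := by
    rw [hχ]
    exact analyticOnNhd_const.mul (hE.2.2.1.mul (analyticOnNhd_dw hE.2.2.2.1))
  have rel P (hP : P ∈ U) :=
    (order_two_relations hE hI hφ hΨ hχ hP one_ne_zero (hne P hP)).2.2
  -- The three relations combine to D(9χ² - 8φ) = 0 with D = Ψ_u - φ_w. Consequently N = μ² + 3χμ +
  -- 2φ is the square of ν = μ + 3χ/2.
  have h9 : ∀ P ∈ U, 9 * (χ P * χ P) = 8 * φ P := fun P hP => by
    obtain ⟨r1, r2, r3⟩ := rel P hP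
    refine sub_eq_zero.1 ((mul_eq_zero.1 ?_).resolve_left (hD P hP))
    linear_combination 2 * r3 - 3 * χ P * r2 - 4 * φ P * r1
  have hχ0 : ∀ P ∈ U, χ P ≠ 0 := fun P hP h => hφ0 P hP (by
    have := h9 P hP
    rw [h] at this
    linear_combination -this / 8)
  have hχw : ∀ P ∈ U, dw χ P = 2 / 3 * dw Ψ P := fun P hP => by
    have h := dw_eq_of_eqOn hU.isOpen h9 hP
    rw [dw_const_mul, dw_const_mul, dw_mul (aχ P hP) (aχ P hP)] at h
    refine mul_left_cancel₀ (hχ0 P hP) ?_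
    linear_combination h / 18 - 2 / 9 * (rel P hP).1
  have hχu : ∀ P ∈ U, du χ P = χ P * dw Ψ P + 2 / 3 * (du Ψ P - dw φ P) := fun P hP => by
    have h := du_eq_of_eqOn hU.isOpen h9 hP
    rw [du_const_mul, du_const_mul, du_mul (aχ P hP) (aχ P hP)] at h
    refine mul_left_cancel₀ (hχ0 P hP) ?_
    linear_combination h / 18 + 2 / 9 * (rel P hP).2.1 - dw Ψ P / 9 * h9 P hP
  obtain ⟨P, hP⟩ := hU.nonempty
  have aD : AnalyticOnNhd ℂ (fun P => du Ψ P - dw φ P) U :=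
    (analyticOnNhd_du aΨ).sub (analyticOnNhd_dw aφ)
  have ak : AnalyticOnNhd ℂ (dw Ψ) U := analyticOnNhd_dw aΨ
  have key := eq_zero_of_ne_zero_imp (q := fun μ =>
    (du Ψ P - dw φ P + dw Ψ P * (μ + 3 / 2 * χ P)) ^ 2 + (μ + 3 / 2 * χ P) *
      ((du Ψ P - dw φ P) * dw Ψ P - (dir (fun P => du Ψ P - dw φ P) P μ +
        dir (dw Ψ) P μ * (μ + 3 / 2 * χ P) +
          dw Ψ P * (du Ψ P - dw φ P + dw Ψ P * (μ + 3 / 2 * χ P)))))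
    ((even ψ (fun _ => 1) f g).differentiable_degeneracyCubic P) (by unfold dir; fun_prop) (hne P hP)
    fun μ hμ => by
      have aν : AnalyticOnNhd ℂ (fun P => μ + 3 / 2 * χ P) U :=
        analyticOnNhd_const.add (analyticOnNhd_const.mul aχ)
      have al : AnalyticOnNhd ℂ (fun P => du Ψ P - dw φ P + dw Ψ P * (μ + 3 / 2 * χ P)) U :=
        aD.add (ak.mul aν)
      -- The cubic factors as νℓ with ℓ = D + Ψ_w ν, and ℓ is also the derivative of ν in the
      -- direction (1, μ). So the coefficient of H² can be divided by ν².
      have hC : ∀ Q ∈ U, (fun Q => (μ + 3 / 2 * χ Q) *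
          (du Ψ Q - dw φ Q + dw Ψ Q * (μ + 3 / 2 * χ Q))) Q =
            du φ Q + (dw φ Q + du Ψ Q) * μ + dw Ψ Q * μ ^ 2 := fun Q hQ => by
        obtain ⟨r1, r2, r3⟩ := rel Q hQ
        linear_combination -r2 / 2 + μ * r1 + dw Ψ Q / 4 * h9 Q hQ
      have hν : dir (fun P => μ + 3 / 2 * χ P) P μ =
          du Ψ P - dw φ P + dw Ψ P * (μ + 3 / 2 * χ P) := by
        rw [dir_add analyticAt_const (analyticAt_const.fun_mul (aχ P hP)), dir_const, dir_const_mul,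
          dir, hχu P hP, hχw P hP]
        ring
      have hl : dir (fun P => du Ψ P - dw φ P + dw Ψ P * (μ + 3 / 2 * χ P)) P μ =
          dir (fun P => du Ψ P - dw φ P) P μ + (dir (dw Ψ) P μ * (μ + 3 / 2 * χ P) +
          dw Ψ P * (du Ψ P - dw φ P + dw Ψ P * (μ + 3 / 2 * χ P))) := by
        rw [← hν, ← dir_mul (ak P hP) (aν P hP)]
        exact dir_add (aD P hP) ((ak P hP).fun_mul (aν P hP))
      have hc : (μ + 3 / 2 * χ P) * (du Ψ P - dw φ P + dw Ψ P * (μ + 3 / 2 * χ P)) ≠ 0 := by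
        have := hC P hP
        simp only at this
        rwa [this, ← degeneracyCubic_even_one hφ hΨ]
      have k := (order_two_conditions hU.isOpen hE hI hφ hΨ hχ hP hC
        (N := fun Q => (μ + 3 / 2 * χ Q) * (μ + 3 / 2 * χ Q))
        (fun Q hQ => by linear_combination h9 Q hQ / 4) hc rfl rfl).2.2
      rw [dir_mul (aν P hP) (aν P hP), dir_mul (aν P hP) (al P hP), hν, hl] at k
      refine mul_left_cancel₀ (pow_ne_zero 2 (left_ne_zero_of_mul hc)) ?_
      have r1 := (rel P hP).1
      linear_combination k - (du Ψ P - dw φ P) * (μ + 3 / 2 * χ P) ^ 2 / 2 * r1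
  -- At the root ν = 0 only D² survives, against D ≠ 0.
  have := key (-(3 / 2) * χ P)
  refine hD P hP (pow_eq_zero_iff two_ne_zero |>.1 ?_)
  linear_combination this

end Equation

/-! ### Reduced form of equations with a difference term -/

namespace Equation

variable {U : Set (ℂ × ℂ)} {ψ f g : ℂ × ℂ → ℂ}

/-- The consequences of the second order conditions for an equation with nonzero difference term. -/
theorem exists_reduced_form (hU : IsRegular U) (hE : (even ψ (fun _ => 1) f g).IsAnalyticOn U)
    (hI : (even ψ (fun _ => 1) f g).Integrable U)
    (hne : ∀ P ∈ U, ∃ μ, (even ψ (fun _ => 1) f g).degeneracyCubic P μ ≠ 0)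
    (hf : ∀ P ∈ U, f P ≠ 0) (hg : ∀ P ∈ U, du g P ≠ 0 ∨ dw g P ≠ 0) :
    ∃ V ⊆ U, IsRegular V ∧ ∃ k c : ℂ, k ≠ 0 ∧ ∀ P ∈ V, ψ P = k * P.2 + c ∧
      dw f P = 0 ∧ dw g P = 0 ∧ du g P ≠ 0 ∧
      du f P * du g P + f P * du (du g) P = 2 * k * (f P * du g P) ∧
      3 * (du f P * du (du g) P) + f P * du (du (du g)) P = 4 * k ^ 2 * (f P * du g P) := by
  obtain ⟨φ, hφ⟩ : ∃ φ, φ = (even ψ (fun _ => 1) f g).limPhi := ⟨_, rfl⟩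
  obtain ⟨Ψ, hΨ⟩ : ∃ Ψ, Ψ = (even ψ (fun _ => 1) f g).limPsi := ⟨_, rfl⟩
  obtain ⟨χ, hχ⟩ : ∃ χ : ℂ × ℂ → ℂ, χ = fun P => 2 * (f P * dw g P) := ⟨_, rfl⟩
  have hφ' : φ = fun P => 2 * (f P * du g P) := hφ.trans limPhi_even
  have hΨ' : ∀ P, Ψ P = ψ P + χ P := fun P => by rw [hΨ, limPsi_even, hχ]
  have aψ : AnalyticOnNhd ℂ ψ U := hE.1
  have af : AnalyticOnNhd ℂ f U := hE.2.2.1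
  have ag : AnalyticOnNhd ℂ g U := hE.2.2.2.1
  have aφ : AnalyticOnNhd ℂ φ U := hφ ▸ analyticOnNhd_limPhi hE
  have aΨ : AnalyticOnNhd ℂ Ψ U := hΨ ▸ analyticOnNhd_limPsi hE
  have aχ : AnalyticOnNhd ℂ χ U := by
    rw [hχ]
    exact analyticOnNhd_const.mul (af.mul (analyticOnNhd_dw ag))
  have rel P (hP : P ∈ U) :=
    (order_two_relations hE hI hφ hΨ hχ hP one_ne_zero (hne P hP)).2.2
  have hcub := degeneracyCubic_even_one hφ hΨ
  -- If φ vanished identically then g_u = 0, so χ ≠ 0, and the relations would give Ψ_u = Ψ_w = 0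
  -- and with it a vanishing cubic.
  rcases hU.eq_zero_or aφ with h0 | ⟨V, hV, hVr, h0⟩
  · obtain ⟨P, hP⟩ := hU.nonempty
    have z1 := du_eq_zero_of_eqOn hU.isOpen h0 hP
    have z2 := dw_eq_zero_of_eqOn hU.isOpen h0 hP
    obtain ⟨r1, r2, r3⟩ := rel P hP
    rw [z1, z2, h0 P hP] at r2
    rw [z2] at r1
    have hgu : du g P = 0 := by
      have := h0 P hP
      rw [hφ'] at this
      exact (mul_eq_zero.1 ((mul_eq_zero.1 this).resolve_left two_ne_zero)).resolve_left (hf P hP)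
    have hχ0 : 3 * χ P ≠ 0 := by
      rw [hχ]
      exact mul_ne_zero three_ne_zero (mul_ne_zero two_ne_zero (mul_ne_zero (hf P hP)
        ((hg P hP).resolve_left fun h => h hgu)))
    have z3 : dw Ψ P = 0 := (mul_eq_zero.1 (by linear_combination r1)).resolve_left hχ0
    have z4 : du Ψ P = 0 := (mul_eq_zero.1 (by linear_combination -r2)).resolve_left hχ0
    obtain ⟨μ, hμ⟩ := hne P hP
    exact absurd (by rw [hcub, z1, z2, z3, z4]; ring) hμ
  have aD : AnalyticOnNhd ℂ (fun P => du Ψ P - dw φ P) U :=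
    (analyticOnNhd_du aΨ).sub (analyticOnNhd_dw aφ)
  rcases hVr.eq_zero_or (aD.mono hV) with hD | ⟨W, hW, hWr, hD⟩
  swap
  · exact (eq_zero_of_relations hWr (hE.mono (hW.trans hV)) (hI.mono (hW.trans hV)) hφ hΨ hχ
      (fun P hP => hne P (hV (hW hP))) (fun P hP => h0 P (hW hP)) hD).elim
  replace hE := hE.mono hV
  replace hI := hI.mono hV
  replace hne := fun P hP => hne P (hV hP)
  replace hf := fun P hP => hf P (hV hP)
  replace rel := fun P hP => rel P (hV hP)
  replace aψ := aψ.mono hV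
  replace af := af.mono hV
  replace ag := ag.mono hV
  replace aφ := aφ.mono hV
  replace aΨ := aΨ.mono hV
  replace aχ := aχ.mono hV
  have hVo := hVr.isOpen
  have hgu : ∀ P ∈ V, du g P ≠ 0 := fun P hP h => h0 P hP (by simp only [hφ', h, mul_zero])
  have hφw : ∀ P ∈ V, dw φ P = 3 / 2 * (dw Ψ P * χ P) := fun P hP => by
    linear_combination -(rel P hP).1 / 2
  have hΨu : ∀ P ∈ V, du Ψ P = dw φ P := fun P hP => sub_eq_zero.1 (hD P hP)
  have hφu : ∀ P ∈ V, du φ P = 2 * (dw Ψ P * φ P) := fun P hP => by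
    linear_combination (rel P hP).2.1 / 2 + 3 / 2 * χ P * hD P hP
  -- With D = 0 the relations say that the cubic is Ψ_w N. Then in the coefficient of H² all terms
  -- cancel except the derivative of Ψ_w, which is therefore constant.
  have hC {μ : ℂ} : ∀ Q ∈ V, (fun Q => dw Ψ Q * (μ ^ 2 + 3 * χ Q * μ + 2 * φ Q)) Q =
      du φ Q + (dw φ Q + du Ψ Q) * μ + dw Ψ Q * μ ^ 2 := fun Q hQ => by
    rw [hΨu Q hQ, hφw Q hQ, hφu Q hQ]
    ring
  have hk0 : ∀ P ∈ V, dw Ψ P ≠ 0 := fun P hP h => by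
    obtain ⟨μ, hμ⟩ := hne P hP
    refine hμ ?_
    have := hC (μ := μ) P hP
    simp only [h] at this
    rw [hcub, h, ← this, zero_mul]
  have cond {P : ℂ × ℂ} (hP : P ∈ V) {μ : ℂ}
      (hμ : (even ψ (fun _ => 1) f g).degeneracyCubic P μ ≠ 0) :=
    order_two_conditions hVo hE hI hφ hΨ hχ hP (μ := μ) hC
      (N := fun Q => μ ^ 2 + 3 * χ Q * μ + 2 * φ Q) (fun Q hQ => rfl)
      (fun h => hμ (by rw [hcub, ← hC P hP]; exact h)) (D := 0) (by rw [hD P hP]) rfl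
  have hN0 {P : ℂ × ℂ} (hP : P ∈ V) {μ : ℂ}
      (hμ : (even ψ (fun _ => 1) f g).degeneracyCubic P μ ≠ 0) :
      dw Ψ P * (μ ^ 2 + 3 * χ P * μ + 2 * φ P) ≠ 0 := by
    have := hC (μ := μ) P hP
    simp only at this
    rwa [this, ← hcub]
  have hk1 : ∀ P ∈ V, du (dw Ψ) P = 0 ∧ dw (dw Ψ) P = 0 := fun P hP => by
    have h := eq_zero_of_ne_zero_imp (q := fun μ => dir (dw Ψ) P μ)
      ((even ψ (fun _ => 1) f g).differentiable_degeneracyCubic P)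
      (by unfold dir; fun_prop) (hne P hP) fun μ hμ => by
        have k := (cond hP hμ).2.2
        have aN : AnalyticAt ℂ (fun Q => μ ^ 2 + 3 * χ Q * μ + 2 * φ Q) P :=
          (analyticAt_const.fun_add ((analyticAt_const.fun_mul (aχ P hP)).fun_mul
            analyticAt_const)).fun_add (analyticAt_const.fun_mul (aφ P hP))
        rw [dir_mul (analyticAt_dw (aΨ P hP)) aN] at k
        refine mul_left_cancel₀ (pow_ne_zero 2 (right_ne_zero_of_mul (hN0 hP hμ))) ?_
        linear_combination -k
    have h1 := h 0
    have h2 := h 1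
    simp only [dir] at h1 h2
    refine ⟨by linear_combination h1, by linear_combination h2 - h1⟩
  obtain ⟨k, hk⟩ := hVr.exists_eq_const (analyticOnNhd_dw aΨ) (fun P hP => (hk1 P hP).1)
    fun P hP => (hk1 P hP).2
  have huw : ∀ P ∈ V, dw (dw φ) P = 0 := fun P hP => by
    rw [← dw_eq_of_eqOn hVo hΨu hP, dw_du (aΨ P hP), (hk1 P hP).1]
  -- This is the coefficient of H¹.
  have hχu : ∀ P ∈ V, du χ P = dw φ P := fun P hP => by
    have h := eq_zero_of_ne_zero_imp (q := fun μ => du χ P - dw φ P)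
      ((even ψ (fun _ => 1) f g).differentiable_degeneracyCubic P)
      (by fun_prop) (hne P hP) fun μ hμ => by
        have k1 := (cond hP hμ).2.1
        have e1 : dir (dw Ψ) P μ = 0 := dir_eq_zero_of_eqOn hVo hk hP
        have e2 : dir2 Ψ P μ = dir (dw φ) P μ := by
          rw [dir2, (hk1 P hP).1, (hk1 P hP).2, du_eq_of_eqOn hVo hΨu hP, dir, huw P hP]
          ring
        rw [e1, e2] at k1
        refine mul_left_cancel₀ (pow_ne_zero 2 (hN0 hP hμ)) ?_
        have e3 : dir χ P μ = du χ P + μ * dw χ P := rfl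
        rw [e3] at k1
        linear_combination k1 / 3
    exact sub_eq_zero.1 (h 0)
  -- The mixed derivative of φ computed in two ways equals 3k²χ and (9/4)k²χ, and k ≠ 0.
  have hχ0 : ∀ P ∈ V, χ P = 0 := fun P hP => by
    have e1 : dw (du φ) P = 2 * k * dw φ P := by
      rw [dw_eq_of_eqOn (G := fun P => 2 * k * φ P) hVo (fun Q hQ => by
        rw [hφu Q hQ, hk Q hQ, mul_assoc]) hP, dw_const_mul]
    have e2 : du (dw φ) P = 3 / 2 * k * du χ P := by
      rw [du_eq_of_eqOn (G := fun P => 3 / 2 * k * χ P) hVo (fun Q hQ => by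
        rw [hφw Q hQ, hk Q hQ, mul_assoc]) hP, du_const_mul]
    have e3 := dw_du (aφ P hP)
    rw [e1, e2, hχu P hP, hφw P hP, hk P hP] at e3
    have hk0 := hk0 P hP
    rw [hk P hP] at hk0
    refine (mul_eq_zero.1 (?_ : k ^ 2 * χ P = 0)).resolve_left (pow_ne_zero 2 hk0)
    linear_combination 4 / 3 * e3
  have hgw : ∀ P ∈ V, dw g P = 0 := fun P hP => by
    have := hχ0 P hP
    rw [hχ] at this
    exact (mul_eq_zero.1 ((mul_eq_zero.1 this).resolve_left two_ne_zero)).resolve_left (hf P hP)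
  have hφw0 : ∀ P ∈ V, dw φ P = 0 := fun P hP => by rw [hφw P hP, hχ0 P hP, mul_zero, mul_zero]
  have hguw : ∀ P ∈ V, dw (du g) P = 0 := fun P hP => by
    rw [dw_du (ag P hP), du_eq_zero_of_eqOn hVo hgw hP]
  have hfw : ∀ P ∈ V, dw f P = 0 := fun P hP => by
    have := hφw0 P hP
    rw [hφ', dw_const_mul, dw_mul (af P hP) (analyticAt_du (ag P hP)), hguw P hP] at this
    refine (mul_eq_zero.1 ?_).resolve_right (hgu P hP)
    linear_combination this / 2
  have hψ : ∀ P ∈ V, Ψ P = ψ P := fun P hP => by rw [hΨ', hχ0 P hP, add_zero]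
  have aw (P : ℂ × ℂ) : AnalyticAt ℂ (fun P : ℂ × ℂ => k * P.2) P :=
    analyticAt_const.fun_mul analyticAt_snd
  obtain ⟨c, hc⟩ := hVr.exists_eq_const (F := fun P => ψ P - k * P.2)
    (fun P hP => (aψ P hP).fun_sub (aw P))
    (fun P hP => by
      rw [du_sub (aψ P hP) (aw P), ← du_eq_of_eqOn hVo hψ hP, hΨu P hP, hφw0 P hP]
      simp [du])
    (fun P hP => by
      rw [dw_sub (aψ P hP) (aw P), ← dw_eq_of_eqOn hVo hψ hP, hk P hP]
      simp [dw])
  have h1 : ∀ P ∈ V, du f P * du g P + f P * du (du g) P = 2 * k * (f P * du g P) := fun P hP => by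
    have := hφu P hP
    rw [hφ', du_const_mul, du_mul (af P hP) (analyticAt_du (ag P hP)), hk P hP] at this
    linear_combination this / 2
  refine ⟨V, hV, hVr, k, c, ?_, fun P hP => ⟨?_, hfw P hP, hgw P hP, hgu P hP, h1 P hP, ?_⟩⟩
  · obtain ⟨P, hP⟩ := hVr.nonempty
    rw [← hk P hP]
    exact hk0 P hP
  · linear_combination hc P hP
  -- The last equation is the coefficient of H⁰, where now all terms with χ or a w-derivative
  -- vanish.
  · obtain ⟨μ, hμ⟩ := hne P hP
    have k0 := (cond hP hμ).1
    have z0 : ∀ P ∈ V, dw (dw g) P = 0 := fun P hP => dw_eq_zero_of_eqOn hVo hgw hP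
    have z1 : ∀ P ∈ V, du (dw g) P = 0 := fun P hP => du_eq_zero_of_eqOn hVo hgw hP
    have z2 : ∀ P ∈ V, dw (du (du g)) P = 0 := fun P hP => by
      rw [dw_du (analyticAt_du (ag P hP)), du_eq_zero_of_eqOn hVo hguw hP]
    have d1 : dir (dw Ψ) P μ = 0 := dir_eq_zero_of_eqOn hVo hk hP
    have d2 : dir (dw φ) P μ = 0 := dir_eq_zero_of_eqOn hVo hφw0 hP
    have d3 : dir f P μ = du f P := by rw [dir, hfw P hP, mul_zero, add_zero]
    have d4 : dir2 g P μ = du (du g) P := by rw [dir2, z0 P hP, z1 P hP]; ring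
    have d5 : dir2 (dw g) P μ = 0 := by
      rw [dir2, du_eq_zero_of_eqOn hVo z1 hP, du_eq_zero_of_eqOn hVo z0 hP,
        dw_eq_zero_of_eqOn hVo z0 hP]
      ring
    have d6 : dir3 g P μ = du (du (du g)) P := by
      rw [dir3, d5, dir2, z2 P hP |> fun h => du_eq_zero_of_eqOn hVo hguw hP,
        dw_eq_zero_of_eqOn hVo hguw hP]
      ring
    have d7 : dir2 χ P μ = 0 := by
      have y1 : ∀ P ∈ V, du χ P = 0 := fun P hP => du_eq_zero_of_eqOn hVo hχ0 hP
      have y2 : ∀ P ∈ V, dw χ P = 0 := fun P hP => dw_eq_zero_of_eqOn hVo hχ0 hP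
      rw [dir2, du_eq_zero_of_eqOn hVo y1 hP, du_eq_zero_of_eqOn hVo y2 hP,
        dw_eq_zero_of_eqOn hVo y2 hP]
      ring
    have d8 : dir2 φ P μ = 4 * k ^ 2 * φ P := by
      rw [dir2, du_eq_zero_of_eqOn hVo hφw0 hP, dw_eq_zero_of_eqOn hVo hφw0 hP,
        du_eq_of_eqOn (G := fun P => 2 * k * φ P) hVo (fun Q hQ => by
          rw [hφu Q hQ, hk Q hQ, mul_assoc]) hP, du_const_mul, hφu P hP, hk P hP]
      ring
    rw [d1, d2, d3, d4, d6, d7, d8, hφ'] at k0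
    linear_combination k0 / 4

end Equation

/-! ### The obstruction of order ε⁴ along exponential functions -/

section OrderFour

variable {A : Type} [CommRing A]

/-- Evaluation at points with entries 0, ±1 isolates the coefficients of R_xx³, R_xx²R_x², R_xxxx
R_x², R_xxx R_x³ and R_xxxxx R_x, which suffice for the obstruction. -/
theorem eq_zero_of_order_six [Algebra ℂ A] {c1 c2 c3 c4 c5 c6 c7 c8 c9 c10 : A}
    (h : (MvPolynomial.C c1 * (MvPolynomial.X 1) ^ 3 +
      MvPolynomial.C c2 * ((MvPolynomial.X 1) ^ 2 * (MvPolynomial.X 0) ^ 2) +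
      MvPolynomial.C c3 * (MvPolynomial.X 3 * MvPolynomial.X 1) +
      MvPolynomial.C c4 * (MvPolynomial.X 2 * MvPolynomial.X 1 * MvPolynomial.X 0) +
      MvPolynomial.C c5 * (MvPolynomial.X 1 * (MvPolynomial.X 0) ^ 4) +
      MvPolynomial.C c6 * (MvPolynomial.X 3 * (MvPolynomial.X 0) ^ 2) +
      MvPolynomial.C c7 * (MvPolynomial.X 2) ^ 2 +
      MvPolynomial.C c8 * (MvPolynomial.X 2 * (MvPolynomial.X 0) ^ 3) +
      MvPolynomial.C c9 * (MvPolynomial.X 4 * MvPolynomial.X 0) +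
      MvPolynomial.C c10 * (MvPolynomial.X 0) ^ 6 : DiffPoly A) = 0) :
    c1 = 0 ∧ c2 = 0 ∧ c6 = 0 ∧ c8 = 0 ∧ c9 = 0 := by
  have ev (x : ℕ → A) := congrArg (MvPolynomial.eval x) h
  simp only [map_add, map_mul, map_pow, MvPolynomial.eval_C, MvPolynomial.eval_X, map_zero] at ev
  have e0 := ev fun k => if k = 0 then 1 else 0
  have e1 := ev fun k => if k = 1 then 1 else 0
  have e2 := ev fun k => if k = 2 then 1 else 0
  have e03 := ev fun k => if k = 0 ∨ k = 3 then 1 else 0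
  have e02 := ev fun k => if k = 0 ∨ k = 2 then 1 else 0
  have e04 := ev fun k => if k = 0 ∨ k = 4 then 1 else 0
  have e01 := ev fun k => if k = 0 ∨ k = 1 then 1 else 0
  have e01' := ev fun k => if k = 0 then 1 else if k = 1 then -1 else 0
  simp at e0 e1 e2 e03 e02 e04 e01 e01'
  refine ⟨e1, eq_zero_of_two_mul_eq_zero ?_, ?_, ?_, ?_⟩
  · linear_combination e01 + e01' - 2 * e0
  · linear_combination e03 - e0
  · linear_combination e02 - e0 - e2
  · linear_combination e04 - e0

theorem C_mul_form3 (x a b c : A) : MvPolynomial.C x * form3 a b c = form3 (x * a) (x * b)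
    (x * c) := by
  simp only [form3, map_mul]
  ring

theorem C_mul_form5 (x a b c d e f g : A) : MvPolynomial.C x * form5 a b c d e f g =
    form5 (x * a) (x * b) (x * c) (x * d) (x * e) (x * f) (x * g) := by
  simp only [form5, map_mul]
  ring

theorem totalDeriv_five_C [Algebra ℂ A] (δ : Derivation ℂ A A) (a : A) :
    totalDeriv δ (totalDeriv δ (totalDeriv δ (totalDeriv δ (totalDeriv δ (MvPolynomial.C a))))) =
      form5 (δ a) (5 * δ (δ a)) (10 * δ (δ a)) (10 * δ (δ (δ a))) (15 * δ (δ (δ a)))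
        (10 * δ (δ (δ (δ a)))) (δ (δ (δ (δ (δ a))))) := by
  rw [totalDeriv_totalDeriv_totalDeriv_C, totalDeriv_form3, totalDeriv_form4]
  simp only [Derivation.leibniz, map_add, derivation_ofNat, smul_eq_mul, mul_zero, add_zero]
  congr 1 <;> ring

theorem prolong_ofNat [Algebra ℂ A] (δ : Derivation ℂ A A) (F : ℕ → DiffPoly A) (n : ℕ)
    [n.AtLeastTwo] :
    prolong δ F (ofNat(n) : DiffPoly A) = 0 := by
  rw [← map_ofNat (MvPolynomial.C : A →+* DiffPoly A) n, prolong_C, derivation_ofNat,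
      map_zero, zero_mul]

open PowerSeries (coeff)

variable [Algebra ℂ A] {δ : Derivation ℂ A A} {h : A} {ψ η f g : ℕ → A} {w Y Z : EpsSeries A}

theorem form3_congr {a b c a' b' c' : A} (h1 : a = a') (h2 : b = b') (h3 : c = c') :
    form3 a b c = form3 a' b' c' := by
  rw [h1, h2, h3]

theorem form5_congr {a b c d e f g a' b' c' d' e' f' g' : A} (h1 : a = a') (h2 : b = b') (h3
    : c = c')
    (h4 : d = d') (h5 : e = e') (h6 : f = f') (h7 : g = g') :
    form5 a b c d e f g = form5 a' b' c' d' e' f' g' := by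
  rw [h1, h2, h3, h4, h5, h6, h7]

/-- The relations which hold along the exponential functions `h` for an equation with
`ψ = k w + const`, `η = 1` and functions `f`, `g` of `u` with `f g_u = C e ^ {2 k u}`. -/
structure IsExponential (δ : Derivation ℂ A A) (h : A) (ψ η f g : ℕ → A) (n k a s : A) : Prop where
  deriv_h : δ h = 2 * n
  deriv_n : δ n = k * n
  deriv_k : δ k = 0
  deriv_a : δ a = 2 * a * (k - a)
  deriv_s : δ s = 2 * k * n
  ψ_zero : ψ 0 = s
  ψ_one : ψ 1 = k
  ψ_two : ψ 2 = 0
  η_zero : η 0 = 1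
  η_one : η 1 = 0
  η_two : η 2 = 0
  f_one : f 1 = 0
  f_two : f 2 = 0
  g_one : g 1 = 0
  g_two : g 2 = 0
  mul_deriv_g : f 0 * δ (g 0) = n ^ 2
  deriv_deriv_g : δ (δ (g 0)) = (2 * k - a) * δ (g 0)
  isUnit_n : IsUnit n
  isUnit_k : IsUnit k

namespace IsExponential

variable {n k a s : A}

theorem cancel (E : IsExponential δ h ψ η f g n k a s) {c : ℂ} (hc : c ≠ 0) {x : A} (hx :
    algebraMap ℂ A c * k * n ^ 2 * x = 0) : x = 0 :=
  ((((IsUnit.mk0 c hc).map (algebraMap ℂ A)).mul E.isUnit_k).mul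
    (E.isUnit_n.pow 2)).mul_right_eq_zero.1 hx

theorem iterate_deriv_h (E : IsExponential δ h ψ η f g n k a s) : δ (δ h) = 2 * k * n ∧ δ (δ
    (δ h)) = 2 * k ^ 2 * n ∧
    δ (δ (δ (δ h))) = 2 * k ^ 3 * n ∧ δ (δ (δ (δ (δ h)))) = 2 * k ^ 4 * n := by
  obtain ⟨hh, hn, hk⟩ := (⟨E.deriv_h, E.deriv_n, E.deriv_k⟩ : _ ∧ _ ∧ _)
  have dh2 : δ (δ h) = 2 * k * n := by
    simp only [hh, Derivation.leibniz, derivation_ofNat, smul_eq_mul, hn]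
    ring
  have dh3 : δ (δ (δ h)) = 2 * k ^ 2 * n := by
    simp only [dh2, Derivation.leibniz, derivation_ofNat, smul_eq_mul, hn, hk]
    ring
  have dh4 : δ (δ (δ (δ h))) = 2 * k ^ 3 * n := by
    simp only [dh3, Derivation.leibniz, Derivation.leibniz_pow, derivation_ofNat,
        smul_eq_mul, hn, hk]
    ring
  refine ⟨dh2, dh3, dh4, ?_⟩
  simp only [dh4, Derivation.leibniz, Derivation.leibniz_pow, derivation_ofNat, smul_eq_mul, hn, hk]
  ring

theorem totalDeriv_three_h (E : IsExponential δ h ψ η f g n k a s) : totalDeriv δ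
    (totalDeriv δ (totalDeriv δ (MvPolynomial.C h))) =
    form3 (2 * n) (6 * k * n) (2 * k ^ 2 * n) := by
  obtain ⟨dh2, dh3, -⟩ := E.iterate_deriv_h
  rw [totalDeriv_totalDeriv_totalDeriv_C, dh3, dh2, E.deriv_h]
  exact form3_congr rfl (by ring) rfl

theorem totalDeriv_five_h (E : IsExponential δ h ψ η f g n k a s) : totalDeriv δ (totalDeriv
    δ (totalDeriv δ (totalDeriv δ
    (totalDeriv δ (MvPolynomial.C h))))) = form5 (2 * n) (10 * k * n) (20 * k * n) (20 * k ^ 2 *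
    n) (30 * k ^ 2 * n) (20 * k ^ 3 * n) (2 * k ^ 4 * n) := by
  obtain ⟨dh2, dh3, dh4, dh5⟩ := E.iterate_deriv_h
  rw [totalDeriv_five_C, dh5, dh4, dh3, dh2, E.deriv_h]
  refine form5_congr ?_ ?_ ?_ ?_ ?_ ?_ ?_ <;> ring

/-- Since g'' = (2k - a)g' and a' = 2a(k - a), all higher derivatives of g are polynomials in a, k
times g'. Thus f times any of them is such a polynomial times n². -/
theorem iterate_deriv_g (E : IsExponential δ h ψ η f g n k a s) : δ (δ (δ (g 0))) = (-6 * a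
    * k + 3 * a ^ 2 + 4 * k ^ 2) * δ (g 0) ∧
    δ (δ (δ (δ (g 0)))) = (-28 * a * k ^ 2 + 36 * a ^ 2 * k - 15 * a ^ 3 + 8 * k ^ 3) * δ (g 0) ∧
    δ (δ (δ (δ (δ (g 0))))) = (-120 * a * k ^ 3 + 300 * a ^ 2 * k ^ 2 - 300 * a ^ 3 * k +
        105 * a ^ 4 + 16 * k ^ 4) * δ (g 0) := by
  obtain ⟨hk, ha, hg⟩ := (⟨E.deriv_k, E.deriv_a, E.deriv_deriv_g⟩ : _ ∧ _ ∧ _)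
  have dg3 : δ (δ (δ (g 0))) = (-6 * a * k + 3 * a ^ 2 + 4 * k ^ 2) * δ (g 0) := by
    simp only [hg, Derivation.leibniz, map_sub, derivation_ofNat, smul_eq_mul, ha, hk]
    ring
  have dg4 : δ (δ (δ (δ (g 0)))) = (-28 * a * k ^ 2 + 36 * a ^ 2 * k - 15 * a ^ 3 + 8 * k ^
      3) * δ (g 0) := by
    simp only [hg, Derivation.leibniz, map_add, map_sub, map_zero, derivation_ofNat, smul_eq_mul, ha, hk]
    ring
  refine ⟨dg3, dg4, ?_⟩
  simp only [hg, Derivation.leibniz, map_add, map_sub, map_zero, derivation_ofNat, smul_eq_mul, ha, hk]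
  ring

theorem C_f (f : ℕ → A) : MvPolynomial.C (f 0) = (2⁻¹ : ℂ) • MvPolynomial.C (σ := ℕ) (2 * f 0) := by
  rw [map_mul, map_ofNat, ← ofNat_smul_diffPoly]
  module

theorem mul_totalDeriv_three_g (E : IsExponential δ h ψ η f g n k a s) : MvPolynomial.C (f
    0) * totalDeriv δ (totalDeriv δ
    (totalDeriv δ (MvPolynomial.C (g 0)))) =
    (2⁻¹ : ℂ) • form3 (2 * n ^ 2) (-6 * a * n ^ 2 + 12 * k * n ^ 2) (-12 * a * k * n ^ 2 + 6
        * a ^ 2 * n ^ 2 + 8 * k ^ 2 * n ^ 2) := by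
  obtain ⟨dg3, -⟩ := E.iterate_deriv_g
  have hp := E.mul_deriv_g
  rw [C_f, smul_mul_assoc]
  refine congrArg _ ?_
  rw [totalDeriv_totalDeriv_totalDeriv_C, dg3, E.deriv_deriv_g, C_mul_form3]
  refine form3_congr ?_ ?_ ?_
  · linear_combination (2) * hp
  · linear_combination (-6 * a + 12 * k) * hp
  · linear_combination (-12 * a * k + 6 * a ^ 2 + 8 * k ^ 2) * hp

theorem mul_totalDeriv_five_g (E : IsExponential δ h ψ η f g n k a s) : MvPolynomial.C (f 0)
    * totalDeriv δ (totalDeriv δ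
    (totalDeriv δ (totalDeriv δ (totalDeriv δ (MvPolynomial.C (g 0)))))) =
    (2⁻¹ : ℂ) • form5 (2 * n ^ 2) (-10 * a * n ^ 2 + 20 * k * n ^ 2) (-20 * a * n ^ 2 + 40 *
        k * n ^ 2) (-120 * a * k * n ^ 2 + 60 * a ^ 2 * n ^ 2 + 80 * k ^ 2 * n ^ 2) (-180 * a *
        k * n ^ 2 + 90 * a ^ 2 * n ^ 2 + 120 * k ^ 2 * n ^ 2) (-560 * a * k ^ 2 * n ^ 2 + 720 *
        a ^ 2 * k * n ^ 2 - 300 * a ^ 3 * n ^ 2 + 160 * k ^ 3 * n ^ 2) (-240 * a * k ^ 3 * n ^ 2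
        + 600 * a ^ 2 * k ^ 2 * n ^ 2 - 600 * a ^ 3 * k * n ^ 2 + 210 * a ^ 4 * n ^ 2 + 32 * k ^
        4 * n ^ 2) := by
  obtain ⟨dg3, dg4, dg5⟩ := E.iterate_deriv_g
  have hp := E.mul_deriv_g
  rw [C_f, smul_mul_assoc]
  refine congrArg _ ?_
  rw [totalDeriv_five_C, dg5, dg4, dg3, E.deriv_deriv_g, C_mul_form5]
  refine form5_congr ?_ ?_ ?_ ?_ ?_ ?_ ?_
  · linear_combination (2) * hp
  · linear_combination (-10 * a + 20 * k) * hp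
  · linear_combination (-20 * a + 40 * k) * hp
  · linear_combination (-120 * a * k + 60 * a ^ 2 + 80 * k ^ 2) * hp
  · linear_combination (-180 * a * k + 90 * a ^ 2 + 120 * k ^ 2) * hp
  · linear_combination (-560 * a * k ^ 2 + 720 * a ^ 2 * k - 300 * a ^ 3 + 160 * k ^ 3) * hp
  · linear_combination (-240 * a * k ^ 3 + 600 * a ^ 2 * k ^ 2 - 600 * a ^ 3 * k + 210 * a ^
      4 + 32 * k ^ 4) * hp

/-- Along these functions the cubic is 8kn², a unit, and the source term of the first order relation
is zero. -/
theorem coeff_one_w (E : IsExponential δ h ψ η f g n k a s)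
    (H : IsDeformation δ 4 h ψ η f g f g w Y Z) : coeff 1 w = 0 := by
  obtain ⟨b, hb, hD⟩ := H.compatibility_one
  have e := (hD (s + 4 * n) (8 * k * n ^ 2) 0 _ _ (by
    rw [E.ψ_zero, E.η_zero, E.g_one, E.deriv_h]; ring) (by
    have e : ψ 0 * δ h + η 0 * δ h ^ 2 + f 0 * δ (g 0) + f 0 * δ (g 0) = 2 * s * n + 6 * n ^ 2 := by
      rw [E.ψ_zero, E.η_zero, E.deriv_h]
      linear_combination 2 * E.mul_deriv_g
    rw [e, E.iterate_deriv_h.1]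
    simp only [Derivation.leibniz, Derivation.leibniz_pow, map_add, derivation_ofNat, smul_eq_mul,
      E.deriv_n, E.deriv_s]
    ring) (sub_self _).symm rfl rfl).1
  have hb0 : b = 0 := by
    refine E.cancel (c := 16) (by norm_num) ?_
    rw [map_ofNat]
    linear_combination e
  rw [hb, hb0, map_zero, zero_mul]

theorem coeff_zero_Y (E : IsExponential δ h ψ η f g n k a s)
    (H : IsDeformation δ 4 h ψ η f g f g w Y Z) : coeff 0 Y = MvPolynomial.C (2 * n) *
        MvPolynomial.X 0 := by
  rw [H.leading_Y, E.deriv_h]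

theorem coeff_zero_Z (E : IsExponential δ h ψ η f g n k a s)
    (H : IsDeformation δ 4 h ψ η f g f g w Y Z) : coeff 0 Z = MvPolynomial.C (s * (2 * n) +
        6 * n ^ 2) * MvPolynomial.X 0 := by
  rw [H.order_zero, E.ψ_zero, E.η_zero, E.deriv_h]
  refine congrArg (fun x => MvPolynomial.C x * MvPolynomial.X 0) ?_
  linear_combination 2 * E.mul_deriv_g

theorem coeff_two_Y (E : IsExponential δ h ψ η f g n k a s)
    (H : IsDeformation δ 4 h ψ η f g f g w Y Z) {q2 q11 : A} (hw2 : coeff 2 w = (24⁻¹ : ℂ) •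
        form2 q2 q11) :
    coeff 2 Y = (24⁻¹ : ℂ) • form3 (-4 * n + q2) (-12 * k * n + 2 * q11 + (δ q2)) (-4 * k ^
        2 * n + (δ q11)) := by
  have e : form3 (-4 * n + q2) (-12 * k * n + 2 * q11 + (δ q2)) (-4 * k ^ 2 * n + (δ q11)) =
      totalDeriv δ (form2 q2 q11) - (2 : ℂ) • form3 (2 * n) (6 * k * n) (2 * k ^ 2 * n) := by
    rw [ofNat_smul_diffPoly, totalDeriv_form2]
    simp only [form3, map_add, map_neg, map_mul, map_ofNat]
    ring
  rw [((nonlocality_iff δ w Y).1 H.nonlocality).2.2.1, hw2, H.leading_w, E.totalDeriv_three_h, e,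
    totalDeriv_smul]
  module

-- Z is kept in the form s Y + z, so that the undifferentiated s disappears from the commutator of
-- order ε².
set_option maxHeartbeats 2000000 in
theorem coeff_two_Z (E : IsExponential δ h ψ η f g n k a s)
    (H : IsDeformation δ 4 h ψ η f g f g w Y Z) {q2 q11 : A} (hw2 : coeff 2 w = (24⁻¹ : ℂ) •
        form2 q2 q11) :
    coeff 2 Z = (24⁻¹ : ℂ) • form3 (s * (-4 * n + q2) + (4 * q2 * n)) (s * (-12 * k * n + 2
        * q11 + (δ q2)) + (-24 * a * n ^ 2 + 24 * k * n ^ 2 + 8 * k * q2 * n + 8 * q11 * n + 4 *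
        (δ q2) * n)) (s * (-4 * k ^ 2 * n + (δ q11)) + (-48 * a * k * n ^ 2 + 24 * a ^ 2 * n ^ 2
        + 6 * k * q11 * n + 24 * k ^ 2 * n ^ 2 + 2 * k ^ 2 * q2 * n + 4 * (δ q11) * n)) := by
  have hw := E.coeff_one_w H
  have hY1 := (H.coeff_one_eq_zero hw).1
  have e : form3 (s * (-4 * n + q2) + (4 * q2 * n)) (s * (-12 * k * n + 2 * q11 + (δ q2)) +
      (-24 * a * n ^ 2 + 24 * k * n ^ 2 + 8 * k * q2 * n + 8 * q11 * n + 4 * (δ q2) * n)) (s *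
      (-4 * k ^ 2 * n + (δ q11)) + (-48 * a * k * n ^ 2 + 24 * a ^ 2 * n ^ 2 + 6 * k * q11 * n +
      24 * k ^ 2 * n ^ 2 + 2 * k ^ 2 * q2 * n + 4 * (δ q11) * n)) = MvPolynomial.C s * form3 (-4
      * n + q2) (-12 * k * n + 2 * q11 + (δ q2)) (-4 * k ^ 2 * n + (δ q11)) + MvPolynomial.C k *
      form2 q2 q11 * (MvPolynomial.C (2 * n) * MvPolynomial.X 0) + (flowBy δ (MvPolynomial.C (2
      * n) * MvPolynomial.X 0) (form2 q2 q11) + MvPolynomial.C (2 * n) * form3 (-4 * n + q2)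
      (-12 * k * n + 2 * q11 + (δ q2)) (-4 * k ^ 2 * n + (δ q11))) + (4 : ℂ) • form3 (2 * n ^ 2)
      (-6 * a * n ^ 2 + 12 * k * n ^ 2) (-12 * a * k * n ^ 2 + 6 * a ^ 2 * n ^ 2 + 8 * k ^ 2 * n
      ^ 2) := by
    have hn := E.deriv_n
    have hk := E.deriv_k
    have ha := E.deriv_a
    rw [ofNat_smul_diffPoly]
    simp only [flowBy, form2, form3, pow_succ, pow_zero, one_mul, prolong_add,
      prolong_mul, prolong_C, prolong_X, Function.iterate_succ_apply', Function.iterate_zero_apply,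
      totalDeriv_add, totalDeriv_mul, totalDeriv_C, totalDeriv_X, map_add, map_mul,
          map_neg,
      map_ofNat, hn, hk, map_zero, mul_zero,
      add_zero, zero_add, zero_mul, totalDeriv_ofNat]
    ring
  rw [H.equation 2 (by norm_num), e]
  simp only [map_add, PowerSeries.coeff_mul, sum_antidiagonal_one, sum_antidiagonal_two,
      sum_antidiagonal_zero, coeff_flowDeriv, coeff_forwardDiff,
      coeff_backwardDiff, H.leading_w, hw, hw2, E.coeff_zero_Y H, hY1, E.coeff_two_Y H hw2,
      coeff_evalAt_zero, coeff_evalAt_one, coeff_evalAt_two _ H.leading_w hw, coeff_evalAt_three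
      _ H.leading_w hw, E.ψ_zero, E.ψ_one, E.η_zero, E.η_one, E.f_one,
      E.g_one, flowBy_zero, flowBy_zero_left, map_zero, zero_mul, mul_zero,
      add_zero, zero_add, smul_zero, map_one, one_mul, Nat.reduceAdd, coeff_shift_one,
      coeff_shift_two, coeff_shift_three, totalDeriv_zero, sub_zero, zero_sub]
  simp only [mul_smul_comm, smul_mul_assoc, flowBy_smul, flowBy_C,
      E.deriv_h, E.mul_totalDeriv_three_g, mul_neg]
  module

/-- The terms of the second order. -/
theorem coeff_two (E : IsExponential δ h ψ η f g n k a s)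
    (H : IsDeformation δ 4 h ψ η f g f g w Y Z) : coeff 2 w = (24⁻¹ : ℂ) • form2 (8 * n) ((9
        * k - 3 * a) * n) ∧ coeff 2 Y
    = (24⁻¹ : ℂ) • form3 (4 * n) (-6 * a * n + 14 * k * n) (-9 * a * k * n + 6 * a ^ 2 * n + 5 *
    k ^ 2 * n) ∧
    coeff 2 Z = (24⁻¹ : ℂ) • form3 (s * (4 * n) + (32 * n ^ 2)) (s * (-6 * a * n + 14 * k *
        n) + (-48 * a * n ^ 2 + 192 * k * n ^ 2)) (s * (-9 * a * k * n + 6 * a ^ 2 * n + 5 * k ^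
        2 * n) + (-102 * a * k * n ^ 2 + 48 * a ^ 2 * n ^ 2 + 130 * k ^ 2 * n ^ 2)) := by
  obtain ⟨q2, q11, hw2⟩ : ∃ q2 q11, coeff 2 w = (24⁻¹ : ℂ) • form2 q2 q11 := by
    obtain ⟨b, c, hbc⟩ := exists_eq_form2 (H.homogeneous_w 2)
    refine ⟨24 * b, 24 * c, ?_⟩
    have e : form2 (24 * b) (24 * c) = (24 : ℂ) • form2 b c := by
      rw [ofNat_smul_diffPoly]
      simp only [form2, map_mul, map_ofNat]
      ring
    rw [hbc, e]
    module
  have hY2 := E.coeff_two_Y H hw2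
  have hZ2 := E.coeff_two_Z H hw2
  obtain ⟨hY1, hZ1⟩ := H.coeff_one_eq_zero (E.coeff_one_w H)
  have hn := E.deriv_n
  have hk := E.deriv_k
  have ha := E.deriv_a
  have hs := E.deriv_s
  have hC2 := H.compatibility 2 (by norm_num)
  rw [coeff_flowDeriv, coeff_flowDeriv, sum_antidiagonal_two, sum_antidiagonal_two, hY1,
      hZ1, E.coeff_zero_Z H,
    hY2, hZ2, E.coeff_zero_Y H, flowBy_zero, add_zero, add_zero] at hC2
  simp only [flowBy_smul, flowBy_smul_left, ← smul_add] at hC2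
  replace hC2 := smul_right_injective _ (inv_ne_zero (OfNat.ofNat_ne_zero 24 : (24 : ℂ) ≠ 0)) hC2
  have k2 := commutator_two_add_mul δ s (2 * n) (6 * n ^ 2)  (-4 * n + q2) (-12 * k * n + 2
      * q11 + (δ q2)) (-4 * k ^ 2 * n + (δ q11))  (4 * q2 * n) (-24 * a * n ^ 2 + 24 * k * n ^ 2
      + 8 * k * q2 * n + 8 * q11 * n + 4 * (δ q2) * n) (-48 * a * k * n ^ 2 + 24 * a ^ 2 * n ^ 2
      + 6 * k * q11 * n + 24 * k ^ 2 * n ^ 2 + 2 * k ^ 2 * q2 * n + 4 * (δ q11) * n)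
  rw [sub_sub, hC2, sub_self] at k2
  obtain ⟨e2, e1, -⟩ := eq_zero_of_order_four k2.symm
  clear k2 hC2
  -- The coefficient of R_xxx R_x in the commutator determines q2, and then that of R_xx R_x²
  -- determines q11.
  have hq2 : q2 = 8 * n := by
    refine sub_eq_zero.1 (E.cancel (c := 24) (by norm_num) ?_)
    rw [map_ofNat]
    simp only [Derivation.leibniz, Derivation.leibniz_pow, derivation_ofNat, smul_eq_mul,
        hn, hs, mul_zero, add_zero, nsmul_eq_mul, Nat.cast_ofNat, Nat.reduceSub, pow_one] at e1
    linear_combination e1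
  subst hq2
  have hq11 : q11 = (9 * k - 3 * a) * n := by
    refine sub_eq_zero.1 (E.cancel (c := 48) (by norm_num) ?_)
    rw [map_ofNat]
    simp only [Derivation.leibniz, Derivation.leibniz_pow, derivation_ofNat, smul_eq_mul,
        hn, hs, mul_zero, add_zero, hk,
        nsmul_eq_mul, Nat.cast_ofNat, Nat.reduceSub, pow_one] at e2
    linear_combination e2
  subst hq11
  refine ⟨hw2, hY2.trans (congrArg _ (form3_congr ?_ ?_ ?_)), hZ2.trans (congrArg _
      (form3_congr ?_ ?_ ?_))⟩ <;>
  first | ring1 | (simp only [Derivation.leibniz, derivation_ofNat,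
      smul_eq_mul, hn, map_sub, mul_zero, add_zero, hk, ha]; ring1)

theorem coeff_four_Y (E : IsExponential δ h ψ η f g n k a s)
    (H : IsDeformation δ 4 h ψ η f g f g w Y Z) {q4 q31 q22 q211 q1111 : A} (hw4 : coeff 4 w
        = (5760⁻¹ : ℂ) • form4 q4
    q31 q22 q211 q1111) :
    coeff 4 Y = (5760⁻¹ : ℂ) • form5 (-64 * n + q4) (120 * a * n - 360 * k * n + q31 + (δ
        q4)) (360 * a * n - 760 * k * n + q31 + 2 * q22) (1260 * a * k * n - 840 * a ^ 2 * n -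
        780 * k ^ 2 * n + q211 + (δ q31)) (2160 * a * k * n - 1440 * a ^ 2 * n - 1200 * k ^ 2 *
        n + 2 * q211 + (δ q22)) (4860 * a * k ^ 2 * n - 8640 * a ^ 2 * k * n + 4320 * a ^ 3 * n
        - 820 * k ^ 3 * n + 4 * q1111 + (δ q211)) (1620 * a * k ^ 3 * n - 5880 * a ^ 2 * k ^ 2 *
        n + 7200 * a ^ 3 * k * n - 2880 * a ^ 4 * n - 84 * k ^ 4 * n + (δ q1111)) := by
  have e : form5 (-64 * n + q4) (120 * a * n - 360 * k * n + q31 + (δ q4)) (360 * a * n -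
      760 * k * n + q31 + 2 * q22) (1260 * a * k * n - 840 * a ^ 2 * n - 780 * k ^ 2 * n + q211
      + (δ q31)) (2160 * a * k * n - 1440 * a ^ 2 * n - 1200 * k ^ 2 * n + 2 * q211 + (δ q22))
      (4860 * a * k ^ 2 * n - 8640 * a ^ 2 * k * n + 4320 * a ^ 3 * n - 820 * k ^ 3 * n + 4 *
      q1111 + (δ q211)) (1620 * a * k ^ 3 * n - 5880 * a ^ 2 * k ^ 2 * n + 7200 * a ^ 3 * k * n
      - 2880 * a ^ 4 * n - 84 * k ^ 4 * n + (δ q1111)) = totalDeriv δ (form4 q4 q31 q22 q211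
      q1111) - (20 : ℂ) • totalDeriv δ (totalDeriv δ (totalDeriv δ (form2 (8 * n) ((9 * k - 3 *
      a) * n)))) + (48 : ℂ) • form5 (2 * n) (10 * k * n) (20 * k * n) (20 * k ^ 2 * n) (30 * k ^
      2 * n) (20 * k ^ 3 * n) (2 * k ^ 4 * n) := by
    have hn := E.deriv_n
    have hk := E.deriv_k
    have ha := E.deriv_a
    rw [ofNat_smul_diffPoly, ofNat_smul_diffPoly, totalDeriv_form2, totalDeriv_form3,
        totalDeriv_form4, totalDeriv_form4]
    simp only [form5, map_add, map_sub, map_neg, map_mul, map_pow, map_ofNat,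
        Derivation.leibniz, derivation_ofNat, smul_eq_mul, mul_zero, add_zero, hn, hk, ha, zero_sub]
    ring
  rw [((nonlocality_iff δ w Y).1 H.nonlocality).2.2.2.2, hw4, (E.coeff_two H).1,
      H.leading_w, E.totalDeriv_five_h, e]
  simp only [totalDeriv_smul]
  module

theorem coeff_five_diff (E : IsExponential δ h ψ η f g n k a s)
    (H : IsDeformation δ 4 h ψ η f g f g w Y Z) (c : ℂ) : coeff 5 (shift δ c (evalAt h g w))
        - coeff 5 (evalAt h g w) =
    (c ^ 5 / 120) • totalDeriv δ (totalDeriv δ (totalDeriv δ (totalDeriv δ (totalDeriv δ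
        (MvPolynomial.C (g 0)))))) := by
  rw [coeff_shift_five, coeff_evalAt_zero, coeff_evalAt_one, coeff_evalAt_two g H.leading_w
      (E.coeff_one_w H), coeff_evalAt_three g H.leading_w (E.coeff_one_w H), coeff_evalAt_four g
      H.leading_w (E.coeff_one_w H)]
  simp [E.g_one, E.g_two, totalDeriv_zero]

-- The terms of order ε² are now known explicitly, so the only unknowns left in Z are the five
-- coefficients of w at order ε⁴.
set_option maxHeartbeats 4000000 in
theorem coeff_four_Z (E : IsExponential δ h ψ η f g n k a s)
    (H : IsDeformation δ 4 h ψ η f g f g w Y Z) {q4 q31 q22 q211 q1111 : A} (hw4 : coeff 4 w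
        = (5760⁻¹ : ℂ) • form4 q4
    q31 q22 q211 q1111) :
    coeff 4 Z = (5760⁻¹ : ℂ) • form5 (s * (-64 * n + q4) + (288 * n ^ 2 + 4 * q4 * n)) (s *
        (120 * a * n - 360 * k * n + q31 + (δ q4)) + (-960 * a * n ^ 2 + 2720 * k * n ^ 2 + 12 *
        k * q4 * n + 4 * q31 * n + 4 * (δ q4) * n)) (s * (360 * a * n - 760 * k * n + q31 + 2 *
        q22) + (-1680 * a * n ^ 2 + 4720 * k * n ^ 2 + 20 * k * q4 * n + 4 * q31 * n + 8 * q22 *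
        n)) (s * (1260 * a * k * n - 840 * a ^ 2 * n - 780 * k ^ 2 * n + q211 + (δ q31)) +
        (-10920 * a * k * n ^ 2 + 5160 * a ^ 2 * n ^ 2 + 12 * k * q31 * n + 10000 * k ^ 2 * n ^
        2 + 20 * k ^ 2 * q4 * n + 4 * q211 * n + 4 * (δ q31) * n)) (s * (2160 * a * k * n - 1440
        * a ^ 2 * n - 1200 * k ^ 2 * n + 2 * q211 + (δ q22)) + (-15840 * a * k * n ^ 2 + 7560 *
        a ^ 2 * n ^ 2 + 6 * k * q31 * n + 14 * k * q22 * n + 13880 * k ^ 2 * n ^ 2 + 30 * k ^ 2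
        * q4 * n + 8 * q211 * n + 4 * (δ q22) * n)) (s * (4860 * a * k ^ 2 * n - 8640 * a ^ 2 *
        k * n + 4320 * a ^ 3 * n - 820 * k ^ 3 * n + 4 * q1111 + (δ q211)) + (-50640 * a * k ^ 2
        * n ^ 2 + 62460 * a ^ 2 * k * n ^ 2 - 25200 * a ^ 3 * n ^ 2 + 12 * k * q211 * n + 12 * k
        ^ 2 * q31 * n + 4 * k ^ 2 * q22 * n + 18500 * k ^ 3 * n ^ 2 + 20 * k ^ 3 * q4 * n + 16 *
        q1111 * n + 4 * (δ q211) * n)) (s * (1620 * a * k ^ 3 * n - 5880 * a ^ 2 * k ^ 2 * n +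
        7200 * a ^ 3 * k * n - 2880 * a ^ 4 * n - 84 * k ^ 4 * n + (δ q1111)) + (-22140 * a * k
        ^ 3 * n ^ 2 + 53280 * a ^ 2 * k ^ 2 * n ^ 2 - 51660 * a ^ 3 * k * n ^ 2 + 17640 * a ^ 4
        * n ^ 2 + 10 * k * q1111 * n + 2 * k ^ 2 * q211 * n + 2 * k ^ 3 * q31 * n + 3568 * k ^ 4
        * n ^ 2 + 2 * k ^ 4 * q4 * n + 4 * (δ q1111) * n)) := by
  have hw := E.coeff_one_w H
  have hY1 := (H.coeff_one_eq_zero hw).1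
  have e : form5 (s * (-64 * n + q4) + (288 * n ^ 2 + 4 * q4 * n)) (s * (120 * a * n - 360 *
      k * n + q31 + (δ q4)) + (-960 * a * n ^ 2 + 2720 * k * n ^ 2 + 12 * k * q4 * n + 4 * q31 *
      n + 4 * (δ q4) * n)) (s * (360 * a * n - 760 * k * n + q31 + 2 * q22) + (-1680 * a * n ^ 2
      + 4720 * k * n ^ 2 + 20 * k * q4 * n + 4 * q31 * n + 8 * q22 * n)) (s * (1260 * a * k * n
      - 840 * a ^ 2 * n - 780 * k ^ 2 * n + q211 + (δ q31)) + (-10920 * a * k * n ^ 2 + 5160 * a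
      ^ 2 * n ^ 2 + 12 * k * q31 * n + 10000 * k ^ 2 * n ^ 2 + 20 * k ^ 2 * q4 * n + 4 * q211 *
      n + 4 * (δ q31) * n)) (s * (2160 * a * k * n - 1440 * a ^ 2 * n - 1200 * k ^ 2 * n + 2 *
      q211 + (δ q22)) + (-15840 * a * k * n ^ 2 + 7560 * a ^ 2 * n ^ 2 + 6 * k * q31 * n + 14 *
      k * q22 * n + 13880 * k ^ 2 * n ^ 2 + 30 * k ^ 2 * q4 * n + 8 * q211 * n + 4 * (δ q22) *
      n)) (s * (4860 * a * k ^ 2 * n - 8640 * a ^ 2 * k * n + 4320 * a ^ 3 * n - 820 * k ^ 3 * n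
      + 4 * q1111 + (δ q211)) + (-50640 * a * k ^ 2 * n ^ 2 + 62460 * a ^ 2 * k * n ^ 2 - 25200
      * a ^ 3 * n ^ 2 + 12 * k * q211 * n + 12 * k ^ 2 * q31 * n + 4 * k ^ 2 * q22 * n + 18500 *
      k ^ 3 * n ^ 2 + 20 * k ^ 3 * q4 * n + 16 * q1111 * n + 4 * (δ q211) * n)) (s * (1620 * a *
      k ^ 3 * n - 5880 * a ^ 2 * k ^ 2 * n + 7200 * a ^ 3 * k * n - 2880 * a ^ 4 * n - 84 * k ^
      4 * n + (δ q1111)) + (-22140 * a * k ^ 3 * n ^ 2 + 53280 * a ^ 2 * k ^ 2 * n ^ 2 - 51660 *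
      a ^ 3 * k * n ^ 2 + 17640 * a ^ 4 * n ^ 2 + 10 * k * q1111 * n + 2 * k ^ 2 * q211 * n + 2
      * k ^ 3 * q31 * n + 3568 * k ^ 4 * n ^ 2 + 2 * k ^ 4 * q4 * n + 4 * (δ q1111) * n)) =
      MvPolynomial.C s * form5 (-64 * n + q4) (120 * a * n - 360 * k * n + q31 + (δ q4)) (360 *
      a * n - 760 * k * n + q31 + 2 * q22) (1260 * a * k * n - 840 * a ^ 2 * n - 780 * k ^ 2 * n
      + q211 + (δ q31)) (2160 * a * k * n - 1440 * a ^ 2 * n - 1200 * k ^ 2 * n + 2 * q211 + (δ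
      q22)) (4860 * a * k ^ 2 * n - 8640 * a ^ 2 * k * n + 4320 * a ^ 3 * n - 820 * k ^ 3 * n +
      4 * q1111 + (δ q211)) (1620 * a * k ^ 3 * n - 5880 * a ^ 2 * k ^ 2 * n + 7200 * a ^ 3 * k
      * n - 2880 * a ^ 4 * n - 84 * k ^ 4 * n + (δ q1111)) + (10 : ℂ) • (MvPolynomial.C k *
      form2 (8 * n) ((9 * k - 3 * a) * n) * form3 (4 * n) (-6 * a * n + 14 * k * n) (-9 * a * k
      * n + 6 * a ^ 2 * n + 5 * k ^ 2 * n)) + MvPolynomial.C k * form4 q4 q31 q22 q211 q1111 *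
      (MvPolynomial.C (2 * n) * MvPolynomial.X 0) + (flowBy δ (MvPolynomial.C (2 * n) *
      MvPolynomial.X 0) (form4 q4 q31 q22 q211 q1111) + (10 : ℂ) • flowBy δ (form3 (4 * n) (-6 *
      a * n + 14 * k * n) (-9 * a * k * n + 6 * a ^ 2 * n + 5 * k ^ 2 * n)) (form2 (8 * n) ((9 *
      k - 3 * a) * n)) + MvPolynomial.C (2 * n) * form5 (-64 * n + q4) (120 * a * n - 360 * k *
      n + q31 + (δ q4)) (360 * a * n - 760 * k * n + q31 + 2 * q22) (1260 * a * k * n - 840 * a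
      ^ 2 * n - 780 * k ^ 2 * n + q211 + (δ q31)) (2160 * a * k * n - 1440 * a ^ 2 * n - 1200 *
      k ^ 2 * n + 2 * q211 + (δ q22)) (4860 * a * k ^ 2 * n - 8640 * a ^ 2 * k * n + 4320 * a ^
      3 * n - 820 * k ^ 3 * n + 4 * q1111 + (δ q211)) (1620 * a * k ^ 3 * n - 5880 * a ^ 2 * k ^
      2 * n + 7200 * a ^ 3 * k * n - 2880 * a ^ 4 * n - 84 * k ^ 4 * n + (δ q1111))) + (48 : ℂ)
      • form5 (2 * n ^ 2) (-10 * a * n ^ 2 + 20 * k * n ^ 2) (-20 * a * n ^ 2 + 40 * k * n ^ 2)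
      (-120 * a * k * n ^ 2 + 60 * a ^ 2 * n ^ 2 + 80 * k ^ 2 * n ^ 2) (-180 * a * k * n ^ 2 +
      90 * a ^ 2 * n ^ 2 + 120 * k ^ 2 * n ^ 2) (-560 * a * k ^ 2 * n ^ 2 + 720 * a ^ 2 * k * n
      ^ 2 - 300 * a ^ 3 * n ^ 2 + 160 * k ^ 3 * n ^ 2) (-240 * a * k ^ 3 * n ^ 2 + 600 * a ^ 2 *
      k ^ 2 * n ^ 2 - 600 * a ^ 3 * k * n ^ 2 + 210 * a ^ 4 * n ^ 2 + 32 * k ^ 4 * n ^ 2) := by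
    have hn := E.deriv_n
    have hk := E.deriv_k
    have ha := E.deriv_a
    simp only [ofNat_smul_diffPoly]
    simp only [flowBy, form2, form3, form4, form5, pow_succ, pow_zero, one_mul, prolong_add,
      prolong_mul, prolong_C, prolong_X, Function.iterate_succ_apply', Function.iterate_zero_apply,
      totalDeriv_add, totalDeriv_mul, totalDeriv_C, totalDeriv_X, map_add, map_sub, map_mul,
          map_neg,
      map_ofNat, hn, hk, ha, map_zero, mul_zero,
      add_zero, zero_add, zero_mul, neg_zero, totalDeriv_ofNat, totalDeriv_neg,
          totalDeriv_sub, prolong_ofNat, prolong_sub]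
    ring
  have hg5 := E.coeff_five_diff H
  have hb5 : coeff 5 (evalAt h g w) - coeff 5 (shift δ (-1) (evalAt h g w)) =
      (120⁻¹ : ℂ) • totalDeriv δ (totalDeriv δ (totalDeriv δ (totalDeriv δ (totalDeriv δ
          (MvPolynomial.C (g 0)))))) := by
    rw [← neg_sub, hg5]
    module
  rw [H.equation 4 (by norm_num), e]
  simp only [map_add, PowerSeries.coeff_mul, sum_antidiagonal_one, sum_antidiagonal_two,
      sum_antidiagonal_three, sum_antidiagonal_four, sum_antidiagonal_zero, coeff_flowDeriv,
      coeff_forwardDiff, coeff_backwardDiff, H.leading_w, hw, (E.coeff_two H).1, hw4,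
      E.coeff_zero_Y H, hY1, (E.coeff_two H).2.1, E.coeff_four_Y H hw4, coeff_evalAt_zero,
      coeff_evalAt_one, coeff_evalAt_two _ H.leading_w hw, coeff_evalAt_three _ H.leading_w hw,
      coeff_evalAt_four _ H.leading_w hw, E.ψ_zero, E.ψ_one, E.ψ_two, E.η_zero, E.η_one,
      E.η_two, E.f_one, E.f_two, E.g_one, E.g_two, flowBy_zero, flowBy_zero_left, map_zero,
      zero_mul, mul_zero, add_zero, zero_add, smul_zero, map_one, one_mul, Nat.reduceAdd,
      coeff_shift_one, coeff_shift_two, coeff_shift_three, coeff_shift_four, totalDeriv_zero,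
      hg5, hb5, sub_zero, zero_sub]
  simp only [mul_smul_comm, smul_mul_assoc, flowBy_smul, flowBy_smul_left, flowBy_C,
      E.deriv_h, E.mul_totalDeriv_five_g]
  module

set_option maxHeartbeats 4000000 in
/-- The obstruction at the fourth order. -/
theorem mul_sub_eq_zero (E : IsExponential δ h ψ η f g n k a s)
    (H : IsDeformation δ 4 h ψ η f g f g w Y Z) : a * (k - a) = 0 := by
  obtain ⟨q4, q31, q22, q211, q1111, hw4⟩ : ∃ q4 q31 q22 q211 q1111,
      coeff 4 w = (5760⁻¹ : ℂ) • form4 q4 q31 q22 q211 q1111 := by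
    obtain ⟨b1, b2, b3, b4, b5, hb⟩ := exists_eq_form4 (H.homogeneous_w 4)
    refine ⟨5760 * b1, 5760 * b2, 5760 * b3, 5760 * b4, 5760 * b5, ?_⟩
    have e : form4 (5760 * b1) (5760 * b2) (5760 * b3) (5760 * b4) (5760 * b5) =
        (5760 : ℂ) • form4 b1 b2 b3 b4 b5 := by
      rw [ofNat_smul_diffPoly]
      simp only [form4, map_mul, map_ofNat]
      ring
    rw [hb, e]
    module
  obtain ⟨hY1, hZ1⟩ := H.coeff_one_eq_zero (E.coeff_one_w H)
  have hC4 := H.compatibility 4 (by norm_num)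
  simp only [coeff_flowDeriv, sum_antidiagonal_four, hY1, hZ1, E.coeff_zero_Z H,
      (E.coeff_two H).2.1, (E.coeff_two H).2.2, E.coeff_zero_Y H, E.coeff_four_Y H hw4,
      E.coeff_four_Z H hw4, flowBy_zero, flowBy_zero_left, add_zero, flowBy_smul,
      flowBy_smul_left] at hC4
  have k4 := commutator_four_add_mul δ s (2 * n) (6 * n ^ 2)  (4 * n) (-6 * a * n + 14 * k *
      n) (-9 * a * k * n + 6 * a ^ 2 * n + 5 * k ^ 2 * n)  (32 * n ^ 2) (-48 * a * n ^ 2 + 192 *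
      k * n ^ 2) (-102 * a * k * n ^ 2 + 48 * a ^ 2 * n ^ 2 + 130 * k ^ 2 * n ^ 2)  (-64 * n +
      q4) (120 * a * n - 360 * k * n + q31 + (δ q4)) (360 * a * n - 760 * k * n + q31 + 2 * q22)
      (1260 * a * k * n - 840 * a ^ 2 * n - 780 * k ^ 2 * n + q211 + (δ q31)) (2160 * a * k * n
      - 1440 * a ^ 2 * n - 1200 * k ^ 2 * n + 2 * q211 + (δ q22)) (4860 * a * k ^ 2 * n - 8640 *
      a ^ 2 * k * n + 4320 * a ^ 3 * n - 820 * k ^ 3 * n + 4 * q1111 + (δ q211)) (1620 * a * k ^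
      3 * n - 5880 * a ^ 2 * k ^ 2 * n + 7200 * a ^ 3 * k * n - 2880 * a ^ 4 * n - 84 * k ^ 4 *
      n + (δ q1111))  (288 * n ^ 2 + 4 * q4 * n) (-960 * a * n ^ 2 + 2720 * k * n ^ 2 + 12 * k *
      q4 * n + 4 * q31 * n + 4 * (δ q4) * n) (-1680 * a * n ^ 2 + 4720 * k * n ^ 2 + 20 * k * q4
      * n + 4 * q31 * n + 8 * q22 * n) (-10920 * a * k * n ^ 2 + 5160 * a ^ 2 * n ^ 2 + 12 * k *
      q31 * n + 10000 * k ^ 2 * n ^ 2 + 20 * k ^ 2 * q4 * n + 4 * q211 * n + 4 * (δ q31) * n)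
      (-15840 * a * k * n ^ 2 + 7560 * a ^ 2 * n ^ 2 + 6 * k * q31 * n + 14 * k * q22 * n +
      13880 * k ^ 2 * n ^ 2 + 30 * k ^ 2 * q4 * n + 8 * q211 * n + 4 * (δ q22) * n) (-50640 * a
      * k ^ 2 * n ^ 2 + 62460 * a ^ 2 * k * n ^ 2 - 25200 * a ^ 3 * n ^ 2 + 12 * k * q211 * n +
      12 * k ^ 2 * q31 * n + 4 * k ^ 2 * q22 * n + 18500 * k ^ 3 * n ^ 2 + 20 * k ^ 3 * q4 * n +
      16 * q1111 * n + 4 * (δ q211) * n) (-22140 * a * k ^ 3 * n ^ 2 + 53280 * a ^ 2 * k ^ 2 * n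
      ^ 2 - 51660 * a ^ 3 * k * n ^ 2 + 17640 * a ^ 4 * n ^ 2 + 10 * k * q1111 * n + 2 * k ^ 2 *
      q211 * n + 2 * k ^ 3 * q31 * n + 3568 * k ^ 4 * n ^ 2 + 2 * k ^ 4 * q4 * n + 4 * (δ q1111)
      * n)
  rw [← ofNat_smul_diffPoly] at k4
  have k0 := k4.symm.trans (c := 0) (by
    linear_combination (norm := module) (5760 : ℂ) • hC4)
  clear k4 hC4
  obtain ⟨e1, e2, e6, e8, e9⟩ := eq_zero_of_order_six k0
  clear k0
  have hn := E.deriv_n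
  have hk := E.deriv_k
  have ha := E.deriv_a
  have hs := E.deriv_s
  -- The coefficients of R_xxxxx R_x, R_xxxx R_x² and R_xx³ determine q4, q31 and q22 in turn, each
  -- after division by a multiple of kn².
  have hq4 : q4 = 80 * n := by
    refine sub_eq_zero.1 (E.cancel (c := 40) (by norm_num) ?_)
    rw [map_ofNat]
    simp only [Derivation.leibniz, Derivation.leibniz_pow, derivation_ofNat, smul_eq_mul,
        hn, hs, mul_zero, add_zero, nsmul_eq_mul, Nat.cast_ofNat, Nat.reduceSub, pow_one] at e9
    linear_combination e9
  subst hq4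
  have hq31 : q31 = n * (420 * k - 180 * a) := by
    refine sub_eq_zero.1 (E.cancel (c := 40) (by norm_num) ?_)
    rw [map_ofNat]
    simp only [Derivation.leibniz, Derivation.leibniz_pow, derivation_ofNat, smul_eq_mul,
        hn, hs, map_add, map_neg, mul_zero, add_zero, hk,
        ha, nsmul_eq_mul, Nat.cast_ofNat, Nat.reduceSub, pow_one] at e6
    linear_combination e6
  subst hq31
  have hq22 : q22 = n * (340 * k - 180 * a) := by
    refine sub_eq_zero.1 (E.cancel (c := 48) (by norm_num) ?_)
    rw [map_ofNat]
    simp only [Derivation.leibniz, Derivation.leibniz_pow, derivation_ofNat, smul_eq_mul,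
        hn, hs, map_add, map_neg, mul_zero, add_zero, hk,
        ha, nsmul_eq_mul, Nat.cast_ofNat, Nat.reduceSub, pow_one] at e1
    linear_combination e1
  subst hq22
  refine E.isUnit_n.mul_right_eq_zero.1 (E.cancel (c := 4320) (by norm_num) ?_)
  rw [map_ofNat]
  simp only [Derivation.leibniz, Derivation.leibniz_pow, derivation_ofNat, smul_eq_mul, hn,
      hs, map_add, map_sub, map_neg, map_zero, mul_zero, add_zero, zero_add, hk, ha,
      nsmul_eq_mul, Nat.cast_ofNat, Nat.reduceSub, pow_one] at e2 e8 ⊢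
  -- The coefficients of R_xx²R_x² and R_xxx R_x³ contain the remaining unknown q211 in the ratio 3
  -- : 1, and q1111 not at all. The combination is therefore a condition on the equation itself,
  -- 4320 k n³ a(k - a) = 0.
  linear_combination e2 - 3 * e8

end IsExponential

end OrderFour

/-! ### From the obstruction to the two equations with difference terms -/

section ReducedForm

variable {V : Set (ℂ × ℂ)} {ψ f g F : ℂ × ℂ → ℂ}

theorem analyticAt_exp_fst (a b : ℂ) (P : ℂ × ℂ) :
    AnalyticAt ℂ (fun P : ℂ × ℂ => Complex.exp (a * (P.1 - b))) P :=
  (analyticAt_const.fun_mul (analyticAt_fst.fun_sub analyticAt_const)).cexp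

theorem deriv_exp_mul_sub (a b z : ℂ) :
    deriv (fun z => Complex.exp (a * (z - b))) z = a * Complex.exp (a * (z - b)) := by
  have h : HasDerivAt (fun z => a * (z - b)) a z := by
    simpa using ((hasDerivAt_id z).sub_const b).const_mul a
  rw [h.cexp.deriv, mul_comm]

/-- The solutions of `F_u = a F`, `F_w = 0` are exponentials. -/
theorem IsRegular.exists_eq_mul_exp (hV : IsRegular V) (hF : AnalyticOnNhd ℂ F V) {a : ℂ} (b : ℂ)
    (hu : ∀ P ∈ V, du F P = a * F P) (hw : ∀ P ∈ V, dw F P = 0) :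
    ∃ c, ∀ P ∈ V, F P = c * Complex.exp (a * (P.1 - b)) := by
  refine hV.exists_eq_const_mul (F := fun P => Complex.exp (a * (P.1 - b)))
    (fun P _ => analyticAt_exp_fst a b P) hF (fun P _ => Complex.exp_ne_zero _) (fun P hP => ?_)
    fun P hP => ?_
  · have e : du (fun P : ℂ × ℂ => Complex.exp (a * (P.1 - b))) P = a * Complex.exp (a * (P.1 - b)) :=
      deriv_exp_mul_sub a b P.1
    rw [e, hu P hP]
    ring
  · have e : dw (fun P : ℂ × ℂ => Complex.exp (a * (P.1 - b))) P = 0 :=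
      congrFun (dw_fst fun z => Complex.exp (a * (z - b))) P
    rw [e, hw P hP, mul_zero, zero_mul]

/-- The difference g_u - bg is a constant e, so g + e/b solves the first order equation and is a
multiple of e^{bu}. -/
theorem exists_eq_mul_exp_of_deriv_deriv (hV : IsRegular V) (hg : AnalyticOnNhd ℂ g V) {b : ℂ}
    (hb : b ≠ 0) (hu : ∀ P ∈ V, du (du g) P = b * du g P) (hw : ∀ P ∈ V, dw g P = 0)
    (hne : ∀ P ∈ V, du g P ≠ 0) :
    ∃ c d, c ≠ 0 ∧ ∀ P ∈ V, g P = c * Complex.exp (b * P.1) + d := by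
  have hVo := hV.isOpen
  obtain ⟨e, he⟩ := hV.exists_eq_const (F := fun P => du g P - b * g P)
    (fun P hP => (analyticAt_du (hg P hP)).fun_sub (analyticAt_const.fun_mul (hg P hP)))
    (fun P hP => by
      rw [du_sub (analyticAt_du (hg P hP)) (analyticAt_const.fun_mul (hg P hP)), du_const_mul,
        hu P hP, sub_self])
    fun P hP => by
      rw [dw_sub (analyticAt_du (hg P hP)) (analyticAt_const.fun_mul (hg P hP)), dw_const_mul,
        hw P hP, dw_du (hg P hP), du_eq_zero_of_eqOn hVo hw hP, mul_zero, sub_zero]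
  obtain ⟨c, hc⟩ := hV.exists_eq_mul_exp (F := fun P => g P + e / b) (a := b)
    (fun P hP => (hg P hP).fun_add analyticAt_const) 0
    (fun P hP => by
      rw [du_add (hg P hP) analyticAt_const, du_const, mul_add, mul_div_cancel₀ _ hb, ← he P hP]
      ring)
    fun P hP => by rw [dw_add (hg P hP) analyticAt_const, dw_const, hw P hP, add_zero]
  simp only [sub_zero] at hc
  refine ⟨c, -(e / b), ?_, fun P hP => by rw [← hc P hP]; ring⟩
  rintro rfl
  obtain ⟨P, hP⟩ := hV.nonempty
  refine hne P hP ?_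
  have h1 := he P hP
  have h2 := hc P hP
  rw [zero_mul] at h2
  field_simp at h2
  linear_combination h1 + h2

variable {r : ℂ} {h : ℂ → ℂ}

theorem along_eq_zero (hV : IsOpen V) (hh : AnalyticAt ℂ h r) (hr : (r, h r) ∈ V)
    (hF : ∀ P ∈ V, F P = 0) : along r h F = 0 := by
  rw [← along_congr hh (F := fun _ => 0) analyticAt_const
    ((hV.eventually_mem hr).mono fun P hP => (hF P hP).symm), along_const, map_zero]

theorem jet_eq_zero (hV : IsOpen V) (hh : AnalyticAt ℂ h r) (hr : (r, h r) ∈ V)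
    (hF : ∀ P ∈ V, dw F P = 0) : jet r h F 1 = 0 ∧ jet r h F 2 = 0 :=
  ⟨along_eq_zero hV hh hr hF, along_eq_zero hV hh hr fun _ hP => dw_eq_zero_of_eqOn hV hF hP⟩

/-- Exponential functions `h` with prescribed initial value and derivative. -/
theorem exists_exponential (r w₀ ν : ℂ) {k : ℂ} (hk : k ≠ 0) : ∃ h : ℂ → ℂ, AnalyticAt ℂ h r ∧
    h r = w₀ ∧ deriv h r = 2 * ν ∧ germDerivation r (germOf r h) =
      2 * germOf r fun z => ν * Complex.exp (k * (z - r)) := by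
  have a1 (z : ℂ) : AnalyticAt ℂ (fun z => Complex.exp (k * (z - r))) z :=
    (analyticAt_const.fun_mul (analyticAt_id.fun_sub analyticAt_const)).cexp
  have a2 (z : ℂ) : AnalyticAt ℂ (fun z => w₀ + 2 * ν / k * (Complex.exp (k * (z - r)) - 1)) z :=
    analyticAt_const.fun_add (analyticAt_const.fun_mul ((a1 z).fun_sub analyticAt_const))
  have d : deriv (fun z => w₀ + 2 * ν / k * (Complex.exp (k * (z - r)) - 1)) =
      fun z => 2 * (ν * Complex.exp (k * (z - r))) := by
    funext z
    rw [deriv_const_add, deriv_const_mul_field, deriv_sub_const, deriv_exp_mul_sub]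
    field_simp
  refine ⟨_, a2 r, by simp, by rw [d]; simp, ?_⟩
  rw [germDerivation_germOf (a2 r), d, germOf_mul analyticAt_const (analyticAt_const.fun_mul (a1 r)),
    germOf_const, map_ofNat]

namespace Equation

/-- The condition at the fourth order for equations in reduced form. -/
theorem order_four_condition (hV : IsRegular V) (hE : (even ψ (fun _ => 1) f g).IsAnalyticOn V)
    (hI : (even ψ (fun _ => 1) f g).Integrable V) {k c : ℂ} (hk : k ≠ 0)
    (hψ : ∀ P ∈ V, ψ P = k * P.2 + c) (hf : ∀ P ∈ V, f P ≠ 0) (hfw : ∀ P ∈ V, dw f P = 0)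
    (hgw : ∀ P ∈ V, dw g P = 0) (hgu : ∀ P ∈ V, du g P ≠ 0)
    (h2 : ∀ P ∈ V, du f P * du g P + f P * du (du g) P = 2 * k * (f P * du g P))
    (h3 : ∀ P ∈ V, 3 * (du f P * du (du g) P) + f P * du (du (du g)) P = 4 * k ^ 2 * (f P * du g P))
    {a : ℂ × ℂ → ℂ} (ha : AnalyticOnNhd ℂ a V)
    (hag : ∀ P ∈ V, du (du g) P = (2 * k - a P) * du g P) {P : ℂ × ℂ} (hP : P ∈ V) :
    a P * (k - a P) = 0 := by
  have hVo := hV.isOpen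
  have aψ : AnalyticOnNhd ℂ ψ V := hE.1
  have af : AnalyticOnNhd ℂ f V := hE.2.2.1
  have ag : AnalyticOnNhd ℂ g V := hE.2.2.2.1
  have aG : AnalyticOnNhd ℂ (fun P => f P * du g P) V := fun P hP =>
    (af P hP).fun_mul (analyticAt_du (ag P hP))
  have hguw : ∀ P ∈ V, dw (du g) P = 0 := fun P hP => by
    rw [dw_du (ag P hP), du_eq_zero_of_eqOn hVo hgw hP]
  have hfu : ∀ P ∈ V, du f P = a P * f P := fun P hP => by
    refine mul_right_cancel₀ (hgu P hP) ?_
    linear_combination h2 P hP - f P * hag P hP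
  have aB : AnalyticOnNhd ℂ (fun P => 2 * k - a P) V := fun P hP =>
    analyticAt_const.fun_sub (ha P hP)
  have haw : ∀ P ∈ V, dw a P = 0 := fun P hP => by
    have e := dw_eq_of_eqOn hVo hag hP
    rw [dw_mul (aB P hP) (analyticAt_du (ag P hP)), hguw P hP, dw_sub analyticAt_const (ha P hP),
      dw_const, dw_du (analyticAt_du (ag P hP)), du_eq_zero_of_eqOn hVo hguw hP] at e
    refine (mul_eq_zero.1 ?_).resolve_right (hgu P hP)
    linear_combination e
  -- Substituting f_u = af and g_uu = (2k - a)g_u into the third order relation leaves exactly this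
  -- equation for a.
  have hau : ∀ P ∈ V, du a P = 2 * (a P * (k - a P)) := fun P hP => by
    have e := du_eq_of_eqOn hVo hag hP
    rw [du_mul (aB P hP) (analyticAt_du (ag P hP)), du_sub analyticAt_const (ha P hP),
      du_const] at e
    have e3 := h3 P hP
    rw [e, hag P hP, hfu P hP] at e3
    refine mul_right_cancel₀ (mul_ne_zero (hf P hP) (hgu P hP)) ?_
    linear_combination -e3
  have hGu : ∀ P ∈ V, du (fun P => f P * du g P) P = 2 * k * (f P * du g P) := fun P hP => by
    rw [du_mul (af P hP) (analyticAt_du (ag P hP)), h2 P hP]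
  have hGw : ∀ P ∈ V, dw (fun P => f P * du g P) P = 0 := fun P hP => by
    rw [dw_mul (af P hP) (analyticAt_du (ag P hP)), hfw P hP, hguw P hP, zero_mul, mul_zero,
      zero_add]
  obtain ⟨r, w₀⟩ := P
  obtain ⟨C, hC⟩ := hV.exists_eq_mul_exp aG r hGu hGw
  -- Since f g_u = C e^{2k(u - r)}, the function n = ν e^{k(R - r)} with ν² = C satisfies n² = f g_u
  -- along any graph in V.
  obtain ⟨ν, hν⟩ := IsAlgClosed.exists_pow_nat_eq C (n := 2) (by norm_num)
  have hCν : f (r, w₀) * du g (r, w₀) = ν ^ 2 := by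
    have := hC _ hP
    simp only [sub_self, mul_zero, Complex.exp_zero, mul_one] at this
    rw [this, hν]
  have hν0 : ν ≠ 0 := by
    rintro rfl
    exact mul_ne_zero (hf _ hP) (hgu _ hP) (by rw [hCν]; ring)
  obtain ⟨h, hh, rfl, hd, hδ⟩ := exists_exponential r w₀ ν hk
  have hev := hVo.eventually_mem hP
  -- The choice h' = 2n is generic: φ_u contributes 4kν² and k h'² the same, 8kν² in total.
  have hcub : (even ψ (fun _ => 1) f g).degeneracyCubic (r, h r) (deriv h r) ≠ 0 := by
    have eφ : (even ψ (fun _ => 1) f g).limPhi = fun P => 2 * (f P * du g P) := limPhi_even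
    have eΨ : ∀ P ∈ V, (even ψ (fun _ => 1) f g).limPsi P = k * P.2 + c := fun P hP => by
      simp only [limPsi_even, hgw P hP, hψ P hP, mul_zero, add_zero]
    rw [degeneracyCubic_even_one rfl rfl, eφ, du_const_mul, dw_const_mul, hGu _ hP, hGw _ hP,
      du_eq_of_eqOn hVo eΨ hP, dw_eq_of_eqOn hVo eΨ hP, hd, hCν]
    have e1 : du (fun P : ℂ × ℂ => k * P.2 + c) (r, h r) = 0 :=
      deriv_const r (k * h r + c)
    have e2 : dw (fun P : ℂ × ℂ => k * P.2 + c) (r, h r) = k :=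
      congrFun (dw_linear_add k fun _ => c) _
    rw [e1, e2]
    refine ne_of_eq_of_ne (?_ : _ = 8 * k * ν ^ 2)
      (mul_ne_zero (mul_ne_zero (by norm_num) hk) (pow_ne_zero 2 hν0))
    ring
  obtain ⟨w, Y, Z, H⟩ := hI r h hh hP hcub
  have aexp : AnalyticAt ℂ (fun z => Complex.exp (k * (z - r))) r :=
    (analyticAt_const.fun_mul (analyticAt_id.fun_sub analyticAt_const)).cexp
  have an : AnalyticAt ℂ (fun z => ν * Complex.exp (k * (z - r))) r := analyticAt_const.fun_mul aexp
  have hψj : jet r h ψ = jet r h fun P => k * P.2 + c := funext fun j =>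
    jet_congr hh (aψ _ hP) (hev.mono hψ) j
  have jf := jet_eq_zero hVo hh hP hfw
  have jg := jet_eq_zero hVo hh hP hgw
  have hη (j : ℕ) : jet r h (fun _ => 1) j = if j = 0 then 1 else 0 := by
    rw [jet_const, map_one]
  have g1 : germDerivation r (along r h g) = along r h (du g) := by
    rw [germDerivation_along hh (ag _ hP), along_eq_zero hVo hh hP hgw, mul_zero, add_zero]
  have aug := analyticAt_du (ag _ hP)
  have hsub (κ : ℂ) : along r h (fun P => κ - a P) = algebraMap ℂ _ κ - along r h a := by
    rw [eq_sub_iff_add_eq, ← along_add hh (analyticAt_const.fun_sub (ha _ hP)) (ha _ hP),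
      ← along_const (h := h)]
    simp only [sub_add_cancel]
  have X : IsExponential (germDerivation r) (germOf r h) (jet r h ψ) (jet r h fun _ => 1) (jet r h f)
      (jet r h g) (germOf r fun z => ν * Complex.exp (k * (z - r))) (algebraMap ℂ _ k) (along r h a)
      (jet r h ψ 0) :=
    { deriv_h := hδ
      deriv_n := by
        rw [germDerivation_germOf an, ← germOf_const, ← germOf_mul analyticAt_const an]
        refine congrArg _ (funext fun z => ?_)
        rw [deriv_const_mul_field, deriv_exp_mul_sub]
        ring
      deriv_k := Derivation.map_algebraMap _ _
      deriv_a := by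
        rw [germDerivation_along hh (ha _ hP), along_eq_zero hVo hh hP haw, mul_zero, add_zero,
          along_congr hh (analyticAt_du (ha _ hP)) (hev.mono hau), along_mul hh analyticAt_const
          ((ha _ hP).fun_mul (analyticAt_const.fun_sub (ha _ hP))),
          along_mul hh (ha _ hP) (analyticAt_const.fun_sub (ha _ hP)), hsub, along_const, map_ofNat,
          mul_assoc]
      deriv_s := by
        rw [hψj, jet_linear_zero (Θ := fun _ => c) hh k analyticAt_const, germOf_const, map_add, Derivation.leibniz,
          Derivation.map_algebraMap, Derivation.map_algebraMap, hδ, smul_zero, add_zero, add_zero,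
          smul_eq_mul]
        ring
      ψ_zero := rfl
      ψ_one := by rw [hψj]; exact jet_linear_one k fun _ => c
      ψ_two := by rw [hψj]; exact jet_linear_two k fun _ => c
      η_zero := hη 0
      η_one := hη 1
      η_two := hη 2
      f_one := jf.1
      f_two := jf.2
      g_one := jg.1
      g_two := jg.2
      mul_deriv_g := by
        rw [jet_eq_along, jet_eq_along, Function.iterate_zero, id, id, g1, ← along_mul hh (af _ hP) aug,
          along_congr hh (aG _ hP) (hev.mono hC), pow_two, ← germOf_mul an an]
        refine congrArg (germOf r) (funext fun z => ?_)
        change C * Complex.exp (2 * k * (z - r)) = _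
        rw [← hν, show 2 * k * (z - r) = k * (z - r) + k * (z - r) by ring, Complex.exp_add]
        ring
      deriv_deriv_g := by
        rw [jet_eq_along, Function.iterate_zero, id, g1, germDerivation_along hh aug,
          along_eq_zero hVo hh hP hguw, mul_zero, add_zero,
          along_congr hh (analyticAt_du aug) (hev.mono hag), along_mul hh (aB _ hP) aug]
        rw [hsub, map_mul, map_ofNat]
      isUnit_n := isUnit_of_germEval_ne_zero (by
        rw [germEval_germOf an]
        exact mul_ne_zero hν0 (Complex.exp_ne_zero _))
      isUnit_k := (IsUnit.mk0 k hk).map _ }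
  have := congrArg (germEval r) (X.mul_sub_eq_zero H)
  rwa [map_mul, map_sub, germEval_algebraMap, germEval_along hh (ha _ hP), map_zero] at this

/-- With a = 2k - g''/g' = f'/f the condition a(k - a) = 0 holds pointwise. On a smaller set a is
one of the constants 0 and k, and f, g can be integrated. -/
theorem locallyListed_of_reduced_form (hV : IsRegular V)
    (hE : (even ψ (fun _ => 1) f g).IsAnalyticOn V) (hI : (even ψ (fun _ => 1) f g).Integrable V)
    {k c : ℂ} (hk : k ≠ 0)
    (hψ : ∀ P ∈ V, ψ P = k * P.2 + c) (hf : ∀ P ∈ V, f P ≠ 0) (hfw : ∀ P ∈ V, dw f P = 0)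
    (hgw : ∀ P ∈ V, dw g P = 0) (hgu : ∀ P ∈ V, du g P ≠ 0)
    (h2 : ∀ P ∈ V, du f P * du g P + f P * du (du g) P = 2 * k * (f P * du g P))
    (h3 : ∀ P ∈ V, 3 * (du f P * du (du g) P) + f P * du (du (du g)) P =
      4 * k ^ 2 * (f P * du g P)) : (even ψ (fun _ => 1) f g).LocallyListed V := by
  have ag : AnalyticOnNhd ℂ g V := hE.2.2.2.1
  obtain ⟨a, ha⟩ : ∃ a : ℂ × ℂ → ℂ, a = fun P => 2 * k - du (du g) P / du g P := ⟨_, rfl⟩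
  have aa : AnalyticOnNhd ℂ a V := fun P hP => by
    rw [ha]
    exact analyticAt_const.fun_sub ((analyticAt_du (analyticAt_du (ag P hP))).fun_div
      (analyticAt_du (ag P hP)) (hgu P hP))
  have hag : ∀ P ∈ V, du (du g) P = (2 * k - a P) * du g P := fun P hP => by
    have := hgu P hP
    rw [ha]
    field_simp
    ring
  have hcond P (hP : P ∈ V) :=
    order_four_condition hV hE hI hk hψ hf hfw hgw hgu h2 h3 aa hag hP
  -- Either a vanishes identically or it is nonzero on a smaller set, where the second factor must
  -- vanish.
  obtain ⟨W, hW, hWr, a₀, ha₀, haW⟩ : ∃ W ⊆ V, IsRegular W ∧ ∃ a₀, (a₀ = 0 ∨ a₀ = k) ∧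
      ∀ P ∈ W, a P = a₀ := by
    rcases hV.eq_zero_or aa with h0 | ⟨W, hW, hWr, h0⟩
    · exact ⟨V, subset_rfl, hV, 0, .inl rfl, h0⟩
    · refine ⟨W, hW, hWr, k, .inr rfl, fun P hP => ?_⟩
      exact (sub_eq_zero.1 ((mul_eq_zero.1 (hcond P (hW hP))).resolve_left (h0 P hP))).symm
  have hfu : ∀ P ∈ W, du f P = a₀ * f P := fun P hP => by
    refine mul_right_cancel₀ (hgu P (hW hP)) ?_
    rw [← haW P hP]
    linear_combination h2 P (hW hP) - f P * hag P (hW hP)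
  obtain ⟨b, hb⟩ := hWr.exists_eq_mul_exp (F := f) (hE.2.2.1.mono hW) 0 hfu fun P hP => hfw P (hW hP)
  simp only [sub_zero] at hb
  have hb0 : b ≠ 0 := by
    rintro rfl
    obtain ⟨P, hP⟩ := hWr.nonempty
    exact hf P (hW hP) (by rw [hb P hP, zero_mul])
  obtain ⟨d, e, hd, hge⟩ := exists_eq_mul_exp_of_deriv_deriv (b := 2 * k - a₀) hWr (ag.mono hW) (by
      rcases ha₀ with rfl | rfl
      · simpa using hk
      · rwa [two_mul, add_sub_cancel_right])
    (fun P hP => by rw [hag P (hW hP), haW P hP]) (fun P hP => hgw P (hW hP))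
    fun P hP => hgu P (hW hP)
  refine ⟨W, hW, hWr.isOpen, hWr.nonempty, ?_⟩
  rcases ha₀ with rfl | rfl
  -- Here f = b is constant and g = d e^{2ku} + e. The shift β of u adjusts the product bd to the
  -- factor e^{2β}/(2k) in the transform of `eqn3`.
  · obtain ⟨β, hβ⟩ : ∃ β, Complex.exp (2 * β) = 2 * k * (b * d) := ⟨Complex.log (2 * k * (b * d)) / 2, by
      rw [mul_div_cancel₀ _ two_ne_zero, Complex.exp_log]
      exact mul_ne_zero (mul_ne_zero two_ne_zero hk) (mul_ne_zero hb0 hd)⟩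
    refine ⟨_, .eqn3, 1, c, k, β, 0, one_ne_zero, hk,
      fun P hP => ?_, fun P hP => ?_, fun P hP Q hQ R hR => ?_⟩
    · simp [even, transform, eqn3, hψ P (hW hP)]
    · simp [even, transform, eqn3]
    · have key (z : ℂ) : Complex.exp (2 * (k * z + β)) = 2 * k * (b * d) * Complex.exp (2 * k * z) := by
        rw [mul_add, Complex.exp_add, hβ, mul_assoc 2 k z]
        ring
      simp only [discretePart, even, transform, eqn3, key, hge P hP, hge Q hQ, hge R hR, hb P hP,
        zero_mul, Complex.exp_zero, sub_zero]
      field_simp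
      ring
  -- Here f = b e^{ku} and g = d e^{ku} + e; the transform of `eqn4` has the factor e^{2β}/k in
  -- place of bd.
  · obtain ⟨β, hβ⟩ : ∃ β, Complex.exp β * Complex.exp β = a₀ * (b * d) :=
      ⟨Complex.log (a₀ * (b * d)) / 2, by
        rw [← Complex.exp_add, add_halves, Complex.exp_log (mul_ne_zero hk (mul_ne_zero hb0 hd))]⟩
    refine ⟨_, .eqn4, 1, c, a₀, β, 0, one_ne_zero, hk,
      fun P hP => ?_, fun P hP => ?_, fun P hP Q hQ R hR => ?_⟩
    · simp [even, transform, eqn4, hψ P (hW hP)]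
    · simp [even, transform, eqn4]
    · simp only [discretePart, even, transform, eqn4, hge P hP, hge Q hQ, hge R hR, hb P hP,
        Complex.exp_add, show 2 * a₀ - a₀ = a₀ by ring]
      field_simp
      linear_combination (Complex.exp (a₀ * R.1) - Complex.exp (a₀ * Q.1)) * hβ

end Equation

end ReducedForm

/-! ### Conclusion of the classification -/

namespace Equation

variable {E : Equation} {Ω V : Set (ℂ × ℂ)} {f g : ℂ × ℂ → ℂ}

/-- Order ε² makes η a nonzero constant e; rescaling time by 1/e brings the equation to η = 1, where
the two cases of a zero and a nonzero difference term have been settled. The rescaling is undone at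
the end. -/
theorem locallyListed_of_sameOn_even (hV : IsRegular V) (hE : E.IsAnalyticOn V) (hI : E.Integrable V)
    (hη : ∀ P ∈ V, E.eta P ≠ 0) (hne : ∀ P ∈ V, ∃ μ, E.degeneracyCubic P μ ≠ 0)
    (hf : AnalyticOnNhd ℂ f V) (hg : AnalyticOnNhd ℂ g V) (hs : E.SameOn (even E.psi E.eta f g) V)
    (hfg : (f = fun _ => 0) ∧ (g = fun _ => 0) ∨
      (∀ P ∈ V, f P ≠ 0) ∧ ∀ P ∈ V, du g P ≠ 0 ∨ dw g P ≠ 0) : E.LocallyListed V := by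
  have hE' : (even E.psi E.eta f g).IsAnalyticOn V := ⟨hE.1, hE.2.1, hf, hg, hf, hg⟩
  have hI' := hs.integrable hV.isOpen hE hE' hI
  have hne' : ∀ P ∈ V, ∃ μ, (even E.psi E.eta f g).degeneracyCubic P μ ≠ 0 := fun P hP => by
    obtain ⟨μ, hμ⟩ := hne P hP
    exact ⟨μ, by rwa [← hs.degeneracyCubic_eq hV.isOpen hP]⟩
  have rel P (hP : P ∈ V) := order_two_relations hE' hI' rfl rfl rfl hP (hη P hP) (hne' P hP)
  obtain ⟨e, he⟩ := hV.exists_eq_const hE.2.1 (fun P hP => (rel P hP).2.1) fun P hP => (rel P hP).1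
  have he0 : e⁻¹ ≠ 0 := by
    obtain ⟨P, hP⟩ := hV.nonempty
    rw [← he P hP]
    exact inv_ne_zero (hη P hP)
  have hs' : ((even E.psi E.eta f g).scale e⁻¹).SameOn
      (even (fun P => e⁻¹ * E.psi P) (fun _ => 1) (fun P => e⁻¹ * f P) g) V :=
    ⟨fun P hP => rfl, fun P hP => by
      change e⁻¹ * E.eta P = 1
      rw [he P hP, inv_mul_cancel₀ fun h => he0 (by rw [h, inv_zero])], fun P hP Q hQ R hR => rfl⟩
  have hEs := hE'.scale e⁻¹
  have hEe : (even (fun P => e⁻¹ * E.psi P) (fun _ => 1) (fun P => e⁻¹ * f P) g).IsAnalyticOn V :=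
    ⟨hEs.1, analyticOnNhd_const, hEs.2.2.1, hg, hEs.2.2.1, hg⟩
  have hIe := hs'.integrable hV.isOpen hEs hEe (hI'.scale hE' e⁻¹)
  have hnee : ∀ P ∈ V, ∃ μ, (even (fun P => e⁻¹ * E.psi P) (fun _ => 1) (fun P => e⁻¹ * f P)
      g).degeneracyCubic P μ ≠ 0 := fun P hP => by
    obtain ⟨μ, hμ⟩ := hne' P hP
    refine ⟨μ, ?_⟩
    rw [← hs'.degeneracyCubic_eq hV.isOpen hP, degeneracyCubic_scale]
    exact mul_ne_zero he0 hμ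
  refine LocallyListed.congr (LocallyListed.of_scale he0 (LocallyListed.congr ?_ hs')) hs
  rcases hfg with ⟨rfl, rfl⟩ | ⟨hf0, hg0⟩
  · simp only [mul_zero] at hEe hIe hnee ⊢
    exact locallyListed_of_trivial hV hEe hIe hnee
  · obtain ⟨W, hW, hWr, k, c, hk, H⟩ := exists_reduced_form hV hEe hIe hnee
      (fun P hP => mul_ne_zero he0 (hf0 P hP)) hg0
    exact (locallyListed_of_reduced_form hWr (hEe.mono hW) (hIe.mono hW) hk (fun P hP => (H P hP).1)
      (fun P hP => mul_ne_zero he0 (hf0 P (hW hP))) (fun P hP => (H P hP).2.1)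
      (fun P hP => (H P hP).2.2.1) (fun P hP => (H P hP).2.2.2.1)
      (fun P hP => (H P hP).2.2.2.2.1) fun P hP => (H P hP).2.2.2.2.2).mono hW

theorem exists_isListed_equivalentOn (hΩ : IsOpen Ω) (hc : IsConnected Ω) (hE : E.IsAnalyticOn Ω)
    (hn : E.NonDegenerate Ω) (H : E.Integrable Ω) : ∃ M, IsListed M ∧ E.EquivalentOn M Ω := by
  obtain ⟨U, hU, hUr, hη, hne⟩ := hn.exists_isRegular hΩ hc.isPreconnected hE
  obtain ⟨V, hV, hVr, hs⟩ := exists_sameOn_even hUr (hE.mono hU) (H.mono hU) hη hne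
  have hVΩ := hV.trans hU
  have hEV := hE.mono hVΩ
  refine LocallyListed.exists_equivalentOn hc.isPreconnected hE (LocallyListed.mono ?_ hVΩ)
  have key {f g : ℂ × ℂ → ℂ} := locallyListed_of_sameOn_even (f := f) (g := g) hVr hEV (H.mono hVΩ)
    (fun P hP => hη P (hV hP)) fun P hP => hne P (hV hP)
  rcases hs with hs | ⟨hf, hg, hs⟩
  · exact key analyticOnNhd_const analyticOnNhd_const hs (.inl ⟨rfl, rfl⟩)
  · exact key hEV.2.2.1 hEV.2.2.2.1 hs (.inr ⟨hf, hg⟩)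

end Equation

end ILW

end

theorem theorem3 :
    (∀ M : ILW.Equation, ILW.IsListed M →
      M.IsAnalyticOn Set.univ ∧ M.NonDegenerate Set.univ ∧ M.Integrable Set.univ) ∧
    (∀ (Ω : Set (ℂ × ℂ)), IsOpen Ω → IsConnected Ω →
      ∀ E : ILW.Equation, E.IsAnalyticOn Ω → E.NonDegenerate Ω →
        (E.Integrable Ω ↔ ∃ M : ILW.Equation, ILW.IsListed M ∧ E.EquivalentOn M Ω)) := by
  refine ⟨fun M hM => ILW.Equation.IsListed.isAnalyticOn_nonDegenerate_integrable hM, fun Ω hΩ hc E hE hn =>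
    ⟨fun H => ?_, fun ⟨M, hM, H⟩ => ILW.Equation.integrable_of_equivalentOn hΩ hE hM H⟩⟩
  exact ILW.Equation.exists_isListed_equivalentOn hΩ hc hE hn H
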